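/- Let $d\in\{5,6,8,10\}$. Write $\theta=z\,d/dz$, and regard multivalued functions of $z\ne0$ as functions on the universal cover, so that $\arg z\in\mathbb R$. For $s\in\mathbb Z$ put $z_s=e^{-s\pi i}z$ (rotation on the universal cover). For $m\in\mathbb Z$ let $$\Xi_{l+m\pi}=\{z:\ -\tfrac{\pi}{2}+m\pi<\arg z<\tfrac{3\pi}{2}+m\pi\}.$$ **Equation.** Consider $$\{z(\theta+1)^3+\mu_d\textstyle\prod_{r\in R_d}(d\theta+r)\}\hat\Pi=0,\qquad(\ast)$$ with $(\mu_d,R_d)=(5,\{1,2,3,4\}),\ (9,\{1,2,4,5\}),\ (16,\{1,3,5,7\}),\ (80,\{1,3,7,9\})$ for $d=5,6,8,10$. Let also $(\kappa_d,\lambda_d)=(5,5^5),\ (3,2^43^6),\ (2,2^{16}),\ (1,2^85^5)$. **Solutions at $z=0$.** Let $\phi_k(z)=\sum_{n\ge0}c_d(n+\rho_k)(-1)^nz^{n+\rho_k}$ with $\rho_k=-k/d$ and $$c_5(x)=\tfrac{\Gamma(1+x)^3\Gamma(2+x)}{\Gamma(6+5x)},\quad c_6(x)=\tfrac{\Gamma(1+x)^3\Gamma(3+2x)}{\Gamma(7+6x)},\quad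 c_8(x)=\tfrac{\Gamma(1+x)^3\Gamma(5+4x)}{\Gamma(9+8x)},\quad c_{10}(x)=\tfrac{\Gamma(1+x)^2\Gamma(2+2x)\Gamma(6+5x)}{\Gamma(11+10x)}.$$ With $\alpha=e^{2\pi i/d}$ (and $\alpha^x=e^{2\pi ix/d}$) let $$\hat w_m(z)=(1-\alpha)\sum_{k=1}^{d-1}p_d(k)\,\alpha^{km+\frac12(k-1)}\phi_{d-k}(z),$$ where $p_5(k)=(1-\alpha^k)^3$, $p_6(k)=(1-\alpha^{2k})(1-\alpha^k)^2$, $p_8(k)=(1-\alpha^{4k})(1-\alpha^k)^2$, $p_{10}(k)=(1-\alpha^{5k})(1-\alpha^{2k})(1-\alpha^k)$. For $a\in\mathbb C$ and a constant $c_N$ let $(f_1,f_2,f_3,f_4)=c_N(\hat w_0,\hat w_1,\hat w_2,\hat w_{d-1})N$, where $N$ is, for $d=5,6,8,10$ respectively, $$\begin{pmatrix}1&-\frac25&-\frac{2a}5-2&1\\0&\frac25&\frac{2a}5-2&-1\\0&\frac15&\frac a5-\frac12&0\\0&-\frac15&-\frac a5-\frac12&0\end{pmatrix},\ \begin{pmatrix}1&-\frac13&-\frac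 a3-\frac32&1\\0&\frac13&\frac a3-\frac32&-1\\0&\frac13&\frac a3-\frac12&0\\0&-\frac13&-\frac a3-\frac12&0\end{pmatrix},\ \begin{pmatrix}1&-\frac12&-\frac{a+3}2&1\\0&\frac12&\frac{a-3}2&-1\\0&\frac12&\frac{a-1}2&0\\0&-\frac12&-\frac{a+1}2&0\end{pmatrix},\ \begin{pmatrix}1&0&-1&1\\0&0&-1&-1\\0&1&a-\frac12&0\\0&-1&-a-\frac12&0\end{pmatrix}.$$ **Matrices.** Put $$L=\begin{pmatrix}1&1&a+\frac{\kappa_d}2&0\\0&1&\kappa_d&0\\0&0&1&0\\0&0&0&1\end{pmatrix},\quad K_{\overline R}=\begin{pmatrix}1&0&0&-b_d\\0&1&0&a-\frac{\kappa_d}2\\0&0&1&-1\\0&0&0&1\end{pmatrix},\quad K_R=\begin{pmatrix}1&0&0&0\\0&1&0&0\\0&0&1&0\\1&0&0&1\end{pmatrix},$$ with $b_d=5,4,4,3$ for $d=5,6,8,10$. For $m\in\mathbb Z$ define $$\Phi_{l+m\pi}(z)=\begin{cases}(f_1(z_{m-1}),f_2(z_{m-1}),f_3(z_{m-1}),f_4(e^{-2\pi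 i}z_{m-1}))\,L^{-\frac{m-1}2}&m\text{ odd},\\(f_1(z_m),f_2(z_m),f_3(z_m),f_4(z_m))\,L^{-\frac m2}&m\text{ even}.\end{cases}$$ **Formal solutions at $z=\infty$.** Let $G(z,\rho)=\sum_{n\ge0}\gamma_d(n+\rho)z^{-(n+\rho+1)}$ with $\gamma_5(x)=\frac{\Gamma(1+5x)}{\Gamma(1+x)^4}$, $\gamma_6(x)=\frac{\Gamma(1+6x)}{\Gamma(1+x)^3\Gamma(1+2x)}$, $\gamma_8(x)=\frac{\Gamma(1+8x)}{\Gamma(1+x)^3\Gamma(1+4x)}$, $\gamma_{10}(x)=\frac{\Gamma(1+10x)}{\Gamma(1+x)^2\Gamma(1+2x)\Gamma(1+5x)}$, let $\partial=\frac1{2\pi i}\frac{\partial}{\partial\rho}$ (acting term by term), and $$g_1=G|_{\rho=0},\quad g_2=\partial G|_{\rho=0},\quad g_3=\{\tfrac{\kappa_d}2\partial^2+a\,\partial\}G|_{\rho=0},\quad g_4=\frac{\lambda_d\sqrt{\kappa_d}}{2\pi i}\,e^{-z/\lambda_d}z^{-2}\Big(1+\frac{C_1}z+\frac{C_2}{z^2}+\cdots\Big),$$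 where $C_1,C_2,\dots$ are the coefficients that make $g_4$ a formal solution of $(\ast)$. Put $\Psi=(g_1,g_2,g_3,g_4)$. **Proposition.** For each $d\in\{5,6,8,10\}$ the coefficients $C_j$ exist and are unique, with $(C_1,C_2)=(-4375,32031250)$, $(-15876,428354568)$, $(-88064,13272875008)$, $(-1040000,1884800000000)$ for $d=5,6,8,10$, and there is a real constant $c_N\neq0$, depending only on $d$, such that the following hold for every $a\in\mathbb C$. 1. For every $m\in\mathbb Z$ the components of $\Phi_{l+m\pi}$ are holomorphic solutions of $(\ast)$ on the universal cover of $\mathbb C\setminus\{0\}$, and, componentwise, $$\Phi_{l+m\pi}(z)\sim\Psi(z)\qquad(z\in\Xi_{l+m\pi},\ z\to\infty)$$ in the sense of Poincaré asymptotic expansions, uniformly on closed subsectors of $\Xi_{l+m\pi}$ (for $g_4$, after division by $e^{-z/\lambda_d}$). 2. For every $k\in\mathbb Z$, $$\Phi_{l+(2k+1)\pi}(z)=\Phi_{l+2k\pi}(z)\,L^kK_{\overline R}L^{-k}\quad(z\in\Xi_{l+(2k+1)\pi}\cap\Xi_{l+2k\pi}),$$ $$\Phi_{l+(2k+2)\pi}(z)=\Phi_{l+(2k+1)\pi}(z)\,L^{k+1}K_RL^{-k-1}\quad(z\in\Xi_{l+(2k+2)\pi}\cap\Xi_{l+(2k+1)\pi}).$$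 -/

import Mathlib

open Filter Asymptotics Matrix

namespace CYStokes

noncomputable section

/-- The four one-parameter Calabi-Yau families, indexed by the degree `d = 5, 6, 8, 10`. -/
inductive Family : Type
  | quintic
  | sextic
  | octic
  | dectic

/-- The degree `d`. -/
def Family.deg : Family → ℕ
  | quintic => 5
  | sextic => 6
  | octic => 8
  | dectic => 10

/-- The constant in front of the product of linear factors in the differential equation. -/
def Family.lead : Family → ℂ
  | quintic => 5
  | sextic => 9
  | octic => 16
  | dectic => 80

/-- The numbers `r` in the factors `d θ + r` of the differential equation. -/
def Family.shifts : Family → List ℂ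
  | quintic => [1, 2, 3, 4]
  | sextic => [1, 2, 4, 5]
  | octic => [1, 3, 5, 7]
  | dectic => [1, 3, 7, 9]

/-- The differential operator `z (θ + 1)^3 + lead * ∏ (d θ + r)`, for a given action of the
Euler operator `θ = z d/dz` and of multiplication by `z` on a complex vector space. -/
def Family.op (X : Family) {V : Type} [AddCommGroup V] [Module ℂ V]
    (θ mulZ : V → V) (F : V) : V :=
  mulZ ((fun H => θ H + H)^[3] F) +
    X.lead • X.shifts.foldr (fun r H => (X.deg : ℂ) • θ H + r • H) F

/-! ### Functions on the universal cover of the punctured plane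

A multivalued function of `z ≠ 0` is a function of `ζ = log z ∈ ℂ`: `z = exp ζ`,
`|z| = exp (re ζ)`, `arg z = im ζ`, the Euler operator `z d/dz` is `d/dζ`, and
`z ↦ exp (-s π i) z` is `ζ ↦ ζ - s π i`. -/

/-- `F` is a holomorphic solution (on the universal cover of `z ≠ 0`). -/
def Family.IsSolution (X : Family) (F : ℂ → ℂ) : Prop :=
  Differentiable ℂ F ∧
    X.op (V := ℂ → ℂ) deriv (fun H ζ => Complex.exp ζ * H ζ) F = 0

/-- The Gamma quotient in the series at `z = 0`, as a function of `x = n + ρ_k`. -/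
def Family.phiGamma : Family → ℂ → ℂ
  | quintic => fun x =>
      Complex.Gamma (1 + x) ^ 3 * Complex.Gamma (2 + x) / Complex.Gamma (6 + 5 * x)
  | sextic => fun x =>
      Complex.Gamma (1 + x) ^ 3 * Complex.Gamma (3 + 2 * x) / Complex.Gamma (7 + 6 * x)
  | octic => fun x =>
      Complex.Gamma (1 + x) ^ 3 * Complex.Gamma (5 + 4 * x) / Complex.Gamma (9 + 8 * x)
  | dectic => fun x =>
      Complex.Gamma (1 + x) ^ 2 * Complex.Gamma (2 + 2 * x) * Complex.Gamma (6 + 5 * x) /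
        Complex.Gamma (11 + 10 * x)

/-- `φ_k(z) = ∑ n, phiGamma (n + ρ_k) (-1)^n z^(n + ρ_k)` with `ρ_k = -k/d`. -/
def Family.phi (X : Family) (k : ℕ) (ζ : ℂ) : ℂ :=
  ∑' n : ℕ, X.phiGamma (n - k / X.deg) * (-1) ^ n * Complex.exp ((n - k / X.deg) * ζ)

/-- `α^x` with `α = exp (2 π i / d)`. -/
def Family.alphaPow (X : Family) (x : ℂ) : ℂ :=
  Complex.exp (2 * Real.pi * Complex.I * x / X.deg)

/-- The product of the factors `1 - α^(w k)`. -/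
def Family.wFactor (X : Family) (k : ℕ) : ℂ :=
  match X with
  | quintic => (1 - quintic.alphaPow k) ^ 3
  | sextic => (1 - sextic.alphaPow (2 * k)) * (1 - sextic.alphaPow k) ^ 2
  | octic => (1 - octic.alphaPow (4 * k)) * (1 - octic.alphaPow k) ^ 2
  | dectic => (1 - dectic.alphaPow (5 * k)) * (1 - dectic.alphaPow (2 * k)) *
      (1 - dectic.alphaPow k)

/-- The functions `ŵ_m(z)`. -/
def Family.wHat (X : Family) (m : ℕ) (ζ : ℂ) : ℂ :=
  (1 - X.alphaPow 1) * ∑ k ∈ Finset.Icc 1 (X.deg - 1),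
    X.wFactor k * X.alphaPow (k * m + (k - 1) / 2) * X.phi (X.deg - k) ζ

/-- The matrix `N`. -/
def Family.matN (X : Family) (a : ℂ) : Matrix (Fin 4) (Fin 4) ℂ :=
  match X with
  | quintic =>
    !![1, -2/5, -(2*a)/5 - 2, 1;
       0, 2/5, (2*a)/5 - 2, -1;
       0, 1/5, a/5 - 1/2, 0;
       0, -1/5, -a/5 - 1/2, 0]
  | sextic =>
    !![1, -1/3, -a/3 - 3/2, 1;
       0, 1/3, a/3 - 3/2, -1;
       0, 1/3, a/3 - 1/2, 0;
       0, -1/3, -a/3 - 1/2, 0]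
  | octic =>
    !![1, -1/2, -(a + 3)/2, 1;
       0, 1/2, (a - 3)/2, -1;
       0, 1/2, (a - 1)/2, 0;
       0, -1/2, -(a + 1)/2, 0]
  | dectic =>
    !![1, 0, -1, 1;
       0, 0, -1, -1;
       0, 1, a - 1/2, 0;
       0, -1, -a - 1/2, 0]

/-- The matrix `L`. -/
def Family.matL (X : Family) (a : ℂ) : Matrix (Fin 4) (Fin 4) ℂ :=
  match X with
  | quintic => !![1, 1, a + 5/2, 0; 0, 1, 5, 0; 0, 0, 1, 0; 0, 0, 0, 1]
  | sextic => !![1, 1, a + 3/2, 0; 0, 1, 3, 0; 0, 0, 1, 0; 0, 0, 0, 1]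
  | octic => !![1, 1, a + 1, 0; 0, 1, 2, 0; 0, 0, 1, 0; 0, 0, 0, 1]
  | dectic => !![1, 1, a + 1/2, 0; 0, 1, 1, 0; 0, 0, 1, 0; 0, 0, 0, 1]

/-- The Stokes matrix of the ray `R̄`. -/
def Family.matKbar (X : Family) (a : ℂ) : Matrix (Fin 4) (Fin 4) ℂ :=
  match X with
  | quintic => !![1, 0, 0, -5; 0, 1, 0, a - 5/2; 0, 0, 1, -1; 0, 0, 0, 1]
  | sextic => !![1, 0, 0, -4; 0, 1, 0, a - 3/2; 0, 0, 1, -1; 0, 0, 0, 1]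
  | octic => !![1, 0, 0, -4; 0, 1, 0, a - 1; 0, 0, 1, -1; 0, 0, 0, 1]
  | dectic => !![1, 0, 0, -3; 0, 1, 0, a - 1/2; 0, 0, 1, -1; 0, 0, 0, 1]

/-- The Stokes matrix of the ray `R`, common to all four families. -/
def matK : Matrix (Fin 4) (Fin 4) ℂ :=
  !![1, 0, 0, 0; 0, 1, 0, 0; 0, 0, 1, 0; 1, 0, 0, 1]

/-- The row vector `(f_1, f_2, f_3, f_4) = c (ŵ_0, ŵ_1, ŵ_2, ŵ_{d-1}) N`. -/
def Family.f (X : Family) (c a : ℂ) (ζ : ℂ) : Fin 4 → ℂ :=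
  c • (![X.wHat 0 ζ, X.wHat 1 ζ, X.wHat 2 ζ, X.wHat (X.deg - 1) ζ] ᵥ* X.matN a)

/-- `z ↦ z_s = exp (-s π i) z` in the coordinate `ζ = log z`. -/
def rot (s : ℤ) (ζ : ℂ) : ℂ := ζ - s * (Real.pi * Complex.I)

/-- The row vector `Φ_{l + m π}(z)`. The integer divisions below are exact. -/
def Family.Phi (X : Family) (c a : ℂ) (m : ℤ) (ζ : ℂ) : Fin 4 → ℂ :=
  if Even m then X.f c a (rot m ζ) ᵥ* (X.matL a) ^ (-(m / 2))
  else
    ![X.f c a (rot (m - 1) ζ) 0, X.f c a (rot (m - 1) ζ) 1, X.f c a (rot (m - 1) ζ) 2,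
      X.f c a (rot 2 (rot (m - 1) ζ)) 3] ᵥ* (X.matL a) ^ (-((m - 1) / 2))

/-- The angular region `Ξ_{l + m π} = {-π/2 + m π < arg z < 3π/2 + m π}`. -/
def sector (m : ℤ) : Set ℂ :=
  {ζ | -(Real.pi / 2) + m * Real.pi < ζ.im ∧ ζ.im < 3 * Real.pi / 2 + m * Real.pi}

/-! ### Formal solutions at infinity -/

/-- A formal expression `exp (rate * z) * ∑ n, term n`, where `term n` is `z^(-n-1)` times a
polynomial in `log z`. -/
structure FormalExp where
  rate : ℂ
  term : ℕ → ℂ → ℂ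

/-- `F(z) ∼ g(z)` as `z → ∞` in `Ξ_{l + m π}`: Poincaré asymptotic expansion,
uniformly on closed subsectors. -/
def IsAsymp (m : ℤ) (F : ℂ → ℂ) (g : FormalExp) : Prop :=
  ∀ α β : ℝ, -(Real.pi / 2) + m * Real.pi < α → β < 3 * Real.pi / 2 + m * Real.pi →
    ∀ n : ℕ,
      (fun ζ : ℂ => Complex.exp (-(g.rate * Complex.exp ζ)) * F ζ -
          ∑ j ∈ Finset.range n, g.term j ζ)
        =o[comap Complex.re atTop ⊓ 𝓟 {ζ : ℂ | α ≤ ζ.im ∧ ζ.im ≤ β}]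
      (fun ζ : ℂ => Real.exp (-(n * ζ.re)))

/-- The Gamma quotient in `G(z, ρ)`, as a function of `x = n + ρ`. -/
def Family.gGamma : Family → ℂ → ℂ
  | quintic => fun x => Complex.Gamma (1 + 5 * x) / Complex.Gamma (1 + x) ^ 4
  | sextic => fun x =>
      Complex.Gamma (1 + 6 * x) / (Complex.Gamma (1 + x) ^ 3 * Complex.Gamma (1 + 2 * x))
  | octic => fun x =>
      Complex.Gamma (1 + 8 * x) / (Complex.Gamma (1 + x) ^ 3 * Complex.Gamma (1 + 4 * x))
  | dectic => fun x =>
      Complex.Gamma (1 + 10 * x) /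
        (Complex.Gamma (1 + x) ^ 2 * Complex.Gamma (1 + 2 * x) * Complex.Gamma (1 + 5 * x))

/-- The `n`-th term of the formal series `G(z, ρ)`. -/
def Family.GTerm (X : Family) (n : ℕ) (ζ ρ : ℂ) : ℂ :=
  X.gGamma (n + ρ) * Complex.exp (-((n + ρ + 1) * ζ))

/-- The number `κ` in `g_3 = {(κ/2) ∂² + a ∂} G` (and `√κ` in the normalization of `g_4`). -/
def Family.kappa : Family → ℝ
  | quintic => 5
  | sextic => 3
  | octic => 2
  | dectic => 1

/-- The number `λ` in the exponential factor `exp (-z / λ)` of `g_4`. -/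
def Family.lam : Family → ℂ
  | quintic => 5 ^ 5
  | sextic => 2 ^ 4 * 3 ^ 6
  | octic => 2 ^ 16
  | dectic => 2 ^ 8 * 5 ^ 5

/-- A sequence `c : ℤ → ℂ` stands for the formal expression `exp (-z/λ) ∑ c_m z^(-m)`. This is
the condition that it has the form `exp (-z/λ) z^(-2) (1 + C_1/z + C_2/z^2 + ⋯)` and solves the
differential equation. The Euler operator sends `exp (-z/λ) z^(-m)` to
`exp (-z/λ) (-m z^(-m) - λ⁻¹ z^(-(m-1)))`. -/
def Family.IsExpSeries (X : Family) (c : ℤ → ℂ) : Prop :=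
  (∀ m < 2, c m = 0) ∧ c 2 = 1 ∧
    X.op (V := ℤ → ℂ) (fun u m => -(m : ℂ) * u m - X.lam⁻¹ * u (m + 1))
      (fun u m => u (m + 1)) c = 0

/-- The displayed coefficients `C_1, C_2` of `g_4`. -/
def Family.expCoeff : Family → ℂ × ℂ
  | quintic => (-4375, 32031250)
  | sextic => (-15876, 428354568)
  | octic => (-88064, 13272875008)
  | dectic => (-1040000, 1884800000000)

/-- The row vector `Ψ(z) = (g_1, g_2, g_3, g_4)` of formal solutions; `c` is the coefficient
sequence of the series in `g_4`. -/
def Family.Psi (X : Family) (a : ℂ) (c : ℤ → ℂ) : Fin 4 → FormalExp :=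
  ![⟨0, fun n ζ => X.GTerm n ζ 0⟩,
    ⟨0, fun n ζ => (2 * Real.pi * Complex.I)⁻¹ * deriv (X.GTerm n ζ) 0⟩,
    ⟨0, fun n ζ =>
      X.kappa / 2 * ((2 * Real.pi * Complex.I)⁻¹ ^ 2 * iteratedDeriv 2 (X.GTerm n ζ) 0) +
        a * ((2 * Real.pi * Complex.I)⁻¹ * deriv (X.GTerm n ζ) 0)⟩,
    ⟨-X.lam⁻¹, fun n ζ =>
      X.lam * Real.sqrt X.kappa / (2 * Real.pi * Complex.I) *
        (c (n + 1) * Complex.exp (-((n + 1) * ζ)))⟩]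

end

end CYStokes

namespace CYStokes

noncomputable section

open MeasureTheory Set Topology Metric

/-! ### Holomorphic dependence of integrals on a parameter -/

/-! Work with ζ = log z, and let a₀ < a₁ < a₂ < a₃ be the numbers r/d; they satisfy a_j + a_{3-j} =
1. Everything is built from one solution V that decays like e^{-z/λ} on the right half plane.

Start from z^{-a₃} e^{-z/λ}, which satisfies a first order equation, and apply three multiplicative
convolutions with Beta densities (`Family.preV`). Moving z(θ+1) through such a convolution turns it
into θ+1-a (`RapidStrip.exp_mul_lin_betaConv`), so V solves the equation (`Family.DE_V`). Each
convolution multiplies the moments by a Beta value, so by Gauss's multiplication formula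
(`Family.gGamma_eq`) the moments of V are exactly γ_d(s) (`Family.moment_V`). Near the origin V is a
combination of the four local solutions. Its coefficients are read off from the poles of the
continued moment function (`Family.coeff_eq`); the reflection formula and a trigonometric identity
then give f₄ = -2πi V (`Family.f_three_eq`).

For j = 0, 1, 2 consider -∫ V(τ) (τ-ζ)^j e^τ/(e^τ - e^ζ) dτ. Expanding the kernel geometrically
gives an asymptotic series whose terms are logarithmic moments of V, that is, ρ-derivatives of the
terms of G (`Rapid.stieltjes_isLittleO`, `Family.GTerm_eq`). The integrals solve the equation
because θ³(zV) is orthogonal to polynomials of degree at most two (`Family.correl_DE`). Their jumps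
around the origin follow from Cauchy's formula (`Family.stieltjes_jump`) and agree with those of f₁,
f₂, f₃, which are polynomial identities in the local monodromy (`Family.colPoly_monodromy`). No
nonzero solution is single-valued, so equal jumps force equality (`Family.exists_f_eq_stieltjes`).

For f₄ put H = e^{z/λ} f₄. The bounds at the origin and on the right half plane, together with
Phragmén-Lindelöf, show that H decays like a power for |arg z| ≤ π
(`Family.exists_norm_H_le_strip`). The jump of H around the origin is e^{z/λ} times a combination of
f₁, f₂, f₃, hence exponentially small near arg z = π (`Family.rapid_J`). Cauchy's formula writes H
as a transform of this jump (`Family.H_eq_stieltjes`), which again gives an expansion. Its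
coefficients satisfy the formal equation because expansions may be differentiated and are unique
(`Family.op_hSeq`). The recurrence determines them up to the leading one, which is found by
comparing large moments of V with the growth of γ_d (`Family.hSeq_two`).

Finally, Φ_{l+mπ} consists of continuations of the f_i, and L^{-k} undoes the effect of continuation
on the logarithmic moments (`Family.gTerm_eq`). The two Stokes relations are the monodromy relations
of the f_i written as matrices (`Family.vecMul_matKbar`, `Family.vecMul_matK`). -/

theorem hasDerivAt_integral_of_holomorphic {α : Type*} [MeasurableSpace α] {μ : Measure α}
    {F : ℂ → α → ℂ} {z₀ : ℂ} {r : ℝ} (hr : 0 < r) {bound : α → ℝ}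
    (hm : ∀ z ∈ ball z₀ r, AEStronglyMeasurable (F z) μ)
    (hd : ∀ᵐ a ∂μ, DifferentiableOn ℂ (fun z => F z a) (ball z₀ r))
    (hb : ∀ᵐ a ∂μ, ∀ z ∈ ball z₀ r, ‖F z a‖ ≤ bound a) (hi : Integrable bound μ) :
    HasDerivAt (fun z => ∫ a, F z a ∂μ) (∫ a, deriv (fun z => F z a) z₀ ∂μ) z₀ := by
  have h0 : z₀ ∈ ball z₀ r := mem_ball_self hr
  -- The derivative is a limit of difference quotients along a real null sequence, so it inherits
  -- measurability from the functions `F z`.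
  have hmeas : AEStronglyMeasurable (fun a => deriv (fun z => F z a) z₀) μ := by
    obtain ⟨e, he, hpos, hlt⟩ : ∃ e : ℕ → ℝ, Tendsto e atTop (𝓝 0) ∧ (∀ n, 0 < e n) ∧
        ∀ n, e n < r := by
      obtain ⟨e, -, h1, h2⟩ := exists_seq_strictAnti_tendsto' hr
      exact ⟨e, h2, fun n => (h1 n).1, fun n => (h1 n).2⟩
    refine aestronglyMeasurable_of_tendsto_ae atTop
      (f := fun n : ℕ => fun a => ((e n : ℝ) : ℂ)⁻¹ • (F (z₀ + (e n : ℂ)) a - F z₀ a))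
      (fun n => ?_) ?_
    · refine ((hm _ ?_).sub (hm _ h0)).const_smul ((e n : ℂ)⁻¹)
      rw [mem_ball, dist_eq_norm, add_sub_cancel_left, Complex.norm_real, Real.norm_eq_abs,
        abs_of_pos (hpos n)]
      exact hlt n
    · filter_upwards [hd] with a ha
      have hda : HasDerivAt (fun z => F z a) (deriv (fun z => F z a) z₀) z₀ :=
        (ha.differentiableAt (isOpen_ball.mem_nhds h0)).hasDerivAt
      refine hda.tendsto_slope_zero.comp
        (tendsto_nhdsWithin_iff.2 ⟨?_, Eventually.of_forall fun n => ?_⟩)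
      · exact (Complex.continuous_ofReal.tendsto' 0 0 Complex.ofReal_zero).comp he
      · simpa using (hpos n).ne'
  -- Cauchy's estimate on circles of radius r/4 about points of the half-radius ball bounds the
  -- derivative by `bound a / (r / 4)`, so domination of `F` itself is enough.
  refine (hasDerivAt_integral_of_dominated_loc_of_deriv_le
    (F' := fun z a => deriv (fun z => F z a) z)
    (ball_mem_nhds z₀ (half_pos hr)) (bound := fun a => bound a / (r / 4)) ?_ ?_ hmeas ?_
    (hi.div_const _) ?_).2
  · filter_upwards [ball_mem_nhds z₀ hr] with z hz using hm z hz
  · exact hi.mono' (hm _ h0) (hb.mono fun a h => h _ h0)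
  · filter_upwards [hd, hb] with a ha hba z hz
    have hsub : closedBall z (r / 4) ⊆ ball z₀ r := fun w hw => by
      rw [mem_ball] at hz ⊢; rw [mem_closedBall] at hw
      linarith [dist_triangle w z z₀]
    exact Complex.norm_deriv_le_of_forall_mem_sphere_norm_le (by positivity)
      (DifferentiableOn.diffContOnCl (ha.mono (closure_ball_subset_closedBall.trans hsub)))
      fun w hw => hba w (hsub (sphere_subset_closedBall hw))
  · filter_upwards [hd] with a ha z hz
    exact (ha.differentiableAt (isOpen_ball.mem_nhds
      (ball_subset_ball (by linarith) hz))).hasDerivAt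

/-! ### Shifting horizontal lines of integration -/

/-- The integral of `F` along the horizontal line at height `y`. -/
def lineInt (F : ℂ → ℂ) (y : ℝ) : ℂ := ∫ x : ℝ, F (x + y * Complex.I)

/-- Cauchy's theorem on the rectangle with corners ±R: the two horizontal sides differ by the
vertical ones, which have fixed length and on which `F` is at most g(±R). -/
theorem tendsto_integral_sub_of_differentiableOn_strip {F : ℂ → ℂ} {y₁ y₂ : ℝ}
    (hy : y₁ ≤ y₂) (hF : DifferentiableOn ℂ F (Complex.im ⁻¹' Icc y₁ y₂)) {g : ℝ → ℝ}
    (hg : Tendsto g (cocompact ℝ) (𝓝 0))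
    (hb : ∀ ζ : ℂ, ζ.im ∈ Icc y₁ y₂ → ‖F ζ‖ ≤ g ζ.re) :
    Tendsto (fun R : ℝ => ∫ x in (-R)..R, (F (x + y₂ * Complex.I) - F (x + y₁ * Complex.I)))
      atTop (𝓝 0) := by
  have hcont : ∀ y ∈ Icc y₁ y₂, Continuous fun x : ℝ => F (x + y * Complex.I) := fun y hy' =>
    hF.continuousOn.comp_continuous (by fun_prop) fun x => by simpa using hy'
  have key : ∀ R : ℝ, ‖∫ x in (-R)..R, (F (x + y₂ * Complex.I) - F (x + y₁ * Complex.I))‖ ≤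
      g R * |y₂ - y₁| + g (-R) * |y₂ - y₁| := by
    intro R
    have hrect := Complex.integral_boundary_rect_eq_zero_of_differentiableOn F
      ((-R : ℝ) + y₁ * Complex.I) ((R : ℝ) + y₂ * Complex.I) (hF.mono fun ζ hζ => by
        have := hζ.2
        simpa [uIcc_of_le hy] using this)
    simp only [Complex.add_re, Complex.ofReal_re, Complex.mul_re, Complex.I_re, mul_zero,
      Complex.ofReal_im, Complex.I_im, mul_one, sub_self, add_zero, Complex.add_im,
      Complex.mul_im, zero_add] at hrect
    have e : ∫ x in (-R)..R, (F (x + y₂ * Complex.I) - F (x + y₁ * Complex.I)) =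
        Complex.I • (∫ y in y₁..y₂, F ((R : ℝ) + y * Complex.I)) -
          Complex.I • (∫ y in y₁..y₂, F ((-R : ℝ) + y * Complex.I)) := by
      rw [intervalIntegral.integral_sub ((hcont _ ⟨hy, le_rfl⟩).intervalIntegrable _ _)
        ((hcont _ ⟨le_rfl, hy⟩).intervalIntegrable _ _)]
      linear_combination -hrect
    have hv : ∀ R : ℝ, ‖Complex.I • (∫ y in y₁..y₂, F ((R : ℝ) + y * Complex.I))‖ ≤
        g R * |y₂ - y₁| := by
      intro R
      rw [norm_smul, Complex.norm_I, one_mul]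
      refine intervalIntegral.norm_integral_le_of_norm_le_const fun y hy' => ?_
      rw [uIoc_of_le hy] at hy'
      simpa using hb (R + y * Complex.I) (by simpa using ⟨hy'.1.le, hy'.2⟩)
    rw [e]
    exact (norm_sub_le _ _).trans (add_le_add (hv R) (hv (-R)))
  have hR : Tendsto (fun R : ℝ => g R * |y₂ - y₁| + g (-R) * |y₂ - y₁|) atTop (𝓝 0) := by
    have h1 := (hg.mono_left atTop_le_cocompact).mul_const (|y₂ - y₁|)
    have h2 := ((hg.mono_left atBot_le_cocompact).comp tendsto_neg_atTop_atBot).mul_const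
      (|y₂ - y₁|)
    simpa using h1.add h2
  exact squeeze_zero_norm key hR

theorem lineInt_eq_of_differentiableOn_strip {F : ℂ → ℂ} {y₁ y₂ : ℝ}
    (hy : y₁ ≤ y₂) (hF : DifferentiableOn ℂ F (Complex.im ⁻¹' Icc y₁ y₂)) {g : ℝ → ℝ}
    (hg : Tendsto g (cocompact ℝ) (𝓝 0)) (hgi : Integrable g)
    (hb : ∀ ζ : ℂ, ζ.im ∈ Icc y₁ y₂ → ‖F ζ‖ ≤ g ζ.re) :
    lineInt F y₁ = lineInt F y₂ := by
  have hint : ∀ y ∈ Icc y₁ y₂, Integrable fun x : ℝ => F (x + y * Complex.I) := fun y hy' =>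
    hgi.mono' (hF.continuousOn.comp_continuous (by fun_prop) fun x => by
      simpa using hy').aestronglyMeasurable (ae_of_all _ fun x => by
        simpa using hb (x + y * Complex.I) (by simpa using hy'))
  have h := tendsto_integral_sub_of_differentiableOn_strip hy hF hg hb
  have h2 := intervalIntegral_tendsto_integral
    ((hint y₂ ⟨hy, le_rfl⟩).sub (hint y₁ ⟨le_rfl, hy⟩)) tendsto_neg_atTop_atBot tendsto_id
  have h3 := tendsto_nhds_unique h2 h
  simp only [Pi.sub_apply] at h3
  rw [integral_sub (hint y₂ ⟨hy, le_rfl⟩) (hint y₁ ⟨le_rfl, hy⟩), sub_eq_zero] at h3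
  exact h3.symm

/-! ### Exponential decay along horizontal strips -/

theorem integrable_exp_neg_mul_abs {m : ℝ} (hm : 0 < m) :
    Integrable fun x : ℝ => Real.exp (-(m * |x|)) := by
  have h1 : IntegrableOn (fun x : ℝ => Real.exp (-(m * |x|))) (Ioi 0) :=
    (exp_neg_integrableOn_Ioi 0 hm).congr_fun (fun x hx => by
      simp only; rw [abs_of_pos hx, neg_mul]) measurableSet_Ioi
  have h2 : IntegrableOn (fun x : ℝ => Real.exp (-(m * |x|))) (Iic 0) :=
    (integrableOn_exp_mul_Iic hm 0).congr_fun (fun x hx => by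
      simp only; rw [abs_of_nonpos hx, mul_neg, neg_neg]) measurableSet_Iic
  rw [← integrableOn_univ, ← Iic_union_Ioi (a := (0 : ℝ))]
  exact h2.union h1

theorem tendsto_exp_neg_mul_abs {m : ℝ} (hm : 0 < m) :
    Tendsto (fun x : ℝ => Real.exp (-(m * |x|))) (cocompact ℝ) (𝓝 0) := by
  refine Real.tendsto_exp_neg_atTop_nhds_zero.comp (Tendsto.const_mul_atTop hm ?_)
  exact tendsto_norm_cocompact_atTop

/-- `F` decays exponentially at both ends of the strip `y₁ ≤ im ζ ≤ y₂`. -/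
def ExpDecay (F : ℂ → ℂ) (y₁ y₂ : ℝ) : Prop :=
  ∃ A m : ℝ, 0 < m ∧ ∀ ζ : ℂ, ζ.im ∈ Icc y₁ y₂ → ‖F ζ‖ ≤ A * Real.exp (-(m * |ζ.re|))

theorem ExpDecay.mono {F : ℂ → ℂ} {y₁ y₂ y₁' y₂' : ℝ} (h : ExpDecay F y₁ y₂)
    (h1 : y₁ ≤ y₁') (h2 : y₂' ≤ y₂) : ExpDecay F y₁' y₂' := by
  obtain ⟨A, m, hm, h⟩ := h
  exact ⟨A, m, hm, fun ζ hζ => h ζ ⟨h1.trans hζ.1, hζ.2.trans h2⟩⟩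

theorem ExpDecay.lineInt_eq {F : ℂ → ℂ} {y₁ y₂ : ℝ} (h : ExpDecay F y₁ y₂) (hy : y₁ ≤ y₂)
    (hF : DifferentiableOn ℂ F (Complex.im ⁻¹' Icc y₁ y₂)) : lineInt F y₁ = lineInt F y₂ := by
  obtain ⟨A, m, hm, h⟩ := h
  exact lineInt_eq_of_differentiableOn_strip hy hF
    (by simpa using (tendsto_exp_neg_mul_abs hm).const_mul A)
    ((integrable_exp_neg_mul_abs hm).const_mul A) h

theorem ExpDecay.integrable {F : ℂ → ℂ} {y₁ y₂ y : ℝ} (h : ExpDecay F y₁ y₂)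
    (hy : y ∈ Icc y₁ y₂) (hF : ContinuousOn F (Complex.im ⁻¹' Icc y₁ y₂)) :
    Integrable fun x : ℝ => F (x + y * Complex.I) := by
  obtain ⟨A, m, hm, h⟩ := h
  refine ((integrable_exp_neg_mul_abs hm).const_mul A).mono'
    (hF.comp_continuous (by fun_prop) fun x => by simpa using hy).aestronglyMeasurable
    (ae_of_all _ fun x => by simpa using h (x + y * Complex.I) (by simpa using hy))

/-- Continuity bridges a compact gap in an exponential bound. -/
theorem ExpDecay.of_tail {F : ℂ → ℂ} {y₁ y₂ A m R : ℝ} (hm : 0 < m)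
    (hF : ContinuousOn F (Complex.im ⁻¹' Icc y₁ y₂))
    (h : ∀ ζ : ℂ, ζ.im ∈ Icc y₁ y₂ → R ≤ |ζ.re| → ‖F ζ‖ ≤ A * Real.exp (-(m * |ζ.re|))) :
    ExpDecay F y₁ y₂ := by
  have hK : IsCompact (Icc (-|R|) |R| ×ℂ Icc y₁ y₂) := isCompact_Icc.reProdIm isCompact_Icc
  obtain ⟨B, hB⟩ := hK.exists_bound_of_continuousOn
    (hF.mono fun ζ hζ => (Complex.mem_reProdIm.1 hζ).2)
  refine ⟨|A| + |B| * Real.exp (m * |R|), m, hm, fun ζ hζ => ?_⟩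
  rw [add_mul]
  by_cases hR : R ≤ |ζ.re|
  · refine (h ζ hζ hR).trans ?_
    have : A * Real.exp (-(m * |ζ.re|)) ≤ |A| * Real.exp (-(m * |ζ.re|)) :=
      mul_le_mul_of_nonneg_right (le_abs_self A) (Real.exp_pos _).le
    have : 0 ≤ |B| * Real.exp (m * |R|) * Real.exp (-(m * |ζ.re|)) := by positivity
    linarith
  · have hR' : |ζ.re| ≤ |R| := (not_le.1 hR).le.trans (le_abs_self R)
    have h1 := hB ζ (Complex.mem_reProdIm.2 ⟨abs_le.1 hR', hζ⟩)
    have h2 : 1 ≤ Real.exp (m * |R|) * Real.exp (-(m * |ζ.re|)) := by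
      rw [← Real.exp_add, Real.one_le_exp_iff]
      nlinarith
    have h3 : |B| ≤ |B| * (Real.exp (m * |R|) * Real.exp (-(m * |ζ.re|))) :=
      le_mul_of_one_le_right (abs_nonneg _) h2
    have : 0 ≤ |A| * Real.exp (-(m * |ζ.re|)) := by positivity
    linarith [le_abs_self B]

theorem lineInt_comp_add (F : ℂ → ℂ) (ζ : ℂ) (y : ℝ) :
    lineInt (fun τ => F (τ + ζ)) y = lineInt F (y + ζ.im) := by
  unfold lineInt
  rw [← integral_add_right_eq_self
    (fun x : ℝ => F (x + ((y + ζ.im : ℝ) : ℂ) * Complex.I)) ζ.re]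
  refine integral_congr_ae (ae_of_all _ fun x => congrArg F ?_)
  apply Complex.ext <;> simp

/-! ### The kernel -/

/-- With r = e^{Re w}, the squared norm is 1 + r² - 2r cos(Im w). On the compact range of heights
the cosine is at most some k with 0 ≤ k < 1, so this is at least (1-k)(1+r²) ≥ (1-k)(1+r)²/2. -/
theorem le_norm_one_sub_exp_of_im {α β : ℝ} (hα : 0 < α) (hβ : β < 2 * Real.pi) :
    ∃ c > 0, ∀ w : ℂ, w.im ∈ Icc α β → c * (1 + Real.exp w.re) ≤ ‖1 - Complex.exp w‖ := by
  by_cases hαβ : α ≤ β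
  swap
  · exact ⟨1, one_pos, fun w hw => absurd (hw.1.trans hw.2) hαβ⟩
  obtain ⟨k, hk0, hk1, hk⟩ : ∃ k : ℝ, 0 ≤ k ∧ k < 1 ∧ ∀ y ∈ Icc α β, Real.cos y ≤ k := by
    have hlt : ∀ y : ℝ, 0 < y → y < 2 * Real.pi → Real.cos y < 1 := fun y h0 h1 =>
      lt_of_le_of_ne (Real.cos_le_one y) fun h =>
        h0.ne' ((Real.cos_eq_one_iff_of_lt_of_lt (by linarith) h1).1 h)
    refine ⟨max 0 (max (Real.cos α) (Real.cos β)), le_max_left _ _, ?_, fun y hy => ?_⟩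
    · simp only [max_lt_iff]
      exact ⟨one_pos, hlt _ hα (by linarith), hlt _ (by linarith) hβ⟩
    · rcases le_total y Real.pi with h | h
      · exact (Real.cos_le_cos_of_nonneg_of_le_pi hα.le h hy.1).trans
          ((le_max_left _ _).trans (le_max_right _ _))
      · have := Real.cos_le_cos_of_nonneg_of_le_pi (x := 2 * Real.pi - β)
          (y := 2 * Real.pi - y) (by linarith) (by linarith) (by linarith [hy.2])
        rw [Real.cos_two_pi_sub, Real.cos_two_pi_sub] at this
        exact this.trans ((le_max_right _ _).trans (le_max_right _ _))
  refine ⟨Real.sqrt ((1 - k) / 2), Real.sqrt_pos.2 (by linarith), fun w hw => ?_⟩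
  have hr := Real.exp_pos w.re
  have e : ‖1 - Complex.exp w‖ ^ 2 =
      1 + Real.exp w.re ^ 2 - 2 * Real.exp w.re * Real.cos w.im := by
    rw [← Complex.normSq_eq_norm_sq, Complex.normSq_apply]
    simp only [Complex.sub_re, Complex.one_re, Complex.exp_re, Complex.sub_im, Complex.one_im,
      Complex.exp_im]
    linear_combination Real.exp w.re ^ 2 * Real.sin_sq_add_cos_sq w.im
  refine (sq_le_sq₀ (by positivity) (norm_nonneg _)).1 ?_
  rw [e, mul_pow, Real.sq_sqrt (by linarith)]
  have h1 := hk _ hw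
  nlinarith [mul_le_mul_of_nonneg_left h1 hr.le, sq_nonneg (1 - Real.exp w.re)]

theorem le_norm_one_sub_exp_of_re {w : ℂ} (hw : 1 ≤ |w.re|) :
    1 / 4 * (1 + Real.exp w.re) ≤ ‖1 - Complex.exp w‖ := by
  have h1 : |1 - Real.exp w.re| ≤ ‖1 - Complex.exp w‖ := by
    have := abs_norm_sub_norm_le (1 : ℂ) (Complex.exp w)
    rwa [norm_one, Complex.norm_exp] at this
  refine le_trans ?_ h1
  rcases le_abs'.1 hw with h | h
  · have h2 : Real.exp w.re * 2 ≤ 1 := by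
      have : Real.exp w.re ≤ Real.exp (-1) := Real.exp_le_exp.2 h
      have h3 : Real.exp (-1) * Real.exp 1 = 1 := by rw [← Real.exp_add]; simp
      nlinarith [Real.add_one_le_exp (1 : ℝ), Real.exp_pos (-1)]
    rw [abs_of_nonneg (by linarith [Real.exp_pos w.re])]
    linarith
  · have h2 : 2 ≤ Real.exp w.re :=
      le_trans (by linarith [Real.add_one_le_exp (1 : ℝ)]) (Real.exp_le_exp.2 h)
    rw [abs_of_nonpos (by linarith)]
    linarith

/-- `U` times the kernel `e^τ / (e^τ - e^ζ)` decays exponentially away from the poles. -/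
def Tame (U : ℂ → ℂ) (y₁ y₂ : ℝ) : Prop :=
  ∃ A m : ℝ, 0 < m ∧ ∀ ζ : ℂ, ζ.im ∈ Icc y₁ y₂ →
    ‖U ζ‖ * (Real.exp ζ.re / (1 + Real.exp ζ.re)) ≤ A * Real.exp (-(m * |ζ.re|))

theorem Tame.mono {F : ℂ → ℂ} {y₁ y₂ y₁' y₂' : ℝ} (h : Tame F y₁ y₂)
    (h1 : y₁ ≤ y₁') (h2 : y₂' ≤ y₂) : Tame F y₁' y₂' := by
  obtain ⟨A, m, hm, h⟩ := h
  exact ⟨A, m, hm, fun ζ hζ => h ζ ⟨h1.trans hζ.1, hζ.2.trans h2⟩⟩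

/-- The weight e^x/(1+e^x) is at most 1 on the right and at most e^x on the left. Hence powers
z^{-p} with 0 < p < 1 are integrable against the Cauchy kernel at both ends. -/
theorem exp_add_exp_mul_le {p q : ℝ} (hpq : p ≤ q) (x : ℝ) :
    (Real.exp (-(p * x)) + Real.exp (-(q * x))) * (Real.exp x / (1 + Real.exp x)) ≤
      2 * Real.exp (-(min p (1 - q) * |x|)) := by
  have hx := Real.exp_pos x
  have hd : 0 < 1 + Real.exp x := by linarith
  rcases le_total 0 x with h | h
  · have h1 : Real.exp x / (1 + Real.exp x) ≤ 1 := by rw [div_le_one hd]; linarith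
    have h2 : Real.exp (-(p * x)) ≤ Real.exp (-(min p (1 - q) * |x|)) := by
      rw [abs_of_nonneg h]
      exact Real.exp_le_exp.2 (by nlinarith [min_le_left p (1 - q)])
    have h3 : Real.exp (-(q * x)) ≤ Real.exp (-(p * x)) := Real.exp_le_exp.2 (by nlinarith)
    calc _ ≤ (Real.exp (-(p * x)) + Real.exp (-(q * x))) * 1 := by gcongr
      _ ≤ _ := by linarith
  · have h1 : Real.exp x / (1 + Real.exp x) ≤ Real.exp x := by
      rw [div_le_iff₀ hd]; nlinarith
    have h3 : Real.exp (-(p * x)) ≤ Real.exp (-(q * x)) := Real.exp_le_exp.2 (by nlinarith)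
    have h2 : Real.exp (-(q * x)) * Real.exp x ≤ Real.exp (-(min p (1 - q) * |x|)) := by
      rw [abs_of_nonpos h, ← Real.exp_add]
      exact Real.exp_le_exp.2 (by nlinarith [min_le_right p (1 - q)])
    calc _ ≤ (Real.exp (-(p * x)) + Real.exp (-(q * x))) * Real.exp x := by gcongr
      _ ≤ (2 * Real.exp (-(q * x))) * Real.exp x := by gcongr; linarith
      _ ≤ _ := by linarith

theorem Tame.of_bound {U : ℂ → ℂ} {y₁ y₂ C p q : ℝ} (hp : 0 < p) (hpq : p ≤ q) (hq : q < 1)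
    (h : ∀ ζ : ℂ, ζ.im ∈ Icc y₁ y₂ →
      ‖U ζ‖ ≤ C * (Real.exp (-(p * ζ.re)) + Real.exp (-(q * ζ.re)))) : Tame U y₁ y₂ := by
  refine ⟨|C| * 2, min p (1 - q), lt_min hp (by linarith), fun ζ hζ => ?_⟩
  have hx := Real.exp_pos ζ.re
  calc _ ≤ (|C| * (Real.exp (-(p * ζ.re)) + Real.exp (-(q * ζ.re)))) *
        (Real.exp ζ.re / (1 + Real.exp ζ.re)) := by
        gcongr
        exact (h ζ hζ).trans (by gcongr; exact le_abs_self C)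
    _ ≤ |C| * (2 * Real.exp (-(min p (1 - q) * |ζ.re|))) := by
        rw [mul_assoc]
        exact mul_le_mul_of_nonneg_left (exp_add_exp_mul_le hpq _) (abs_nonneg C)
    _ = _ := by ring

/-- Separates the variables: a fixed weight in τ times a constant depending on ζ. The elementary
input is (1 + 1/u)(u + v) ≥ 1 + v for positive u and v. -/
theorem norm_kernel_le {c : ℝ} (hc : 0 < c) {τ ζ : ℂ}
    (h : c * (1 + Real.exp (τ - ζ).re) ≤ ‖1 - Complex.exp (τ - ζ)‖) :
    ‖Complex.exp τ / (Complex.exp τ - Complex.exp ζ)‖ ≤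
      c⁻¹ * (1 + Real.exp (-ζ.re)) * (Real.exp τ.re / (1 + Real.exp τ.re)) := by
  have e : Complex.exp τ - Complex.exp ζ = -(Complex.exp ζ * (1 - Complex.exp (τ - ζ))) := by
    rw [mul_sub, ← Complex.exp_add]; ring_nf
  have hz := Real.exp_pos ζ.re
  have ht := Real.exp_pos τ.re
  have ed : Real.exp (τ - ζ).re = Real.exp τ.re / Real.exp ζ.re := by
    rw [Complex.sub_re, Real.exp_sub]
  have h1 : c * (Real.exp ζ.re + Real.exp τ.re) ≤ ‖Complex.exp τ - Complex.exp ζ‖ := by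
    rw [e, norm_neg, norm_mul, Complex.norm_exp]
    calc _ = Real.exp ζ.re * (c * (1 + Real.exp (τ - ζ).re)) := by rw [ed]; field_simp
      _ ≤ _ := by gcongr
  rw [norm_div, Complex.norm_exp, div_le_iff₀ (lt_of_lt_of_le (by positivity) h1)]
  refine le_trans ?_ (mul_le_mul_of_nonneg_left h1 (by positivity))
  rw [Real.exp_neg]
  have h2 : c⁻¹ * (1 + (Real.exp ζ.re)⁻¹) * (Real.exp τ.re / (1 + Real.exp τ.re)) *
      (c * (Real.exp ζ.re + Real.exp τ.re)) = Real.exp τ.re *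
      ((1 + (Real.exp ζ.re)⁻¹) * (Real.exp ζ.re + Real.exp τ.re) / (1 + Real.exp τ.re)) := by
    field_simp
  rw [h2]
  refine le_mul_of_one_le_right ht.le ?_
  rw [le_div_iff₀ (by positivity)]
  have h3 : (Real.exp ζ.re)⁻¹ * Real.exp ζ.re = 1 := inv_mul_cancel₀ hz.ne'
  have h4 : 0 < (Real.exp ζ.re)⁻¹ * Real.exp τ.re := by positivity
  nlinarith

theorem Tame.expDecay_mul_kernel {U : ℂ → ℂ} {y₁ y₂ : ℝ} (h : Tame U y₁ y₂) {ζ : ℂ}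
    (h1 : ζ.im < y₁) (h2 : y₂ < ζ.im + 2 * Real.pi) :
    ExpDecay (fun τ => U τ * (Complex.exp τ / (Complex.exp τ - Complex.exp ζ))) y₁ y₂ := by
  obtain ⟨A, m, hm, h⟩ := h
  obtain ⟨c, hc, hk⟩ := le_norm_one_sub_exp_of_im (α := y₁ - ζ.im) (β := y₂ - ζ.im)
    (by linarith) (by linarith)
  refine ⟨c⁻¹ * (1 + Real.exp (-ζ.re)) * A, m, hm, fun τ hτ => ?_⟩
  rw [norm_mul]
  calc _ ≤ ‖U τ‖ * (c⁻¹ * (1 + Real.exp (-ζ.re)) * (Real.exp τ.re / (1 + Real.exp τ.re))) := by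
        gcongr
        exact norm_kernel_le hc (hk _ (by simpa using hτ))
    _ = c⁻¹ * (1 + Real.exp (-ζ.re)) * (‖U τ‖ * (Real.exp τ.re / (1 + Real.exp τ.re))) := by ring
    _ ≤ c⁻¹ * (1 + Real.exp (-ζ.re)) * (A * Real.exp (-(m * |τ.re|))) := by
        exact mul_le_mul_of_nonneg_left (h τ hτ) (by positivity)
    _ = _ := by ring

theorem Tame.add {U V : ℂ → ℂ} {y₁ y₂ : ℝ} (hU : Tame U y₁ y₂) (hV : Tame V y₁ y₂) :
    Tame (fun τ => U τ + V τ) y₁ y₂ := by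
  obtain ⟨A, m, hm, hU⟩ := hU
  obtain ⟨B, n, hn, hV⟩ := hV
  refine ⟨|A| + |B|, min m n, lt_min hm hn, fun ζ hζ => ?_⟩
  have h1 : A * Real.exp (-(m * |ζ.re|)) ≤ |A| * Real.exp (-(min m n * |ζ.re|)) := by
    gcongr
    · exact le_abs_self A
    · exact min_le_left _ _
  have h2 : B * Real.exp (-(n * |ζ.re|)) ≤ |B| * Real.exp (-(min m n * |ζ.re|)) := by
    gcongr
    · exact le_abs_self B
    · exact min_le_right _ _
  calc _ ≤ (‖U ζ‖ + ‖V ζ‖) * (Real.exp ζ.re / (1 + Real.exp ζ.re)) := by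
        gcongr; exact norm_add_le _ _
    _ ≤ _ := by rw [add_mul, add_mul]; linarith [hU ζ hζ, hV ζ hζ]

theorem Tame.const_mul {U : ℂ → ℂ} {y₁ y₂ : ℝ} (hU : Tame U y₁ y₂) (c : ℂ) :
    Tame (fun τ => c * U τ) y₁ y₂ := by
  obtain ⟨A, m, hm, hU⟩ := hU
  refine ⟨‖c‖ * A, m, hm, fun ζ hζ => ?_⟩
  rw [norm_mul, mul_assoc, mul_assoc]
  exact mul_le_mul_of_nonneg_left (hU ζ hζ) (norm_nonneg _)

/-- This function takes the value 1 at ζ and its kernel integrals are explicit. It is the reference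
subtracted to remove the pole in Cauchy's formula. -/
theorem tame_exp_neg_half (ζ : ℂ) (y₁ y₂ : ℝ) :
    Tame (fun τ => Complex.exp (-((τ - ζ) / 2))) y₁ y₂ := by
  refine Tame.of_bound (p := 1 / 2) (q := 1 / 2) (C := Real.exp (ζ.re / 2)) (by norm_num) le_rfl
    (by norm_num) fun τ _ => ?_
  rw [Complex.norm_exp]
  have : (-((τ - ζ) / 2)).re = ζ.re / 2 + -(1 / 2 * τ.re) := by
    simp; ring
  rw [this, Real.exp_add]
  have := Real.exp_pos (ζ.re / 2)
  have := Real.exp_pos (-(1 / 2 * τ.re))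
  nlinarith [mul_pos ‹0 < Real.exp (ζ.re / 2)› this]

theorem exp_kernel_ne_zero {τ ζ : ℂ} (h0 : τ ≠ ζ) (h1 : |τ.im - ζ.im| < 2 * Real.pi) :
    Complex.exp τ - Complex.exp ζ ≠ 0 := by
  intro h
  obtain ⟨n, hn⟩ := Complex.exp_eq_exp_iff_exists_int.1 (sub_eq_zero.1 h)
  have him : τ.im - ζ.im = n * (2 * Real.pi) := by rw [hn]; simp
  have hn0 : n = 0 := by
    rw [him, abs_mul, abs_of_pos (show 0 < 2 * Real.pi by positivity)] at h1
    have h2 : |(n : ℝ)| < 1 := by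
      by_contra! h3
      nlinarith [Real.pi_pos]
    rw [← Int.cast_abs] at h2
    exact Int.abs_lt_one_iff.1 (by exact_mod_cast h2)
  exact h0 (by rw [hn, hn0]; simp)

/-- A kernel integral does not change across a point where the density vanishes. -/
theorem Tame.lineInt_kernel_eq {U : ℂ → ℂ} {y₁ y₂ : ℝ} (hb : Tame U y₁ y₂)
    (hU : DifferentiableOn ℂ U (Complex.im ⁻¹' Icc y₁ y₂)) {ζ : ℂ} (h1 : y₁ < ζ.im)
    (h2 : ζ.im < y₂) (h1' : ζ.im - 2 * Real.pi < y₁) (h2' : y₂ < ζ.im + 2 * Real.pi)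
    (h0 : U ζ = 0) :
    lineInt (fun τ => U τ * (Complex.exp τ / (Complex.exp τ - Complex.exp ζ))) y₁ =
      lineInt (fun τ => U τ * (Complex.exp τ / (Complex.exp τ - Complex.exp ζ))) y₂ := by
  -- Divided differences of `U` and of the exponential at ζ turn the integrand into a quotient `G`
  -- that is holomorphic across ζ, so the line may be moved through that point.
  set E : ℂ → ℂ := dslope Complex.exp ζ
  set G : ℂ → ℂ := fun τ => dslope U ζ τ * (Complex.exp τ / E τ) with hG
  have hne : ∀ τ : ℂ, τ.im ∈ Icc y₁ y₂ → E τ ≠ 0 := by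
    intro τ hτ
    by_cases h : τ = ζ
    · rw [h]; simp [E, dslope_same]
    · intro hE
      have := sub_smul_dslope Complex.exp ζ τ
      rw [show dslope Complex.exp ζ τ = 0 from hE, smul_zero] at this
      exact exp_kernel_ne_zero h (abs_lt.2 ⟨by linarith [hτ.1], by linarith [hτ.2]⟩) this.symm
  have hGeq : ∀ τ : ℂ, τ ≠ ζ →
      G τ = U τ * (Complex.exp τ / (Complex.exp τ - Complex.exp ζ)) := by
    intro τ hτ
    have e1 := sub_smul_dslope Complex.exp ζ τ
    have e2 := sub_smul_dslope U ζ τ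
    rw [h0, sub_zero, smul_eq_mul] at e2
    rw [smul_eq_mul] at e1
    rw [← e1, ← e2, hG]
    have : τ - ζ ≠ 0 := sub_ne_zero.2 hτ
    simp only [E]
    field_simp
  have hnhds : Complex.im ⁻¹' Icc y₁ y₂ ∈ 𝓝 ζ :=
    Complex.continuous_im.continuousAt.preimage_mem_nhds (Icc_mem_nhds h1 h2)
  have hGd : DifferentiableOn ℂ G (Complex.im ⁻¹' Icc y₁ y₂) := by
    refine ((Complex.differentiableOn_dslope hnhds).2 hU).mul
      (Complex.differentiable_exp.differentiableOn.div ?_ hne)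
    exact (Complex.differentiableOn_dslope hnhds).2 Complex.differentiable_exp.differentiableOn
  have hGe : ExpDecay G y₁ y₂ := by
    obtain ⟨A, m, hm, hb⟩ := hb
    refine ExpDecay.of_tail (A := (1 / 4 : ℝ)⁻¹ * (1 + Real.exp (-ζ.re)) * A)
      (R := |ζ.re| + 1) hm hGd.continuousOn fun τ hτ hR => ?_
    have hre : 1 ≤ |(τ - ζ).re| := by
      rw [Complex.sub_re]
      linarith [abs_sub_abs_le_abs_sub τ.re ζ.re]
    have hne' : τ ≠ ζ := by rintro rfl; norm_num at hre
    rw [hGeq τ hne', norm_mul]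
    calc _ ≤ ‖U τ‖ * ((1 / 4 : ℝ)⁻¹ * (1 + Real.exp (-ζ.re)) *
          (Real.exp τ.re / (1 + Real.exp τ.re))) := by
          gcongr
          exact norm_kernel_le (by norm_num) (le_norm_one_sub_exp_of_re hre)
      _ = (1 / 4 : ℝ)⁻¹ * (1 + Real.exp (-ζ.re)) *
          (‖U τ‖ * (Real.exp τ.re / (1 + Real.exp τ.re))) := by ring
      _ ≤ (1 / 4 : ℝ)⁻¹ * (1 + Real.exp (-ζ.re)) * (A * Real.exp (-(m * |τ.re|))) := by
          exact mul_le_mul_of_nonneg_left (hb τ hτ) (by positivity)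
      _ = _ := by ring
  have hline : ∀ y : ℝ, y ≠ ζ.im → lineInt G y =
      lineInt (fun τ => U τ * (Complex.exp τ / (Complex.exp τ - Complex.exp ζ))) y := by
    intro y hy
    unfold lineInt
    refine integral_congr_ae (ae_of_all _ fun x => hGeq _ fun h => hy ?_)
    simpa using congrArg Complex.im h
  rw [← hline y₁ h1.ne, ← hline y₂ h2.ne', hGe.lineInt_eq (by linarith) hGd]

theorem Tame.lineInt_kernel_eq_of_lt {U : ℂ → ℂ} {y₁ y₂ : ℝ} (hb : Tame U y₁ y₂) (hy : y₁ ≤ y₂)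
    (hU : DifferentiableOn ℂ U (Complex.im ⁻¹' Icc y₁ y₂)) {ζ : ℂ} (h1 : ζ.im < y₁)
    (h2 : y₂ < ζ.im + 2 * Real.pi) :
    lineInt (fun τ => U τ * (Complex.exp τ / (Complex.exp τ - Complex.exp ζ))) y₁ =
      lineInt (fun τ => U τ * (Complex.exp τ / (Complex.exp τ - Complex.exp ζ))) y₂ := by
  refine (hb.expDecay_mul_kernel h1 h2).lineInt_eq hy (hU.mul
    (Complex.differentiable_exp.differentiableOn.div
      (Complex.differentiable_exp.sub_const _).differentiableOn fun τ hτ => ?_))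
  have := hτ.1; have := hτ.2
  refine exp_kernel_ne_zero (fun h => ?_) (abs_lt.2 ⟨by linarith [Real.pi_pos], by linarith⟩)
  rw [h] at this; linarith [hτ.1, h ▸ hτ.1]

theorem exp_sub_two_pi_I (ζ : ℂ) : Complex.exp (ζ - 2 * Real.pi * Complex.I) = Complex.exp ζ :=
  Complex.exp_periodic.sub_eq ζ

theorem exp_add_two_pi_I (ζ : ℂ) : Complex.exp (ζ + 2 * Real.pi * Complex.I) = Complex.exp ζ :=
  Complex.exp_periodic ζ

theorem Tame.integrable_kernel_of_lt {U : ℂ → ℂ} {y : ℝ} (hb : Tame U y y)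
    (hU : ContinuousOn U (Complex.im ⁻¹' Icc y y)) {ζ : ℂ} (h1 : ζ.im < y)
    (h2 : y < ζ.im + 2 * Real.pi) :
    Integrable fun x : ℝ => U (x + y * Complex.I) * (Complex.exp (x + y * Complex.I) /
      (Complex.exp (x + y * Complex.I) - Complex.exp ζ)) := by
  refine (hb.expDecay_mul_kernel h1 h2).integrable ⟨le_rfl, le_rfl⟩ (hU.mul
    (Complex.continuous_exp.continuousOn.div
      (Complex.continuous_exp.sub continuous_const).continuousOn fun τ hτ => ?_))
  have h3 := hτ.1; have h4 := hτ.2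
  refine exp_kernel_ne_zero (fun h => ?_) (abs_lt.2 ⟨by linarith [Real.pi_pos], by linarith⟩)
  rw [h] at h3; linarith

/-- The kernel depends on ζ only modulo 2πi, so a line below ζ is a line above ζ - 2πi. -/
theorem Tame.integrable_kernel {U : ℂ → ℂ} {y : ℝ} (hb : Tame U y y)
    (hU : ContinuousOn U (Complex.im ⁻¹' Icc y y)) {ζ : ℂ} (h0 : y ≠ ζ.im)
    (h1 : ζ.im - 2 * Real.pi < y) (h2 : y < ζ.im + 2 * Real.pi) :
    Integrable fun x : ℝ => U (x + y * Complex.I) * (Complex.exp (x + y * Complex.I) /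
      (Complex.exp (x + y * Complex.I) - Complex.exp ζ)) := by
  rcases lt_or_gt_of_ne h0 with h | h
  · have := hb.integrable_kernel_of_lt hU (ζ := ζ - 2 * Real.pi * Complex.I) (by simpa using h1)
      (by simpa using h)
    simpa only [exp_sub_two_pi_I] using this
  · exact hb.integrable_kernel_of_lt hU h h2

/-! ### Cauchy's formula on a strip with the 2πi-periodic kernel -/

theorem integral_exp_half_div : ∫ x : ℝ, Real.exp (x / 2) / (1 + Real.exp x) = Real.pi := by
  have hd : ∀ x : ℝ, HasDerivAt (fun x => 2 * Real.arctan (Real.exp (x / 2)))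
      (Real.exp (x / 2) / (1 + Real.exp x)) x := by
    intro x
    have h1 : HasDerivAt (fun x : ℝ => Real.exp (x / 2)) (Real.exp (x / 2) * (1 / 2)) x :=
      ((hasDerivAt_id x).div_const 2).exp
    have h2 := (h1.arctan).const_mul 2
    refine h2.congr_deriv ?_
    have : Real.exp (x / 2) ^ 2 = Real.exp x := by rw [← Real.exp_nat_mul]; congr 1; push_cast; ring
    rw [this]
    ring
  have ht : Tendsto (fun x : ℝ => 2 * Real.arctan (Real.exp (x / 2))) atTop (𝓝 Real.pi) := by
    have := ((Real.tendsto_arctan_atTop.mono_right nhdsWithin_le_nhds).comp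
      (Real.tendsto_exp_atTop.comp (tendsto_id.atTop_div_const (zero_lt_two' ℝ)))).const_mul 2
    rw [mul_div_cancel₀ Real.pi two_ne_zero] at this
    exact this
  have hb : Tendsto (fun x : ℝ => 2 * Real.arctan (Real.exp (x / 2))) atBot (𝓝 0) := by
    have := ((Real.continuous_arctan.tendsto 0).comp
      (Real.tendsto_exp_atBot.comp (tendsto_id.atBot_div_const (zero_lt_two' ℝ)))).const_mul 2
    simpa using this
  have hi : Integrable fun x : ℝ => Real.exp (x / 2) / (1 + Real.exp x) := by
    refine ((integrable_exp_neg_mul_abs (m := 1 / 2) (by norm_num)).const_mul 1).mono' ?_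
      (ae_of_all _ fun x => ?_)
    · exact (Continuous.div (by fun_prop) (by fun_prop) fun x => by positivity).aestronglyMeasurable
    · rw [Real.norm_of_nonneg (by positivity)]
      have := exp_add_exp_mul_le (p := 1 / 2) (q := 1 / 2) le_rfl x
      have e : Real.exp (x / 2) = Real.exp (-(1 / 2 * x)) * Real.exp x := by
        rw [← Real.exp_add]; congr 1; ring
      rw [e]
      rw [show min (1 / 2 : ℝ) (1 - 1 / 2) = 1 / 2 by norm_num, ← two_mul, mul_assoc] at this
      rw [mul_div_assoc]
      linarith
  rw [integral_of_hasDerivAt_of_tendsto hd hi hb ht, sub_zero]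

/-- At height π the integrand becomes -i e^{x/2}/(1 + e^x), whose integral is elementary; the other
heights in (0, 2π) follow by moving the line. -/
theorem lineInt_exp_neg_half_kernel {y : ℝ} (h0 : 0 < y) (h1 : y < 2 * Real.pi) :
    lineInt (fun τ => Complex.exp (-(τ / 2)) * (Complex.exp τ / (Complex.exp τ - 1))) y =
      -(Complex.I * Real.pi) := by
  have hT : ∀ y₁ y₂, Tame (fun τ => Complex.exp (-(τ / 2))) y₁ y₂ := fun y₁ y₂ => by
    simpa using tame_exp_neg_half 0 y₁ y₂
  have hd : Differentiable ℂ fun τ : ℂ => Complex.exp (-(τ / 2)) := by fun_prop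
  have hpi : lineInt (fun τ => Complex.exp (-(τ / 2)) * (Complex.exp τ / (Complex.exp τ - 1)))
      Real.pi = -(Complex.I * Real.pi) := by
    unfold lineInt
    have hval : ((∫ x : ℝ, Real.exp (x / 2) / (1 + Real.exp x) : ℝ) : ℂ) = Real.pi := by
      rw [integral_exp_half_div]
    rw [show -(Complex.I * (Real.pi : ℂ)) = ∫ x : ℝ, -(Complex.I *
      ((Real.exp (x / 2) / (1 + Real.exp x) : ℝ) : ℂ)) by
        rw [integral_neg, integral_const_mul, integral_complex_ofReal, hval]]
    refine integral_congr_ae (ae_of_all _ fun x => ?_)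
    simp only
    have e1 : Complex.exp (x + Real.pi * Complex.I) = -Complex.exp x := by
      rw [Complex.exp_add, Complex.exp_pi_mul_I]; ring
    have e2 : Complex.exp (-((x + Real.pi * Complex.I) / 2)) = -Complex.I * Complex.exp (-(x / 2)) := by
      rw [show -((x + Real.pi * Complex.I) / 2 : ℂ) = -(x / 2) + -(Real.pi / 2 * Complex.I) by ring,
        Complex.exp_add, Complex.exp_neg (Real.pi / 2 * Complex.I), Complex.exp_pi_div_two_mul_I,
        Complex.inv_I]
      ring
    have e3 : Complex.exp (x : ℂ) = Complex.exp (x / 2) * Complex.exp (x / 2) := by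
      rw [← Complex.exp_add]; ring_nf
    have e4 : (1 + Complex.exp (x : ℂ)) ≠ 0 := by
      rw [← Complex.ofReal_exp]; norm_cast; positivity
    rw [e1, e2, Complex.exp_neg]
    push_cast
    have e6 : (1 + Complex.exp (x / 2 : ℂ) * Complex.exp (x / 2 : ℂ)) ≠ 0 := by rwa [← e3]
    rw [e3, show ∀ E : ℂ, -(E * E) - 1 = -(1 + E * E) from fun E => by ring]
    field_simp
  have hgo : ∀ y₁ y₂ : ℝ, 0 < y₁ → y₁ ≤ y₂ → y₂ < 2 * Real.pi →
      lineInt (fun τ => Complex.exp (-(τ / 2)) * (Complex.exp τ / (Complex.exp τ - 1))) y₁ =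
      lineInt (fun τ => Complex.exp (-(τ / 2)) * (Complex.exp τ / (Complex.exp τ - 1))) y₂ := by
    intro y₁ y₂ h1 h2 h3
    simpa using (hT y₁ y₂).lineInt_kernel_eq_of_lt h2 hd.differentiableOn (ζ := 0)
      (by simpa using h1) (by simpa using h3)
  rcases le_total y Real.pi with h | h
  · rw [hgo y _ h0 h (by linarith [Real.pi_pos]), hpi]
  · rw [← hgo _ y Real.pi_pos h h1, hpi]

/-- The integrand equals 1/(e^{τ/2} - e^{-τ/2}), an odd function of τ, so reflection changes the
sign of the integral. -/
theorem lineInt_exp_neg_half_kernel' {y : ℝ} (h0 : 0 < y) (h1 : y < 2 * Real.pi) :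
    lineInt (fun τ => Complex.exp (-(τ / 2)) * (Complex.exp τ / (Complex.exp τ - 1))) (-y) =
      Complex.I * Real.pi := by
  rw [← neg_neg (Complex.I * Real.pi : ℂ), ← lineInt_exp_neg_half_kernel h0 h1]
  unfold lineInt
  rw [← integral_neg_eq_self, ← integral_neg]
  refine integral_congr_ae (ae_of_all _ fun x => ?_)
  have e : ((-x : ℝ) : ℂ) + ((-y : ℝ) : ℂ) * Complex.I = -(x + y * Complex.I) := by push_cast; ring
  simp only
  rw [e]
  generalize (x + y * Complex.I : ℂ) = w
  have e3 : Complex.exp w = Complex.exp (w / 2) * Complex.exp (w / 2) := by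
    rw [← Complex.exp_add]; ring_nf
  rw [neg_div, neg_neg, Complex.exp_neg, Complex.exp_neg, e3]
  have hne := Complex.exp_ne_zero (w / 2)
  by_cases h : Complex.exp (w / 2) * Complex.exp (w / 2) = 1
  · rw [h]; simp
  · have h3 : (Complex.exp (w / 2) * Complex.exp (w / 2))⁻¹ - 1 =
        -((Complex.exp (w / 2) * Complex.exp (w / 2)) - 1) /
          (Complex.exp (w / 2) * Complex.exp (w / 2)) := by
      field_simp
      ring
    rw [h3]
    have h4 := sub_ne_zero.2 h
    field_simp

/-- Cauchy's formula for the strip, with the periodic kernel. -/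
theorem Tame.lineInt_kernel_sub {U : ℂ → ℂ} {y₁ y₂ : ℝ} (hb : Tame U y₁ y₂)
    (hU : DifferentiableOn ℂ U (Complex.im ⁻¹' Icc y₁ y₂)) {ζ : ℂ} (h1 : y₁ < ζ.im)
    (h2 : ζ.im < y₂) (h1' : ζ.im - 2 * Real.pi < y₁) (h2' : y₂ < ζ.im + 2 * Real.pi) :
    lineInt (fun τ => U τ * (Complex.exp τ / (Complex.exp τ - Complex.exp ζ))) y₁ -
      lineInt (fun τ => U τ * (Complex.exp τ / (Complex.exp τ - Complex.exp ζ))) y₂ =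
      2 * Real.pi * Complex.I * U ζ := by
  set P : ℂ → ℂ := fun τ => Complex.exp (-((τ - ζ) / 2)) with hP
  have hPd : Differentiable ℂ P := by fun_prop
  -- The density U - U(ζ)P vanishes at ζ, so its kernel integral is the same on both lines. The
  -- integrals of P, equal to iπ below and -iπ above, produce 2πi U(ζ).
  set U₂ : ℂ → ℂ := fun τ => U τ + -U ζ * P τ with hU₂
  have hU₂b : Tame U₂ y₁ y₂ := hb.add ((tame_exp_neg_half ζ y₁ y₂).const_mul _)
  have hU₂d : DifferentiableOn ℂ U₂ (Complex.im ⁻¹' Icc y₁ y₂) :=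
    hU.add (hPd.differentiableOn.const_mul _)
  have h12 : y₁ ≤ y₂ := by linarith
  have key := hU₂b.lineInt_kernel_eq hU₂d h1 h2 h1' h2' (by simp [hU₂, hP])
  have hPval : ∀ y, lineInt (fun τ => P τ * (Complex.exp τ / (Complex.exp τ - Complex.exp ζ))) y =
      lineInt (fun τ => Complex.exp (-(τ / 2)) * (Complex.exp τ / (Complex.exp τ - 1)))
        (y - ζ.im) := by
    intro y
    have := lineInt_comp_add
      (fun τ => Complex.exp (-(τ / 2)) * (Complex.exp τ / (Complex.exp τ - 1))) (-ζ) y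
    rw [Complex.neg_im, ← sub_eq_add_neg] at this
    rw [← this]
    congr 1; ext τ
    rw [← sub_eq_add_neg, hP]
    simp only
    congr 1
    rw [Complex.exp_sub]
    have := Complex.exp_ne_zero ζ
    by_cases h : Complex.exp τ = Complex.exp ζ
    · rw [h]; simp
    · have h4 := sub_ne_zero.2 h
      have : Complex.exp τ / Complex.exp ζ - 1 ≠ 0 := by
        rwa [div_sub_one (Complex.exp_ne_zero ζ), div_ne_zero_iff, and_iff_left this]
      field_simp
  have hsplit : ∀ y ∈ Icc y₁ y₂, y ≠ ζ.im →
      lineInt (fun τ => U₂ τ * (Complex.exp τ / (Complex.exp τ - Complex.exp ζ))) y =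
      lineInt (fun τ => U τ * (Complex.exp τ / (Complex.exp τ - Complex.exp ζ))) y -
      U ζ * lineInt (fun τ => Complex.exp (-(τ / 2)) * (Complex.exp τ / (Complex.exp τ - 1)))
        (y - ζ.im) := by
    intro y hy hne
    rw [← hPval]
    unfold lineInt
    have hsub : Complex.im ⁻¹' Icc y y ⊆ Complex.im ⁻¹' Icc y₁ y₂ :=
      preimage_mono (Icc_subset_Icc hy.1 hy.2)
    have i1 := (hb.mono hy.1 hy.2).integrable_kernel (hU.continuousOn.mono hsub) hne
      (h1'.trans_le hy.1) (hy.2.trans_lt h2')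
    have i2 := (tame_exp_neg_half ζ y y).integrable_kernel
      hPd.continuous.continuousOn hne (h1'.trans_le hy.1) (hy.2.trans_lt h2')
    rw [← integral_const_mul, ← integral_sub i1 (i2.const_mul _)]
    refine integral_congr_ae (ae_of_all _ fun x => ?_)
    simp only [hU₂, hP]
    ring
  have e2 := lineInt_exp_neg_half_kernel (y := y₂ - ζ.im) (by linarith) (by linarith)
  have e1 := lineInt_exp_neg_half_kernel' (y := ζ.im - y₁) (by linarith) (by linarith)
  rw [hsplit y₁ ⟨le_rfl, h12⟩ h1.ne, hsplit y₂ ⟨h12, le_rfl⟩ h2.ne', e2,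
    ← neg_sub ζ.im y₁, e1] at key
  linear_combination key

/-! ### Densities with doubly exponential decay -/

theorem exists_exp_mul_exp_neg_exp_le {s c : ℝ} (hs : 0 < s) (hc : 0 < c) (j : ℕ) :
    ∃ A m : ℝ, 0 < m ∧ ∀ x : ℝ,
      Real.exp (s * x) * Real.exp (-(c * Real.exp x)) * (1 + |x|) ^ j ≤
        A * Real.exp (-(m * |x|)) := by
  -- One has e^{-c e^x} ≤ (k!/c^k) e^{-kx}. Taking k ≥ 2s turns e^{sx} into decay at rate s on the
  -- right, half of which absorbs the polynomial factor.
  obtain ⟨k, hk⟩ := exists_nat_ge (2 * s)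
  have hk' : (0 : ℝ) < k.factorial := by positivity
  set B : ℝ := k.factorial / c ^ k with hB
  set D : ℝ := j.factorial / (s / 2) ^ j * Real.exp (s / 2) with hD
  have hpoly : ∀ x : ℝ, (1 + |x|) ^ j ≤ D * Real.exp (s / 2 * |x|) := by
    intro x
    have h := Real.pow_div_factorial_le_exp (x := s / 2 * (1 + |x|)) (by positivity) j
    rw [mul_pow, mul_add, mul_one, Real.exp_add, div_le_iff₀ (by positivity)] at h
    rw [hD, mul_assoc, div_mul_eq_mul_div, le_div_iff₀ (by positivity)]
    linarith
  have hexp : ∀ x : ℝ, Real.exp (-(c * Real.exp x)) ≤ B * Real.exp (-(k * x)) := by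
    intro x
    have h := Real.pow_div_factorial_le_exp (x := c * Real.exp x) (by positivity) k
    rw [mul_pow, ← Real.exp_nat_mul, div_le_iff₀ hk'] at h
    rw [Real.exp_neg, Real.exp_neg, hB, inv_le_iff_one_le_mul₀ (by positivity)]
    have e1 : 0 < c ^ k * Real.exp (k * x) := by positivity
    calc (1 : ℝ) = (c ^ k * Real.exp (k * x)) / (c ^ k * Real.exp (k * x)) := by
          rw [div_self e1.ne']
      _ ≤ (Real.exp (c * Real.exp x) * k.factorial) / (c ^ k * Real.exp (k * x)) := by gcongr
      _ = _ := by field_simp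
  refine ⟨(1 + B) * D, s / 2, by positivity, fun x => ?_⟩
  have hB0 : 0 ≤ B := by positivity
  have hD0 : 0 ≤ D := by positivity
  have key : Real.exp (s * x) * Real.exp (-(c * Real.exp x)) ≤ (1 + B) * Real.exp (-(s * |x|)) := by
    rcases le_total 0 x with h | h
    · rw [abs_of_nonneg h]
      calc _ ≤ Real.exp (s * x) * (B * Real.exp (-(k * x))) := by gcongr; exact hexp x
        _ = B * Real.exp (s * x + -(k * x)) := by rw [Real.exp_add]; ring
        _ ≤ (1 + B) * Real.exp (-(s * x)) := by
            gcongr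
            · linarith
            · nlinarith
    · rw [abs_of_nonpos h]
      have h1 : Real.exp (-(c * Real.exp x)) ≤ 1 := by
        rw [Real.exp_le_one_iff]; have := Real.exp_pos x; nlinarith
      calc _ ≤ Real.exp (s * x) * 1 := by gcongr
        _ = 1 * Real.exp (-(s * -x)) := by rw [mul_one, one_mul]; congr 1; ring
        _ ≤ _ := by gcongr; linarith
  calc _ ≤ ((1 + B) * Real.exp (-(s * |x|))) * (D * Real.exp (s / 2 * |x|)) := by
        gcongr; exact hpoly x
    _ = (1 + B) * D * (Real.exp (-(s * |x|)) * Real.exp (s / 2 * |x|)) := by ring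
    _ = _ := by rw [← Real.exp_add]; congr 2; ring

/-- Doubly exponential decay to the right, growth at most `e^(-b re ζ)` to the left. -/
def Rapid (U : ℂ → ℂ) (b y₁ y₂ : ℝ) : Prop :=
  ∃ C c : ℝ, 0 < c ∧ ∀ ζ : ℂ, ζ.im ∈ Icc y₁ y₂ →
    ‖U ζ‖ ≤ C * (Real.exp (-(b * ζ.re)) * Real.exp (-(c * Real.exp ζ.re)))

theorem Rapid.mono {U : ℂ → ℂ} {b y₁ y₂ y₁' y₂' : ℝ} (h : Rapid U b y₁ y₂)
    (h1 : y₁ ≤ y₁') (h2 : y₂' ≤ y₂) : Rapid U b y₁' y₂' := by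
  obtain ⟨A, m, hm, h⟩ := h
  exact ⟨A, m, hm, fun ζ hζ => h ζ ⟨h1.trans hζ.1, hζ.2.trans h2⟩⟩

theorem Rapid.exists_bound {U : ℂ → ℂ} {b y₁ y₂ s : ℝ} (h : Rapid U b y₁ y₂) (hs : b < s)
    (j : ℕ) : ∃ A m : ℝ, 0 < m ∧ ∀ ζ : ℂ, ζ.im ∈ Icc y₁ y₂ →
      ‖U ζ‖ * (1 + |ζ.re|) ^ j * Real.exp (s * ζ.re) ≤ A * Real.exp (-(m * |ζ.re|)) := by
  obtain ⟨C, c, hc, h⟩ := h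
  obtain ⟨A, m, hm, hA⟩ := exists_exp_mul_exp_neg_exp_le (sub_pos.2 hs) hc j
  refine ⟨|C| * A, m, hm, fun ζ hζ => ?_⟩
  calc _ ≤ (|C| * (Real.exp (-(b * ζ.re)) * Real.exp (-(c * Real.exp ζ.re)))) *
        (1 + |ζ.re|) ^ j * Real.exp (s * ζ.re) := by
        gcongr
        exact (h ζ hζ).trans (by gcongr; exact le_abs_self C)
    _ = |C| * (Real.exp ((s - b) * ζ.re) * Real.exp (-(c * Real.exp ζ.re)) * (1 + |ζ.re|) ^ j) := by
        rw [show (s - b) * ζ.re = s * ζ.re + -(b * ζ.re) by ring, Real.exp_add]; ring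
    _ ≤ |C| * (A * Real.exp (-(m * |ζ.re|))) :=
        mul_le_mul_of_nonneg_left (hA _) (abs_nonneg C)
    _ = _ := by ring

theorem norm_sub_pow_le (τ ζ : ℂ) (j : ℕ) :
    ‖(τ - ζ) ^ j‖ ≤ (1 + |τ.im| + ‖ζ‖) ^ j * (1 + |τ.re|) ^ j := by
  rw [norm_pow, ← mul_pow]
  gcongr
  have h1 : ‖τ - ζ‖ ≤ |τ.re| + |τ.im| + ‖ζ‖ :=
    (norm_sub_le _ _).trans (by gcongr; exact Complex.norm_le_abs_re_add_abs_im τ)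
  nlinarith [abs_nonneg τ.re, abs_nonneg τ.im, norm_nonneg ζ,
    mul_nonneg (abs_nonneg τ.im) (abs_nonneg τ.re), mul_nonneg (norm_nonneg ζ) (abs_nonneg τ.re)]

theorem Rapid.integrable_mul {U : ℂ → ℂ} {b y₁ y₂ s y : ℝ} (h : Rapid U b y₁ y₂) (hs : b < s)
    (hy : y ∈ Icc y₁ y₂) (j : ℕ) {g : ℂ → ℂ} {B : ℝ}
    (hU : Continuous fun x : ℝ => U (x + y * Complex.I))
    (hg : Continuous fun x : ℝ => g (x + y * Complex.I))
    (hgb : ∀ x : ℝ, ‖g (x + y * Complex.I)‖ ≤ B * ((1 + |x|) ^ j * Real.exp (s * x))) :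
    Integrable fun x : ℝ => U (x + y * Complex.I) * g (x + y * Complex.I) := by
  obtain ⟨A, m, hm, hA⟩ := h.exists_bound hs j
  have hB : 0 ≤ B := by
    have := (norm_nonneg _).trans (hgb 0)
    simpa using this
  refine ((integrable_exp_neg_mul_abs hm).const_mul (B * A)).mono'
    (hU.mul hg).aestronglyMeasurable (ae_of_all _ fun x => ?_)
  have h1 := hA (x + y * Complex.I) (by simpa using hy)
  simp only [Complex.add_re, Complex.ofReal_re, Complex.mul_re, Complex.I_re, mul_zero,
    Complex.ofReal_im, Complex.I_im, mul_one, sub_self, add_zero] at h1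
  rw [norm_mul]
  calc _ ≤ ‖U (x + y * Complex.I)‖ * (B * ((1 + |x|) ^ j * Real.exp (s * x))) := by
        gcongr; exact hgb x
    _ = B * (‖U (x + y * Complex.I)‖ * (1 + |x|) ^ j * Real.exp (s * x)) := by ring
    _ ≤ B * (A * Real.exp (-(m * |x|))) := by gcongr
    _ = _ := by ring

theorem Rapid.tame_mul_pow {U : ℂ → ℂ} {b y₁ y₂ : ℝ} (h : Rapid U b y₁ y₂) (hb : b < 1)
    (ζ : ℂ) (j : ℕ) : Tame (fun τ => U τ * (τ - ζ) ^ j) y₁ y₂ := by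
  obtain ⟨A, m, hm, hA⟩ := h.exists_bound hb j
  refine ⟨(1 + max |y₁| |y₂| + ‖ζ‖) ^ j * A, m, hm, fun τ hτ => ?_⟩
  have him : |τ.im| ≤ max |y₁| |y₂| := abs_le_max_abs_abs hτ.1 hτ.2
  have hx := Real.exp_pos τ.re
  have h1 : Real.exp τ.re / (1 + Real.exp τ.re) ≤ Real.exp (1 * τ.re) := by
    rw [one_mul, div_le_iff₀ (by linarith)]; nlinarith
  rw [norm_mul]
  calc _ ≤ ‖U τ‖ * ((1 + max |y₁| |y₂| + ‖ζ‖) ^ j * (1 + |τ.re|) ^ j) * Real.exp (1 * τ.re) := by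
        gcongr
        exact (norm_sub_pow_le τ ζ j).trans (by gcongr)
    _ = (1 + max |y₁| |y₂| + ‖ζ‖) ^ j * (‖U τ‖ * (1 + |τ.re|) ^ j * Real.exp (1 * τ.re)) := by ring
    _ ≤ (1 + max |y₁| |y₂| + ‖ζ‖) ^ j * (A * Real.exp (-(m * |τ.re|))) :=
        mul_le_mul_of_nonneg_left (hA τ hτ) (by positivity)
    _ = _ := by ring

/-! ### The Stieltjes-type transform -/

/-- `∫ U(τ) (τ - ζ)^j e^τ / (e^τ - e^ζ) dτ` along the line `im τ = y`. -/
def stieltjes (U : ℂ → ℂ) (j : ℕ) (y : ℝ) (ζ : ℂ) : ℂ :=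
  lineInt (fun τ => U τ * (τ - ζ) ^ j *
    (Complex.exp τ / (Complex.exp τ - Complex.exp ζ))) y

/-- The coefficient of `z^(-n-1)` in the expansion of the transform. -/
def stieltjesTerm (U : ℂ → ℂ) (j n : ℕ) (y : ℝ) (ζ : ℂ) : ℂ :=
  lineInt (fun τ => U τ * ((τ - ζ) ^ j * Complex.exp ((n + 1) * (τ - ζ)))) y

theorem Rapid.integrable_term {U : ℂ → ℂ} {b y : ℝ} (h : Rapid U b y y) (hb : b < 1)
    (hU : Continuous fun x : ℝ => U (x + y * Complex.I)) (j n : ℕ) (ζ : ℂ) :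
    Integrable fun x : ℝ => U (x + y * Complex.I) * ((x + y * Complex.I - ζ) ^ j *
      Complex.exp ((n + 1) * (x + y * Complex.I - ζ))) := by
  refine h.integrable_mul (s := n + 1) (by have := n.cast_nonneg (α := ℝ); linarith)
    ⟨le_rfl, le_rfl⟩ j (g := fun τ => (τ - ζ) ^ j * Complex.exp ((n + 1) * (τ - ζ)))
    (B := (1 + |y| + ‖ζ‖) ^ j * Real.exp (-((n + 1) * ζ.re))) hU (by fun_prop) fun x => ?_
  have h1 := norm_sub_pow_le (x + y * Complex.I) ζ j
  simp only [Complex.add_re, Complex.ofReal_re, Complex.mul_re, Complex.I_re, mul_zero,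
    Complex.ofReal_im, Complex.I_im, mul_one, sub_self, add_zero, Complex.add_im,
    Complex.mul_im, zero_add] at h1
  have h2 : ‖Complex.exp ((n + 1) * (x + y * Complex.I - ζ))‖ =
      Real.exp (-((n + 1) * ζ.re)) * Real.exp ((n + 1) * x) := by
    rw [Complex.norm_exp, ← Real.exp_add]; congr 1; simp; ring
  rw [norm_mul, h2]
  calc _ ≤ ((1 + |y| + ‖ζ‖) ^ j * (1 + |x|) ^ j) *
        (Real.exp (-((n + 1) * ζ.re)) * Real.exp ((n + 1) * x)) := by gcongr
    _ = _ := by ring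

theorem isLittleO_one_add_norm_pow (α β : ℝ) (j N : ℕ) :
    (fun ζ : ℂ => (1 + ‖ζ‖) ^ j * Real.exp (-((N + 1) * ζ.re)))
      =o[comap Complex.re atTop ⊓ 𝓟 {ζ : ℂ | α ≤ ζ.im ∧ ζ.im ≤ β}]
      fun ζ : ℂ => Real.exp (-(N * ζ.re)) := by
  set M : ℝ := 1 + max |α| |β|
  have h0 : Tendsto (fun x : ℝ => (M + x) ^ j * Real.exp (-x)) atTop (𝓝 0) := by
    have h1 := (Real.tendsto_pow_mul_exp_neg_atTop_nhds_zero j).comp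
      (tendsto_atTop_add_const_left atTop M tendsto_id)
    have h2 := h1.const_mul (Real.exp M)
    rw [mul_zero] at h2
    refine h2.congr fun x => ?_
    simp only [Function.comp, id]
    rw [show Real.exp (-x) = Real.exp M * Real.exp (-(M + x)) by rw [← Real.exp_add]; congr 1; ring]
    ring
  have h1 : Tendsto (fun ζ : ℂ => (M + ζ.re) ^ j * Real.exp (-ζ.re))
      (comap Complex.re atTop ⊓ 𝓟 {ζ : ℂ | α ≤ ζ.im ∧ ζ.im ≤ β}) (𝓝 0) :=
    h0.comp (tendsto_comap.mono_left inf_le_left)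
  refine isLittleO_iff_tendsto' (Eventually.of_forall fun ζ h => absurd h (Real.exp_pos _).ne') |>.2 ?_
  have hpos : ∀ᶠ ζ : ℂ in comap Complex.re atTop ⊓ 𝓟 {ζ : ℂ | α ≤ ζ.im ∧ ζ.im ≤ β}, 0 ≤ ζ.re :=
    (tendsto_comap.eventually (eventually_ge_atTop 0)).filter_mono inf_le_left
  have hstrip : ∀ᶠ ζ : ℂ in comap Complex.re atTop ⊓ 𝓟 {ζ : ℂ | α ≤ ζ.im ∧ ζ.im ≤ β},
      α ≤ ζ.im ∧ ζ.im ≤ β := (eventually_principal.2 fun ζ h => h).filter_mono inf_le_right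
  refine squeeze_zero' (Eventually.of_forall fun ζ => by positivity) ?_ h1
  filter_upwards [hpos, hstrip] with ζ h h'
  have h3 : 1 + ‖ζ‖ ≤ M + ζ.re := by
    have := Complex.norm_le_abs_re_add_abs_im ζ
    have h4 : |ζ.im| ≤ max |α| |β| := abs_le_max_abs_abs h'.1 h'.2
    rw [abs_of_nonneg h] at this
    simp only [M]; linarith
  rw [mul_div_assoc, ← Real.exp_sub]
  have : -((N + 1) * ζ.re) - -(N * ζ.re) = -ζ.re := by ring
  rw [this]
  gcongr

/-- With q = e^{τ-ζ} the kernel is -q/(1-q) = -∑_{n<N} q^{n+1} - q^{N+1}/(1-q). On a closed substrip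
|1-q| is bounded below, so the remainder is O((1+|ζ|)^j e^{-(N+1) Re ζ}). The expansion carries a
minus sign, which is why solutions appear later as minus the transform. -/
theorem Rapid.stieltjes_isLittleO {U : ℂ → ℂ} {b y : ℝ} (h : Rapid U b y y) (hb : b < 1)
    (hU : Continuous fun x : ℝ => U (x + y * Complex.I)) (j : ℕ) {α β : ℝ} (hα : y < α)
    (hβ : β < y + 2 * Real.pi) (N : ℕ) :
    (fun ζ => stieltjes U j y ζ + ∑ n ∈ Finset.range N, stieltjesTerm U j n y ζ)
      =o[comap Complex.re atTop ⊓ 𝓟 {ζ : ℂ | α ≤ ζ.im ∧ ζ.im ≤ β}]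
      fun ζ : ℂ => Real.exp (-(N * ζ.re)) := by
  obtain ⟨A, m, hm, hA⟩ := h.exists_bound (s := N + 1)
    (by have := N.cast_nonneg (α := ℝ); linarith) j
  obtain ⟨c, hc, hk⟩ := le_norm_one_sub_exp_of_im (α := 2 * Real.pi + y - β)
    (β := 2 * Real.pi + y - α) (by linarith) (by linarith)
  set I₀ := ∫ x : ℝ, Real.exp (-(m * |x|))
  refine (IsBigO.of_bound (c⁻¹ * (1 + |y|) ^ j * A * I₀) ?_).trans_isLittleO
    (isLittleO_one_add_norm_pow α β j N)
  have hstrip : ∀ᶠ ζ : ℂ in comap Complex.re atTop ⊓ 𝓟 {ζ : ℂ | α ≤ ζ.im ∧ ζ.im ≤ β},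
      α ≤ ζ.im ∧ ζ.im ≤ β := (eventually_principal.2 fun ζ h => h).filter_mono inf_le_right
  filter_upwards [hstrip] with ζ hζ
  have hker : ∀ x : ℝ, c ≤ ‖1 - Complex.exp (x + y * Complex.I - ζ)‖ := by
    intro x
    -- The height of τ - ζ lies in (-2π, 0); adding 2πi brings it into (0, 2π), where the lower
    -- bound for |1 - e^w| applies.
    have h1 := hk (x + y * Complex.I - ζ + 2 * Real.pi * Complex.I) (by
      simp only [Complex.add_im, Complex.sub_im, Complex.ofReal_im, Complex.mul_im,
        Complex.ofReal_re, Complex.I_im, Complex.I_re, mul_one, mul_zero, add_zero, zero_add]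
      norm_num
      constructor <;> linarith [hζ.1, hζ.2])
    rw [exp_add_two_pi_I] at h1
    refine le_trans ?_ h1
    nlinarith [Real.exp_pos (x + y * Complex.I - ζ + 2 * Real.pi * Complex.I).re]
  have hne : ∀ x : ℝ, 1 - Complex.exp (x + y * Complex.I - ζ) ≠ 0 := fun x h0 => by
    have := hker x; rw [h0, norm_zero] at this; linarith
  have hi1 : Integrable fun x : ℝ => U (x + y * Complex.I) * (x + y * Complex.I - ζ) ^ j *
      (Complex.exp (x + y * Complex.I) / (Complex.exp (x + y * Complex.I) - Complex.exp ζ)) := by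
    have hUc : ContinuousOn U (Complex.im ⁻¹' Icc y y) := by
      have : ∀ τ ∈ Complex.im ⁻¹' Icc y y, τ = (τ.re : ℂ) + y * Complex.I := fun τ hτ => by
        have : τ.im = y := le_antisymm hτ.2 hτ.1
        rw [← this, Complex.re_add_im]
      refine ContinuousOn.congr (f := fun τ : ℂ => U (τ.re + y * Complex.I)) ?_
        fun τ hτ => by simp only; rw [← this τ hτ]
      exact (hU.comp Complex.continuous_re).continuousOn
    have := (h.tame_mul_pow hb ζ j).integrable_kernel (ζ := ζ - 2 * Real.pi * Complex.I)
      (hUc.mul (by fun_prop)) (by simp; linarith [hζ.2]) (by simp; linarith [hζ.2, Real.pi_pos])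
      (by simp; linarith [hζ.1])
    simpa only [exp_sub_two_pi_I] using this
  have hsum : stieltjes U j y ζ + ∑ n ∈ Finset.range N, stieltjesTerm U j n y ζ =
      ∫ x : ℝ, U (x + y * Complex.I) * (x + y * Complex.I - ζ) ^ j *
        (-(Complex.exp ((N + 1) * (x + y * Complex.I - ζ)) /
          (1 - Complex.exp (x + y * Complex.I - ζ)))) := by
    unfold stieltjes stieltjesTerm lineInt
    rw [← integral_finsetSum _ fun n _ => h.integrable_term hb hU j n ζ,
      ← integral_add hi1 (integrable_finsetSum _ fun n _ => h.integrable_term hb hU j n ζ)]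
    refine integral_congr_ae (ae_of_all _ fun x => ?_)
    simp only
    have hne := hne x
    have ek : Complex.exp (x + y * Complex.I) / (Complex.exp (x + y * Complex.I) - Complex.exp ζ) =
        -(Complex.exp (x + y * Complex.I - ζ) / (1 - Complex.exp (x + y * Complex.I - ζ))) := by
      have e1 : Complex.exp (x + y * Complex.I) =
          Complex.exp ζ * Complex.exp (x + y * Complex.I - ζ) := by
        rw [← Complex.exp_add]; ring_nf
      have := Complex.exp_ne_zero ζ
      have e2 : Complex.exp ζ * Complex.exp (x + y * Complex.I - ζ) - Complex.exp ζ =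
          -(Complex.exp ζ * (1 - Complex.exp (x + y * Complex.I - ζ))) := by ring
      rw [e1, e2]
      field_simp
    rw [ek]
    set q := Complex.exp (x + y * Complex.I - ζ)
    have eq1 : ∀ n : ℕ, Complex.exp ((n + 1) * (x + y * Complex.I - ζ)) = q ^ (n + 1) := fun n => by
      rw [← Complex.exp_nat_mul]; push_cast; rfl
    simp_rw [eq1]
    rw [← Finset.mul_sum, ← Finset.mul_sum]
    have hg : (∑ n ∈ Finset.range N, q ^ (n + 1)) * (1 - q) = q - q ^ (N + 1) := by
      simp_rw [pow_succ]
      rw [← Finset.sum_mul, mul_right_comm, geom_sum_mul_neg]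
      ring
    have hg' : (∑ n ∈ Finset.range N, q ^ (n + 1)) = (q - q ^ (N + 1)) / (1 - q) := by
      rw [eq_div_iff hne, hg]
    rw [hg']
    field_simp
    ring
  rw [hsum]
  have hfin : ∀ x : ℝ, ‖U (x + y * Complex.I) * (x + y * Complex.I - ζ) ^ j *
        (-(Complex.exp ((N + 1) * (x + y * Complex.I - ζ)) /
          (1 - Complex.exp (x + y * Complex.I - ζ))))‖ ≤
      (c⁻¹ * (1 + |y|) ^ j * A * ((1 + ‖ζ‖) ^ j * Real.exp (-((N + 1) * ζ.re)))) *
        Real.exp (-(m * |x|)) := by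
    intro x
    have h1 := norm_sub_pow_le (x + y * Complex.I) ζ j
    have h3 := hA (x + y * Complex.I) (by simp)
    simp only [Complex.add_re, Complex.ofReal_re, Complex.mul_re, Complex.I_re, mul_zero,
      Complex.ofReal_im, Complex.I_im, mul_one, sub_self, add_zero, Complex.add_im,
      Complex.mul_im, zero_add] at h1 h3
    have h2 : ‖Complex.exp ((N + 1) * (x + y * Complex.I - ζ))‖ =
        Real.exp (-((N + 1) * ζ.re)) * Real.exp ((N + 1) * x) := by
      rw [Complex.norm_exp, ← Real.exp_add]; congr 1; simp; ring
    rw [norm_mul, norm_mul, norm_neg, norm_div, h2]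
    have h4 : (1 + |y| + ‖ζ‖) ^ j ≤ (1 + |y|) ^ j * (1 + ‖ζ‖) ^ j := by
      rw [← mul_pow]; gcongr
      nlinarith [mul_nonneg (abs_nonneg y) (norm_nonneg ζ)]
    calc _ ≤ ‖U (x + y * Complex.I)‖ * (((1 + |y|) ^ j * (1 + ‖ζ‖) ^ j) * (1 + |x|) ^ j) *
          (Real.exp (-((N + 1) * ζ.re)) * Real.exp ((N + 1) * x) / c) := by
          gcongr
          · exact h1.trans (by gcongr)
          · exact hker x
      _ = (c⁻¹ * (1 + |y|) ^ j * ((1 + ‖ζ‖) ^ j * Real.exp (-((N + 1) * ζ.re)))) *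
          (‖U (x + y * Complex.I)‖ * (1 + |x|) ^ j * Real.exp ((N + 1) * x)) := by
          field_simp
      _ ≤ (c⁻¹ * (1 + |y|) ^ j * ((1 + ‖ζ‖) ^ j * Real.exp (-((N + 1) * ζ.re)))) *
          (A * Real.exp (-(m * |x|))) := mul_le_mul_of_nonneg_left h3 (by positivity)
      _ = _ := by ring
  refine (norm_integral_le_of_norm_le ((integrable_exp_neg_mul_abs hm).const_mul _)
    (ae_of_all _ hfin)).trans ?_
  rw [integral_const_mul, Real.norm_of_nonneg (by positivity)]
  simp only [I₀]
  exact le_of_eq (by ring)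

theorem Rapid.differentiableAt_stieltjes {U : ℂ → ℂ} {b y : ℝ} (h : Rapid U b y y) (hb : b < 1)
    (hU : Continuous fun x : ℝ => U (x + y * Complex.I)) (j : ℕ) {ζ₀ : ℂ} (h1 : y < ζ₀.im)
    (h2 : ζ₀.im < y + 2 * Real.pi) : DifferentiableAt ℂ (stieltjes U j y) ζ₀ := by
  obtain ⟨A, m, hm, hA⟩ := h.exists_bound hb j
  obtain ⟨r, hr, hr1, hr2⟩ : ∃ r > 0, y < ζ₀.im - r ∧ ζ₀.im + r < y + 2 * Real.pi := by
    refine ⟨min (ζ₀.im - y) (y + 2 * Real.pi - ζ₀.im) / 2, ?_, ?_, ?_⟩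
    · exact half_pos (lt_min (by linarith) (by linarith))
    · linarith [min_le_left (ζ₀.im - y) (y + 2 * Real.pi - ζ₀.im)]
    · linarith [min_le_right (ζ₀.im - y) (y + 2 * Real.pi - ζ₀.im)]
  obtain ⟨c, hc, hk⟩ := le_norm_one_sub_exp_of_im (α := 2 * Real.pi + y - (ζ₀.im + r))
    (β := 2 * Real.pi + y - (ζ₀.im - r)) (by linarith) (by linarith)
  have hball : ∀ ζ ∈ ball ζ₀ r, |ζ.re - ζ₀.re| < r ∧ |ζ.im - ζ₀.im| < r := fun ζ hζ => by
    rw [mem_ball, dist_eq_norm] at hζ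
    exact ⟨(Complex.abs_re_le_norm (ζ - ζ₀)).trans_lt hζ,
      (Complex.abs_im_le_norm (ζ - ζ₀)).trans_lt hζ⟩
  have hne : ∀ ζ ∈ ball ζ₀ r, ∀ x : ℝ, Complex.exp (x + y * Complex.I) - Complex.exp ζ ≠ 0 := by
    intro ζ hζ x
    have := abs_lt.1 (hball ζ hζ).2
    refine exp_kernel_ne_zero (fun h => ?_) ?_
    · have h3 := congrArg Complex.im h
      simp at h3; linarith
    · simp; rw [abs_lt]; constructor <;> linarith
  refine (hasDerivAt_integral_of_holomorphic (μ := volume) (α := ℝ)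
    (F := fun ζ x => U (x + y * Complex.I) * (x + y * Complex.I - ζ) ^ j *
      (Complex.exp (x + y * Complex.I) / (Complex.exp (x + y * Complex.I) - Complex.exp ζ)))
    hr (bound := fun x => (1 + |y| + (‖ζ₀‖ + r)) ^ j * (c⁻¹ * (1 + Real.exp (-(ζ₀.re - r)))) *
      A * Real.exp (-(m * |x|))) ?_ ?_ ?_ ?_).differentiableAt
  · intro ζ hζ
    refine Continuous.aestronglyMeasurable ((hU.mul (by fun_prop)).mul ?_)
    exact Continuous.div (by fun_prop) (by fun_prop) (hne ζ hζ)
  · refine ae_of_all _ fun x => ?_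
    refine DifferentiableOn.mul (by fun_prop) (DifferentiableOn.div (by fun_prop) (by fun_prop)
      fun ζ hζ => hne ζ hζ x)
  · refine ae_of_all _ fun x ζ hζ => ?_
    have hζ' := hball ζ hζ
    have h5 := abs_lt.1 hζ'.1
    have h6 := abs_lt.1 hζ'.2
    have h3 := hA (x + y * Complex.I) (by simp)
    have h4 := norm_sub_pow_le (x + y * Complex.I) ζ j
    have h7 := norm_kernel_le hc (hk (x + y * Complex.I - (ζ - 2 * Real.pi * Complex.I)) (by
      simp; constructor <;> linarith))
    rw [exp_sub_two_pi_I] at h7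
    have h8 : ‖ζ‖ ≤ ‖ζ₀‖ + r := by
      rw [mem_ball, dist_eq_norm] at hζ
      linarith [norm_le_norm_add_norm_sub' ζ ζ₀]
    have h9 : (1 + |(x + y * Complex.I).im| + ‖ζ‖) ^ j ≤ (1 + |y| + (‖ζ₀‖ + r)) ^ j := by
      simp only [Complex.add_im, Complex.ofReal_im, Complex.mul_im, Complex.ofReal_re,
        Complex.I_im, mul_one, Complex.I_re, mul_zero, add_zero, zero_add]
      gcongr
    have h10 : Real.exp (-(ζ - 2 * Real.pi * Complex.I).re) ≤ Real.exp (-(ζ₀.re - r)) := by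
      apply Real.exp_le_exp.2; simp; linarith
    have hx := Real.exp_pos (x + y * Complex.I).re
    have h11 : Real.exp (x + y * Complex.I).re / (1 + Real.exp (x + y * Complex.I).re) ≤
        Real.exp (1 * (x + y * Complex.I).re) := by
      rw [one_mul, div_le_iff₀ (by linarith)]; nlinarith
    rw [norm_mul, norm_mul]
    calc _ ≤ ‖U (x + y * Complex.I)‖ * ((1 + |y| + (‖ζ₀‖ + r)) ^ j *
          (1 + |(x + y * Complex.I).re|) ^ j) * (c⁻¹ * (1 + Real.exp (-(ζ₀.re - r))) *
            Real.exp (1 * (x + y * Complex.I).re)) := by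
          gcongr
          · exact h4.trans (by gcongr)
          · exact h7.trans (by gcongr)
      _ = (1 + |y| + (‖ζ₀‖ + r)) ^ j * (c⁻¹ * (1 + Real.exp (-(ζ₀.re - r)))) *
          (‖U (x + y * Complex.I)‖ * (1 + |(x + y * Complex.I).re|) ^ j *
            Real.exp (1 * (x + y * Complex.I).re)) := by ring
      _ ≤ (1 + |y| + (‖ζ₀‖ + r)) ^ j * (c⁻¹ * (1 + Real.exp (-(ζ₀.re - r)))) *
          (A * Real.exp (-(m * |(x + y * Complex.I).re|))) :=
          mul_le_mul_of_nonneg_left h3 (by positivity)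
      _ = _ := by simp; ring
  · exact (integrable_exp_neg_mul_abs hm).const_mul _

/-! ### The differential operator in factored form -/

/-- The first order operator `θ + a`. -/
def lin (a : ℂ) (F : ℂ → ℂ) : ℂ → ℂ := fun ζ => deriv F ζ + a * F ζ

/-- The numerators of the local exponents at the origin. -/
def Family.idx : Family → Fin 4 → ℕ
  | .quintic => ![1, 2, 3, 4]
  | .sextic => ![1, 2, 4, 5]
  | .octic => ![1, 3, 5, 7]
  | .dectic => ![1, 3, 7, 9]

/-- The numbers `r / d`, in increasing order. -/
def Family.root (X : Family) (j : Fin 4) : ℝ := X.idx j / X.deg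

/-- The number `λ` as a real number. -/
def Family.lamR : Family → ℝ
  | .quintic => 5 ^ 5
  | .sextic => 2 ^ 4 * 3 ^ 6
  | .octic => 2 ^ 16
  | .dectic => 2 ^ 8 * 5 ^ 5

theorem Family.lam_eq (X : Family) : X.lam = (X.lamR : ℂ) := by
  cases X <;> simp [Family.lam, Family.lamR]

theorem Family.lamR_pos (X : Family) : 0 < X.lamR := by
  cases X <;> norm_num [Family.lamR]

theorem Family.deg_pos (X : Family) : 0 < X.deg := by
  cases X <;> norm_num [Family.deg]

theorem Family.root_pos (X : Family) (j : Fin 4) : 0 < X.root j := by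
  cases X <;> fin_cases j <;> norm_num [Family.root, Family.idx, Family.deg]

theorem Family.root_lt_one (X : Family) (j : Fin 4) : X.root j < 1 := by
  cases X <;> fin_cases j <;> norm_num [Family.root, Family.idx, Family.deg]

theorem Family.root_strictMono (X : Family) : StrictMono X.root := by
  refine Fin.strictMono_iff_lt_succ.2 fun j => ?_
  cases X <;> fin_cases j <;> norm_num [Family.root, Family.idx, Family.deg, Fin.succ]

theorem Family.root_rev (X : Family) (j : Fin 4) : X.root j.rev = 1 - X.root j := by
  cases X <;> fin_cases j <;> norm_num [Family.root, Family.idx, Family.deg, Fin.rev]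

/-- The operator `z (θ + 1)^3 + λ ∏ (θ + a_j)` on functions of `ζ = log z`. -/
def Family.DE (X : Family) (F : ℂ → ℂ) : ℂ → ℂ := fun ζ =>
  Complex.exp ζ * lin 1 (lin 1 (lin 1 F)) ζ +
    X.lamR * lin (X.root 0) (lin (X.root 1) (lin (X.root 2) (lin (X.root 3) F))) ζ

theorem smul_deriv_add_smul {d : ℂ} (hd : d ≠ 0) (r : ℂ) (F : ℂ → ℂ) :
    d • deriv F + r • F = d • lin (r / d) F := by
  ext ζ
  simp only [Pi.add_apply, Pi.smul_apply, smul_eq_mul, lin]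
  field_simp

theorem lin_smul (a c : ℂ) (F : ℂ → ℂ) : lin a (c • F) = c • lin a F := by
  ext ζ
  simp only [lin, Pi.smul_apply, smul_eq_mul]
  rw [deriv_const_smul_field, smul_eq_mul]
  ring

theorem foldr_four_eq {d : ℂ} (hd : d ≠ 0) (r₀ r₁ r₂ r₃ : ℂ) (F : ℂ → ℂ) :
    [r₀, r₁, r₂, r₃].foldr (fun r H => d • deriv H + r • H) F =
      d ^ 4 • lin (r₀ / d) (lin (r₁ / d) (lin (r₂ / d) (lin (r₃ / d) F))) := by
  simp only [List.foldr]
  simp only [smul_deriv_add_smul hd, lin_smul]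
  simp only [smul_smul]
  ring_nf

theorem Family.op_eq (X : Family) (F : ℂ → ℂ) :
    X.op (V := ℂ → ℂ) deriv (fun H ζ => Complex.exp ζ * H ζ) F = X.DE F := by
  have h1 : ∀ H : ℂ → ℂ, deriv H + H = lin 1 H := fun H => by ext; simp [lin]
  have hd : (X.deg : ℂ) ≠ 0 := by exact_mod_cast X.deg_pos.ne'
  have hs : X.shifts = [(X.idx 0 : ℂ), (X.idx 1 : ℂ), (X.idx 2 : ℂ), (X.idx 3 : ℂ)] := by
    cases X <;> simp [Family.shifts, Family.idx]
  -- Pulling the factor d out of each of the four operators dθ + r turns the leading constant into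
  -- λ.
  have hl : X.lead * (X.deg : ℂ) ^ 4 = X.lamR := by
    cases X <;> norm_num [Family.lead, Family.deg, Family.lamR]
  ext ζ
  simp only [Family.op, hs, foldr_four_eq hd, Family.DE, Function.iterate_succ,
    Function.iterate_zero, Function.comp, id, Pi.add_apply, h1, smul_smul, hl, Family.root]
  push_cast
  simp

theorem Family.isSolution_iff (X : Family) (F : ℂ → ℂ) :
    X.IsSolution F ↔ Differentiable ℂ F ∧ X.DE F = 0 := by
  rw [Family.IsSolution, X.op_eq]

theorem differentiableOn_lin {F : ℂ → ℂ} {U : Set ℂ} (hU : IsOpen U)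
    (hF : DifferentiableOn ℂ F U) (a : ℂ) : DifferentiableOn ℂ (lin a F) U :=
  (hF.deriv hU).add (hF.const_mul a)

theorem differentiable_lin {F : ℂ → ℂ} (hF : Differentiable ℂ F) (a : ℂ) :
    Differentiable ℂ (lin a F) :=
  hF.deriv.add (hF.const_mul a)

theorem lin_eqOn {F G : ℂ → ℂ} {U : Set ℂ} (hU : IsOpen U) (h : EqOn F G U) (a : ℂ) :
    EqOn (lin a F) (lin a G) U := fun ζ hζ => by
  simp only [lin, h.deriv hU hζ, h hζ]

theorem lin_add_smul {F G : ℂ → ℂ} {U : Set ℂ} (hU : IsOpen U)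
    (hF : DifferentiableOn ℂ F U) (hG : DifferentiableOn ℂ G U) (a c : ℂ) :
    EqOn (lin a (F + c • G)) (lin a F + c • lin a G) U := fun ζ hζ => by
  have h1 := hF.differentiableAt (hU.mem_nhds hζ)
  have h2 := hG.differentiableAt (hU.mem_nhds hζ)
  simp only [lin, Pi.add_apply, Pi.smul_apply, smul_eq_mul]
  rw [deriv_add h1 (h2.const_smul c), deriv_const_smul_field]
  simp only [smul_eq_mul]
  ring

theorem lin_add_smul' {F G : ℂ → ℂ} (hF : Differentiable ℂ F) (hG : Differentiable ℂ G)
    (a c : ℂ) : lin a (F + c • G) = lin a F + c • lin a G := by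
  ext ζ
  exact lin_add_smul isOpen_univ hF.differentiableOn hG.differentiableOn a c (mem_univ ζ)

theorem Family.IsSolution.add_smul {X : Family} {F G : ℂ → ℂ} (hF : X.IsSolution F)
    (hG : X.IsSolution G) (c : ℂ) : X.IsSolution (F + c • G) := by
  rw [Family.isSolution_iff] at *
  obtain ⟨hF, hF0⟩ := hF
  obtain ⟨hG, hG0⟩ := hG
  refine ⟨hF.add (hG.const_smul c), ?_⟩
  ext ζ
  have e1 := congrFun hF0 ζ
  have e2 := congrFun hG0 ζ
  simp only [Family.DE, Pi.zero_apply] at e1 e2 ⊢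
  have d : ∀ {H : ℂ → ℂ}, Differentiable ℂ H → ∀ a, Differentiable ℂ (lin a H) :=
    fun h a => differentiable_lin h a
  rw [lin_add_smul' hF hG, lin_add_smul' (d hF _) (d hG _),
    lin_add_smul' (d (d hF _) _) (d (d hG _) _), lin_add_smul' hF hG,
    lin_add_smul' (d hF _) (d hG _), lin_add_smul' (d (d hF _) _) (d (d hG _) _),
    lin_add_smul' (d (d (d hF _) _) _) (d (d (d hG _) _) _)]
  simp only [Pi.add_apply, Pi.smul_apply, smul_eq_mul]
  linear_combination e1 + c * e2

theorem Family.isSolution_zero (X : Family) : X.IsSolution 0 := by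
  have h0 : ∀ a, lin a 0 = 0 := fun a => by ext; simp [lin]
  rw [Family.isSolution_iff]
  refine ⟨differentiable_const 0, ?_⟩
  ext ζ
  simp [Family.DE, h0]

theorem Family.IsSolution.smul {X : Family} {G : ℂ → ℂ} (hG : X.IsSolution G) (c : ℂ) :
    X.IsSolution (c • G) := by
  simpa using X.isSolution_zero.add_smul hG c

theorem Family.IsSolution.add {X : Family} {F G : ℂ → ℂ} (hF : X.IsSolution F)
    (hG : X.IsSolution G) : X.IsSolution (F + G) := by
  simpa using hF.add_smul hG 1

theorem Family.IsSolution.sub {X : Family} {F G : ℂ → ℂ} (hF : X.IsSolution F)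
    (hG : X.IsSolution G) : X.IsSolution (F - G) := by
  simpa [sub_eq_add_neg] using hF.add_smul hG (-1)

theorem Family.IsSolution.sum {X : Family} {ι : Type*} (s : Finset ι) {F : ι → ℂ → ℂ}
    (hF : ∀ i ∈ s, X.IsSolution (F i)) : X.IsSolution (∑ i ∈ s, F i) := by
  classical
  induction s using Finset.induction_on with
  | empty => simpa using X.isSolution_zero
  | insert i s hi ih =>
    rw [Finset.sum_insert hi]
    exact (hF i (Finset.mem_insert_self i s)).add
      (ih fun k hk => hF k (Finset.mem_insert_of_mem hk))

theorem lin_comp_add (a c : ℂ) (F : ℂ → ℂ) :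
    lin a (fun ζ => F (ζ + c)) = fun ζ => lin a F (ζ + c) := by
  ext ζ
  simp only [lin, deriv_comp_add_const]

/-- Translation by a period of the coefficients preserves solutions. -/
theorem Family.IsSolution.comp_add {X : Family} {F : ℂ → ℂ} (hF : X.IsSolution F) {c : ℂ}
    (hc : Complex.exp c = 1) : X.IsSolution fun ζ => F (ζ + c) := by
  rw [Family.isSolution_iff] at *
  refine ⟨hF.1.comp (differentiable_id.add_const c), ?_⟩
  ext ζ
  have h := congrFun hF.2 (ζ + c)
  simp only [Family.DE, lin_comp_add, Complex.exp_add, hc, mul_one] at h ⊢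
  exact h

/-! ### Uniqueness -/

/-- Initial data adapted to the factored operator. -/
def Family.jet (X : Family) (F : ℂ → ℂ) (ζ : ℂ) : Fin 4 → ℂ :=
  ![F ζ, lin (X.root 3) F ζ, lin (X.root 2) (lin (X.root 3) F) ζ,
    lin (X.root 1) (lin (X.root 2) (lin (X.root 3) F)) ζ]

theorem deriv_eq_lin_sub (a : ℂ) (F : ℂ → ℂ) (ζ : ℂ) : deriv F ζ = lin a F ζ - a * F ζ := by
  simp [lin]

/-- The coefficient of θ⁴ is the nonzero constant λ, so along a short horizontal segment the jet
obeys a linear first order system with bounded coefficients. Grönwall's inequality kills it there,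
and the identity theorem does the rest. -/
theorem Family.eqOn_zero_of_jet_eq_zero (X : Family) {U : Set ℂ} (hU : IsOpen U)
    (hc : IsPreconnected U) {F : ℂ → ℂ} (hF : DifferentiableOn ℂ F U)
    (hD : ∀ ζ ∈ U, X.DE F ζ = 0) {ζ₀ : ℂ} (h0 : ζ₀ ∈ U) (hj : X.jet F ζ₀ = 0) :
    EqOn F 0 U := by
  set a0 : ℂ := (X.root 0 : ℂ) with ha0
  set a1 : ℂ := (X.root 1 : ℂ) with ha1
  set a2 : ℂ := (X.root 2 : ℂ) with ha2
  set a3 : ℂ := (X.root 3 : ℂ) with ha3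
  set F1 := lin a3 F with hF1
  set F2 := lin a2 F1 with hF2
  set F3 := lin a1 F2 with hF3
  have d0 := hF
  have d1 : DifferentiableOn ℂ F1 U := differentiableOn_lin hU d0 _
  have d2 : DifferentiableOn ℂ F2 U := differentiableOn_lin hU d1 _
  have d3 : DifferentiableOn ℂ F3 U := differentiableOn_lin hU d2 _
  have hl : (X.lamR : ℂ) ≠ 0 := by exact_mod_cast X.lamR_pos.ne'
  obtain ⟨r, hr, hball⟩ := Metric.isOpen_iff.1 hU ζ₀ h0
  -- `(θ + 1)^3 F` as a combination of the jet
  obtain ⟨k0, k1, k2, hk⟩ : ∃ k0 k1 k2 : ℂ, ∀ ζ ∈ U,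
      lin 1 (lin 1 (lin 1 F)) ζ = F3 ζ + k2 * F2 ζ + k1 * F1 ζ + k0 * F ζ := by
    have s0 : EqOn (lin 1 F) (F1 + (1 - a3) • F) U := fun ζ _ => by
      simp [hF1, lin]; ring
    have s1 : EqOn (lin 1 (lin 1 F)) (lin 1 F1 + (1 - a3) • lin 1 F) U :=
      (lin_eqOn hU s0 1).trans (lin_add_smul hU d1 d0 1 _)
    have s1' : EqOn (lin 1 F1) (F2 + (1 - a2) • F1) U := fun ζ _ => by
      simp [hF2, lin]; ring
    have s2' : EqOn (lin 1 F2) (F3 + (1 - a1) • F2) U := fun ζ _ => by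
      simp [hF3, lin]; ring
    have s3 : EqOn (lin 1 (lin 1 F1)) (lin 1 F2 + (1 - a2) • lin 1 F1) U :=
      (lin_eqOn hU s1' 1).trans (lin_add_smul hU d2 d1 1 _)
    have s4 : EqOn (lin 1 (lin 1 (lin 1 F))) (lin 1 (lin 1 F1) + (1 - a3) • lin 1 (lin 1 F)) U :=
      (lin_eqOn hU s1 1).trans (lin_add_smul hU (differentiableOn_lin hU d1 1)
        (differentiableOn_lin hU d0 1) 1 _)
    refine ⟨(1 - a3) ^ 3, (1 - a2) ^ 2 + (1 - a3) * (1 - a2) + (1 - a3) ^ 2,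
      (1 - a1) + (1 - a2) + (1 - a3), fun ζ hζ => ?_⟩
    have t0 := s0 hζ; have t1 := s1 hζ; have t1' := s1' hζ; have t2 := s2' hζ
    have t3 := s3 hζ; have t4 := s4 hζ
    simp only [Pi.add_apply, Pi.smul_apply, smul_eq_mul] at t0 t1 t1' t2 t3 t4
    rw [t4, t3, t2, t1, t1', t0]
    ring
  set y : ℝ → Fin 4 → ℂ := fun t => X.jet F (ζ₀ + t) with hy
  have hmem : ∀ t : ℝ, t ∈ Icc 0 (r / 2) → ζ₀ + t ∈ U := fun t ht => hball (by
    rw [mem_ball, dist_eq_norm, add_sub_cancel_left, Complex.norm_real, Real.norm_eq_abs,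
      abs_of_nonneg ht.1]
    linarith [ht.2])
  set y' : ℝ → Fin 4 → ℂ := fun t => ![F1 (ζ₀ + t) - a3 * F (ζ₀ + t),
    F2 (ζ₀ + t) - a2 * F1 (ζ₀ + t), F3 (ζ₀ + t) - a1 * F2 (ζ₀ + t),
    lin a0 F3 (ζ₀ + t) - a0 * F3 (ζ₀ + t)] with hy'
  have hderiv : ∀ t ∈ Icc 0 (r / 2), HasDerivAt y (y' t) t := by
    intro t ht
    have go : ∀ {H : ℂ → ℂ} (a : ℂ), DifferentiableOn ℂ H U →
        HasDerivAt (fun t : ℝ => H (ζ₀ + t)) (lin a H (ζ₀ + t) - a * H (ζ₀ + t)) t := by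
      intro H a hH
      rw [← deriv_eq_lin_sub]
      exact ((hH.differentiableAt (hU.mem_nhds (hmem t ht))).hasDerivAt.comp_const_add
        ζ₀ (t : ℂ)).comp_ofReal
    rw [hasDerivAt_pi]
    intro i
    fin_cases i
    · exact go a3 d0
    · exact go a2 d1
    · exact go a1 d2
    · exact go a0 d3
  set K : ℝ := 4 + X.lamR⁻¹ * (Real.exp (ζ₀.re + r) * (1 + ‖k2‖ + ‖k1‖ + ‖k0‖)) with hK
  have hbound : ∀ t ∈ Ico 0 (r / 2), ‖y' t‖ ≤ K * ‖y t‖ + 0 := by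
    intro t ht
    have htU := hmem t ⟨ht.1, ht.2.le⟩
    have n0 : ‖F (ζ₀ + t)‖ ≤ ‖y t‖ := norm_le_pi_norm (y t) 0
    have n1 : ‖F1 (ζ₀ + t)‖ ≤ ‖y t‖ := norm_le_pi_norm (y t) 1
    have n2 : ‖F2 (ζ₀ + t)‖ ≤ ‖y t‖ := norm_le_pi_norm (y t) 2
    have n3 : ‖F3 (ζ₀ + t)‖ ≤ ‖y t‖ := norm_le_pi_norm (y t) 3
    have ha : ∀ j, ‖(X.root j : ℂ)‖ ≤ 1 := fun j => by
      rw [Complex.norm_real, Real.norm_eq_abs, abs_of_pos (X.root_pos j)]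
      exact (X.root_lt_one j).le
    have hlast : ‖lin a0 F3 (ζ₀ + t)‖ ≤
        X.lamR⁻¹ * (Real.exp (ζ₀.re + r) * (1 + ‖k2‖ + ‖k1‖ + ‖k0‖)) * ‖y t‖ := by
      have h := hD _ htU
      simp only [Family.DE] at h
      rw [hk _ htU] at h
      have e : lin a0 F3 (ζ₀ + t) = -((X.lamR : ℂ)⁻¹ * (Complex.exp (ζ₀ + t) *
          (F3 (ζ₀ + t) + k2 * F2 (ζ₀ + t) + k1 * F1 (ζ₀ + t) + k0 * F (ζ₀ + t)))) := by
        have h' : (X.lamR : ℂ) * lin a0 F3 (ζ₀ + t) = -(Complex.exp (ζ₀ + t) *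
          (F3 (ζ₀ + t) + k2 * F2 (ζ₀ + t) + k1 * F1 (ζ₀ + t) + k0 * F (ζ₀ + t))) := by
          linear_combination h
        rw [← mul_neg, ← h', inv_mul_cancel_left₀ hl]
      rw [e, norm_neg, norm_mul, norm_mul, norm_inv, Complex.norm_real, Real.norm_eq_abs,
        abs_of_pos X.lamR_pos, Complex.norm_exp, mul_assoc, mul_assoc]
      have hlp := X.lamR_pos
      gcongr
      · simp; linarith [ht.2]
      · calc _ ≤ ‖F3 (ζ₀ + t)‖ + ‖k2 * F2 (ζ₀ + t)‖ + ‖k1 * F1 (ζ₀ + t)‖ + ‖k0 * F (ζ₀ + t)‖ :=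
              norm_add₄_le
          _ ≤ ‖y t‖ + ‖k2‖ * ‖y t‖ + ‖k1‖ * ‖y t‖ + ‖k0‖ * ‖y t‖ := by
              simp only [norm_mul]; gcongr
          _ = _ := by ring
    have hK0 : 0 ≤ X.lamR⁻¹ * (Real.exp (ζ₀.re + r) * (1 + ‖k2‖ + ‖k1‖ + ‖k0‖)) * ‖y t‖ :=
      (norm_nonneg _).trans hlast
    have hyn := norm_nonneg (y t)
    have hsub : ∀ (u v : ℂ) (j : Fin 4), ‖u‖ ≤ ‖y t‖ → ‖v‖ ≤ ‖y t‖ →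
        ‖u - X.root j * v‖ ≤ 2 * ‖y t‖ := fun u v j hu hv => by
      refine (norm_sub_le _ _).trans ?_
      rw [norm_mul]
      nlinarith [ha j, norm_nonneg v]
    rw [add_zero, hK, add_mul, pi_norm_le_iff_of_nonneg (by positivity)]
    intro i
    fin_cases i
    · exact (hsub _ _ 3 n1 n0).trans (by linarith)
    · exact (hsub _ _ 2 n2 n1).trans (by linarith)
    · exact (hsub _ _ 1 n3 n2).trans (by linarith)
    · refine (norm_sub_le _ _).trans ?_
      rw [norm_mul]
      have := ha 0
      change ‖lin a0 F3 (ζ₀ + t)‖ + ‖a0‖ * ‖F3 (ζ₀ + t)‖ ≤ _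
      nlinarith [norm_nonneg (F3 (ζ₀ + t))]
  have hzero : ∀ t ∈ Icc 0 (r / 2), y t = 0 := by
    intro t ht
    have := norm_le_gronwallBound_of_norm_deriv_right_le (f := y) (f' := y') (δ := 0) (K := K)
      (ε := 0) (a := 0) (b := r / 2)
      (fun s hs => (hderiv s hs).continuousAt.continuousWithinAt)
      (fun s hs => (hderiv s ⟨hs.1, hs.2.le⟩).hasDerivWithinAt)
      (by simp [hy, hj]) hbound t ht
    rw [gronwallBound_ε0, zero_mul] at this
    exact norm_le_zero_iff.1 this
  -- The zeros on the segment to the right of ζ₀ accumulate at ζ₀.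
  refine (hF.analyticOnNhd hU).eqOn_zero_of_preconnected_of_frequently_eq_zero hc h0 ?_
  have ht : Tendsto (fun t : ℝ => ζ₀ + t) (𝓝[>] 0) (𝓝[≠] ζ₀) := by
    refine tendsto_nhdsWithin_iff.2 ⟨?_, ?_⟩
    · exact (Continuous.tendsto' (by fun_prop) _ _ (by simp)).mono_left nhdsWithin_le_nhds
    · filter_upwards [self_mem_nhdsWithin] with t ht
      simpa using ne_of_gt ht
  refine ht.frequently (Eventually.frequently ?_)
  filter_upwards [Ioo_mem_nhdsGT (half_pos hr)] with t ht
  exact congrFun (hzero t ⟨ht.1.le, ht.2.le⟩) 0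

/-! ### Series in powers of `z` -/

/-- `∑ c_n z^(n + ρ)`. -/
def expSeries (c : ℕ → ℂ) (ρ : ℂ) (ζ : ℂ) : ℂ := ∑' n : ℕ, c n * Complex.exp ((n + ρ) * ζ)

/-- The radius of convergence is infinite. -/
def EntireSeq (c : ℕ → ℂ) : Prop := ∀ R : ℝ, 0 < R → Summable fun n => ‖c n‖ * R ^ n

theorem EntireSeq.mul_affine {c : ℕ → ℂ} (hc : EntireSeq c) (a : ℂ) :
    EntireSeq fun n => (n + a) * c n := by
  intro R hR
  refine Summable.of_nonneg_of_le (fun n => by positivity) (fun n => ?_)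
    (((hc (2 * R) (by positivity)).mul_left (1 + ‖a‖)))
  have h1 : ‖(n : ℂ) + a‖ ≤ (1 + ‖a‖) * 2 ^ n := by
    have h2 : (n : ℝ) ≤ 2 ^ n := by exact_mod_cast n.lt_two_pow_self.le
    have h3 : (1 : ℝ) ≤ 2 ^ n := one_le_pow₀ (by norm_num)
    calc _ ≤ ‖(n : ℂ)‖ + ‖a‖ := norm_add_le _ _
      _ = n + ‖a‖ := by simp
      _ ≤ _ := by nlinarith [norm_nonneg a]
  rw [norm_mul, mul_pow]
  calc _ ≤ (1 + ‖a‖) * 2 ^ n * ‖c n‖ * R ^ n := by gcongr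
    _ = _ := by ring

theorem norm_exp_nat_add_mul (ρ ζ : ℂ) (n : ℕ) :
    ‖Complex.exp ((n + ρ) * ζ)‖ = ‖Complex.exp (ρ * ζ)‖ * Real.exp ζ.re ^ n := by
  rw [← Real.exp_nat_mul, Complex.norm_exp, Complex.norm_exp, ← Real.exp_add]
  congr 1; simp; ring

theorem EntireSeq.summable {c : ℕ → ℂ} (hc : EntireSeq c) (ρ ζ : ℂ) :
    Summable fun n : ℕ => c n * Complex.exp ((n + ρ) * ζ) := by
  refine Summable.of_norm ?_
  refine ((hc _ (Real.exp_pos ζ.re)).mul_left ‖Complex.exp (ρ * ζ)‖).congr fun n => ?_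
  rw [norm_mul, norm_exp_nat_add_mul]; ring

theorem EntireSeq.hasDerivAt {c : ℕ → ℂ} (hc : EntireSeq c) (ρ ζ : ℂ) :
    HasDerivAt (expSeries c ρ) (expSeries (fun n => (n + ρ) * c n) ρ ζ) ζ := by
  set U : Set ℂ := ball 0 (‖ζ‖ + 1) with hU
  have hζ : ζ ∈ U := by simp [hU]
  have hle : ∀ (n : ℕ) (w : ℂ), w ∈ U → ‖c n * Complex.exp ((n + ρ) * w)‖ ≤
      Real.exp (‖ρ‖ * (‖ζ‖ + 1)) * (‖c n‖ * Real.exp (‖ζ‖ + 1) ^ n) := by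
    intro n w hw
    have hw' : ‖w‖ ≤ ‖ζ‖ + 1 := by simpa [hU] using (mem_ball.1 hw).le
    have h1 : ‖Complex.exp (ρ * w)‖ ≤ Real.exp (‖ρ‖ * (‖ζ‖ + 1)) :=
      (Complex.norm_exp_le_exp_norm _).trans (Real.exp_le_exp.2 (by rw [norm_mul]; gcongr))
    have h2 : Real.exp w.re ≤ Real.exp (‖ζ‖ + 1) :=
      Real.exp_le_exp.2 (((le_abs_self _).trans (Complex.abs_re_le_norm w)).trans hw')
    rw [norm_mul, norm_exp_nat_add_mul]
    calc _ ≤ ‖c n‖ * (Real.exp (‖ρ‖ * (‖ζ‖ + 1)) * Real.exp (‖ζ‖ + 1) ^ n) := by gcongr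
      _ = _ := by ring
  have hsum := (hc _ (Real.exp_pos (‖ζ‖ + 1))).mul_left (Real.exp (‖ρ‖ * (‖ζ‖ + 1)))
  have hd : ∀ n : ℕ, DifferentiableOn ℂ (fun w => c n * Complex.exp ((n + ρ) * w)) U :=
    fun n => Differentiable.differentiableOn (by fun_prop)
  have h1 : DifferentiableAt ℂ (expSeries c ρ) ζ :=
    (Complex.differentiableOn_tsum_of_summable_norm hsum hd isOpen_ball hle).differentiableAt
      (isOpen_ball.mem_nhds hζ)
  have h2 := Complex.hasSum_deriv_of_summable_norm hsum hd isOpen_ball hle hζ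
  have h3 : deriv (expSeries c ρ) ζ = expSeries (fun n => (n + ρ) * c n) ρ ζ := by
    refine h2.tsum_eq.symm.trans (tsum_congr fun n => ?_)
    have : HasDerivAt (fun w => c n * Complex.exp ((n + ρ) * w))
        (c n * (Complex.exp ((n + ρ) * ζ) * (n + ρ))) ζ := by
      simpa using (((hasDerivAt_id ζ).const_mul ((n : ℂ) + ρ)).cexp).const_mul (c n)
    rw [this.deriv]; ring
  exact h3 ▸ h1.hasDerivAt

theorem EntireSeq.differentiable {c : ℕ → ℂ} (hc : EntireSeq c) (ρ : ℂ) :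
    Differentiable ℂ (expSeries c ρ) := fun ζ => (hc.hasDerivAt ρ ζ).differentiableAt

theorem EntireSeq.lin_eq {c : ℕ → ℂ} (hc : EntireSeq c) (ρ a : ℂ) :
    lin a (expSeries c ρ) = expSeries (fun n => (n + (ρ + a)) * c n) ρ := by
  ext ζ
  rw [lin, (hc.hasDerivAt ρ ζ).deriv, expSeries, expSeries, expSeries, ← tsum_mul_left,
    ← ((hc.mul_affine ρ).summable ρ ζ).tsum_add ((hc.summable ρ ζ).mul_left a)]
  congr 1; ext n; ring

/-- Multiplication by z shifts the index by one. The term n = 0 of the fourth order part vanishes by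
the indicial equation, and each later term n + 1 cancels the term n of the other part. -/
theorem Family.isSolution_expSeries (X : Family) {c : ℕ → ℂ} (hc : EntireSeq c) (ρ : ℂ)
    (h0 : ∏ j, (ρ + X.root j) = 0)
    (h1 : ∀ n : ℕ, X.lamR * (∏ j, (n + 1 + ρ + X.root j)) * c (n + 1) +
      (n + 1 + ρ) ^ 3 * c n = 0) : X.IsSolution (expSeries c ρ) := by
  rw [Family.isSolution_iff]
  refine ⟨hc.differentiable ρ, ?_⟩
  ext ζ
  have e1 := hc.mul_affine (ρ + 1)
  have e2 := e1.mul_affine (ρ + 1)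
  have e3 := e2.mul_affine (ρ + 1)
  have f1 := hc.mul_affine (ρ + X.root 3)
  have f2 := f1.mul_affine (ρ + X.root 2)
  have f3 := f2.mul_affine (ρ + X.root 1)
  have f4 := f3.mul_affine (ρ + X.root 0)
  simp only [Family.DE, Pi.zero_apply]
  rw [hc.lin_eq ρ 1, e1.lin_eq ρ 1, e2.lin_eq ρ 1, hc.lin_eq ρ, f1.lin_eq ρ, f2.lin_eq ρ,
    f3.lin_eq ρ]
  simp only [expSeries]
  have hs := (f4.summable ρ ζ).mul_left (X.lamR : ℂ)
  rw [← tsum_mul_left, ← tsum_mul_left, hs.tsum_eq_zero_add, add_left_comm,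
    ← ((e3.summable ρ ζ).mul_left _).tsum_add ((summable_nat_add_iff 1).2 hs)]
  rw [Fin.prod_univ_four] at h0
  have hz : ∀ n : ℕ, Complex.exp ζ * ((n + (ρ + 1)) * ((n + (ρ + 1)) * ((n + (ρ + 1)) * c n)) *
      Complex.exp ((n + ρ) * ζ)) + (X.lamR : ℂ) * (((n + 1 : ℕ) + (ρ + X.root 0)) *
      (((n + 1 : ℕ) + (ρ + X.root 1)) * (((n + 1 : ℕ) + (ρ + X.root 2)) *
      (((n + 1 : ℕ) + (ρ + X.root 3)) * c (n + 1)))) *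
      Complex.exp (((n + 1 : ℕ) + ρ) * ζ)) = 0 := by
    intro n
    have h := h1 n
    rw [Fin.prod_univ_four] at h
    have e : Complex.exp (((n + 1 : ℕ) + ρ) * ζ) = Complex.exp ζ * Complex.exp ((n + ρ) * ζ) := by
      rw [← Complex.exp_add]; push_cast; ring_nf
    rw [e]
    push_cast
    linear_combination (Complex.exp ζ * Complex.exp ((n + ρ) * ζ)) * h
  simp_rw [hz]
  simp only [tsum_zero, add_zero, Nat.cast_zero, zero_add]
  linear_combination (X.lamR : ℂ) * c 0 * Complex.exp (ρ * ζ) * h0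

theorem expSeries_add_two_pi_I (c : ℕ → ℂ) (ρ ζ : ℂ) :
    expSeries c ρ (ζ + 2 * Real.pi * Complex.I) =
      Complex.exp (2 * Real.pi * Complex.I * ρ) * expSeries c ρ ζ := by
  rw [expSeries, expSeries, ← tsum_mul_left]
  congr 1; ext n
  have : Complex.exp ((n + ρ) * (ζ + 2 * Real.pi * Complex.I)) =
      Complex.exp (2 * Real.pi * Complex.I * ρ) * Complex.exp ((n + ρ) * ζ) := by
    rw [← Complex.exp_add, ← mul_one (Complex.exp (_ + _)), ← Complex.exp_nat_mul_two_pi_mul_I n,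
      ← Complex.exp_add]
    ring_nf
  rw [this]; ring

/-! ### The local solutions -/

/-- The power series coefficients of `φ_k`. -/
def Family.phiCoeff (X : Family) (k n : ℕ) : ℂ := X.phiGamma (n - k / X.deg) * (-1) ^ n

theorem Family.phi_eq (X : Family) (k : ℕ) :
    X.phi k = expSeries (X.phiCoeff k) (-(k / X.deg)) := by
  ext ζ
  simp only [Family.phi, expSeries, Family.phiCoeff, sub_eq_add_neg]

theorem Gamma_add_nat_of_re_pos {s : ℂ} (hs : 0 < s.re) (n : ℕ) :
    Complex.Gamma (s + n) = (∏ i ∈ Finset.range n, (s + i)) * Complex.Gamma s := by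
  induction n with
  | zero => simp
  | succ n ih =>
    have h : s + n ≠ 0 := fun h => by
      have := congrArg Complex.re h
      simp at this
      have := n.cast_nonneg (α := ℝ)
      linarith
    rw [Nat.cast_succ, ← add_assoc, Complex.Gamma_add_one _ h, ih, Finset.prod_range_succ]
    ring

/-- Raising x by one makes the denominator Gamma gain d consecutive factors. Those not of the form
dx + r with r admissible (mod d) cancel against the numerator Gammas; what remains is λ ∏(x + 1 +
a_j) against (x + 1)³. -/
theorem Family.phiGamma_add_one (X : Family) {x : ℂ} (hx : -1 < x.re) :
    X.lamR * (∏ j, (x + 1 + X.root j)) * X.phiGamma (x + 1) = (x + 1) ^ 3 * X.phiGamma x := by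
  have hne : ∀ (s : ℂ), 0 < s.re → s ≠ 0 := fun s hs h => by simp [h] at hs
  have g : ∀ (s : ℂ), 0 < s.re → Complex.Gamma s ≠ 0 := fun s hs =>
    Complex.Gamma_ne_zero_of_re_pos hs
  have h1 : Complex.Gamma (1 + (x + 1)) = (1 + x) * Complex.Gamma (1 + x) := by
    rw [← Complex.Gamma_add_one _ (hne _ (by simp; linarith))]; ring_nf
  rw [Fin.prod_univ_four]
  cases X
  · have h2 : Complex.Gamma (2 + (x + 1)) = (2 + x) * Complex.Gamma (2 + x) := by
      rw [← Complex.Gamma_add_one _ (hne _ (by simp; linarith))]; ring_nf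
    have h3 := Gamma_add_nat_of_re_pos (s := 6 + 5 * x) (by simp; linarith) 5
    rw [show 6 + 5 * x + ((5 : ℕ) : ℂ) = 6 + 5 * (x + 1) by push_cast; ring] at h3
    have n0 := g (6 + 5 * x) (by simp; linarith)
    have q0 := g (6 + 5 * (x + 1)) (by simp; linarith)
    rw [h3] at q0
    simp only [Family.phiGamma, h1, h2, h3, Finset.prod_range_succ, Finset.prod_range_zero,
      Family.root, Family.idx, Family.deg, Family.lamR]
    rw [← mul_div_assoc, ← mul_div_assoc, div_eq_div_iff (by simpa [Finset.prod_range_succ] using q0) n0]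
    simp
    ring
  · have h2 := Gamma_add_nat_of_re_pos (s := 3 + 2 * x) (by simp; linarith) 2
    rw [show 3 + 2 * x + ((2 : ℕ) : ℂ) = 3 + 2 * (x + 1) by push_cast; ring] at h2
    have h3 := Gamma_add_nat_of_re_pos (s := 7 + 6 * x) (by simp; linarith) 6
    rw [show 7 + 6 * x + ((6 : ℕ) : ℂ) = 7 + 6 * (x + 1) by push_cast; ring] at h3
    have n0 := g (7 + 6 * x) (by simp; linarith)
    have q0 := g (7 + 6 * (x + 1)) (by simp; linarith)
    rw [h3] at q0
    simp only [Family.phiGamma, h1, h2, h3, Finset.prod_range_succ, Finset.prod_range_zero,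
      Family.root, Family.idx, Family.deg, Family.lamR]
    rw [← mul_div_assoc, ← mul_div_assoc, div_eq_div_iff (by simpa [Finset.prod_range_succ] using q0) n0]
    simp
    ring
  · have h2 := Gamma_add_nat_of_re_pos (s := 5 + 4 * x) (by simp; linarith) 4
    rw [show 5 + 4 * x + ((4 : ℕ) : ℂ) = 5 + 4 * (x + 1) by push_cast; ring] at h2
    have h3 := Gamma_add_nat_of_re_pos (s := 9 + 8 * x) (by simp; linarith) 8
    rw [show 9 + 8 * x + ((8 : ℕ) : ℂ) = 9 + 8 * (x + 1) by push_cast; ring] at h3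
    have n0 := g (9 + 8 * x) (by simp; linarith)
    have q0 := g (9 + 8 * (x + 1)) (by simp; linarith)
    rw [h3] at q0
    simp only [Family.phiGamma, h1, h2, h3, Finset.prod_range_succ, Finset.prod_range_zero,
      Family.root, Family.idx, Family.deg, Family.lamR]
    rw [← mul_div_assoc, ← mul_div_assoc, div_eq_div_iff (by simpa [Finset.prod_range_succ] using q0) n0]
    simp
    ring
  · have h2 := Gamma_add_nat_of_re_pos (s := 2 + 2 * x) (by simp; linarith) 2
    rw [show 2 + 2 * x + ((2 : ℕ) : ℂ) = 2 + 2 * (x + 1) by push_cast; ring] at h2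
    have h4 := Gamma_add_nat_of_re_pos (s := 6 + 5 * x) (by simp; linarith) 5
    rw [show 6 + 5 * x + ((5 : ℕ) : ℂ) = 6 + 5 * (x + 1) by push_cast; ring] at h4
    have h3 := Gamma_add_nat_of_re_pos (s := 11 + 10 * x) (by simp; linarith) 10
    rw [show 11 + 10 * x + ((10 : ℕ) : ℂ) = 11 + 10 * (x + 1) by push_cast; ring] at h3
    have n0 := g (11 + 10 * x) (by simp; linarith)
    have q0 := g (11 + 10 * (x + 1)) (by simp; linarith)
    rw [h3] at q0
    simp only [Family.phiGamma, h1, h2, h3, h4, Finset.prod_range_succ, Finset.prod_range_zero,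
      Family.root, Family.idx, Family.deg, Family.lamR]
    rw [← mul_div_assoc, ← mul_div_assoc, div_eq_div_iff (by simpa [Finset.prod_range_succ] using q0) n0]
    simp
    ring

/-- The solution with exponent `-a_j`. -/
def Family.basis (X : Family) (j : Fin 4) : ℂ → ℂ := X.phi (X.idx j)

theorem Family.basis_eq (X : Family) (j : Fin 4) :
    X.basis j = expSeries (X.phiCoeff (X.idx j)) (-(X.root j : ℂ)) := by
  rw [Family.basis, X.phi_eq, Family.root]; push_cast; rfl

theorem Family.phiCoeff_idx (X : Family) (j : Fin 4) (n : ℕ) :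
    X.phiCoeff (X.idx j) n = X.phiGamma (n - X.root j) * (-1) ^ n := by
  rw [Family.phiCoeff, Family.root]; push_cast; rfl

theorem Family.phiCoeff_succ (X : Family) (j : Fin 4) (n : ℕ) :
    X.lamR * (∏ i, (n + 1 + -(X.root j : ℂ) + X.root i)) * X.phiCoeff (X.idx j) (n + 1) +
      (n + 1 + -(X.root j : ℂ)) ^ 3 * X.phiCoeff (X.idx j) n = 0 := by
  have h := X.phiGamma_add_one (x := n - X.root j) (by
    simp; linarith [X.root_lt_one j, n.cast_nonneg (α := ℝ)])
  rw [X.phiCoeff_idx, X.phiCoeff_idx]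
  push_cast
  rw [show (n : ℂ) - X.root j + 1 = n + 1 + -(X.root j : ℂ) by ring] at h
  rw [show (n : ℂ) + 1 - X.root j = n + 1 + -(X.root j : ℂ) by ring]
  rw [pow_succ]
  linear_combination (-1) ^ n * (-1) * h

/-- In the recurrence the factor with i = j is exactly n + 1 and the other three are at least e = n
+ 1 - a_j, so each step gains at least 1/(λ(n+1)). This yields the sharp exponential type 1/λ, which
is needed later on the negative axis. -/
theorem Family.norm_phiCoeff_le (X : Family) (j : Fin 4) (n : ℕ) :
    ‖X.phiCoeff (X.idx j) n‖ ≤ ‖X.phiCoeff (X.idx j) 0‖ * (X.lamR⁻¹ ^ n / n.factorial) := by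
  have hl := X.lamR_pos
  induction n with
  | zero => simp
  | succ n ih =>
    refine le_trans ?_ ((mul_le_mul_of_nonneg_left ih (a := X.lamR⁻¹ / (n + 1))
      (by positivity)).trans (le_of_eq ?_))
    swap
    · rw [Nat.factorial_succ, pow_succ]; push_cast; field_simp
    have hn := n.cast_nonneg (α := ℝ)
    set e : ℝ := n + 1 - X.root j with he
    have he0 : 0 < e := by have := X.root_lt_one j; linarith
    have h := X.phiCoeff_succ j n
    have hprod : (n + 1) * e ^ 3 ≤ ∏ i, (e + X.root i) := by
      have hj : e + X.root j = n + 1 := by rw [he]; ring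
      rw [← Finset.mul_prod_erase Finset.univ _ (Finset.mem_univ j), hj]
      have h3 : e ^ 3 = ∏ i ∈ Finset.univ.erase j, e := by
        rw [Finset.prod_const, Finset.card_erase_of_mem (Finset.mem_univ j)]; simp
      rw [h3]
      gcongr with i hi
      linarith [X.root_pos i]
    have hP : 0 < ∏ i, (e + X.root i) := Finset.prod_pos fun i _ => by linarith [X.root_pos i]
    have hcast : (∏ i, (n + 1 + -(X.root j : ℂ) + X.root i)) =
        ((∏ i, (e + X.root i) : ℝ) : ℂ) := by
      push_cast [he]; congr 1
    have hcast' : (n + 1 + -(X.root j : ℂ)) = (e : ℂ) := by push_cast [he]; ring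
    rw [hcast, hcast'] at h
    have h2 := congrArg norm (eq_neg_of_add_eq_zero_left h)
    rw [norm_neg, norm_mul, norm_mul, norm_mul, norm_pow, Complex.norm_of_nonneg hl.le,
      Complex.norm_of_nonneg hP.le, Complex.norm_of_nonneg he0.le] at h2
    have hn0 := norm_nonneg (X.phiCoeff (X.idx j) n)
    have h4 : X.lamR * ((n + 1) * e ^ 3) * ‖X.phiCoeff (X.idx j) (n + 1)‖ ≤
        e ^ 3 * ‖X.phiCoeff (X.idx j) n‖ := by
      rw [← h2]; gcongr
    have he3 : 0 < e ^ 3 := by positivity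
    have h5 : X.lamR * (n + 1) * ‖X.phiCoeff (X.idx j) (n + 1)‖ ≤ ‖X.phiCoeff (X.idx j) n‖ := by
      refine le_of_mul_le_mul_left ?_ he3
      linarith
    calc ‖X.phiCoeff (X.idx j) (n + 1)‖ = X.lamR⁻¹ / (n + 1) *
          (X.lamR * (n + 1) * ‖X.phiCoeff (X.idx j) (n + 1)‖) := by field_simp
      _ ≤ _ := by gcongr

theorem Family.entireSeq_phiCoeff (X : Family) (j : Fin 4) :
    EntireSeq (X.phiCoeff (X.idx j)) := by
  intro R hR
  refine Summable.of_nonneg_of_le (fun n => by positivity) (fun n => ?_)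
    ((Real.summable_pow_div_factorial (X.lamR⁻¹ * R)).mul_left ‖X.phiCoeff (X.idx j) 0‖)
  calc _ ≤ ‖X.phiCoeff (X.idx j) 0‖ * (X.lamR⁻¹ ^ n / n.factorial) * R ^ n := by
        gcongr; exact X.norm_phiCoeff_le j n
    _ = _ := by rw [mul_pow]; ring

theorem Family.isSolution_basis (X : Family) (j : Fin 4) : X.IsSolution (X.basis j) := by
  rw [X.basis_eq]
  exact X.isSolution_expSeries (X.entireSeq_phiCoeff j) _
    (Finset.prod_eq_zero (Finset.mem_univ j) (by simp)) (X.phiCoeff_succ j)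

theorem Family.norm_basis_le (X : Family) (j : Fin 4) (ζ : ℂ) :
    ‖X.basis j ζ‖ ≤ ‖X.phiCoeff (X.idx j) 0‖ *
      (Real.exp (-(X.root j * ζ.re)) * Real.exp (Real.exp ζ.re / X.lamR)) := by
  have hl := X.lamR_pos
  have hs := Real.summable_pow_div_factorial (X.lamR⁻¹ * Real.exp ζ.re)
  rw [X.basis_eq, expSeries]
  have hle : ∀ n : ℕ, ‖X.phiCoeff (X.idx j) n * Complex.exp ((n + -(X.root j : ℂ)) * ζ)‖ ≤
      (‖X.phiCoeff (X.idx j) 0‖ * Real.exp (-(X.root j * ζ.re))) *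
        ((X.lamR⁻¹ * Real.exp ζ.re) ^ n / n.factorial) := fun n => by
    rw [norm_mul, norm_exp_nat_add_mul, Complex.norm_exp]
    have : (-(X.root j : ℂ) * ζ).re = -(X.root j * ζ.re) := by simp
    rw [this]
    calc _ ≤ ‖X.phiCoeff (X.idx j) 0‖ * (X.lamR⁻¹ ^ n / n.factorial) *
          (Real.exp (-(X.root j * ζ.re)) * Real.exp ζ.re ^ n) := by
          gcongr; exact X.norm_phiCoeff_le j n
      _ = _ := by rw [mul_pow]; ring
  refine (tsum_of_norm_bounded ((hs.mul_left _).hasSum) hle).trans (le_of_eq ?_)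
  rw [tsum_mul_left, mul_assoc, Real.exp_eq_exp_ℝ, NormedSpace.exp_eq_tsum_div]
  simp only [div_eq_inv_mul, mul_comm]

theorem Family.norm_basis_sub_le (X : Family) (j : Fin 4) {ζ : ℂ} (hζ : ζ.re ≤ 0) :
    ‖X.basis j ζ - X.phiCoeff (X.idx j) 0 * Complex.exp (-(X.root j : ℂ) * ζ)‖ ≤
      ‖X.phiCoeff (X.idx j) 0‖ * Real.exp (1 / X.lamR) * Real.exp ((1 - X.root j) * ζ.re) := by
  have hl := X.lamR_pos
  have hs := Real.summable_pow_div_factorial (1 / X.lamR)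
  have hsum := (X.entireSeq_phiCoeff j).summable (-(X.root j : ℂ)) ζ
  rw [X.basis_eq, expSeries, hsum.tsum_eq_zero_add]
  simp only [Nat.cast_zero, zero_add, add_sub_cancel_left]
  have hle : ∀ n : ℕ, ‖X.phiCoeff (X.idx j) (n + 1) *
      Complex.exp (((n + 1 : ℕ) + -(X.root j : ℂ)) * ζ)‖ ≤
      (‖X.phiCoeff (X.idx j) 0‖ * Real.exp ((1 - X.root j) * ζ.re)) *
        ((1 / X.lamR) ^ (n + 1) / (n + 1).factorial) := fun n => by
    rw [norm_mul, norm_exp_nat_add_mul, Complex.norm_exp]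
    have h1 : (-(X.root j : ℂ) * ζ).re = -(X.root j * ζ.re) := by simp
    have h2 : Real.exp ζ.re ^ (n + 1) ≤ Real.exp ζ.re := by
      rw [pow_succ]
      exact mul_le_of_le_one_left (Real.exp_pos _).le
        (pow_le_one₀ (Real.exp_pos _).le (Real.exp_le_one_iff.2 hζ))
    rw [h1, show (1 - X.root j) * ζ.re = -(X.root j * ζ.re) + ζ.re by ring, Real.exp_add]
    calc _ ≤ ‖X.phiCoeff (X.idx j) 0‖ * (X.lamR⁻¹ ^ (n + 1) / (n + 1).factorial) *
          (Real.exp (-(X.root j * ζ.re)) * Real.exp ζ.re) := by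
          gcongr; exact X.norm_phiCoeff_le j (n + 1)
      _ = _ := by rw [one_div]; ring
  refine (tsum_of_norm_bounded (((summable_nat_add_iff 1).2 hs).mul_left _).hasSum hle).trans ?_
  rw [tsum_mul_left, mul_right_comm]
  gcongr
  rw [Real.exp_eq_exp_ℝ, NormedSpace.exp_eq_tsum_div]
  simp only
  rw [hs.tsum_eq_zero_add]
  simp

theorem Family.basis_add_two_pi_I (X : Family) (j : Fin 4) (ζ : ℂ) :
    X.basis j (ζ + 2 * Real.pi * Complex.I) =
      Complex.exp (-(2 * Real.pi * Complex.I * X.root j)) * X.basis j ζ := by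
  rw [X.basis_eq, expSeries_add_two_pi_I, mul_neg]

/-! ### The solution space -/

/-- The monodromy eigenvalue of the solution with exponent `-a_j`. -/
def Family.mono (X : Family) (j : Fin 4) : ℂ := Complex.exp (-(2 * Real.pi * Complex.I * X.root j))

theorem Family.mono_injective (X : Family) : Function.Injective X.mono := by
  intro i j h
  obtain ⟨n, hn⟩ := Complex.exp_eq_exp_iff_exists_int.1 h
  have h2 : (2 * Real.pi * Complex.I : ℂ) ≠ 0 := Complex.two_pi_I_ne_zero
  have h3 : (X.root j : ℂ) - X.root i = n := by
    apply mul_left_cancel₀ h2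
    linear_combination hn
  have h4 : X.root j - X.root i = n := by exact_mod_cast h3
  have h5 : |(n : ℝ)| < 1 := by
    rw [← h4, abs_lt]
    constructor <;> linarith [X.root_pos i, X.root_pos j, X.root_lt_one i, X.root_lt_one j]
  have h6 : n = 0 := by
    rw [← Int.cast_abs] at h5
    exact Int.abs_lt_one_iff.1 (by exact_mod_cast h5)
  rw [h6] at h4
  exact X.root_strictMono.injective (by push_cast at h4; linarith)

theorem Family.mono_ne_one (X : Family) (j : Fin 4) : X.mono j ≠ 1 := by
  intro h
  obtain ⟨n, hn⟩ := Complex.exp_eq_one_iff.1 h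
  have h2 : (2 * Real.pi * Complex.I : ℂ) ≠ 0 := Complex.two_pi_I_ne_zero
  have h3 : -(X.root j : ℂ) = n := by
    apply mul_left_cancel₀ h2
    linear_combination hn
  have h4 : -X.root j = n := by exact_mod_cast h3
  have h5 : (n : ℝ) < 0 := by linarith [X.root_pos j]
  have h6 : (-1 : ℝ) < n := by linarith [X.root_lt_one j]
  have h7 : n < 0 := by exact_mod_cast h5
  have h8 : -1 < n := by exact_mod_cast h6
  omega

theorem Family.phiGamma_ne_zero (X : Family) {x : ℂ} (hx : -1 < x.re) : X.phiGamma x ≠ 0 := by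
  have g : ∀ (s : ℂ), 0 < s.re → Complex.Gamma s ≠ 0 := fun s hs =>
    Complex.Gamma_ne_zero_of_re_pos hs
  cases X
  · exact div_ne_zero (mul_ne_zero (pow_ne_zero _ (g _ (by simp; linarith)))
      (g _ (by simp; linarith))) (g _ (by simp; linarith))
  · exact div_ne_zero (mul_ne_zero (pow_ne_zero _ (g _ (by simp; linarith)))
      (g _ (by simp; linarith))) (g _ (by simp; linarith))
  · exact div_ne_zero (mul_ne_zero (pow_ne_zero _ (g _ (by simp; linarith)))
      (g _ (by simp; linarith))) (g _ (by simp; linarith))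
  · exact div_ne_zero (mul_ne_zero (mul_ne_zero (pow_ne_zero _ (g _ (by simp; linarith)))
      (g _ (by simp; linarith))) (g _ (by simp; linarith))) (g _ (by simp; linarith))

theorem Family.phiCoeff_zero (X : Family) (j : Fin 4) :
    X.phiCoeff (X.idx j) 0 = X.phiGamma (-X.root j) := by
  simp [X.phiCoeff_idx]

theorem Family.phiCoeff_zero_ne_zero (X : Family) (j : Fin 4) : X.phiCoeff (X.idx j) 0 ≠ 0 := by
  rw [X.phiCoeff_zero]
  exact X.phiGamma_ne_zero (by simpa using X.root_lt_one j)

/-- For real ζ tending to -∞ the leading term dominates the rest by a factor of order e^{-ζ}, so the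
sum cannot vanish identically. -/
theorem Family.basis_ne_zero (X : Family) (j : Fin 4) : X.basis j ≠ 0 := by
  intro h
  have hc := norm_pos_iff.2 (X.phiCoeff_zero_ne_zero j)
  have hl := X.lamR_pos
  have hle : ∀ x : ℝ, x ≤ 0 → 1 ≤ Real.exp (1 / X.lamR) * Real.exp x := by
    intro x hx
    have h1 := X.norm_basis_sub_le j (ζ := x) (by simpa using hx)
    rw [h] at h1
    simp only [Pi.zero_apply, zero_sub, norm_neg, norm_mul, Complex.norm_exp] at h1
    have h2 : (-(X.root j : ℂ) * x).re = -(X.root j * x) := by simp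
    rw [h2, Complex.ofReal_re, show (1 - X.root j) * x = x + -(X.root j * x) by ring,
      Real.exp_add, mul_assoc] at h1
    have h3 := le_of_mul_le_mul_left h1 hc
    have h4 := Real.exp_pos (-(X.root j * x))
    rw [← mul_assoc] at h3
    exact le_of_mul_le_mul_right (by linarith) h4
  have h1 := hle (-(1 / X.lamR) - 1) (by have := one_div_pos.2 hl; linarith)
  rw [← Real.exp_add] at h1
  have h2 : Real.exp (1 / X.lamR + (-(1 / X.lamR) - 1)) < 1 := by
    rw [Real.exp_lt_one_iff]; ring_nf; norm_num
  linarith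

/-- The local solutions are eigenvectors of continuation around the origin with distinct
eigenvalues. -/
theorem Family.linearIndependent_basis (X : Family) : LinearIndependent ℂ X.basis := by
  refine Module.End.eigenvectors_linearIndependent'
    (LinearMap.funLeft ℂ ℂ fun ζ : ℂ => ζ + 2 * Real.pi * Complex.I) X.mono X.mono_injective
    X.basis fun j => ?_
  refine Module.End.hasEigenvector_iff.2 ⟨Module.End.mem_eigenspace_iff.2 ?_, X.basis_ne_zero j⟩
  ext ζ
  simp only [LinearMap.funLeft_apply, Pi.smul_apply, smul_eq_mul]
  exact X.basis_add_two_pi_I j ζ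

theorem Family.jet_add_smul (X : Family) {F G : ℂ → ℂ} {U : Set ℂ} (hU : IsOpen U)
    (hF : DifferentiableOn ℂ F U) (hG : DifferentiableOn ℂ G U) (c : ℂ) {ζ : ℂ} (hζ : ζ ∈ U) :
    X.jet (F + c • G) ζ = X.jet F ζ + c • X.jet G ζ := by
  have d := fun {H : ℂ → ℂ} (h : DifferentiableOn ℂ H U) (a : ℂ) => differentiableOn_lin hU h a
  have e1 := lin_add_smul hU hF hG (X.root 3) c
  have e2 := (lin_eqOn hU e1 (X.root 2)).trans (lin_add_smul hU (d hF _) (d hG _) _ c)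
  have e3 := (lin_eqOn hU e2 (X.root 1)).trans (lin_add_smul hU (d (d hF _) _) (d (d hG _) _) _ c)
  ext i
  fin_cases i
  · rfl
  · exact e1 hζ
  · exact e2 hζ
  · exact e3 hζ

theorem Family.DE_add_smul (X : Family) {F G : ℂ → ℂ} {U : Set ℂ} (hU : IsOpen U)
    (hF : DifferentiableOn ℂ F U) (hG : DifferentiableOn ℂ G U) (c : ℂ) {ζ : ℂ} (hζ : ζ ∈ U) :
    X.DE (F + c • G) ζ = X.DE F ζ + c * X.DE G ζ := by
  have d := fun {H : ℂ → ℂ} (h : DifferentiableOn ℂ H U) (a : ℂ) => differentiableOn_lin hU h a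
  have e1 := lin_add_smul hU hF hG (X.root 3) c
  have e2 := (lin_eqOn hU e1 (X.root 2)).trans (lin_add_smul hU (d hF _) (d hG _) _ c)
  have e3 := (lin_eqOn hU e2 (X.root 1)).trans (lin_add_smul hU (d (d hF _) _) (d (d hG _) _) _ c)
  have e4 := (lin_eqOn hU e3 (X.root 0)).trans
    (lin_add_smul hU (d (d (d hF _) _) _) (d (d (d hG _) _) _) _ c)
  have f1 := lin_add_smul hU hF hG 1 c
  have f2 := (lin_eqOn hU f1 1).trans (lin_add_smul hU (d hF _) (d hG _) _ c)
  have f3 := (lin_eqOn hU f2 1).trans (lin_add_smul hU (d (d hF _) _) (d (d hG _) _) _ c)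
  have e := e4 hζ
  have f := f3 hζ
  simp only [Pi.add_apply, Pi.smul_apply, smul_eq_mul] at e f
  simp only [Family.DE, e, f]
  ring

theorem Family.jet_sum (X : Family) (g : Fin 4 → ℂ) (s : Finset (Fin 4)) (ζ : ℂ) :
    X.jet (∑ j ∈ s, g j • X.basis j) ζ = ∑ j ∈ s, g j • X.jet (X.basis j) ζ := by
  induction s using Finset.induction_on with
  | empty =>
    have h0 : ∀ a, lin a 0 = 0 := fun a => by ext; simp [lin]
    ext i
    fin_cases i <;> simp [Family.jet, h0]
  | insert i s hi ih =>
    rw [Finset.sum_insert hi, Finset.sum_insert hi, add_comm, X.jet_add_smul isOpen_univ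
      (Family.IsSolution.sum s fun j _ => (X.isSolution_basis j).smul _).1.differentiableOn
      (X.isSolution_basis i).1.differentiableOn _ (mem_univ ζ), ih, add_comm]

/-- By uniqueness the jets of the four local solutions at a point form a basis of ℂ⁴; match the jet
of `F`. Since the local solutions are entire in ζ, every solution on a connected open set thereby
extends to the whole plane. -/
theorem Family.exists_eq_sum_basis (X : Family) {U : Set ℂ} (hU : IsOpen U)
    (hc : IsPreconnected U) (hne : U.Nonempty) {F : ℂ → ℂ} (hF : DifferentiableOn ℂ F U)
    (hD : ∀ ζ ∈ U, X.DE F ζ = 0) :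
    ∃ e : Fin 4 → ℂ, EqOn F (∑ j, e j • X.basis j) U := by
  obtain ⟨ζ₀, h0⟩ := hne
  have hli : LinearIndependent ℂ fun j => X.jet (X.basis j) ζ₀ := by
    rw [Fintype.linearIndependent_iff]
    intro g hg
    refine Fintype.linearIndependent_iff.1 X.linearIndependent_basis g ?_
    have hs : X.IsSolution (∑ j, g j • X.basis j) :=
      Family.IsSolution.sum _ fun j _ => (X.isSolution_basis j).smul _
    rw [Family.isSolution_iff] at hs
    have := X.eqOn_zero_of_jet_eq_zero isOpen_univ isPreconnected_univ hs.1.differentiableOn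
      (fun ζ _ => congrFun hs.2 ζ) (mem_univ ζ₀) (by rw [X.jet_sum, hg])
    exact funext fun ζ => this (mem_univ ζ)
  let b := basisOfLinearIndependentOfCardEqFinrank hli (by simp)
  refine ⟨fun j => b.repr (X.jet F ζ₀) j, ?_⟩
  set e : Fin 4 → ℂ := fun j => b.repr (X.jet F ζ₀) j
  have he : X.jet F ζ₀ = ∑ j, e j • X.jet (X.basis j) ζ₀ := by
    have := b.sum_repr (X.jet F ζ₀)
    rw [← this]
    simp [b, e]
  have hs : X.IsSolution (∑ j, e j • X.basis j) :=
    Family.IsSolution.sum _ fun j _ => (X.isSolution_basis j).smul _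
  rw [Family.isSolution_iff] at hs
  have hz := X.eqOn_zero_of_jet_eq_zero hU hc
    (F := F + (-1 : ℂ) • ∑ j, e j • X.basis j)
    (hF.add (hs.1.differentiableOn.const_smul (-1 : ℂ)))
    (fun ζ hζ => by
      rw [X.DE_add_smul hU hF hs.1.differentiableOn _ hζ, hD ζ hζ, hs.2]; simp) h0
    (by rw [X.jet_add_smul hU hF hs.1.differentiableOn _ h0, X.jet_sum, he]; simp)
  intro ζ hζ
  have := hz hζ
  simp only [Pi.add_apply, Pi.smul_apply, smul_eq_mul, Pi.zero_apply] at this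
  linear_combination this

/-- A single-valued solution vanishes. -/
theorem Family.IsSolution.eq_zero_of_periodic {X : Family} {F : ℂ → ℂ} (hF : X.IsSolution F)
    (hp : ∀ ζ, F (ζ + 2 * Real.pi * Complex.I) = F ζ) : F = 0 := by
  rw [Family.isSolution_iff] at hF
  obtain ⟨e, he⟩ := X.exists_eq_sum_basis isOpen_univ isPreconnected_univ univ_nonempty
    hF.1.differentiableOn (fun ζ _ => congrFun hF.2 ζ)
  have he' : F = ∑ j, e j • X.basis j := funext fun ζ => he (mem_univ ζ)
  have h0 : ∑ j, ((X.mono j - 1) * e j) • X.basis j = 0 := by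
    ext ζ
    have h1 := hp ζ
    rw [he'] at h1
    simp only [Finset.sum_apply, Pi.smul_apply, smul_eq_mul, X.basis_add_two_pi_I] at h1
    simp only [Finset.sum_apply, Pi.smul_apply, smul_eq_mul, Pi.zero_apply]
    rw [← sub_eq_zero, ← Finset.sum_sub_distrib] at h1
    rw [← h1]
    refine Finset.sum_congr rfl fun j _ => ?_
    simp only [Family.mono]
    ring
  have h2 := Fintype.linearIndependent_iff.1 X.linearIndependent_basis _ h0
  rw [he']
  refine Finset.sum_eq_zero fun j _ => ?_
  have := (mul_eq_zero.1 (h2 j)).resolve_left (sub_ne_zero.2 (X.mono_ne_one j))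
  rw [this, zero_smul]

/-! ### The multiplication formula for the Gamma function -/

theorem prod_range_prod_range {M : Type*} [CommMonoid M] (m n : ℕ) (g : ℕ → M) :
    ∏ k ∈ Finset.range m, ∏ j ∈ Finset.range n, g (m * j + k) = ∏ i ∈ Finset.range (m * n), g i := by
  rw [Finset.prod_comm]
  induction n with
  | zero => simp
  | succ n ih => rw [Finset.prod_range_succ, ih, mul_add, mul_one, Finset.prod_range_add]

theorem GammaSeq_eq_exp (s : ℂ) {n : ℕ} (hn : n ≠ 0) :
    Complex.GammaSeq s n = Complex.exp (Real.log n * s) * n.factorial /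
      ∏ j ∈ Finset.range (n + 1), (s + j) := by
  rw [Complex.GammaSeq, Complex.cpow_def_of_ne_zero (by exact_mod_cast hn), Complex.natCast_log]

/-- The denominators of the m Euler approximants interlace into one progression 1 + ms + i of length
m(n+1), so the approximant of Γ(1+ms) has index mn + m - 1. Comparing with s = 0 cancels all factors
independent of s. -/
theorem prod_GammaSeq_mul {m n : ℕ} (hm : m ≠ 0) (hn : n ≠ 0) (s : ℂ) :
    (∏ k ∈ Finset.range m, Complex.GammaSeq (s + (k + 1) / m) n) *
        Complex.GammaSeq 1 (m * n + m - 1) =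
      (∏ k ∈ Finset.range m, Complex.GammaSeq ((k + 1) / m) n) *
        Complex.exp ((Real.log n - Real.log (m * n + m - 1 : ℕ)) * (m * s)) *
        Complex.GammaSeq (1 + m * s) (m * n + m - 1) := by
  have hm' : (m : ℂ) ≠ 0 := by exact_mod_cast hm
  set N := m * n + m - 1 with hN
  have hN0 : N ≠ 0 := by
    have : 1 ≤ m * n := Nat.one_le_iff_ne_zero.2 (mul_ne_zero hm hn)
    omega
  have hN1 : N + 1 = m * (n + 1) := by
    have : 1 ≤ m := Nat.one_le_iff_ne_zero.2 hm
    rw [mul_add, mul_one]; omega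
  have key : ∀ s : ℂ, ∏ k ∈ Finset.range m, Complex.GammaSeq (s + (k + 1) / m) n =
      Complex.exp (Real.log n * (m * s)) *
        (∏ k ∈ Finset.range m, Complex.exp (Real.log n * ((k + 1) / m)) * n.factorial) *
        ((∏ i ∈ Finset.range (N + 1), (1 + m * s + i))⁻¹ * (m : ℂ) ^ (m * (n + 1))) := by
    intro s
    simp_rw [GammaSeq_eq_exp _ hn, Finset.prod_div_distrib]
    have h1 : ∏ k ∈ Finset.range m, ∏ j ∈ Finset.range (n + 1), (s + (k + 1) / m + j : ℂ) =
        (∏ i ∈ Finset.range (N + 1), (1 + m * s + i)) / (m : ℂ) ^ (m * (n + 1)) := by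
      rw [hN1, ← prod_range_prod_range]
      have : (m : ℂ) ^ (m * (n + 1)) = ∏ k ∈ Finset.range m, ∏ j ∈ Finset.range (n + 1), (m : ℂ) := by
        simp only [Finset.prod_const, Finset.card_range, ← pow_mul]; rw [mul_comm]
      rw [this, ← Finset.prod_div_distrib]
      refine Finset.prod_congr rfl fun k _ => ?_
      rw [← Finset.prod_div_distrib]
      refine Finset.prod_congr rfl fun j _ => ?_
      push_cast
      field_simp
      ring
    rw [h1, div_div_eq_mul_div, div_eq_mul_inv]
    have h2 : ∏ k ∈ Finset.range m,
        (Complex.exp (Real.log n * (s + (k + 1) / m)) * (n.factorial : ℂ)) =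
        Complex.exp (Real.log n * (m * s)) *
        (∏ k ∈ Finset.range m, Complex.exp (Real.log n * ((k + 1) / m)) * n.factorial) := by
      have : Complex.exp (Real.log n * (m * s)) =
          ∏ k ∈ Finset.range m, Complex.exp (Real.log n * s) := by
        rw [Finset.prod_const, Finset.card_range, ← Complex.exp_nat_mul]; congr 1; ring
      rw [this, ← Finset.prod_mul_distrib]
      refine Finset.prod_congr rfl fun k _ => ?_
      rw [mul_add, Complex.exp_add, mul_assoc]
    rw [h2]; ring
  have key0 := key 0
  simp only [zero_add, mul_zero, Complex.exp_zero, one_mul, add_zero] at key0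
  rw [key0, key s, GammaSeq_eq_exp _ hN0, GammaSeq_eq_exp _ hN0, sub_mul, Complex.exp_sub,
    mul_add (Real.log N : ℂ), Complex.exp_add]
  have hE := Complex.exp_ne_zero (Real.log N * (m * s))
  generalize (∏ k ∈ Finset.range m,
    Complex.exp (Real.log n * (((k : ℂ) + 1) / m)) * (n.factorial : ℂ)) = A
  field_simp

/-- Gauss's multiplication formula, obtained as the limit of the previous identity. The constant is
kept as ∏ Γ((k+1)/m), since only ratios of such constants are needed. -/
theorem Gamma_one_add_nat_mul {m : ℕ} (hm : m ≠ 0) (s : ℂ) :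
    Complex.Gamma (1 + m * s) = Complex.exp (m * s * Real.log m) *
      ((∏ k ∈ Finset.range m, Complex.Gamma (s + (k + 1) / m)) /
        ∏ k ∈ Finset.range m, Complex.Gamma ((k + 1) / m)) := by
  have hN : Tendsto (fun n : ℕ => m * n + m - 1) atTop atTop := by
    refine tendsto_atTop_mono (fun n => ?_) tendsto_id
    have : 1 ≤ m := Nat.one_le_iff_ne_zero.2 hm
    have : n ≤ m * n := Nat.le_mul_of_pos_left n this
    simp only [id]; omega
  have hlog : Tendsto (fun n : ℕ => Real.log n - Real.log (m * n + m - 1 : ℕ)) atTop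
      (𝓝 (-Real.log m)) := by
    have h1 : Tendsto (fun n : ℕ => ((m : ℝ) + ((m : ℝ) - 1) * (n : ℝ)⁻¹)) atTop (𝓝 (m + ((m : ℝ) - 1) * 0)) :=
      (tendsto_natCast_atTop_atTop.inv_tendsto_atTop.const_mul _).const_add _
    have h2 := (h1.log (by simpa using hm)).neg
    rw [mul_zero, add_zero] at h2
    refine h2.congr' ?_
    filter_upwards [eventually_ge_atTop 1] with n hn
    have hm1 : (1 : ℝ) ≤ m := by exact_mod_cast Nat.one_le_iff_ne_zero.2 hm
    have hn' : (1 : ℝ) ≤ n := by exact_mod_cast hn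
    have e : ((m * n + m - 1 : ℕ) : ℝ) = n * ((m : ℝ) + ((m : ℝ) - 1) * (n : ℝ)⁻¹) := by
      rw [Nat.cast_sub (by have := Nat.one_le_iff_ne_zero.2 hm; omega)]
      push_cast; field_simp; ring
    have hp : 0 < (m : ℝ) + ((m : ℝ) - 1) * (n : ℝ)⁻¹ := by
      have : 0 ≤ ((m : ℝ) - 1) * (n : ℝ)⁻¹ := mul_nonneg (by linarith) (by positivity)
      linarith
    rw [e, Real.log_mul (by positivity) hp.ne']
    ring
  have hP : ∀ s : ℂ, Tendsto (fun n : ℕ => ∏ k ∈ Finset.range m,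
      Complex.GammaSeq (s + (k + 1) / m) n) atTop
      (𝓝 (∏ k ∈ Finset.range m, Complex.Gamma (s + (k + 1) / m))) := fun s =>
    tendsto_finsetProd _ fun k _ => Complex.GammaSeq_tendsto_Gamma _
  have hP0 := hP 0
  simp only [zero_add] at hP0
  have hlog' : Tendsto (fun n : ℕ => ((Real.log n : ℂ) - (Real.log (m * n + m - 1 : ℕ) : ℂ))) atTop
      (𝓝 (-(Real.log m : ℂ))) := by
    have := (Complex.continuous_ofReal.tendsto _).comp hlog
    simpa [Function.comp_def] using this
  have hE := (Complex.continuous_exp.tendsto _).comp (hlog'.mul_const ((m : ℂ) * s))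
  have hl := (hP s).mul ((Complex.GammaSeq_tendsto_Gamma 1).comp hN)
  have hr := (hP0.mul hE).mul ((Complex.GammaSeq_tendsto_Gamma (1 + m * s)).comp hN)
  have heq := tendsto_nhds_unique (hl.congr' (by
    filter_upwards [eventually_ge_atTop 1] with n hn
    exact prod_GammaSeq_mul hm (by omega) s)) hr
  rw [Complex.Gamma_one, mul_one] at heq
  have hK : ∏ k ∈ Finset.range m, Complex.Gamma (((k : ℂ) + 1) / m) ≠ 0 := by
    refine Finset.prod_ne_zero_iff.2 fun k _ => Complex.Gamma_ne_zero_of_re_pos ?_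
    have : ((k : ℂ) + 1) / m = (((k + 1) / m : ℝ) : ℂ) := by push_cast; rfl
    rw [this, Complex.ofReal_re]
    have : (0 : ℝ) < m := by exact_mod_cast Nat.pos_of_ne_zero hm
    positivity
  rw [heq, neg_mul, Complex.exp_neg, mul_comm (Real.log m : ℂ)]
  have := Complex.exp_ne_zero (m * s * Real.log m)
  field_simp

/-- The inverse of the product of the values `Γ(root j)`. -/
def Family.gConst (X : Family) : ℂ := (∏ j, Complex.Gamma (X.root j))⁻¹

/-- The multiplication formula splits every Γ(1+ms). The fractions common to numerator and
denominator cancel, leaving the four roots, and each factor with k + 1 = m contributes a Γ(1+s). -/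
theorem Family.gGamma_eq (X : Family) {s : ℂ} (hs : -X.root 0 < s.re) :
    X.gGamma s = X.gConst * Complex.exp (s * Real.log X.lamR) *
      (∏ j, Complex.Gamma (s + X.root j)) / Complex.Gamma (1 + s) ^ 3 := by
  have h1 : ∀ x : ℚ, X.root 0 ≤ x → Complex.Gamma (s + (x : ℂ)) ≠ 0 := fun x hx =>
    Complex.Gamma_ne_zero_of_re_pos (by
      rw [Complex.add_re, ← Complex.ofReal_ratCast, Complex.ofReal_re]; linarith)
  have h2 : ∀ x : ℚ, 0 < x → Complex.Gamma (x : ℂ) ≠ 0 := fun x hx =>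
    Complex.Gamma_ne_zero_of_re_pos (by
      rw [← Complex.ofReal_ratCast, Complex.ofReal_re]; exact_mod_cast hx)
  cases X
  · have l5 := Gamma_one_add_nat_mul (m := 5) (by norm_num) s
    have hlog : Real.log (Family.quintic.lamR) = 5 * Real.log 5 := by
      rw [show Family.quintic.lamR = (5 : ℝ) ^ 5 by norm_num [Family.lamR], Real.log_pow]
      norm_num
    simp only [Finset.prod_range_succ, Finset.prod_range_zero] at l5
    simp only [Family.root, Family.idx, Family.deg] at h1
    simp only [Family.gGamma, Family.gConst, Family.root, Family.idx, Family.deg, hlog,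
      Fin.prod_univ_four, Fin.isValue, Matrix.cons_val]
    norm_num at l5 h1 ⊢
    have p1_5 := h1 (1/5) (by norm_num)
    have q1_5 := h2 (1/5) (by norm_num)
    have p2_5 := h1 (2/5) (by norm_num)
    have q2_5 := h2 (2/5) (by norm_num)
    have p3_5 := h1 (3/5) (by norm_num)
    have q3_5 := h2 (3/5) (by norm_num)
    have p4_5 := h1 (4/5) (by norm_num)
    have q4_5 := h2 (4/5) (by norm_num)
    have p1_1 := h1 (1) (by norm_num)
    have E : Complex.exp (s * (5 * Complex.log 5)) = Complex.exp (5 * s * Complex.log 5) := by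
      congr 1; ring
    push_cast at p1_5 q1_5 p2_5 q2_5 p3_5 q3_5 p4_5 q4_5 p1_1
    rw [E, l5, add_comm 1 s]
    generalize Complex.Gamma (s + 1/5) = x1_5 at p1_5 ⊢
    generalize Complex.Gamma (s + 2/5) = x2_5 at p2_5 ⊢
    generalize Complex.Gamma (s + 3/5) = x3_5 at p3_5 ⊢
    generalize Complex.Gamma (s + 4/5) = x4_5 at p4_5 ⊢
    generalize Complex.Gamma (s + 1) = x1_1 at p1_1 ⊢
    field_simp
  · have l6 := Gamma_one_add_nat_mul (m := 6) (by norm_num) s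
    have l2 := Gamma_one_add_nat_mul (m := 2) (by norm_num) s
    have hlog : Real.log (Family.sextic.lamR) = 6 * Real.log 6 - 2 * Real.log 2 := by
      rw [show Family.sextic.lamR = (6 : ℝ) ^ 6 / 2 ^ 2 by norm_num [Family.lamR], Real.log_div (by norm_num) (by norm_num), Real.log_pow, Real.log_pow]
      norm_num
    simp only [Finset.prod_range_succ, Finset.prod_range_zero] at l6 l2
    simp only [Family.root, Family.idx, Family.deg] at h1
    simp only [Family.gGamma, Family.gConst, Family.root, Family.idx, Family.deg, hlog,
      Fin.prod_univ_four, Fin.isValue, Matrix.cons_val]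
    norm_num at l6 l2 h1 ⊢
    have p1_6 := h1 (1/6) (by norm_num)
    have q1_6 := h2 (1/6) (by norm_num)
    have p1_3 := h1 (1/3) (by norm_num)
    have q1_3 := h2 (1/3) (by norm_num)
    have p1_2 := h1 (1/2) (by norm_num)
    have q1_2 := h2 (1/2) (by norm_num)
    have p2_3 := h1 (2/3) (by norm_num)
    have q2_3 := h2 (2/3) (by norm_num)
    have p5_6 := h1 (5/6) (by norm_num)
    have q5_6 := h2 (5/6) (by norm_num)
    have p1_1 := h1 (1) (by norm_num)
    have E : Complex.exp (s * (6 * Complex.log 6 - 2 * Complex.log 2)) = Complex.exp (6 * s * Complex.log 6) / Complex.exp (2 * s * Complex.log 2) := by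
      simp only [← Complex.exp_sub]; congr 1; ring
    push_cast at p1_6 q1_6 p1_3 q1_3 p1_2 q1_2 p2_3 q2_3 p5_6 q5_6 p1_1
    rw [E, l6, l2, add_comm 1 s]
    generalize Complex.Gamma (s + 1/6) = x1_6 at p1_6 ⊢
    generalize Complex.Gamma (s + 1/3) = x1_3 at p1_3 ⊢
    generalize Complex.Gamma (s + 1/2) = x1_2 at p1_2 ⊢
    generalize Complex.Gamma (s + 2/3) = x2_3 at p2_3 ⊢
    generalize Complex.Gamma (s + 5/6) = x5_6 at p5_6 ⊢
    generalize Complex.Gamma (s + 1) = x1_1 at p1_1 ⊢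
    field_simp
  · have l8 := Gamma_one_add_nat_mul (m := 8) (by norm_num) s
    have l4 := Gamma_one_add_nat_mul (m := 4) (by norm_num) s
    have hlog : Real.log (Family.octic.lamR) = 8 * Real.log 8 - 4 * Real.log 4 := by
      rw [show Family.octic.lamR = (8 : ℝ) ^ 8 / 4 ^ 4 by norm_num [Family.lamR], Real.log_div (by norm_num) (by norm_num), Real.log_pow, Real.log_pow]
      norm_num
    simp only [Finset.prod_range_succ, Finset.prod_range_zero] at l8 l4
    simp only [Family.root, Family.idx, Family.deg] at h1
    simp only [Family.gGamma, Family.gConst, Family.root, Family.idx, Family.deg, hlog,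
      Fin.prod_univ_four, Fin.isValue, Matrix.cons_val]
    norm_num at l8 l4 h1 ⊢
    have p1_8 := h1 (1/8) (by norm_num)
    have q1_8 := h2 (1/8) (by norm_num)
    have p1_4 := h1 (1/4) (by norm_num)
    have q1_4 := h2 (1/4) (by norm_num)
    have p3_8 := h1 (3/8) (by norm_num)
    have q3_8 := h2 (3/8) (by norm_num)
    have p1_2 := h1 (1/2) (by norm_num)
    have q1_2 := h2 (1/2) (by norm_num)
    have p5_8 := h1 (5/8) (by norm_num)
    have q5_8 := h2 (5/8) (by norm_num)
    have p3_4 := h1 (3/4) (by norm_num)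
    have q3_4 := h2 (3/4) (by norm_num)
    have p7_8 := h1 (7/8) (by norm_num)
    have q7_8 := h2 (7/8) (by norm_num)
    have p1_1 := h1 (1) (by norm_num)
    have E : Complex.exp (s * (8 * Complex.log 8 - 4 * Complex.log 4)) = Complex.exp (8 * s * Complex.log 8) / Complex.exp (4 * s * Complex.log 4) := by
      simp only [← Complex.exp_sub]; congr 1; ring
    push_cast at p1_8 q1_8 p1_4 q1_4 p3_8 q3_8 p1_2 q1_2 p5_8 q5_8 p3_4 q3_4 p7_8 q7_8 p1_1
    rw [E, l8, l4, add_comm 1 s]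
    generalize Complex.Gamma (s + 1/8) = x1_8 at p1_8 ⊢
    generalize Complex.Gamma (s + 1/4) = x1_4 at p1_4 ⊢
    generalize Complex.Gamma (s + 3/8) = x3_8 at p3_8 ⊢
    generalize Complex.Gamma (s + 1/2) = x1_2 at p1_2 ⊢
    generalize Complex.Gamma (s + 5/8) = x5_8 at p5_8 ⊢
    generalize Complex.Gamma (s + 3/4) = x3_4 at p3_4 ⊢
    generalize Complex.Gamma (s + 7/8) = x7_8 at p7_8 ⊢
    generalize Complex.Gamma (s + 1) = x1_1 at p1_1 ⊢
    field_simp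
  · have l10 := Gamma_one_add_nat_mul (m := 10) (by norm_num) s
    have l2 := Gamma_one_add_nat_mul (m := 2) (by norm_num) s
    have l5 := Gamma_one_add_nat_mul (m := 5) (by norm_num) s
    have hlog : Real.log (Family.dectic.lamR) = 10 * Real.log 10 - 2 * Real.log 2 - 5 * Real.log 5 := by
      rw [show Family.dectic.lamR = (10 : ℝ) ^ 10 / 2 ^ 2 / 5 ^ 5 by norm_num [Family.lamR], Real.log_div (by norm_num) (by norm_num), Real.log_div (by norm_num) (by norm_num), Real.log_pow, Real.log_pow, Real.log_pow]
      norm_num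
    simp only [Finset.prod_range_succ, Finset.prod_range_zero] at l10 l2 l5
    simp only [Family.root, Family.idx, Family.deg] at h1
    simp only [Family.gGamma, Family.gConst, Family.root, Family.idx, Family.deg, hlog,
      Fin.prod_univ_four, Fin.isValue, Matrix.cons_val]
    norm_num at l10 l2 l5 h1 ⊢
    have p1_10 := h1 (1/10) (by norm_num)
    have q1_10 := h2 (1/10) (by norm_num)
    have p1_5 := h1 (1/5) (by norm_num)
    have q1_5 := h2 (1/5) (by norm_num)
    have p3_10 := h1 (3/10) (by norm_num)
    have q3_10 := h2 (3/10) (by norm_num)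
    have p2_5 := h1 (2/5) (by norm_num)
    have q2_5 := h2 (2/5) (by norm_num)
    have p1_2 := h1 (1/2) (by norm_num)
    have q1_2 := h2 (1/2) (by norm_num)
    have p3_5 := h1 (3/5) (by norm_num)
    have q3_5 := h2 (3/5) (by norm_num)
    have p7_10 := h1 (7/10) (by norm_num)
    have q7_10 := h2 (7/10) (by norm_num)
    have p4_5 := h1 (4/5) (by norm_num)
    have q4_5 := h2 (4/5) (by norm_num)
    have p9_10 := h1 (9/10) (by norm_num)
    have q9_10 := h2 (9/10) (by norm_num)
    have p1_1 := h1 (1) (by norm_num)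
    have E : Complex.exp (s * (10 * Complex.log 10 - 2 * Complex.log 2 - 5 * Complex.log 5)) = Complex.exp (10 * s * Complex.log 10) / Complex.exp (2 * s * Complex.log 2) / Complex.exp (5 * s * Complex.log 5) := by
      simp only [← Complex.exp_sub]; congr 1; ring
    push_cast at p1_10 q1_10 p1_5 q1_5 p3_10 q3_10 p2_5 q2_5 p1_2 q1_2 p3_5 q3_5 p7_10 q7_10 p4_5 q4_5 p9_10 q9_10 p1_1
    rw [E, l10, l2, l5, add_comm 1 s]
    generalize Complex.Gamma (s + 1/10) = x1_10 at p1_10 ⊢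
    generalize Complex.Gamma (s + 1/5) = x1_5 at p1_5 ⊢
    generalize Complex.Gamma (s + 3/10) = x3_10 at p3_10 ⊢
    generalize Complex.Gamma (s + 2/5) = x2_5 at p2_5 ⊢
    generalize Complex.Gamma (s + 1/2) = x1_2 at p1_2 ⊢
    generalize Complex.Gamma (s + 3/5) = x3_5 at p3_5 ⊢
    generalize Complex.Gamma (s + 7/10) = x7_10 at p7_10 ⊢
    generalize Complex.Gamma (s + 4/5) = x4_5 at p4_5 ⊢
    generalize Complex.Gamma (s + 9/10) = x9_10 at p9_10 ⊢
    generalize Complex.Gamma (s + 1) = x1_1 at p1_1 ⊢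
    field_simp

/-! ### A solution with exponential decay, as an iterated Beta convolution -/

/-- The strip over the right half plane. -/
def rightStrip : Set ℂ := {ζ | |ζ.im| < Real.pi / 2}

theorem isOpen_rightStrip : IsOpen rightStrip :=
  isOpen_lt (continuous_abs.comp Complex.continuous_im) continuous_const

theorem exp_re_pos {ζ : ℂ} (hζ : ζ ∈ rightStrip) : 0 < (Complex.exp ζ).re := by
  rw [Complex.exp_re]
  exact mul_pos (Real.exp_pos _) (Real.cos_pos_of_mem_Ioo (abs_lt.1 hζ))

theorem ofReal_mem_rightStrip (x : ℝ) : (x : ℂ) ∈ rightStrip := by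
  simp [rightStrip, Real.pi_pos]

theorem sub_ofReal_mem_rightStrip {ζ : ℂ} (hζ : ζ ∈ rightStrip) (x : ℝ) : ζ - x ∈ rightStrip := by
  simpa [rightStrip] using hζ

/-- Holomorphic functions on the right half plane of size at most `|z|^(-b) |exp (-z / l)|`. -/
def ExpClass (b l : ℝ) (f : ℂ → ℂ) : Prop :=
  DifferentiableOn ℂ f rightStrip ∧ ∃ C : ℝ, ∀ ζ ∈ rightStrip,
    ‖f ζ‖ ≤ C * (Real.exp (-(b * ζ.re)) * Real.exp (-((Complex.exp ζ).re / l)))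

/-- The kernel of the Beta convolution. -/
def betaKer (a t : ℝ) : ℂ := (t : ℂ) ^ ((a : ℂ) - 2) * (1 - (t : ℂ)) ^ (-(a : ℂ))

/-- Multiplicative convolution with a Beta density. -/
def betaConv (a : ℝ) (f : ℂ → ℂ) (ζ : ℂ) : ℂ :=
  ∫ t in Ioo (0 : ℝ) 1, betaKer a t * f (ζ - Real.log t)

theorem continuousOn_betaKer (a : ℝ) : ContinuousOn (betaKer a) (Ioo 0 1) := by
  intro t ht
  refine ContinuousAt.continuousWithinAt (ContinuousAt.mul ?_ ?_)
  · exact Complex.continuous_ofReal.continuousAt.cpow continuousAt_const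
      (Complex.ofReal_mem_slitPlane.2 ht.1)
  · refine (continuousAt_const.sub Complex.continuous_ofReal.continuousAt).cpow continuousAt_const ?_
    change (1 : ℂ) - (t : ℂ) ∈ _
    rw [← Complex.ofReal_one, ← Complex.ofReal_sub]
    exact Complex.ofReal_mem_slitPlane.2 (by linarith [ht.2])

theorem betaKer_mul_cpow (a : ℝ) (w : ℂ) {t : ℝ} (ht : t ∈ Ioo (0 : ℝ) 1) :
    betaKer a t * (t : ℂ) ^ w = (t : ℂ) ^ ((a + w - 1 : ℂ) - 1) * (1 - (t : ℂ)) ^ ((1 - a : ℂ) - 1) := by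
  have ht0 : (t : ℂ) ≠ 0 := by exact_mod_cast ht.1.ne'
  rw [betaKer, mul_right_comm, ← Complex.cpow_add _ _ ht0]
  congr 2 <;> ring

theorem integrableOn_betaKer_mul_cpow {a : ℝ} {w : ℂ} (ha : a < 1) (hw : 1 < a + w.re) :
    IntegrableOn (fun t : ℝ => betaKer a t * (t : ℂ) ^ w) (Ioo 0 1) := by
  have h := Complex.betaIntegral_convergent (u := (a + w - 1 : ℂ)) (v := (1 - a : ℂ))
    (by simp; linarith) (by simp; linarith)
  rw [intervalIntegrable_iff_integrableOn_Ioo_of_le zero_le_one] at h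
  exact h.congr_fun (fun t ht => (betaKer_mul_cpow a w ht).symm) measurableSet_Ioo

theorem integral_betaKer_mul_cpow (a : ℝ) (w : ℂ) :
    ∫ t in Ioo (0 : ℝ) 1, betaKer a t * (t : ℂ) ^ w = Complex.betaIntegral (a + w - 1) (1 - a) := by
  rw [Complex.betaIntegral, intervalIntegral.integral_of_le zero_le_one, integral_Ioc_eq_integral_Ioo]
  exact setIntegral_congr_fun measurableSet_Ioo fun t ht => betaKer_mul_cpow a w ht

theorem ofReal_cpow_eq_exp_log {t : ℝ} (ht : 0 < t) (w : ℂ) :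
    (t : ℂ) ^ w = Complex.exp (Real.log t * w) := by
  rw [Complex.cpow_def_of_ne_zero (by exact_mod_cast ht.ne'), Complex.ofReal_log ht.le]

/-- Convolution evaluates `f` at z/t with 0 < t < 1, where |e^{-z/l}| is no larger than at z. Only
the power |z|^{-b} changes, by the factor t^b, so convolution preserves the exact exponential rate.
-/
theorem ExpClass.norm_le {b l : ℝ} (hl : 0 < l) {f : ℂ → ℂ} {C : ℝ}
    (hC : ∀ ζ ∈ rightStrip,
      ‖f ζ‖ ≤ C * (Real.exp (-(b * ζ.re)) * Real.exp (-((Complex.exp ζ).re / l))))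
    {ζ : ℂ} (hζ : ζ ∈ rightStrip) {a t : ℝ} (ht : t ∈ Ioo (0 : ℝ) 1) :
    ‖betaKer a t * f (ζ - Real.log t)‖ ≤
      (|C| * (Real.exp (-(b * ζ.re)) * Real.exp (-((Complex.exp ζ).re / l)))) *
        ‖betaKer a t * (t : ℂ) ^ (b : ℂ)‖ := by
  have h := hC _ (sub_ofReal_mem_rightStrip hζ (Real.log t))
  have h2 : Real.exp (-(b * (ζ - Real.log t).re)) = Real.exp (-(b * ζ.re)) * ‖(t : ℂ) ^ (b : ℂ)‖ := by
    rw [ofReal_cpow_eq_exp_log ht.1, Complex.norm_exp, ← Real.exp_add]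
    congr 1
    simp; ring
  have h3 : (Complex.exp ζ).re ≤ (Complex.exp (ζ - Real.log t)).re := by
    rw [Complex.exp_sub, ← Complex.ofReal_exp, Real.exp_log ht.1, Complex.div_ofReal_re,
      le_div_iff₀ ht.1]
    nlinarith [exp_re_pos hζ, ht.2]
  rw [norm_mul, norm_mul]
  calc _ ≤ ‖betaKer a t‖ * (|C| * (Real.exp (-(b * (ζ - Real.log t).re)) *
        Real.exp (-((Complex.exp ζ).re / l)))) := by
        gcongr
        refine h.trans ?_
        gcongr
        exact le_abs_self C
    _ = _ := by rw [h2]; ring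

theorem continuousOn_comp_sub_log {f : ℂ → ℂ} (hf : ContinuousOn f rightStrip) {ζ : ℂ}
    (hζ : ζ ∈ rightStrip) : ContinuousOn (fun t : ℝ => f (ζ - Real.log t)) (Ioo 0 1) := by
  refine hf.comp (continuousOn_const.sub ?_) fun t _ => sub_ofReal_mem_rightStrip hζ _
  exact Complex.continuous_ofReal.comp_continuousOn
    (Real.continuousOn_log.mono fun t ht => ht.1.ne')

/-- Holomorphic functions on the right half plane, rapidly decaying in closed subsectors, of size
at most `|z|^(-b)` near the origin. -/
def RapidStrip (b : ℝ) (f : ℂ → ℂ) : Prop :=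
  DifferentiableOn ℂ f rightStrip ∧ ∀ δ < Real.pi / 2, Rapid f b (-δ) δ

theorem ExpClass.rapidStrip {b l : ℝ} (hl : 0 < l) {f : ℂ → ℂ} (hf : ExpClass b l f) :
    RapidStrip b f := by
  obtain ⟨hd, C, hC⟩ := hf
  refine ⟨hd, fun δ hδ => ?_⟩
  rcases lt_or_ge δ 0 with h0 | h0
  · exact ⟨0, 1, one_pos, fun ζ hζ => absurd (hζ.1.trans hζ.2) (by linarith)⟩
  have hcos : 0 < Real.cos δ := Real.cos_pos_of_mem_Ioo ⟨by linarith, hδ⟩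
  refine ⟨|C|, Real.cos δ / l, div_pos hcos hl, fun ζ hζ => ?_⟩
  have him : |ζ.im| ≤ δ := abs_le.2 hζ
  refine (hC ζ (him.trans_lt hδ)).trans ?_
  gcongr ?_ * (_ * Real.exp ?_)
  · exact le_abs_self C
  · rw [neg_le_neg_iff, Complex.exp_re, div_mul_eq_mul_div, mul_comm]
    have : Real.cos δ ≤ Real.cos ζ.im := by
      rw [← Real.cos_abs ζ.im]
      exact Real.cos_le_cos_of_nonneg_of_le_pi (abs_nonneg _) (by linarith [Real.pi_pos]) him
    gcongr

/-- A bound locally uniform in ζ with the t-dependence isolated as t^b, to be used as the dominating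
function for differentiation under the convolution integral. -/
theorem RapidStrip.exists_ball {b : ℝ} {f : ℂ → ℂ} (hf : RapidStrip b f) {ζ₀ : ℂ}
    (hζ₀ : ζ₀ ∈ rightStrip) : ∃ r > 0, ∃ B : ℝ, ∀ ζ ∈ ball ζ₀ r, ζ ∈ rightStrip ∧
      ∀ t ∈ Ioo (0 : ℝ) 1, ‖f (ζ - Real.log t)‖ ≤ B * ‖(t : ℂ) ^ (b : ℂ)‖ := by
  have hζ₀' : |ζ₀.im| < Real.pi / 2 := hζ₀
  set r := (Real.pi / 2 - |ζ₀.im|) / 2 with hr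
  have hr0 : 0 < r := by rw [hr]; linarith
  obtain ⟨C, c, hc, hC⟩ := hf.2 (|ζ₀.im| + r) (by rw [hr]; linarith)
  refine ⟨r, hr0, |C| * Real.exp (|b| * (|ζ₀.re| + r)), fun ζ hζ => ?_⟩
  rw [mem_ball, dist_eq_norm] at hζ
  have h1 := (Complex.abs_re_le_norm _).trans hζ.le
  have h2 := (Complex.abs_im_le_norm _).trans hζ.le
  rw [Complex.sub_re] at h1
  rw [Complex.sub_im] at h2
  have h3 : |ζ.im| ≤ |ζ₀.im| + r := by
    have := abs_add_le ζ₀.im (ζ.im - ζ₀.im); rw [add_sub_cancel] at this; linarith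
  have h4 : |ζ.re| ≤ |ζ₀.re| + r := by
    have := abs_add_le ζ₀.re (ζ.re - ζ₀.re); rw [add_sub_cancel] at this; linarith
  refine ⟨show |ζ.im| < _ by rw [hr] at h3; linarith, fun t ht => ?_⟩
  refine (hC _ (by simpa using abs_le.1 h3)).trans ?_
  rw [ofReal_cpow_eq_exp_log ht.1, Complex.norm_exp, mul_assoc,
    ← Real.exp_add (|b| * (|ζ₀.re| + r))]
  have e : Real.exp (-(b * (ζ - Real.log t).re)) ≤
      Real.exp (|b| * (|ζ₀.re| + r) + (Real.log t * (b : ℂ)).re) := by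
    gcongr
    have h5 : -(b * ζ.re) ≤ |b| * (|ζ₀.re| + r) := by
      calc -(b * ζ.re) ≤ |b * ζ.re| := neg_le_abs _
        _ ≤ _ := by rw [abs_mul]; gcongr
    simp only [Complex.sub_re, Complex.ofReal_re, Complex.re_ofReal_mul]
    linarith
  have e2 : Real.exp (-(c * Real.exp (ζ - Real.log t).re)) ≤ 1 := by
    rw [Real.exp_le_one_iff, neg_nonpos]; positivity
  calc _ ≤ |C| * (Real.exp (-(b * (ζ - Real.log t).re)) * 1) := by
        gcongr; exact le_abs_self C
    _ ≤ _ := by rw [mul_one]; gcongr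

theorem norm_betaKer_mul_le {a b B t : ℝ} {w : ℂ} (h : ‖w‖ ≤ B * ‖(t : ℂ) ^ (b : ℂ)‖) :
    ‖betaKer a t * w‖ ≤ B * ‖betaKer a t * (t : ℂ) ^ (b : ℂ)‖ := by
  rw [norm_mul, norm_mul, mul_left_comm]
  exact mul_le_mul_of_nonneg_left h (norm_nonneg _)

theorem RapidStrip.hasDerivAt_betaConv {a b : ℝ} {f : ℂ → ℂ} (hf : RapidStrip b f) (ha : a < 1)
    (hab : 1 < a + b) {ζ₀ : ℂ} (hζ₀ : ζ₀ ∈ rightStrip) :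
    HasDerivAt (betaConv a f) (betaConv a (deriv f) ζ₀) ζ₀ := by
  have hi : IntegrableOn (fun t : ℝ => ‖betaKer a t * (t : ℂ) ^ (b : ℂ)‖) (Ioo 0 1) :=
    (integrableOn_betaKer_mul_cpow ha (by simpa using hab)).norm
  obtain ⟨r, hr, B, hB⟩ := hf.exists_ball hζ₀
  have hd := hf.1
  have hdt : ∀ t : ℝ, DifferentiableOn ℂ (fun ζ => f (ζ - Real.log t)) (ball ζ₀ r) := fun t =>
    hd.comp (differentiableOn_id.sub_const _) fun z hz => sub_ofReal_mem_rightStrip (hB z hz).1 _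
  have h := hasDerivAt_integral_of_holomorphic (μ := volume.restrict (Ioo (0 : ℝ) 1)) hr
    (F := fun ζ t => betaKer a t * f (ζ - Real.log t))
    (bound := fun t => B * ‖betaKer a t * (t : ℂ) ^ (b : ℂ)‖)
    (fun z hz => ((continuousOn_betaKer a).mul
      (continuousOn_comp_sub_log hd.continuousOn (hB z hz).1)).aestronglyMeasurable
        measurableSet_Ioo) ?_ ?_ (hi.const_mul B)
  · refine h.congr_deriv ?_
    rw [CYStokes.betaConv]
    refine setIntegral_congr_fun measurableSet_Ioo fun t _ => ?_
    rw [deriv_const_mul _ ((hdt t).differentiableAt (isOpen_ball.mem_nhds (mem_ball_self hr))), deriv_comp_sub_const]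
  · exact Eventually.of_forall fun t => (hdt t).const_mul _
  · filter_upwards [ae_restrict_mem measurableSet_Ioo] with t ht z hz
    exact norm_betaKer_mul_le ((hB z hz).2 t ht)

theorem RapidStrip.integrableOn {a b : ℝ} {f : ℂ → ℂ} (hf : RapidStrip b f) (ha : a < 1)
    (hab : 1 < a + b) {ζ : ℂ} (hζ : ζ ∈ rightStrip) :
    IntegrableOn (fun t : ℝ => betaKer a t * f (ζ - Real.log t)) (Ioo 0 1) := by
  obtain ⟨r, hr, B, hB⟩ := hf.exists_ball hζ
  refine ((integrableOn_betaKer_mul_cpow ha (w := b) (by simpa using hab)).norm.const_mul B).mono'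
    (((continuousOn_betaKer a).mul
      (continuousOn_comp_sub_log hf.1.continuousOn hζ)).aestronglyMeasurable measurableSet_Ioo) ?_
  filter_upwards [ae_restrict_mem measurableSet_Ioo] with t ht
  exact norm_betaKer_mul_le ((hB ζ (mem_ball_self hr)).2 t ht)

theorem ExpClass.betaConv {b l a : ℝ} (hl : 0 < l) {f : ℂ → ℂ} (hf : ExpClass b l f) (ha : a < 1)
    (hab : 1 < a + b) : ExpClass b l (betaConv a f) := by
  obtain ⟨C, hC⟩ := hf.2
  have hi : IntegrableOn (fun t : ℝ => ‖betaKer a t * (t : ℂ) ^ (b : ℂ)‖) (Ioo 0 1) :=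
    (integrableOn_betaKer_mul_cpow ha (by simpa using hab)).norm
  refine ⟨fun ζ₀ hζ₀ => ((hf.rapidStrip hl).hasDerivAt_betaConv ha hab
    hζ₀).differentiableAt.differentiableWithinAt,
    |C| * ∫ t in Ioo (0 : ℝ) 1, ‖betaKer a t * (t : ℂ) ^ (b : ℂ)‖, fun ζ hζ => ?_⟩
  refine (norm_integral_le_of_norm_le (hi.const_mul
    (|C| * (Real.exp (-(b * ζ.re)) * Real.exp (-((Complex.exp ζ).re / l))))) ?_).trans ?_
  · filter_upwards [ae_restrict_mem measurableSet_Ioo] with t ht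
    exact ExpClass.norm_le hl hC hζ ht
  · rw [integral_const_mul]
    exact le_of_eq (by ring)

theorem RapidStrip.betaConv {b a : ℝ} {f : ℂ → ℂ} (hf : RapidStrip b f) (ha : a < 1)
    (hab : 1 < a + b) : RapidStrip b (betaConv a f) := by
  refine ⟨fun ζ₀ hζ₀ => (hf.hasDerivAt_betaConv ha hab
    hζ₀).differentiableAt.differentiableWithinAt, fun δ hδ => ?_⟩
  obtain ⟨C, c, hc, hC⟩ := hf.2 δ hδ
  have hi : IntegrableOn (fun t : ℝ => ‖betaKer a t * (t : ℂ) ^ (b : ℂ)‖) (Ioo 0 1) :=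
    (integrableOn_betaKer_mul_cpow ha (by simpa using hab)).norm
  refine ⟨|C| * ∫ t in Ioo (0 : ℝ) 1, ‖betaKer a t * (t : ℂ) ^ (b : ℂ)‖, c, hc, fun ζ hζ => ?_⟩
  refine (norm_integral_le_of_norm_le (hi.const_mul
    (|C| * (Real.exp (-(b * ζ.re)) * Real.exp (-(c * Real.exp ζ.re))))) ?_).trans ?_
  · filter_upwards [ae_restrict_mem measurableSet_Ioo] with t ht
    refine norm_betaKer_mul_le ((hC _ (by simpa using hζ)).trans ?_)
    have h2 : Real.exp (-(b * (ζ - Real.log t).re)) =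
        Real.exp (-(b * ζ.re)) * ‖(t : ℂ) ^ (b : ℂ)‖ := by
      rw [ofReal_cpow_eq_exp_log ht.1, Complex.norm_exp, ← Real.exp_add]
      congr 1
      simp; ring
    have h3 : ζ.re ≤ (ζ - Real.log t).re := by
      have := Real.log_nonpos ht.1.le ht.2.le
      simpa using this
    rw [h2]
    calc _ ≤ |C| * (Real.exp (-(b * ζ.re)) * ‖(t : ℂ) ^ (b : ℂ)‖ *
          Real.exp (-(c * Real.exp ζ.re))) := by
          gcongr; exact le_abs_self C
      _ = _ := by ring
  · rw [integral_const_mul]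
    exact le_of_eq (by ring)

/-! ### Moments of Beta convolutions and the normalized decaying solution -/

/-- The moments of a function on the positive half line, in the logarithmic coordinate. -/
def moment (f : ℂ → ℂ) (s : ℂ) : ℂ := ∫ τ : ℝ, f τ * Complex.exp ((s + 1) * τ)

theorem integrable_exp_mul_exp_neg_exp {s c : ℝ} (hs : 0 < s) (hc : 0 < c) :
    Integrable fun x : ℝ => Real.exp (s * x) * Real.exp (-(c * Real.exp x)) := by
  obtain ⟨A, m, hm, hA⟩ := exists_exp_mul_exp_neg_exp_le hs hc 0
  refine ((integrable_exp_neg_mul_abs hm).const_mul A).mono' ?_ (Eventually.of_forall fun x => ?_)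
  · exact Continuous.aestronglyMeasurable (by fun_prop)
  · have := hA x
    rw [pow_zero, mul_one] at this
    rwa [Real.norm_of_nonneg (by positivity)]

/-- Fubini: translating τ by log t pulls out t^{s+1}, and the remaining integral over t is a Beta
integral. -/
theorem moment_betaConv {b l a : ℝ} (hl : 0 < l) {f : ℂ → ℂ} (hf : ExpClass b l f) (ha : a < 1)
    (hab : 1 < a + b) {s : ℂ} (hs : b < s.re + 1) :
    moment (betaConv a f) s = Complex.betaIntegral (s + a) (1 - a) * moment f s := by
  obtain ⟨hd, C, hC⟩ := hf
  have hi : IntegrableOn (fun t : ℝ => ‖betaKer a t * (t : ℂ) ^ (b : ℂ)‖) (Ioo 0 1) :=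
    (integrableOn_betaKer_mul_cpow ha (by simpa using hab)).norm
  have hi2 := (integrable_exp_mul_exp_neg_exp (sub_pos.2 hs) (inv_pos.2 hl)).const_mul |C|
  have hmeas : AEStronglyMeasurable (Function.uncurry fun (τ t : ℝ) =>
      betaKer a t * f ((τ : ℂ) - Real.log t) * Complex.exp ((s + 1) * τ))
      ((volume : Measure ℝ).prod (volume.restrict (Ioo (0 : ℝ) 1))) := by
    have e : (volume : Measure ℝ).prod (volume.restrict (Ioo (0 : ℝ) 1)) =
        (volume.prod volume).restrict (univ ×ˢ Ioo (0 : ℝ) 1) := by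
      rw [← Measure.prod_restrict, Measure.restrict_univ]
    rw [e]
    refine ContinuousOn.aestronglyMeasurable ?_ (MeasurableSet.univ.prod measurableSet_Ioo)
    refine ContinuousOn.mul (ContinuousOn.mul ?_ ?_) (Continuous.continuousOn (by fun_prop))
    · exact (continuousOn_betaKer a).comp continuousOn_snd fun p hp => hp.2
    · refine hd.continuousOn.comp (t := rightStrip) ?_
        fun p _ => sub_ofReal_mem_rightStrip (ofReal_mem_rightStrip _) _
      refine ContinuousOn.sub (Continuous.continuousOn (by fun_prop)) ?_
      exact Complex.continuous_ofReal.comp_continuousOn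
        (Real.continuousOn_log.comp continuousOn_snd fun p hp => hp.2.1.ne')
  have hint : Integrable (Function.uncurry fun (τ t : ℝ) =>
      betaKer a t * f ((τ : ℂ) - Real.log t) * Complex.exp ((s + 1) * τ))
      ((volume : Measure ℝ).prod (volume.restrict (Ioo (0 : ℝ) 1))) := by
    refine (hi2.mul_prod hi).mono' hmeas ?_
    have hae : ∀ᵐ p ∂((volume : Measure ℝ).prod (volume.restrict (Ioo (0 : ℝ) 1))),
        p.2 ∈ Ioo (0 : ℝ) 1 :=
      Measure.quasiMeasurePreserving_snd.ae (ae_restrict_mem measurableSet_Ioo)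
    filter_upwards [hae] with p hp
    have h := ExpClass.norm_le hl hC (ofReal_mem_rightStrip p.1) (a := a) hp
    simp only [Function.uncurry]
    rw [norm_mul]
    calc _ ≤ _ := mul_le_mul_of_nonneg_right h (norm_nonneg _)
      _ = _ := by
        rw [Complex.norm_exp, Complex.ofReal_re, ← Complex.ofReal_exp, Complex.ofReal_re]
        have e1 : Real.exp ((s.re + 1 - b) * p.1) =
            Real.exp (-(b * p.1)) * Real.exp ((s + 1) * (p.1 : ℂ)).re := by
          rw [← Real.exp_add]; congr 1
          simp; ring
        rw [e1, div_eq_inv_mul]; ring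
  simp only [moment, betaConv]
  simp_rw [← integral_mul_const]
  rw [integral_integral_swap hint]
  have inner : ∀ t ∈ Ioo (0 : ℝ) 1, ∫ τ : ℝ, betaKer a t * f ((τ : ℂ) - Real.log t) *
      Complex.exp ((s + 1) * τ) = betaKer a t * (t : ℂ) ^ (s + 1) * moment f s := by
    intro t ht
    rw [← integral_sub_right_eq_self _ (-Real.log t), moment, ← integral_const_mul]
    refine integral_congr_ae (Eventually.of_forall fun τ => ?_)
    simp only
    rw [ofReal_cpow_eq_exp_log ht.1]
    push_cast
    rw [show ((τ : ℂ) - -(Real.log t : ℂ)) - (Real.log t : ℂ) = τ by ring,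
      show (s + 1) * ((τ : ℂ) - -(Real.log t : ℂ)) = (s + 1) * τ + Real.log t * (s + 1) by ring,
      Complex.exp_add]
    ring
  rw [setIntegral_congr_fun measurableSet_Ioo inner, integral_mul_const, integral_betaKer_mul_cpow]
  congr 2; ring

theorem expClass_exp_neg_exp {b l : ℝ} :
    ExpClass b l fun ζ => Complex.exp (-(b * ζ)) * Complex.exp (-(Complex.exp ζ / l)) := by
  refine ⟨by fun_prop, 1, fun ζ _ => le_of_eq ?_⟩
  rw [norm_mul, Complex.norm_exp, Complex.norm_exp, one_mul, Complex.neg_re, Complex.neg_re,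
    Complex.div_ofReal_re, Complex.re_ofReal_mul]

/-- Euler's integral for Γ under the substitution t = e^τ. -/
theorem moment_exp_neg_exp {b l : ℝ} (hl : 0 < l) {s : ℂ} (hs : b < s.re + 1) :
    moment (fun ζ => Complex.exp (-(b * ζ)) * Complex.exp (-(Complex.exp ζ / l))) s =
      Complex.exp ((s + 1 - b) * Real.log l) * Complex.Gamma (s + 1 - b) := by
  have h := Complex.integral_cpow_mul_exp_neg_mul_Ioi (a := s + 1 - b) (r := l⁻¹)
    (by simp; linarith) (inv_pos.2 hl)
  have hexp : ((1 / (l⁻¹ : ℝ) : ℂ)) ^ (s + 1 - b) = Complex.exp ((s + 1 - b) * Real.log l) := by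
    rw [Complex.ofReal_inv, one_div, inv_inv, ofReal_cpow_eq_exp_log hl, mul_comm]
  rw [hexp] at h
  rw [← h, ← Real.range_exp, ← image_univ,
    integral_image_eq_integral_abs_deriv_smul MeasurableSet.univ
      (fun x _ => (Real.hasDerivAt_exp x).hasDerivWithinAt) Real.exp_injective.injOn,
    Measure.restrict_univ, moment]
  refine integral_congr_ae (Eventually.of_forall fun τ => ?_)
  simp only
  rw [abs_of_pos (Real.exp_pos τ), ofReal_cpow_eq_exp_log (Real.exp_pos τ), Real.log_exp,
    Complex.real_smul, Complex.ofReal_inv, Complex.ofReal_exp]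
  simp only [← Complex.exp_add]
  congr 1
  ring

theorem moment_const_mul (k : ℂ) (f : ℂ → ℂ) (s : ℂ) :
    moment (fun ζ => k * f ζ) s = k * moment f s := by
  simp only [moment, mul_assoc]
  rw [integral_const_mul]

theorem ExpClass.const_mul {b l : ℝ} {f : ℂ → ℂ} (hf : ExpClass b l f) (k : ℂ) :
    ExpClass b l fun ζ => k * f ζ := by
  obtain ⟨hd, C, hC⟩ := hf
  refine ⟨hd.const_mul k, ‖k‖ * C, fun ζ hζ => ?_⟩
  rw [norm_mul, mul_assoc]
  exact mul_le_mul_of_nonneg_left (hC ζ hζ) (norm_nonneg k)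

/-- The exponent `1 - root 0`. -/
def Family.gap (X : Family) : ℝ := 1 - X.root 0

/-- The unnormalized decaying solution. -/
def Family.preV (X : Family) : ℂ → ℂ :=
  betaConv (X.root 3) (betaConv (X.root 2) (betaConv (X.root 1)
    fun ζ => Complex.exp (-(X.gap * ζ)) * Complex.exp (-(Complex.exp ζ / X.lamR))))

/-- The decaying solution, normalized so that its moments are the values of `gGamma`. -/
def Family.V (X : Family) (ζ : ℂ) : ℂ :=
  X.gConst * Complex.exp (-(X.root 0 * Real.log X.lamR)) * (Complex.Gamma (1 - X.root 1) *
    Complex.Gamma (1 - X.root 2) * Complex.Gamma (1 - X.root 3))⁻¹ * X.preV ζ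

theorem Family.one_lt_root_add_gap (X : Family) {j : Fin 4} (hj : 0 < j) :
    1 < X.root j + X.gap := by
  have := X.root_strictMono hj
  rw [Family.gap]; linarith

theorem Family.expClass_V (X : Family) : ExpClass X.gap X.lamR X.V :=
  ((((expClass_exp_neg_exp.betaConv X.lamR_pos (X.root_lt_one 1)
    (X.one_lt_root_add_gap (by decide))).betaConv X.lamR_pos (X.root_lt_one 2)
    (X.one_lt_root_add_gap (by decide))).betaConv X.lamR_pos (X.root_lt_one 3)
    (X.one_lt_root_add_gap (by decide)))).const_mul _

/-- The starting function contributes λ^{s+a₀} Γ(s+a₀), and each convolution with j = 1, 2, 3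
contributes Γ(s+a_j) Γ(1-a_j)/Γ(1+s). This is `Family.gGamma_eq` up to constants absorbed in the
normalization of `V`. -/
theorem Family.moment_V (X : Family) {s : ℂ} (hs : -X.root 0 < s.re) :
    moment X.V s = X.gGamma s := by
  have hs' : X.gap < s.re + 1 := by rw [Family.gap]; linarith
  have c0 := expClass_exp_neg_exp (b := X.gap) (l := X.lamR)
  have c1 := c0.betaConv X.lamR_pos (X.root_lt_one 1) (X.one_lt_root_add_gap (by decide))
  have c2 := c1.betaConv X.lamR_pos (X.root_lt_one 2) (X.one_lt_root_add_gap (by decide))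
  have hs1 : Complex.Gamma (1 + s) ≠ 0 := Complex.Gamma_ne_zero_of_re_pos (by
    rw [Complex.add_re, Complex.one_re]; linarith [X.root_lt_one 0])
  have hbeta : ∀ j, Complex.betaIntegral (s + X.root j) (1 - X.root j) =
      Complex.Gamma (s + X.root j) * Complex.Gamma (1 - X.root j) / Complex.Gamma (1 + s) := by
    intro j
    have := X.root_strictMono.monotone (Fin.zero_le j)
    rw [Complex.betaIntegral_eq_Gamma_mul_div _ _ (by simp; linarith)
      (by simpa using X.root_lt_one j)]
    congr 2; ring
  have hr : ∀ j, Complex.Gamma (1 - X.root j) ≠ 0 := fun j =>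
    Complex.Gamma_ne_zero_of_re_pos (by simpa using X.root_lt_one j)
  rw [X.gGamma_eq hs]
  rw [show X.V = fun ζ => X.gConst * Complex.exp (-(X.root 0 * Real.log X.lamR)) *
    (Complex.Gamma (1 - X.root 1) * Complex.Gamma (1 - X.root 2) *
      Complex.Gamma (1 - X.root 3))⁻¹ * X.preV ζ from rfl, moment_const_mul, Family.preV, moment_betaConv X.lamR_pos c2 (X.root_lt_one 3)
      (X.one_lt_root_add_gap (by decide)) hs', moment_betaConv X.lamR_pos c1 (X.root_lt_one 2)
      (X.one_lt_root_add_gap (by decide)) hs', moment_betaConv X.lamR_pos c0 (X.root_lt_one 1)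
      (X.one_lt_root_add_gap (by decide)) hs', moment_exp_neg_exp X.lamR_pos hs', hbeta, hbeta,
    hbeta, Fin.prod_univ_four]
  have e1 : s + 1 - (X.gap : ℂ) = s + X.root 0 := by
    rw [Family.gap]; push_cast; ring
  have e2 : Complex.exp ((s + X.root 0) * Real.log X.lamR) =
      Complex.exp (s * Real.log X.lamR) * Complex.exp (X.root 0 * Real.log X.lamR) := by
    rw [← Complex.exp_add]; congr 1; ring
  rw [e1, e2, Complex.exp_neg]
  have h1 := hr 1
  have h2 := hr 2
  have h3 := hr 3
  have h4 := Complex.exp_ne_zero (X.root 0 * Real.log X.lamR)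
  generalize Complex.Gamma (1 - X.root 1) = g1 at *
  generalize Complex.Gamma (1 - X.root 2) = g2 at *
  generalize Complex.Gamma (1 - X.root 3) = g3 at *
  generalize Complex.Gamma (s + X.root 0) = k0 at *
  generalize Complex.Gamma (s + X.root 1) = k1 at *
  generalize Complex.Gamma (s + X.root 2) = k2 at *
  generalize Complex.Gamma (s + X.root 3) = k3 at *
  field_simp

/-! ### The decaying solution satisfies the differential equation -/

/-- Cauchy's estimate on discs of radius ε/2. Moving by ε/2 costs a constant in the power and
shrinks the rate c to c e^{-ε/2}. -/
theorem Rapid.deriv {U : ℂ → ℂ} {b y₁ y₂ ε : ℝ} (h : Rapid U b y₁ y₂)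
    (hU : DifferentiableOn ℂ U (Complex.im ⁻¹' Ioo y₁ y₂)) (hε : 0 < ε) :
    Rapid (deriv U) b (y₁ + ε) (y₂ - ε) := by
  obtain ⟨C, c, hc, h⟩ := h
  refine ⟨|C| * Real.exp (|b| * (ε / 2)) / (ε / 2), c * Real.exp (-(ε / 2)), by positivity,
    fun ζ hζ => ?_⟩
  have hmem : ∀ z ∈ closedBall ζ (ε / 2), |z.re - ζ.re| ≤ ε / 2 ∧ z.im ∈ Ioo y₁ y₂ := by
    intro z hz
    rw [mem_closedBall, dist_eq_norm] at hz
    have h1 := (Complex.abs_re_le_norm _).trans hz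
    have h2 := abs_le.1 ((Complex.abs_im_le_norm _).trans hz)
    rw [Complex.sub_re] at h1
    rw [Complex.sub_im] at h2
    exact ⟨h1, by linarith [hζ.1], by linarith [hζ.2]⟩
  have hopen : IsOpen (Complex.im ⁻¹' Ioo y₁ y₂) := isOpen_Ioo.preimage Complex.continuous_im
  refine (Complex.norm_deriv_le_of_forall_mem_sphere_norm_le (half_pos hε)
    (C := |C| * (Real.exp (|b| * (ε / 2)) * Real.exp (-(b * ζ.re)) *
      Real.exp (-(c * Real.exp (-(ε / 2)) * Real.exp ζ.re)))) ?_ ?_).trans (le_of_eq (by ring))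
  · refine DifferentiableOn.diffContOnCl fun z hz => ?_
    rw [closure_ball _ (half_pos hε).ne'] at hz
    exact (hU.differentiableAt (hopen.mem_nhds (hmem z hz).2)).differentiableWithinAt
  · intro z hz
    obtain ⟨h1, h2⟩ := hmem z (sphere_subset_closedBall hz)
    refine (h z (Ioo_subset_Icc_self h2)).trans ?_
    rw [← Real.exp_add, mul_assoc c, ← Real.exp_add (-(ε / 2)), ← Real.exp_add, ← Real.exp_add]
    have h3 : -(b * z.re) ≤ |b| * (ε / 2) + -(b * ζ.re) := by
      have : -(b * (z.re - ζ.re)) ≤ |b| * (ε / 2) := by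
        refine (neg_le_abs _).trans ?_
        rw [abs_mul]; gcongr
      linarith
    have h4 : -(ε / 2) + ζ.re ≤ z.re := by linarith [(abs_le.1 h1).1]
    gcongr
    exact le_abs_self C

theorem RapidStrip.deriv {b : ℝ} {f : ℂ → ℂ} (hf : RapidStrip b f) : RapidStrip b (deriv f) := by
  refine ⟨hf.1.deriv isOpen_rightStrip, fun δ hδ => ?_⟩
  have h := hf.2 ((δ + Real.pi / 2) / 2) (by linarith)
  refine (h.deriv (ε := (Real.pi / 2 - δ) / 2) (hf.1.mono fun z hz => ?_) (by linarith)).mono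
    (by linarith) (by linarith)
  have hz : z.im ∈ Ioo _ _ := hz
  change |z.im| < Real.pi / 2
  exact abs_lt.2 ⟨by linarith [hz.1], by linarith [hz.2]⟩

theorem Rapid.const_mul {U : ℂ → ℂ} {b y₁ y₂ : ℝ} (h : Rapid U b y₁ y₂) (k : ℂ) :
    Rapid (fun ζ => k * U ζ) b y₁ y₂ := by
  obtain ⟨C, c, hc, h⟩ := h
  refine ⟨‖k‖ * C, c, hc, fun ζ hζ => ?_⟩
  rw [norm_mul, mul_assoc]
  exact mul_le_mul_of_nonneg_left (h ζ hζ) (norm_nonneg k)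

theorem Rapid.add {U W : ℂ → ℂ} {b y₁ y₂ : ℝ} (h : Rapid U b y₁ y₂) (h' : Rapid W b y₁ y₂) :
    Rapid (fun ζ => U ζ + W ζ) b y₁ y₂ := by
  obtain ⟨C, c, hc, h⟩ := h
  obtain ⟨C', c', hc', h'⟩ := h'
  refine ⟨|C| + |C'|, min c c', lt_min hc hc', fun ζ hζ => (norm_add_le _ _).trans ?_⟩
  rw [add_mul]
  refine add_le_add ((h ζ hζ).trans ?_) ((h' ζ hζ).trans ?_)
  · gcongr
    · exact le_abs_self C
    · exact min_le_left _ _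
  · gcongr
    · exact le_abs_self C'
    · exact min_le_right _ _

theorem Rapid.exp_mul {U : ℂ → ℂ} {b y₁ y₂ : ℝ} (h : Rapid U b y₁ y₂) :
    Rapid (fun ζ => Complex.exp ζ * U ζ) b y₁ y₂ := by
  obtain ⟨C, c, hc, h⟩ := h
  refine ⟨2 / c * |C|, c / 2, half_pos hc, fun ζ hζ => ?_⟩
  rw [norm_mul, Complex.norm_exp]
  have h1 : Real.exp ζ.re ≤ 2 / c * Real.exp (c / 2 * Real.exp ζ.re) := by
    have := Real.add_one_le_exp (c / 2 * Real.exp ζ.re)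
    rw [div_mul_eq_mul_div, le_div_iff₀ hc]
    linarith
  calc _ ≤ (2 / c * Real.exp (c / 2 * Real.exp ζ.re)) *
        (|C| * (Real.exp (-(b * ζ.re)) * Real.exp (-(c * Real.exp ζ.re)))) := by
        gcongr
        refine (h ζ hζ).trans ?_
        gcongr
        exact le_abs_self C
    _ = 2 / c * |C| * (Real.exp (-(b * ζ.re)) *
        (Real.exp (c / 2 * Real.exp ζ.re) * Real.exp (-(c * Real.exp ζ.re)))) := by ring
    _ = _ := by rw [← Real.exp_add]; congr 4; ring

theorem RapidStrip.lin {b : ℝ} {f : ℂ → ℂ} (hf : RapidStrip b f) (k : ℂ) :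
    RapidStrip b (lin k f) :=
  ⟨differentiableOn_lin isOpen_rightStrip hf.1 k,
    fun δ hδ => (hf.deriv.2 δ hδ).add ((hf.2 δ hδ).const_mul k)⟩

theorem RapidStrip.exp_mul {b : ℝ} {f : ℂ → ℂ} (hf : RapidStrip b f) :
    RapidStrip b fun ζ => Complex.exp ζ * f ζ :=
  ⟨Complex.differentiable_exp.differentiableOn.mul hf.1, fun δ hδ => (hf.2 δ hδ).exp_mul⟩

theorem RapidStrip.lin_betaConv {a b : ℝ} {f : ℂ → ℂ} (hf : RapidStrip b f) (ha : a < 1)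
    (hab : 1 < a + b) (k : ℂ) :
    EqOn (CYStokes.lin k (CYStokes.betaConv a f)) (CYStokes.betaConv a (CYStokes.lin k f))
      rightStrip := by
  intro ζ hζ
  rw [CYStokes.lin, (hf.hasDerivAt_betaConv ha hab hζ).deriv, CYStokes.betaConv,
    CYStokes.betaConv, CYStokes.betaConv, ← integral_const_mul,
    ← integral_add (hf.deriv.integrableOn ha hab hζ) ((hf.integrableOn ha hab hζ).const_mul k)]
  refine setIntegral_congr_fun measurableSet_Ioo fun t _ => ?_
  simp only [CYStokes.lin]
  ring

theorem RapidStrip.tendsto_zero {a b : ℝ} {f : ℂ → ℂ} (hf : RapidStrip b f) {ζ : ℂ}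
    (hζ : ζ ∈ rightStrip) :
    Tendsto (fun t : ℝ => (t : ℂ) ^ (a : ℂ) * f (ζ - Real.log t)) (𝓝[>] 0) (𝓝 0) := by
  obtain ⟨C, c, hc, hC⟩ := hf.2 _ hζ
  obtain ⟨A, m, hm, hA⟩ := exists_exp_mul_exp_neg_exp_le (s := |b| + |a| + 1) (by positivity) hc 0
  have hy : Tendsto (fun t : ℝ => ζ.re - Real.log t) (𝓝[>] 0) atTop :=
    tendsto_const_nhds.add_atTop (tendsto_neg_atBot_atTop.comp Real.tendsto_log_nhdsGT_zero)
  have hlim : Tendsto (fun t : ℝ => |C| * Real.exp (|a| * |ζ.re|) *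
      (A * Real.exp (-(m * (ζ.re - Real.log t))))) (𝓝[>] 0) (𝓝 0) := by
    have := (Real.tendsto_exp_neg_atTop_nhds_zero.comp (hy.const_mul_atTop hm)).const_mul
      (|C| * Real.exp (|a| * |ζ.re|) * A)
    rw [mul_zero] at this
    exact this.congr fun t => by simp only [Function.comp]; ring
  refine squeeze_zero_norm' ?_ hlim
  filter_upwards [self_mem_nhdsWithin, hy.eventually_ge_atTop 0] with t ht ht2
  have ht0 : 0 < t := ht
  rw [norm_mul, ofReal_cpow_eq_exp_log ht0, Complex.norm_exp]
  have h1 := hC (ζ - Real.log t) (by simpa using abs_le.1 le_rfl)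
  have h2 := hA (ζ.re - Real.log t)
  rw [pow_zero, mul_one, abs_of_nonneg ht2] at h2
  simp only [Complex.sub_re, Complex.ofReal_re, Complex.re_ofReal_mul] at h1 ⊢
  set y := ζ.re - Real.log t with hy'
  have h3 : Real.log t * a ≤ |a| * |ζ.re| + |a| * y := by
    have e : Real.log t * a = a * ζ.re + -(a * y) := by rw [hy']; ring
    have e1 : a * ζ.re ≤ |a| * |ζ.re| := by rw [← abs_mul]; exact le_abs_self _
    have e2 : -(a * y) ≤ |a| * y := by
      calc -(a * y) ≤ |a * y| := neg_le_abs _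
        _ = _ := by rw [abs_mul, abs_of_nonneg ht2]
    linarith
  have h4 : -(b * y) ≤ |b| * y := by
    calc -(b * y) ≤ |b * y| := neg_le_abs _
      _ = _ := by rw [abs_mul, abs_of_nonneg ht2]
  calc _ ≤ Real.exp (|a| * |ζ.re| + |a| * y) *
        (|C| * (Real.exp (|b| * y) * Real.exp (-(c * Real.exp y)))) := by
        gcongr
        refine h1.trans ?_
        gcongr
        exact le_abs_self C
    _ = |C| * Real.exp (|a| * |ζ.re|) * (Real.exp ((|b| + |a|) * y) *
        Real.exp (-(c * Real.exp y))) := by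
        rw [add_mul, Real.exp_add, Real.exp_add]; ring
    _ ≤ |C| * Real.exp (|a| * |ζ.re|) * (Real.exp ((|b| + |a| + 1) * y) *
        Real.exp (-(c * Real.exp y))) := by
        gcongr ?_ * (?_ * _)
        exact Real.exp_le_exp.2 (mul_le_mul_of_nonneg_right (by linarith) ht2)
    _ ≤ _ := by gcongr

/-- The difference of the two sides is the integral over (0, 1) of the t-derivative of e^ζ t^{a-2}
(1-t)^{1-a} f(ζ - log t). This vanishes at t = 0 by the rapid decay of `f` and at t = 1 because a <
1. -/
theorem RapidStrip.exp_mul_lin_betaConv {a b : ℝ} {f : ℂ → ℂ} (hf : RapidStrip b f) (ha : a < 1)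
    (hab : 1 < a + b) {ζ : ℂ} (hζ : ζ ∈ rightStrip) :
    Complex.exp ζ * CYStokes.lin 1 (CYStokes.betaConv a f) ζ =
      CYStokes.lin (1 - a) (CYStokes.betaConv a fun τ => Complex.exp τ * f τ) ζ := by
  have hE := hf.exp_mul
  rw [hf.lin_betaConv ha hab 1 hζ, hE.lin_betaConv ha hab _ hζ]
  have h1 := ((hf.lin 1).integrableOn ha hab hζ).const_mul (Complex.exp ζ)
  have h2 := (hE.lin (1 - a)).integrableOn ha hab hζ
  rw [CYStokes.betaConv, CYStokes.betaConv, ← integral_const_mul, ← sub_eq_zero,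
    ← integral_sub h1 h2]
  have hder : ∀ t ∈ Ioo (0 : ℝ) 1, HasDerivAt
      (fun t : ℝ => Complex.exp ζ * ((t : ℂ) ^ ((a : ℂ) - 2) * (1 - (t : ℂ)) ^ (1 - (a : ℂ)) *
        f (ζ - Real.log t)))
      (Complex.exp ζ * (betaKer a t * CYStokes.lin 1 f (ζ - Real.log t)) -
        betaKer a t * CYStokes.lin (1 - a) (fun τ => Complex.exp τ * f τ) (ζ - Real.log t)) t := by
    intro t ht
    have ht0 : (t : ℂ) ≠ 0 := by exact_mod_cast ht.1.ne'
    have ht1 : (1 - t : ℂ) ≠ 0 := by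
      rw [← Complex.ofReal_one, ← Complex.ofReal_sub]; exact_mod_cast (sub_pos.2 ht.2).ne'
    have d1 : HasDerivAt (fun t : ℝ => (t : ℂ) ^ ((a : ℂ) - 2))
        (((a : ℂ) - 2) * (t : ℂ) ^ ((a : ℂ) - 2 - 1)) t := by
      have := (hasDerivAt_id (t : ℂ)).cpow_const (c := (a : ℂ) - 2)
        (Complex.ofReal_mem_slitPlane.2 ht.1)
      simpa using this.comp_ofReal
    have d2 : HasDerivAt (fun t : ℝ => (1 - (t : ℂ)) ^ (1 - (a : ℂ)))
        (-((1 - (a : ℂ)) * (1 - (t : ℂ)) ^ (1 - (a : ℂ) - 1))) t := by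
      have := ((hasDerivAt_id (t : ℂ)).const_sub 1).cpow_const (c := 1 - (a : ℂ)) (by
        simp only [id]
        rw [← Complex.ofReal_one, ← Complex.ofReal_sub]
        exact Complex.ofReal_mem_slitPlane.2 (by linarith [ht.2]))
      simpa using this.comp_ofReal
    have hw : ζ - Real.log t ∈ rightStrip := sub_ofReal_mem_rightStrip hζ _
    have hfd := (hf.1.differentiableAt (isOpen_rightStrip.mem_nhds hw)).hasDerivAt
    have d3 : HasDerivAt (fun t : ℝ => f (ζ - Real.log t))
        (_root_.deriv f (ζ - Real.log t) * -((t⁻¹ : ℝ) : ℂ)) t :=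
      hfd.comp_of_eq t ((Real.hasDerivAt_log ht.1.ne').ofReal_comp.const_sub ζ) rfl
    refine (((d1.mul d2).mul d3).const_mul (Complex.exp ζ)).congr_deriv ?_
    have d4 : _root_.deriv (fun τ => Complex.exp τ * f τ) (ζ - Real.log t) =
        Complex.exp (ζ - Real.log t) * f (ζ - Real.log t) +
          Complex.exp (ζ - Real.log t) * _root_.deriv f (ζ - Real.log t) :=
      ((Complex.hasDerivAt_exp _).mul hfd).deriv
    have e1 : (t : ℂ) ^ ((a : ℂ) - 2 - 1) = (t : ℂ) ^ ((a : ℂ) - 2) / t := by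
      rw [Complex.cpow_sub _ _ ht0, Complex.cpow_one]
    have e2 : (1 - t : ℂ) ^ (1 - (a : ℂ)) = (1 - t : ℂ) ^ (-(a : ℂ)) * (1 - t) := by
      rw [sub_eq_neg_add (1 : ℂ) (a : ℂ), Complex.cpow_add _ _ ht1, Complex.cpow_one]
    have e3 : (1 - t : ℂ) ^ (1 - (a : ℂ) - 1) = (1 - t : ℂ) ^ (-(a : ℂ)) := by
      congr 1; ring
    have e4 : Complex.exp (ζ - Real.log t) = Complex.exp ζ / t := by
      rw [Complex.exp_sub, ← Complex.ofReal_exp, Real.exp_log ht.1]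
    simp only [CYStokes.lin, d4, Pi.mul_apply]
    rw [e1, e2, e3, e4, betaKer, Complex.ofReal_inv]
    field_simp
    ring
  have hI := intervalIntegral.integral_eq_sub_of_hasDerivAt_of_tendsto zero_lt_one hder
    ((intervalIntegrable_iff_integrableOn_Ioo_of_le zero_le_one).2 (h1.sub h2)) (fa := 0) (fb := 0)
    ?_ ?_
  · rwa [intervalIntegral.integral_of_le zero_le_one, integral_Ioc_eq_integral_Ioo, sub_zero] at hI
  · have l1 := hf.tendsto_zero (a := a - 2) hζ
    have l2 : Tendsto (fun t : ℝ => (1 - (t : ℂ)) ^ (1 - (a : ℂ))) (𝓝[>] 0) (𝓝 1) := by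
      have : ContinuousAt (fun t : ℝ => (1 - (t : ℂ)) ^ (1 - (a : ℂ))) 0 :=
        (continuousAt_const.sub Complex.continuous_ofReal.continuousAt).cpow continuousAt_const
          (by simp)
      have h := this.tendsto
      simp only [Complex.ofReal_zero, sub_zero, Complex.one_cpow] at h
      exact h.mono_left nhdsWithin_le_nhds
    have := ((l1.mul l2).const_mul (Complex.exp ζ))
    rw [zero_mul, mul_zero] at this
    refine this.congr fun t => ?_
    push_cast; ring
  · have l2 : Tendsto (fun t : ℝ => (1 - (t : ℂ)) ^ (1 - (a : ℂ))) (𝓝[<] 1) (𝓝 0) := by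
      have : ContinuousAt (fun t : ℝ => (1 - (t : ℂ)) ^ (1 - (a : ℂ))) 1 := by
        refine ContinuousAt.comp (g := fun w : ℂ => w ^ (1 - (a : ℂ)))
          (Complex.continuousAt_cpow_const_of_re_pos (by simp) (by simpa using ha))
          (continuousAt_const.sub Complex.continuous_ofReal.continuousAt)
      have h := this.tendsto
      rw [Complex.ofReal_one, sub_self, Complex.zero_cpow] at h
      · exact h.mono_left nhdsWithin_le_nhds
      · rw [← Complex.ofReal_one, ← Complex.ofReal_sub]; exact_mod_cast (sub_pos.2 ha).ne'
    have l1 : Tendsto (fun t : ℝ => (t : ℂ) ^ ((a : ℂ) - 2) * f (ζ - Real.log t)) (𝓝[<] 1)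
        (𝓝 (((1 : ℝ) : ℂ) ^ ((a : ℂ) - 2) * f (ζ - Real.log 1))) := by
      refine Tendsto.mono_left (ContinuousAt.tendsto (ContinuousAt.mul ?_ ?_)) nhdsWithin_le_nhds
      · exact Complex.continuous_ofReal.continuousAt.cpow continuousAt_const (by simp)
      · refine ContinuousAt.comp (g := f) ?_ (continuousAt_const.sub
          (Complex.continuous_ofReal.continuousAt.comp (Real.continuousAt_log one_ne_zero)))
        exact (hf.1.differentiableAt
          (isOpen_rightStrip.mem_nhds (sub_ofReal_mem_rightStrip hζ _))).continuousAt
    have := ((l1.mul l2).const_mul (Complex.exp ζ))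
    rw [mul_zero, mul_zero] at this
    refine this.congr fun t => ?_
    ring

theorem betaConv_congr {a : ℝ} {f g : ℂ → ℂ} (h : EqOn f g rightStrip) :
    EqOn (betaConv a f) (betaConv a g) rightStrip := fun ζ hζ => by
  rw [betaConv, betaConv]
  exact setIntegral_congr_fun measurableSet_Ioo fun t _ => by
    simp only [h (sub_ofReal_mem_rightStrip hζ _)]

theorem Family.rapidStrip_V (X : Family) : RapidStrip X.gap X.V := X.expClass_V.rapidStrip X.lamR_pos

theorem RapidStrip.lin_lin_betaConv {a b : ℝ} {f : ℂ → ℂ} (hf : RapidStrip b f) (ha : a < 1)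
    (hab : 1 < a + b) (k k' : ℂ) :
    EqOn (CYStokes.lin k (CYStokes.lin k' (CYStokes.betaConv a f)))
      (CYStokes.betaConv a (CYStokes.lin k (CYStokes.lin k' f))) rightStrip :=
  (lin_eqOn isOpen_rightStrip (hf.lin_betaConv ha hab k') k).trans
    ((hf.lin k').lin_betaConv ha hab k)

/-- The starting function satisfies zf = -λ(θ + a₃)f. Each factor θ + 1 carried through the
convolution with parameter a_j becomes θ + 1 - a_j = θ + a_{3-j}, so the three convolutions produce
the factors with a₂, a₁, a₀, while θ commutes with convolution. -/
theorem Family.DE_preV (X : Family) : EqOn (X.DE X.preV) 0 rightStrip := by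
  have hS := isOpen_rightStrip
  set f : ℂ → ℂ := fun ζ => Complex.exp (-(X.gap * ζ)) * Complex.exp (-(Complex.exp ζ / X.lamR))
    with hf_def
  have hf : RapidStrip X.gap f := expClass_exp_neg_exp.rapidStrip X.lamR_pos
  have h1 := X.root_lt_one 1
  have h2 := X.root_lt_one 2
  have h3 := X.root_lt_one 3
  have g1 := X.one_lt_root_add_gap (j := 1) (by decide)
  have g2 := X.one_lt_root_add_gap (j := 2) (by decide)
  have g3 := X.one_lt_root_add_gap (j := 3) (by decide)
  have r1 : (1 - X.root 1 : ℂ) = X.root 2 := by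
    rw [← Complex.ofReal_one, ← Complex.ofReal_sub]; exact_mod_cast (X.root_rev 1).symm
  have r2 : (1 - X.root 2 : ℂ) = X.root 1 := by
    rw [← Complex.ofReal_one, ← Complex.ofReal_sub]; exact_mod_cast (X.root_rev 2).symm
  have r3 : (1 - X.root 3 : ℂ) = X.root 0 := by
    rw [← Complex.ofReal_one, ← Complex.ofReal_sub]; exact_mod_cast (X.root_rev 3).symm
  have r0 : (X.gap : ℂ) = X.root 3 := by
    rw [Family.gap]; exact_mod_cast (X.root_rev 0).symm
  have hbase : ∀ ζ, Complex.exp ζ * f ζ = -X.lamR * lin (X.root 3) f ζ := by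
    intro ζ
    have hd : HasDerivAt f (-X.gap * Complex.exp (-(X.gap * ζ)) *
        Complex.exp (-(Complex.exp ζ / X.lamR)) + Complex.exp (-(X.gap * ζ)) *
        (Complex.exp (-(Complex.exp ζ / X.lamR)) * -(Complex.exp ζ / X.lamR))) ζ := by
      have e1 : HasDerivAt (fun ζ : ℂ => Complex.exp (-(X.gap * ζ)))
          (-X.gap * Complex.exp (-(X.gap * ζ))) ζ :=
        (((hasDerivAt_id ζ).const_mul (X.gap : ℂ)).neg.cexp).congr_deriv (by simp; ring)
      exact e1.mul (((Complex.hasDerivAt_exp ζ).div_const _).neg.cexp)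
    have hl : (X.lamR : ℂ) ≠ 0 := by exact_mod_cast X.lamR_pos.ne'
    rw [lin, hd.deriv, ← r0, hf_def]
    field_simp
    ring
  have hq1 := hf.betaConv h1 g1
  have hq2 := hq1.betaConv h2 g2
  have A1 : EqOn (fun ζ => Complex.exp ζ * lin 1 (betaConv (X.root 1) f) ζ)
      (fun ζ => -X.lamR * lin (X.root 2) (betaConv (X.root 1) (lin (X.root 3) f)) ζ)
      rightStrip := by
    intro ζ hζ
    simp only
    rw [hf.exp_mul_lin_betaConv h1 g1 hζ, r1]
    have : (betaConv (X.root 1) fun τ => Complex.exp τ * f τ) =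
        (-X.lamR : ℂ) • betaConv (X.root 1) (lin (X.root 3) f) := by
      ext ζ
      simp only [Pi.smul_apply, smul_eq_mul, betaConv]
      rw [← integral_const_mul]
      simp only [hbase]
      refine integral_congr_ae (Eventually.of_forall fun t => ?_)
      simp only
      ring
    rw [this, lin_smul, Pi.smul_apply, smul_eq_mul]
  have smul_conv : ∀ (a : ℝ) (k : ℂ) (g : ℂ → ℂ), betaConv a (fun ζ => k * g ζ) =
      k • betaConv a g := by
    intro a k g
    ext ζ
    simp only [Pi.smul_apply, smul_eq_mul, betaConv]
    rw [← integral_const_mul]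
    refine integral_congr_ae (Eventually.of_forall fun t => ?_)
    simp only
    ring
  have A2 : EqOn (fun ζ => Complex.exp ζ *
        lin 1 (lin 1 (betaConv (X.root 2) (betaConv (X.root 1) f))) ζ)
      (fun ζ => -X.lamR * lin (X.root 1) (betaConv (X.root 2) (lin (X.root 2)
        (betaConv (X.root 1) (lin (X.root 3) f)))) ζ) rightStrip := by
    intro ζ hζ
    simp only
    rw [lin_eqOn hS (hq1.lin_betaConv h2 g2 1) 1 hζ,
      (hq1.lin 1).exp_mul_lin_betaConv h2 g2 hζ, r2, lin_eqOn hS (betaConv_congr A1) _ hζ,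
      smul_conv, lin_smul, Pi.smul_apply, smul_eq_mul]
  have A3 : EqOn (fun ζ => Complex.exp ζ * lin 1 (lin 1 (lin 1 X.preV)) ζ)
      (fun ζ => -X.lamR * lin (X.root 0) (betaConv (X.root 3) (lin (X.root 1)
        (betaConv (X.root 2) (lin (X.root 2) (betaConv (X.root 1) (lin (X.root 3) f)))))) ζ)
      rightStrip := by
    intro ζ hζ
    simp only
    rw [Family.preV, lin_eqOn hS (hq2.lin_lin_betaConv h3 g3 1 1) 1 hζ,
      ((hq2.lin 1).lin 1).exp_mul_lin_betaConv h3 g3 hζ, r3,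
      lin_eqOn hS (betaConv_congr A2) _ hζ, smul_conv, lin_smul, Pi.smul_apply, smul_eq_mul]
  have B3 : EqOn (lin (X.root 1) (lin (X.root 2) (lin (X.root 3) X.preV)))
      (betaConv (X.root 3) (lin (X.root 1) (betaConv (X.root 2) (lin (X.root 2)
        (betaConv (X.root 1) (lin (X.root 3) f)))))) rightStrip := by
    have b1 : EqOn (lin (X.root 3) (betaConv (X.root 1) f))
        (betaConv (X.root 1) (lin (X.root 3) f)) rightStrip := hf.lin_betaConv h1 g1 _
    have b2 : EqOn (lin (X.root 2) (lin (X.root 3) (betaConv (X.root 2) (betaConv (X.root 1) f))))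
        (betaConv (X.root 2) (lin (X.root 2) (betaConv (X.root 1) (lin (X.root 3) f))))
        rightStrip :=
      (hq1.lin_lin_betaConv h2 g2 _ _).trans (betaConv_congr (lin_eqOn hS b1 _))
    have b3 : EqOn (lin (X.root 1) (lin (X.root 2) (lin (X.root 3) X.preV)))
        (betaConv (X.root 3) (lin (X.root 1) (lin (X.root 2) (lin (X.root 3)
          (betaConv (X.root 2) (betaConv (X.root 1) f)))))) rightStrip :=
      (lin_eqOn hS (hq2.lin_lin_betaConv h3 g3 _ _) _).trans
        (((hq2.lin _).lin _).lin_betaConv h3 g3 _)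
    exact b3.trans (betaConv_congr (lin_eqOn hS b2 _))
  intro ζ hζ
  have e1 := A3 hζ
  have e2 := lin_eqOn hS B3 (X.root 0) hζ
  simp only at e1
  rw [Family.DE, e1, e2, Pi.zero_apply]
  ring

theorem Family.DE_V (X : Family) : EqOn (X.DE X.V) 0 rightStrip := by
  intro ζ hζ
  set k := X.gConst * Complex.exp (-(X.root 0 * Real.log X.lamR)) * (Complex.Gamma (1 - X.root 1) *
    Complex.Gamma (1 - X.root 2) * Complex.Gamma (1 - X.root 3))⁻¹
  have : X.V = k • X.preV := rfl
  have h := X.DE_preV hζ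
  simp only [this, Family.DE, lin_smul, Pi.smul_apply, smul_eq_mul, Pi.zero_apply] at h ⊢
  linear_combination k * h

theorem Family.exists_V_eq_sum_basis (X : Family) : ∃ e : Fin 4 → ℂ,
    EqOn X.V (∑ j, e j • X.basis j) rightStrip := by
  have hc : IsPreconnected rightStrip := by
    have : rightStrip = Complex.im ⁻¹' Ioo (-(Real.pi / 2)) (Real.pi / 2) := by
      ext; simp [rightStrip, abs_lt]
    rw [this]
    exact ((convex_Ioo _ _).is_linear_preimage Complex.imLm.isLinear).isPreconnected
  exact X.exists_eq_sum_basis isOpen_rightStrip hc ⟨0, by simp [rightStrip, Real.pi_pos]⟩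
    X.expClass_V.1 fun ζ hζ => X.DE_V hζ

/-! ### The expansion of the decaying solution at the origin -/

theorem Family.root_zero_le (X : Family) (j : Fin 4) : X.root 0 ≤ X.root j :=
  X.root_strictMono.monotone (Fin.zero_le j)

theorem Family.root_le_three (X : Family) (j : Fin 4) : X.root j ≤ X.root 3 :=
  X.root_strictMono.monotone (Fin.le_last j)

theorem Family.root_three (X : Family) : X.root 3 = 1 - X.root 0 := X.root_rev 0

/-- The difference between the decaying solution and its principal part at the origin. -/
def Family.remV (X : Family) (e : Fin 4 → ℂ) (τ : ℝ) : ℂ :=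
  X.V τ - (Iic (0 : ℝ)).indicator
    (fun τ => ∑ j, e j * X.phiCoeff (X.idx j) 0 * Complex.exp (-X.root j * τ)) τ

theorem Family.measurable_remV (X : Family) (e : Fin 4 → ℂ) :
    AEStronglyMeasurable (X.remV e) volume := by
  refine AEStronglyMeasurable.sub ?_ ?_
  · refine Continuous.aestronglyMeasurable ?_
    rw [← continuousOn_univ]
    exact X.expClass_V.1.continuousOn.comp Complex.continuous_ofReal.continuousOn
      fun x _ => ofReal_mem_rightStrip x
  · exact (Continuous.aestronglyMeasurable (by fun_prop)).indicator measurableSet_Iic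

/-- For τ ≤ 0 the remainder is of order e^{(1-a_j)τ}, hence at most of order e^{a₀τ}; for τ > 0 `V`
decays doubly exponentially. So the subtracted moments converge for Re s > -1, past the poles. -/
theorem Family.exists_remV_bound (X : Family) {e : Fin 4 → ℂ}
    (he : EqOn X.V (∑ j, e j • X.basis j) rightStrip) {p q : ℝ} (hp : 0 < p) :
    ∃ B : ℝ → ℝ, Integrable B ∧ ∀ s : ℂ, p ≤ s.re + 1 → s.re + 1 ≤ q →
      ∀ τ : ℝ, ‖X.remV e τ * Complex.exp ((s + 1) * τ)‖ ≤ B τ := by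
  obtain ⟨C, hC⟩ := X.expClass_V.2
  obtain ⟨A, m, hm, hA⟩ := exists_exp_mul_exp_neg_exp_le (s := |X.gap| + |q| + 1) (by positivity)
    (inv_pos.2 X.lamR_pos) 0
  set K : ℝ := ∑ j, ‖e j‖ * (‖X.phiCoeff (X.idx j) 0‖ * Real.exp (1 / X.lamR)) with hK
  have hK0 : 0 ≤ K := Finset.sum_nonneg fun j _ => by positivity
  refine ⟨fun τ => K * Real.exp (-(X.root 0 * |τ|)) + |C| * |A| * Real.exp (-(m * |τ|)),
    ((integrable_exp_neg_mul_abs (X.root_pos 0)).const_mul K).add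
      ((integrable_exp_neg_mul_abs hm).const_mul _), fun s h1 h2 τ => ?_⟩
  have hexp : ‖Complex.exp ((s + 1) * τ)‖ = Real.exp ((s.re + 1) * τ) := by
    rw [Complex.norm_exp]; simp
  rw [norm_mul, hexp, Family.remV]
  rcases le_or_gt τ 0 with h0 | h0
  · have hle : ‖X.V τ - ∑ j, e j * X.phiCoeff (X.idx j) 0 * Complex.exp (-X.root j * τ)‖ ≤
        K * Real.exp (X.root 0 * τ) := by
      rw [he (ofReal_mem_rightStrip τ), Finset.sum_apply, ← Finset.sum_sub_distrib, hK,
        Finset.sum_mul]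
      refine (norm_sum_le _ _).trans (Finset.sum_le_sum fun j _ => ?_)
      rw [Pi.smul_apply, smul_eq_mul, mul_assoc, ← mul_sub, norm_mul, mul_assoc]
      gcongr
      refine (X.norm_basis_sub_le j (ζ := τ) (by simpa using h0)).trans ?_
      rw [Complex.ofReal_re]
      gcongr ?_ * Real.exp ?_
      have := X.root_le_three j
      rw [X.root_three] at this
      nlinarith
    rw [indicator_of_mem (show τ ∈ Iic (0 : ℝ) from h0)]
    have h3 : Real.exp ((s.re + 1) * τ) ≤ 1 := by
      rw [Real.exp_le_one_iff]; nlinarith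
    calc _ ≤ K * Real.exp (X.root 0 * τ) * 1 := by gcongr
      _ = K * Real.exp (-(X.root 0 * |τ|)) := by rw [abs_of_nonpos h0, mul_one]; ring_nf
      _ ≤ _ := le_add_of_nonneg_right (by positivity)
  · rw [indicator_of_notMem (by simpa using h0), sub_zero]
    have h3 := hC τ (ofReal_mem_rightStrip τ)
    rw [← Complex.ofReal_exp, Complex.ofReal_re, Complex.ofReal_re, div_eq_inv_mul] at h3
    have h4 := hA τ
    rw [pow_zero, mul_one] at h4
    have h5 : Real.exp (-(X.gap * τ)) * Real.exp ((s.re + 1) * τ) ≤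
        Real.exp ((|X.gap| + |q| + 1) * τ) := by
      rw [← Real.exp_add]
      gcongr
      have e1 : -X.gap ≤ |X.gap| := neg_le_abs _
      have e2 : q ≤ |q| := le_abs_self _
      nlinarith
    calc _ ≤ |C| * (Real.exp (-(X.gap * τ)) * Real.exp (-(X.lamR⁻¹ * Real.exp τ))) *
          Real.exp ((s.re + 1) * τ) := by
          gcongr
          refine h3.trans ?_
          gcongr
          exact le_abs_self C
      _ = |C| * ((Real.exp (-(X.gap * τ)) * Real.exp ((s.re + 1) * τ)) *
          Real.exp (-(X.lamR⁻¹ * Real.exp τ))) := by ring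
      _ ≤ |C| * (Real.exp ((|X.gap| + |q| + 1) * τ) * Real.exp (-(X.lamR⁻¹ * Real.exp τ))) := by
          gcongr
      _ ≤ |C| * (|A| * Real.exp (-(m * |τ|))) := by
          refine mul_le_mul_of_nonneg_left (h4.trans ?_) (abs_nonneg C)
          gcongr
          exact le_abs_self A
      _ = |C| * |A| * Real.exp (-(m * |τ|)) := by ring
      _ ≤ _ := le_add_of_nonneg_left (by positivity)

/-- The regular part of the moment function. -/
def Family.remMoment (X : Family) (e : Fin 4 → ℂ) (s : ℂ) : ℂ :=
  ∫ τ : ℝ, X.remV e τ * Complex.exp ((s + 1) * τ)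

theorem Family.differentiableAt_remMoment (X : Family) {e : Fin 4 → ℂ}
    (he : EqOn X.V (∑ j, e j • X.basis j) rightStrip) {s : ℂ} (hs : -1 < s.re) :
    DifferentiableAt ℂ (X.remMoment e) s := by
  set r := (s.re + 1) / 2 with hr
  have hr0 : 0 < r := by rw [hr]; linarith
  obtain ⟨B, hB, hle⟩ := X.exists_remV_bound he (p := r) (q := s.re + 1 + r) hr0
  refine (hasDerivAt_integral_of_holomorphic hr0
    (F := fun s τ => X.remV e τ * Complex.exp ((s + 1) * (τ : ℝ)))
    (fun z _ => (X.measurable_remV e).mul (Continuous.aestronglyMeasurable (by fun_prop)))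
    (Eventually.of_forall fun τ => by fun_prop) (Eventually.of_forall fun τ z hz => ?_)
    hB).differentiableAt
  rw [mem_ball, dist_eq_norm] at hz
  have h1 := abs_le.1 ((Complex.abs_re_le_norm _).trans hz.le)
  rw [Complex.sub_re] at h1
  exact hle z (by rw [hr] at *; linarith [h1.1]) (by linarith [h1.2]) τ

/-- Each leading exponential integrates over (-∞, 0] to a simple pole at s = a_j - 1 whose residue
carries the unknown coefficient. -/
theorem Family.moment_eq_remMoment_add (X : Family) {e : Fin 4 → ℂ}
    (he : EqOn X.V (∑ j, e j • X.basis j) rightStrip) {s : ℂ} (hs : -X.root 0 < s.re) :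
    moment X.V s = X.remMoment e s +
      ∑ j, e j * X.phiCoeff (X.idx j) 0 / (s + 1 - X.root j) := by
  have hpos : ∀ j, 0 < (s + 1 - X.root j).re := by
    intro j
    have h1 := X.root_le_three j
    rw [X.root_three] at h1
    simp only [Complex.sub_re, Complex.add_re, Complex.one_re, Complex.ofReal_re]
    linarith
  have hi1 : Integrable fun τ : ℝ => X.remV e τ * Complex.exp ((s + 1) * τ) := by
    obtain ⟨B, hB, hle⟩ := X.exists_remV_bound he (p := s.re + 1) (q := s.re + 1)
      (by linarith [X.root_lt_one 0])
    exact hB.mono' ((X.measurable_remV e).mul (Continuous.aestronglyMeasurable (by fun_prop)))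
      (Eventually.of_forall fun τ => hle s le_rfl le_rfl τ)
  have hi3 : ∀ j, IntegrableOn (fun τ : ℝ => e j * X.phiCoeff (X.idx j) 0 *
      Complex.exp ((s + 1 - X.root j) * τ)) (Iic 0) := fun j =>
    (integrableOn_exp_mul_complex_Iic (hpos j) 0).const_mul _
  have hi2 : Integrable ((Iic (0 : ℝ)).indicator fun τ : ℝ =>
      ∑ j, e j * X.phiCoeff (X.idx j) 0 * Complex.exp ((s + 1 - X.root j) * τ)) :=
    (integrable_indicator_iff measurableSet_Iic).2 (integrable_finsetSum _ fun j _ => hi3 j)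
  have hsplit : moment X.V s = X.remMoment e s + ∫ τ : ℝ, (Iic (0 : ℝ)).indicator (fun τ : ℝ =>
      ∑ j, e j * X.phiCoeff (X.idx j) 0 * Complex.exp ((s + 1 - X.root j) * τ)) τ := by
    rw [Family.remMoment, ← integral_add hi1 hi2, moment]
    refine integral_congr_ae (Eventually.of_forall fun τ => ?_)
    simp only [Family.remV]
    by_cases h : τ ∈ Iic (0 : ℝ)
    · rw [indicator_of_mem h, indicator_of_mem h, sub_mul, Finset.sum_mul]
      have : ∀ j, e j * X.phiCoeff (X.idx j) 0 * Complex.exp (-X.root j * τ) *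
          Complex.exp ((s + 1) * τ) = e j * X.phiCoeff (X.idx j) 0 *
            Complex.exp ((s + 1 - X.root j) * τ) := by
        intro j
        rw [mul_assoc, ← Complex.exp_add]
        congr 2; ring
      simp only [this]
      ring
    · rw [indicator_of_notMem h, indicator_of_notMem h]
      ring
  rw [hsplit, integral_indicator measurableSet_Iic, integral_finsetSum _ fun j _ => hi3 j]
  congr 1
  refine Finset.sum_congr rfl fun j _ => ?_
  rw [integral_const_mul, integral_exp_mul_complex_Iic (hpos j)]
  simp [div_eq_mul_inv]

theorem Family.prod_add_root (X : Family) (s : ℂ) :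
    ∏ j, (s + X.root j) = ∏ j, (s + 1 - X.root j) := by
  rw [← Equiv.prod_comp Fin.revPerm]
  refine Finset.prod_congr rfl fun j _ => ?_
  rw [Fin.revPerm_apply, X.root_rev]
  push_cast; ring

/-- Multiply the moment identity by ∏(s + 1 - a_i) = ∏(s + a_i): the poles on the left disappear,
and the Gammas on the right become Γ(s + a_i + 1). Both sides are holomorphic for Re s > -1, so the
identity extends there and can be evaluated at s = a_j - 1. -/
theorem Family.coeff_eq (X : Family) {e : Fin 4 → ℂ}
    (he : EqOn X.V (∑ j, e j • X.basis j) rightStrip) (j : Fin 4) :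
    e j * X.phiCoeff (X.idx j) 0 * ∏ i ∈ Finset.univ.erase j, ((X.root j : ℂ) - X.root i) =
      X.gConst * Complex.exp ((X.root j - 1) * Real.log X.lamR) *
        (∏ i, Complex.Gamma (X.root j + X.root i)) / Complex.Gamma (X.root j) ^ 3 := by
  set U : Set ℂ := {s | -1 < s.re} with hU
  have hUo : IsOpen U := isOpen_lt continuous_const Complex.continuous_re
  have hUc : IsPreconnected U := (convex_halfSpace_re_gt (-1)).isPreconnected
  set G : ℂ → ℂ := fun s => (∏ i, (s + 1 - X.root i)) * X.remMoment e s +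
    ∑ j, e j * X.phiCoeff (X.idx j) 0 * ∏ i ∈ Finset.univ.erase j, (s + 1 - X.root i) -
    X.gConst * Complex.exp (s * Real.log X.lamR) *
      (∏ i, Complex.Gamma (s + X.root i + 1)) * ((Complex.Gamma (1 + s))⁻¹) ^ 3 with hG
  have hGd : DifferentiableOn ℂ G U := by
    intro s hs
    have hs' : -1 < s.re := hs
    refine DifferentiableAt.differentiableWithinAt ?_
    have h1 := X.differentiableAt_remMoment he hs'
    have h2 : DifferentiableAt ℂ (fun s => (Complex.Gamma (1 + s))⁻¹) s :=
      Complex.differentiable_one_div_Gamma.differentiableAt.comp s (by fun_prop)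
    have h3 : ∀ i, DifferentiableAt ℂ (fun s => Complex.Gamma (s + X.root i + 1)) s := by
      intro i
      refine DifferentiableAt.comp s (Complex.differentiableAt_Gamma _ fun m hm => ?_) (by fun_prop)
      have := congrArg Complex.re hm
      simp only [Complex.add_re, Complex.ofReal_re, Complex.one_re, Complex.neg_re,
        Complex.natCast_re] at this
      have hm0 : (0 : ℝ) ≤ m := Nat.cast_nonneg m
      linarith [X.root_pos i]
    have h4 : DifferentiableAt ℂ (fun s => ∏ i, Complex.Gamma (s + X.root i + 1)) s := by
      have := DifferentiableAt.fun_finsetProd (u := (Finset.univ : Finset (Fin 4))) fun i _ => h3 i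
      exact this
    have h5 : ∀ t : Finset (Fin 4), DifferentiableAt ℂ (fun s : ℂ => ∏ i ∈ t, (s + 1 - (X.root i : ℂ))) s :=
      fun t => DifferentiableAt.fun_finsetProd fun i _ => by fun_prop
    have h6 : DifferentiableAt ℂ (fun s : ℂ => ∑ j, e j * X.phiCoeff (X.idx j) 0 *
        ∏ i ∈ Finset.univ.erase j, (s + 1 - (X.root i : ℂ))) s :=
      DifferentiableAt.fun_sum fun j _ => (h5 _).const_mul _
    exact (((h5 _).mul h1).add h6).sub
      ((((Complex.differentiable_exp.differentiableAt.comp s (by fun_prop)).const_mul _).mul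
        h4).mul (h2.pow 3))
  have hzero : ∀ s : ℂ, -X.root 0 < s.re → G s = 0 := by
    intro s hs
    have h1 := X.moment_eq_remMoment_add he hs
    have hne : ∀ j, s + 1 - (X.root j : ℂ) ≠ 0 := by
      intro j h
      have := congrArg Complex.re h
      have h1 := X.root_le_three j
      rw [X.root_three] at h1
      simp only [Complex.sub_re, Complex.add_re, Complex.one_re, Complex.ofReal_re,
        Complex.zero_re] at this
      linarith
    have hne2 : ∀ j, s + (X.root j : ℂ) ≠ 0 := by
      intro j h
      have := congrArg Complex.re h
      simp only [Complex.add_re, Complex.ofReal_re, Complex.zero_re] at this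
      linarith [X.root_zero_le j]
    rw [X.moment_V hs, X.gGamma_eq hs] at h1
    have h2 : ∑ j, e j * X.phiCoeff (X.idx j) 0 * ∏ i ∈ Finset.univ.erase j, (s + 1 - X.root i) =
        (∏ i, (s + 1 - X.root i)) *
          ∑ j, e j * X.phiCoeff (X.idx j) 0 / (s + 1 - X.root j) := by
      rw [Finset.mul_sum]
      refine Finset.sum_congr rfl fun j _ => ?_
      rw [← Finset.mul_prod_erase _ _ (Finset.mem_univ j)]
      have := hne j
      field_simp
    have h3 : ∏ i, Complex.Gamma (s + X.root i + 1) =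
        (∏ i, (s + 1 - X.root i)) * ∏ i, Complex.Gamma (s + X.root i) := by
      rw [← X.prod_add_root, ← Finset.prod_mul_distrib]
      exact Finset.prod_congr rfl fun i _ => Complex.Gamma_add_one _ (hne2 i)
    simp only [hG]
    rw [h2, h3]
    rw [div_eq_mul_inv, ← inv_pow] at h1
    linear_combination (-∏ i, (s + 1 - (X.root i : ℂ))) * h1
  have hev : G =ᶠ[𝓝 0] 0 := by
    have : {s : ℂ | -X.root 0 < s.re} ∈ 𝓝 (0 : ℂ) :=
      (isOpen_lt continuous_const Complex.continuous_re).mem_nhds (by simpa using X.root_pos 0)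
    filter_upwards [this] with s hs using hzero s hs
  have hall := (hGd.analyticOnNhd hUo).eqOn_zero_of_preconnected_of_eventuallyEq_zero hUc
    (show (0 : ℂ) ∈ U by simp [hU]) hev
  have hmem : ((X.root j : ℂ) - 1) ∈ U := by simp [hU, X.root_pos j]
  have h := hall hmem
  simp only [hG, Pi.zero_apply] at h
  have e0 : ∀ i, ((X.root j : ℂ) - 1 + 1 - X.root i) = X.root j - X.root i := fun i => by ring
  have e1 : ∀ i, ((X.root j : ℂ) - 1 + X.root i + 1) = X.root j + X.root i := fun i => by ring
  simp only [e0, e1, add_sub_cancel] at h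
  rw [← Finset.mul_prod_erase _ _ (Finset.mem_univ j), sub_self, zero_mul, zero_mul, zero_add,
    Finset.sum_eq_single j] at h
  · rw [div_eq_mul_inv, ← inv_pow]
    exact sub_eq_zero.1 h
  · intro i _ hij
    rw [← Finset.mul_prod_erase _ _ (Finset.mem_erase.2 ⟨hij.symm, Finset.mem_univ j⟩), sub_self,
      zero_mul, mul_zero]
  · exact fun h => absurd (Finset.mem_univ j) h

/-! ### The decaying solution as a combination of the functions `wHat` -/

/-- The ratio between the two normalizations of the Gamma quotients. -/
def Family.mult : Family → ℝ
  | .quintic => 1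
  | .sextic => 1
  | .octic => 1
  | .dectic => 2

/-- `sin (π x / d)`. -/
def Family.sn (X : Family) (x : ℝ) : ℝ := Real.sin (Real.pi * (x / X.deg))

/-- The product of sines corresponding to `wFactor k * (1 - α^k)`. -/
def Family.sinProd (X : Family) (k : ℕ) : ℝ :=
  match X with
  | .quintic => Family.quintic.sn k ^ 4
  | .sextic => Family.sextic.sn (2 * k) * Family.sextic.sn k ^ 3
  | .octic => Family.octic.sn (4 * k) * Family.octic.sn k ^ 3
  | .dectic => Family.dectic.sn (5 * k) * Family.dectic.sn (2 * k) * Family.dectic.sn k ^ 2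

theorem Family.deg_ne_zero (X : Family) : (X.deg : ℝ) ≠ 0 := by exact_mod_cast X.deg_pos.ne'

theorem Family.sn_neg (X : Family) (x : ℝ) : X.sn (-x) = -X.sn x := by
  rw [Family.sn, Family.sn, ← Real.sin_neg]; congr 1; ring

theorem Family.sn_sub (X : Family) (x : ℝ) : X.sn (X.deg - x) = X.sn x := by
  rw [Family.sn, Family.sn, sub_div, div_self X.deg_ne_zero, mul_sub, mul_one, Real.sin_pi_sub]

theorem prod_erase_eq_prod_ite {ι M : Type*} [Fintype ι] [DecidableEq ι] [CommMonoid M]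
    (g : ι → M) (j : ι) :
    ∏ i ∈ Finset.univ.erase j, g i = ∏ i, if i = j then 1 else g i := by
  rw [← Finset.mul_prod_erase Finset.univ _ (Finset.mem_univ j), if_pos rfl, one_mul]
  exact Finset.prod_congr rfl fun i hi => (if_neg (Finset.ne_of_mem_erase hi)).symm

theorem Family.sn_reduce (X : Family) (q : ℕ) (x : ℝ) :
    X.sn (q * X.deg + x) = (-1) ^ q * X.sn x := by
  rw [Family.sn, Family.sn, add_div, mul_div_cancel_right₀ _ X.deg_ne_zero, mul_add, add_comm,
    mul_comm Real.pi (q : ℝ), Real.sin_add_nat_mul_pi]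

theorem sn_quintic : Family.quintic.sn 1 * Family.quintic.sn 2 = Real.sqrt 5 / 4 := by
  have e1 : Family.quintic.sn 1 = Real.sin (Real.pi / 5) := by
    rw [Family.sn, Family.deg]; congr 1; push_cast; ring
  have e2 : Family.quintic.sn 2 = Real.sin (2 * (Real.pi / 5)) := by
    rw [Family.sn, Family.deg]; congr 1; push_cast; ring
  have h2 := Real.sin_sq (Real.pi / 5)
  have h5 := Real.sq_sqrt (show (0 : ℝ) ≤ 5 by norm_num)
  rw [e1, e2, Real.sin_two_mul]
  rw [Real.cos_pi_div_five] at h2 ⊢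
  linear_combination (1 + Real.sqrt 5) / 2 * h2 - (3 + Real.sqrt 5) / 32 * h5

theorem sn_sextic : Family.sextic.sn 1 = 1 / 2 ∧ Family.sextic.sn 2 = Real.sqrt 3 / 2 ∧
    Family.sextic.sn 3 = 1 := by
  refine ⟨?_, ?_, ?_⟩
  · rw [← Real.sin_pi_div_six, Family.sn, Family.deg]; congr 1; push_cast; ring
  · rw [← Real.sin_pi_div_three, Family.sn, Family.deg]; congr 1; push_cast; ring
  · rw [← Real.sin_pi_div_two, Family.sn, Family.deg]; congr 1; push_cast; ring

theorem sn_octic : Family.octic.sn 1 * Family.octic.sn 3 = Real.sqrt 2 / 4 ∧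
    Family.octic.sn 2 = Real.sqrt 2 / 2 ∧ Family.octic.sn 4 = 1 := by
  refine ⟨?_, ?_, ?_⟩
  · have e1 : Family.octic.sn 1 = Real.sin (Real.pi / 8) := by
      rw [Family.sn, Family.deg]; congr 1; push_cast; ring
    have e3 : Family.octic.sn 3 = Real.cos (Real.pi / 8) := by
      rw [Family.sn, Family.deg, ← Real.sin_pi_div_two_sub]; congr 1; push_cast; ring
    have h := Real.sin_two_mul (Real.pi / 8)
    rw [show 2 * (Real.pi / 8) = Real.pi / 4 by ring, Real.sin_pi_div_four] at h
    rw [e1, e3]; linarith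
  · rw [← Real.sin_pi_div_four, Family.sn, Family.deg]; congr 1; push_cast; ring
  · rw [← Real.sin_pi_div_two, Family.sn, Family.deg]; congr 1; push_cast; ring

theorem sn_dectic : Family.dectic.sn 1 = (Real.sqrt 5 - 1) / 4 ∧
    Family.dectic.sn 3 = (Real.sqrt 5 + 1) / 4 ∧
    Family.dectic.sn 2 * Family.dectic.sn 4 = Real.sqrt 5 / 4 ∧
    Family.dectic.sn 2 ^ 2 = (5 - Real.sqrt 5) / 8 ∧
    Family.dectic.sn 4 ^ 2 = (5 + Real.sqrt 5) / 8 ∧ Family.dectic.sn 5 = 1 := by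
  have e2 : Family.dectic.sn 2 = Real.sin (Real.pi / 5) := by
    rw [Family.sn, Family.deg]; congr 1; push_cast; ring
  have e4 : Family.dectic.sn 4 = Real.sin (2 * (Real.pi / 5)) := by
    rw [Family.sn, Family.deg]; congr 1; push_cast; ring
  have e3 : Family.dectic.sn 3 = Real.cos (Real.pi / 5) := by
    rw [Family.sn, Family.deg, ← Real.sin_pi_div_two_sub]; congr 1; push_cast; ring
  have e1 : Family.dectic.sn 1 = Real.cos (2 * (Real.pi / 5)) := by
    rw [Family.sn, Family.deg, ← Real.sin_pi_div_two_sub]; congr 1; push_cast; ring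
  have h2 := Real.sin_sq (Real.pi / 5)
  have h5 := Real.sq_sqrt (show (0 : ℝ) ≤ 5 by norm_num)
  rw [e1, e2, e3, e4, Real.sin_two_mul, Real.cos_two_mul]
  rw [Real.cos_pi_div_five] at h2 ⊢
  refine ⟨?_, ?_, ?_, ?_, ?_, ?_⟩
  · linear_combination h5 / 8
  · ring
  · linear_combination (1 + Real.sqrt 5) / 2 * h2 - (3 + Real.sqrt 5) / 32 * h5
  · linear_combination h2 - h5 / 16
  · linear_combination (1 + Real.sqrt 5) ^ 2 / 4 * h2 -
      (Real.sqrt 5 ^ 2 + 4 * Real.sqrt 5 - 5) / 64 * h5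
  · rw [← Real.sin_pi_div_two, Family.sn, Family.deg]; congr 1; push_cast; ring

theorem Family.sn_mul_sn (X : Family) :
    X.sn (X.idx 0) * X.sn (X.idx 1) = Real.sqrt X.kappa / 4 := by
  have h5 := Real.sq_sqrt (show (0 : ℝ) ≤ 5 by norm_num)
  obtain ⟨a1, a2, -⟩ := sn_sextic
  obtain ⟨b1, -⟩ := sn_octic
  obtain ⟨c1, c3, -⟩ := sn_dectic
  cases X
  · simpa [Family.idx, Family.kappa] using sn_quintic
  · simp [Family.idx, Family.kappa, a1, a2]; ring
  · simpa [Family.idx, Family.kappa] using b1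
  · simp [Family.idx, Family.kappa, c1, c3]; linear_combination h5 / 16

/-- The arithmetic fact that makes the coefficients of `V` proportional to those of the ŵ_m: the
sines from the reflection formula on one side, the sines in the factors 1 - α^k on the other. It is
checked case by case from explicit values. -/
theorem Family.sine_identity (X : Family) (j : Fin 4) :
    X.deg * X.sn (X.idx j) ^ 3 = -16 * (-1) ^ (X.deg - X.idx j) * X.sinProd (X.deg - X.idx j) *
      ∏ i ∈ Finset.univ.erase j, X.sn (X.idx j - X.idx i) := by
  rw [prod_erase_eq_prod_ite, Fin.prod_univ_four]
  have r2 := Real.sq_sqrt (show (0 : ℝ) ≤ 2 by norm_num)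
  have r3 := Real.sq_sqrt (show (0 : ℝ) ≤ 3 by norm_num)
  have r5 := Real.sq_sqrt (show (0 : ℝ) ≤ 5 by norm_num)
  have hn := X.sn_neg
  cases X
  · have R := sn_quintic
    have m4 : Family.quintic.sn 4 = Family.quintic.sn 1 := by
      have h2 := Family.quintic.sn_sub 1
      norm_num [Family.deg] at h2
      rw [← h2]
    have m3 : Family.quintic.sn 3 = Family.quintic.sn 2 := by
      have h2 := Family.quintic.sn_sub 2
      norm_num [Family.deg] at h2
      rw [← h2]
    fin_cases j <;> simp [Family.idx, Family.deg, Family.sinProd] <;> norm_num <;>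
      simp only [m4, m3, hn 1, hn 2, hn 3]
    all_goals
      generalize Family.quintic.sn 1 = p at *
      generalize Family.quintic.sn 2 = q at *
      have R' : 16 * p ^ 2 * q ^ 2 = 5 := by linear_combination 16 * (p * q + Real.sqrt 5 / 4) * R + r5
    · linear_combination -p ^ 3 * R'
    · linear_combination -q ^ 3 * R'
    · linear_combination -q ^ 3 * R'
    · linear_combination -p ^ 3 * R'
  · obtain ⟨R1, R2, R3⟩ := sn_sextic
    have m4 : Family.sextic.sn 4 = Family.sextic.sn 2 := by
      have h2 := Family.sextic.sn_sub 2
      norm_num [Family.deg] at h2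
      rw [← h2]
    have m5 : Family.sextic.sn 5 = Family.sextic.sn 1 := by
      have h2 := Family.sextic.sn_sub 1
      norm_num [Family.deg] at h2
      rw [← h2]
    have m8 : Family.sextic.sn 8 = -Family.sextic.sn 2 := by
      have := Family.sextic.sn_reduce 1 2
      norm_num [Family.deg] at this
      rw [this]
    have m10 : Family.sextic.sn 10 = -Family.sextic.sn 2 := by
      have := Family.sextic.sn_reduce 1 4
      have h2 := Family.sextic.sn_sub 2
      norm_num [Family.deg] at this h2
      rw [this, ← h2]
    fin_cases j <;> simp [Family.idx, Family.deg, Family.sinProd] <;> norm_num <;>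
      simp only [m4, m5, m8, m10, hn 1, hn 2, hn 3, hn 4, R1, R2, R3]
    all_goals
      ring_nf
      try simp only [show Real.sqrt 3 ^ 5 = (Real.sqrt 3 ^ 2) ^ 2 * Real.sqrt 3 by ring, show Real.sqrt 3 ^ 3 = (Real.sqrt 3 ^ 2) * Real.sqrt 3 by ring, r3]
      try ring
  · obtain ⟨R1, R2, R3⟩ := sn_octic
    have m5 : Family.octic.sn 5 = Family.octic.sn 3 := by
      have h2 := Family.octic.sn_sub 3
      norm_num [Family.deg] at h2
      rw [← h2]
    have m6 : Family.octic.sn 6 = Family.octic.sn 2 := by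
      have h2 := Family.octic.sn_sub 2
      norm_num [Family.deg] at h2
      rw [← h2]
    have m7 : Family.octic.sn 7 = Family.octic.sn 1 := by
      have h2 := Family.octic.sn_sub 1
      norm_num [Family.deg] at h2
      rw [← h2]
    have m12 : Family.octic.sn 12 = -Family.octic.sn 4 := by
      have := Family.octic.sn_reduce 1 4
      norm_num [Family.deg] at this
      rw [this]
    have m20 : Family.octic.sn 20 = Family.octic.sn 4 := by
      have := Family.octic.sn_reduce 2 4
      norm_num [Family.deg] at this
      rw [this]
    have m28 : Family.octic.sn 28 = -Family.octic.sn 4 := by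
      have := Family.octic.sn_reduce 3 4
      norm_num [Family.deg] at this
      rw [this]
    fin_cases j <;> simp [Family.idx, Family.deg, Family.sinProd] <;> norm_num <;>
      simp only [m5, m6, m7, m12, m20, m28, hn 2, hn 4, hn 6, R2, R3]
    all_goals
      generalize Family.octic.sn 1 = p at *
      generalize Family.octic.sn 3 = q at *
    · linear_combination -4 * p ^ 3 * r2
    · linear_combination -4 * q ^ 3 * r2
    · linear_combination -4 * q ^ 3 * r2
    · linear_combination -4 * p ^ 3 * r2
  · obtain ⟨R1, R3, R, R2, R4, R5⟩ := sn_dectic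
    have m6 : Family.dectic.sn 6 = Family.dectic.sn 4 := by
      have h2 := Family.dectic.sn_sub 4
      norm_num [Family.deg] at h2
      rw [← h2]
    have m7 : Family.dectic.sn 7 = Family.dectic.sn 3 := by
      have h2 := Family.dectic.sn_sub 3
      norm_num [Family.deg] at h2
      rw [← h2]
    have m8 : Family.dectic.sn 8 = Family.dectic.sn 2 := by
      have h2 := Family.dectic.sn_sub 2
      norm_num [Family.deg] at h2
      rw [← h2]
    have m9 : Family.dectic.sn 9 = Family.dectic.sn 1 := by
      have h2 := Family.dectic.sn_sub 1
      norm_num [Family.deg] at h2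
      rw [← h2]
    have m14 : Family.dectic.sn 14 = -Family.dectic.sn 4 := by
      have := Family.dectic.sn_reduce 1 4
      norm_num [Family.deg] at this
      rw [this]
    have m15 : Family.dectic.sn 15 = -Family.dectic.sn 5 := by
      have := Family.dectic.sn_reduce 1 5
      norm_num [Family.deg] at this
      rw [this]
    have m18 : Family.dectic.sn 18 = -Family.dectic.sn 2 := by
      have := Family.dectic.sn_reduce 1 8
      have h2 := Family.dectic.sn_sub 2
      norm_num [Family.deg] at this h2
      rw [this, ← h2]
    have m35 : Family.dectic.sn 35 = -Family.dectic.sn 5 := by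
      have := Family.dectic.sn_reduce 3 5
      norm_num [Family.deg] at this
      rw [this]
    have m45 : Family.dectic.sn 45 = Family.dectic.sn 5 := by
      have := Family.dectic.sn_reduce 4 5
      norm_num [Family.deg] at this
      rw [this]
    fin_cases j <;> simp [Family.idx, Family.deg, Family.sinProd] <;> norm_num <;>
      simp only [m6, m7, m8, m9, m14, m15, m18, m35, m45, hn 2, hn 4, hn 6, hn 8, R1, R3, R5]
    all_goals
      generalize Family.dectic.sn 2 = q at *
      generalize Family.dectic.sn 4 = t at *
      have Q1 : 8 * q ^ 3 * t = 5 * ((Real.sqrt 5 - 1) / 4) := by linear_combination 8 * q * t * R2 + (5 - Real.sqrt 5) * R - r5 / 4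
      have Q2 : 8 * t ^ 3 * q = 5 * ((Real.sqrt 5 + 1) / 4) := by linear_combination 8 * q * t * R4 + (5 + Real.sqrt 5) * R + r5 / 4
    · linear_combination -2 * ((Real.sqrt 5 - 1) / 4) ^ 2 * Q1
    · linear_combination -2 * ((Real.sqrt 5 + 1) / 4) ^ 2 * Q2
    · linear_combination -2 * ((Real.sqrt 5 + 1) / 4) ^ 2 * Q2
    · linear_combination -2 * ((Real.sqrt 5 - 1) / 4) ^ 2 * Q1

/-- The large Gamma factors of the two normalizations cancel. The factor 2 for d = 10 arises because
there the local series uses Γ(2y) where γ_d uses Γ(1+2y) = 2yΓ(2y). -/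
theorem Family.gGamma_mul_phiGamma (X : Family) {y : ℂ} (hy : 0 < y.re) :
    X.mult * X.gGamma y * Complex.Gamma (1 + y) ^ 3 * X.phiGamma (y - 1) =
      Complex.Gamma y ^ 3 := by
  have g : ∀ (s : ℂ), 0 < s.re → Complex.Gamma s ≠ 0 := fun s hs =>
    Complex.Gamma_ne_zero_of_re_pos hs
  have h1 := g (1 + y) (by simp; linarith)
  have h2 := g (1 + 2 * y) (by simp; linarith)
  have h4 := g (1 + 4 * y) (by simp; linarith)
  have h5 := g (1 + 5 * y) (by simp; linarith)
  have h6 := g (1 + 6 * y) (by simp; linarith)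
  have h8 := g (1 + 8 * y) (by simp; linarith)
  have h10 := g (1 + 10 * y) (by simp; linarith)
  cases X
  · simp only [Family.mult, Family.gGamma, Family.phiGamma]
    rw [show 1 + (y - 1) = y by ring, show 2 + (y - 1) = 1 + y by ring,
      show 6 + 5 * (y - 1) = 1 + 5 * y by ring]
    push_cast; field_simp
  · simp only [Family.mult, Family.gGamma, Family.phiGamma]
    rw [show 1 + (y - 1) = y by ring, show 3 + 2 * (y - 1) = 1 + 2 * y by ring,
      show 7 + 6 * (y - 1) = 1 + 6 * y by ring]
    generalize Complex.Gamma (1 + 2 * y) = u at *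
    push_cast; field_simp
  · simp only [Family.mult, Family.gGamma, Family.phiGamma]
    rw [show 1 + (y - 1) = y by ring, show 5 + 4 * (y - 1) = 1 + 4 * y by ring,
      show 9 + 8 * (y - 1) = 1 + 8 * y by ring]
    generalize Complex.Gamma (1 + 4 * y) = u at *
    push_cast; field_simp
  · have hy0 : y ≠ 0 := fun h => by simp [h] at hy
    have r1 : Complex.Gamma (1 + y) = y * Complex.Gamma y := by
      rw [← Complex.Gamma_add_one _ hy0, add_comm]
    have r2 : Complex.Gamma (1 + 2 * y) = 2 * y * Complex.Gamma (2 * y) := by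
      rw [← Complex.Gamma_add_one _ (mul_ne_zero two_ne_zero hy0), add_comm]
    have q1 := g y hy
    have q2 := g (2 * y) (by simpa using hy)
    simp only [Family.mult, Family.gGamma, Family.phiGamma]
    rw [show 1 + (y - 1) = y by ring, show 2 + 2 * (y - 1) = 2 * y by ring,
      show 6 + 5 * (y - 1) = 1 + 5 * y by ring, show 11 + 10 * (y - 1) = 1 + 10 * y by ring,
      r1, r2]
    generalize Complex.Gamma (1 + 5 * y) = u at *
    generalize Complex.Gamma (1 + 10 * y) = v at *
    push_cast; field_simp

theorem Gamma_mul_Gamma_one_sub_ofReal (x : ℝ) :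
    Complex.Gamma x * Complex.Gamma (1 - x) = (Real.pi / Real.sin (Real.pi * x) : ℝ) := by
  rw [Complex.Gamma_mul_Gamma_one_sub]; push_cast; rfl

theorem Family.sn_root (X : Family) (j : Fin 4) :
    X.sn (X.idx j) = Real.sin (Real.pi * X.root j) := rfl

theorem Family.sn_root_pos (X : Family) (j : Fin 4) : 0 < X.sn (X.idx j) := by
  rw [X.sn_root]
  exact Real.sin_pos_of_pos_of_lt_pi (mul_pos Real.pi_pos (X.root_pos j))
    (by nlinarith [Real.pi_pos, X.root_lt_one j])

/-- The roots pair as a₀ + a₃ = a₁ + a₂ = 1, so the reflection formula turns the product of Gammas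
into π² over two sines, whose product is √κ/4. -/
theorem Family.gConst_eq (X : Family) :
    X.gConst = ((Real.sqrt X.kappa / (4 * Real.pi ^ 2) : ℝ) : ℂ) := by
  have h0 := Gamma_mul_Gamma_one_sub_ofReal (X.root 0)
  have h1 := Gamma_mul_Gamma_one_sub_ofReal (X.root 1)
  have e3 : (X.root 3 : ℂ) = 1 - X.root 0 := by rw [X.root_three]; push_cast; rfl
  have e2 : (X.root 2 : ℂ) = 1 - X.root 1 := by
    rw [show X.root 2 = 1 - X.root 1 from X.root_rev 1]; push_cast; rfl
  have hs := X.sn_mul_sn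
  rw [X.sn_root, X.sn_root] at hs
  have p0 := X.sn_root_pos 0
  have p1 := X.sn_root_pos 1
  rw [X.sn_root] at p0 p1
  rw [Family.gConst, Fin.prod_univ_four, e2, e3]
  rw [show ∀ a b c d : ℂ, a * b * c * d = (a * d) * (b * c) from fun a b c d => by ring, h0, h1,
    ← Complex.ofReal_mul, ← Complex.ofReal_inv]
  congr 1
  rw [show Real.sqrt X.kappa = 4 * (Real.sin (Real.pi * X.root 0) * Real.sin (Real.pi * X.root 1))
    by linarith]
  have := Real.pi_ne_zero
  field_simp

/-- In the residue formula Γ(a_j + a_i) becomes, after i ↦ 3 - i, Γ(a_j - a_i + 1). The leading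
coefficient of the local series supplies the complementary Γ(1 - (a_j - a_i)), so reflection leaves
only sines, to which `Family.sine_identity` applies. -/
theorem Family.V_coeff (X : Family) {e : Fin 4 → ℂ}
    (he : EqOn X.V (∑ j, e j • X.basis j) rightStrip) (j : Fin 4) :
    e j = ((-(X.mult * X.kappa / (X.deg * Real.pi ^ 4)) * (-1) ^ (X.deg - X.idx j) *
      X.sinProd (X.deg - X.idx j) : ℝ) : ℂ) := by
  have h := X.coeff_eq he j
  have hy : 0 < (1 - X.root j : ℂ).re := by simpa using X.root_lt_one j
  have hphi := X.gGamma_mul_phiGamma hy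
  have hg := X.gGamma_eq (s := 1 - X.root j) (by linarith [X.root_pos 0])
  have hG1 : Complex.Gamma (1 + (1 - X.root j)) ≠ 0 := Complex.Gamma_ne_zero_of_re_pos (by
    rw [Complex.add_re, Complex.one_re]; linarith)
  have hGa : Complex.Gamma (X.root j) ≠ 0 :=
    Complex.Gamma_ne_zero_of_re_pos (by simpa using X.root_pos j)
  have hGb : Complex.Gamma (1 - X.root j) ≠ 0 := Complex.Gamma_ne_zero_of_re_pos hy
  rw [hg, show (1 - X.root j : ℂ) - 1 = -X.root j by ring, ← X.phiCoeff_zero] at hphi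
  have hne : ∀ i ∈ Finset.univ.erase j, (X.root j : ℂ) - X.root i ≠ 0 := by
    intro i hi
    rw [sub_ne_zero]
    exact_mod_cast fun h => Finset.ne_of_mem_erase hi (X.root_strictMono.injective h).symm
  have hprod1 : ∏ i, Complex.Gamma (X.root j + X.root i) =
      (∏ i ∈ Finset.univ.erase j, ((X.root j : ℂ) - X.root i)) *
        ∏ i ∈ Finset.univ.erase j, Complex.Gamma (X.root j - X.root i) := by
    have e1 : ∏ i, Complex.Gamma (X.root j + X.root i) =
        ∏ i, Complex.Gamma (X.root j - X.root i + 1) := by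
      rw [← Equiv.prod_comp Fin.revPerm]
      refine Finset.prod_congr rfl fun i _ => ?_
      rw [Fin.revPerm_apply, X.root_rev]
      push_cast; congr 1; ring
    rw [e1, ← Finset.mul_prod_erase _ _ (Finset.mem_univ j), sub_self, zero_add,
      Complex.Gamma_one, one_mul, ← Finset.prod_mul_distrib]
    exact Finset.prod_congr rfl fun i hi => Complex.Gamma_add_one _ (hne i hi)
  have hprod2 : ∏ i, Complex.Gamma (1 - X.root j + X.root i) =
      ∏ i ∈ Finset.univ.erase j, Complex.Gamma (1 - (X.root j - X.root i)) := by
    rw [← Finset.mul_prod_erase _ _ (Finset.mem_univ j), sub_add_cancel, Complex.Gamma_one, one_mul]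
    exact Finset.prod_congr rfl fun i _ => by congr 1; ring
  have hprod3 : (∏ i ∈ Finset.univ.erase j, Complex.Gamma (X.root j - X.root i)) *
      ∏ i ∈ Finset.univ.erase j, Complex.Gamma (1 - (X.root j - X.root i)) =
      ((∏ i ∈ Finset.univ.erase j, (Real.pi / X.sn (X.idx j - X.idx i)) : ℝ) : ℂ) := by
    rw [← Finset.prod_mul_distrib, Complex.ofReal_prod]
    refine Finset.prod_congr rfl fun i _ => ?_
    have := Gamma_mul_Gamma_one_sub_ofReal (X.root j - X.root i)
    rw [Complex.ofReal_sub] at this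
    rw [this, Family.sn, sub_div]; rfl
  have hD : ∏ i ∈ Finset.univ.erase j, ((X.root j : ℂ) - X.root i) ≠ 0 :=
    Finset.prod_ne_zero_iff.2 hne
  have hexp : Complex.exp ((X.root j - 1) * Real.log X.lamR) *
      Complex.exp ((1 - X.root j) * Real.log X.lamR) = 1 := by
    rw [← Complex.exp_add, ← add_mul]; simp
  have hrefl := Gamma_mul_Gamma_one_sub_ofReal (X.root j)
  rw [← X.sn_root] at hrefl
  rw [hprod1] at h
  rw [hprod2] at hphi
  have hsp := X.sn_root_pos j
  have hpi := Real.pi_ne_zero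
  have hkap : Real.sqrt X.kappa ^ 2 = X.kappa := Real.sq_sqrt (by cases X <;> norm_num [Family.kappa])
  -- All Gammas enter through reflection pairs: three factors π/sin(πa_j) on the left and one factor
  -- for each i ≠ j on the right.
  have key : e j * ((Real.pi / X.sn (X.idx j) : ℝ) : ℂ) ^ 3 = X.mult * X.gConst ^ 2 *
      ((∏ i ∈ Finset.univ.erase j, (Real.pi / X.sn (X.idx j - X.idx i)) : ℝ) : ℂ) := by
    rw [← hprod3, ← hrefl]
    generalize (∏ i ∈ Finset.univ.erase j, Complex.Gamma (X.root j - X.root i)) = P1 at *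
    generalize (∏ i ∈ Finset.univ.erase j, Complex.Gamma (1 - (X.root j - X.root i))) = P2 at *
    generalize ∏ i ∈ Finset.univ.erase j, ((X.root j : ℂ) - X.root i) = D at *
    generalize Complex.exp ((X.root j - 1) * Real.log X.lamR) = E1 at *
    generalize Complex.exp ((1 - X.root j) * Real.log X.lamR) = E2 at *
    generalize Complex.Gamma (1 + (1 - X.root j)) = G1 at *
    generalize Complex.Gamma (X.root j) = Ga at *
    generalize Complex.Gamma (1 - X.root j) = Gb at *
    field_simp at h hphi
    linear_combination (-e j * Ga ^ 3) * hphi + (X.mult * X.gConst * E2 * P2) * h +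
      X.mult * X.gConst ^ 2 * P1 * P2 * hexp
  rw [X.gConst_eq] at key
  have hsne : ∀ i ∈ Finset.univ.erase j, X.sn (X.idx j - X.idx i) ≠ 0 := by
    intro i hi h0
    have h1 := X.sine_identity j
    rw [Finset.prod_eq_zero hi h0, mul_zero] at h1
    exact (mul_ne_zero X.deg_ne_zero (pow_ne_zero 3 hsp.ne')) h1
  have hcoe : ((Real.pi / X.sn (X.idx j) : ℝ) : ℂ) ^ 3 ≠ 0 :=
    pow_ne_zero _ (by exact_mod_cast div_ne_zero hpi hsp.ne')
  refine mul_right_cancel₀ hcoe (key.trans ?_)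
  have hS : ∏ i ∈ Finset.univ.erase j, X.sn (X.idx j - X.idx i) ≠ 0 :=
    Finset.prod_ne_zero_iff.2 hsne
  have hcard : (Finset.univ.erase j).card = 3 := by
    rw [Finset.card_erase_of_mem (Finset.mem_univ j)]; rfl
  rw [Finset.prod_div_distrib, Finset.prod_const, hcard]
  simp only [← Complex.ofReal_pow, ← Complex.ofReal_mul, Complex.ofReal_inj]
  have hid := X.sine_identity j
  have hdeg := X.deg_ne_zero
  rw [div_pow, div_pow, hkap]
  generalize ∏ i ∈ Finset.univ.erase j, X.sn (X.idx j - X.idx i) = S at *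
  generalize (-1 : ℝ) ^ (X.deg - X.idx j) = sg at *
  field_simp
  linear_combination X.mult * X.kappa * hid

/-! ### The functions ŵ_m and the row f in the basis at the origin, and their monodromy -/

theorem Family.alphaPow_add (X : Family) (x y : ℂ) :
    X.alphaPow (x + y) = X.alphaPow x * X.alphaPow y := by
  rw [Family.alphaPow, Family.alphaPow, Family.alphaPow, ← Complex.exp_add]; congr 1; ring

theorem Family.one_sub_alphaPow (X : Family) (x : ℝ) :
    1 - X.alphaPow x = -2 * Complex.I * X.sn x * X.alphaPow (x / 2) := by
  have e : X.alphaPow x = X.alphaPow (x / 2) * X.alphaPow (x / 2) := by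
    rw [← X.alphaPow_add]; congr 1; ring
  have h : X.alphaPow (x / 2) = Complex.exp (Real.pi * (x / X.deg) * Complex.I) := by
    rw [Family.alphaPow]; congr 1; ring
  have hs : (X.sn x : ℂ) = (Complex.exp (-(Real.pi * (x / X.deg)) * Complex.I) -
      Complex.exp (Real.pi * (x / X.deg) * Complex.I)) * Complex.I / 2 := by
    rw [Family.sn, Complex.ofReal_sin, Complex.sin]; push_cast; rfl
  rw [e, h, hs, neg_mul (Real.pi * (x / X.deg) : ℂ), Complex.exp_neg]
  have := Complex.exp_ne_zero (Real.pi * (x / X.deg) * Complex.I)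
  field_simp
  linear_combination (1 - Complex.exp (Real.pi * x * Complex.I / X.deg) ^ 2) * Complex.I_sq

theorem Family.alphaPow_deg_mul (X : Family) (k : ℕ) : X.alphaPow (X.deg * k / 2) = (-1) ^ k := by
  rw [Family.alphaPow, ← Complex.exp_pi_mul_I, ← Complex.exp_nat_mul]
  congr 1
  have : (X.deg : ℂ) ≠ 0 := by exact_mod_cast X.deg_pos.ne'
  field_simp

/-- Each of the five factors 1 - α^x is -2i sin(πx/d) α^{x/2}. The constants give (-2i)^5 = -32i,
and the half powers of α, together with α^{(k-1)/2}, add up to α^{dk/2} = (-1)^k. -/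
theorem Family.wFactor_mul (X : Family) (k : ℕ) :
    (1 - X.alphaPow 1) * X.wFactor k * X.alphaPow ((k - 1) / 2) * (1 - X.alphaPow k) =
      -32 * Complex.I * X.sn 1 * (-1) ^ k * X.sinProd k := by
  have h1 := X.one_sub_alphaPow 1
  have hk := X.one_sub_alphaPow k
  have h2 := X.one_sub_alphaPow (2 * k)
  have h4 := X.one_sub_alphaPow (4 * k)
  have h5 := X.one_sub_alphaPow (5 * k)
  push_cast at h1 hk h2 h4 h5
  have hI : Complex.I ^ 5 = Complex.I := by
    rw [show (5 : ℕ) = 4 + 1 from rfl, pow_succ, Complex.I_pow_four, one_mul]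
  have hpow : ∀ (x : ℂ) (n : ℕ), X.alphaPow x ^ n = X.alphaPow (n * x) := by
    intro x n
    rw [Family.alphaPow, Family.alphaPow, ← Complex.exp_nat_mul]; congr 1; ring
  have hd := X.alphaPow_deg_mul k
  rw [h1, hk, ← hd]
  cases X
  · have e : Family.quintic.alphaPow (Family.quintic.deg * k / 2) = Family.quintic.alphaPow (1 / 2) *
        Family.quintic.alphaPow ((k - 1) / 2) * Family.quintic.alphaPow (k / 2) ^ 4 := by
      rw [hpow, ← Family.alphaPow_add, ← Family.alphaPow_add, Family.deg]
      congr 1; push_cast; ring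
    simp only [Family.wFactor, Family.sinProd, hk, e]
    push_cast
    linear_combination (-32 * Family.quintic.sn 1 * Family.quintic.alphaPow (1 / 2) *
      Family.quintic.sn k ^ 4 * Family.quintic.alphaPow (k / 2) ^ 4 *
      Family.quintic.alphaPow ((k - 1) / 2)) * hI
  · have e : Family.sextic.alphaPow (Family.sextic.deg * k / 2) = Family.sextic.alphaPow (1 / 2) *
        Family.sextic.alphaPow ((k - 1) / 2) * Family.sextic.alphaPow (2 * k / 2) *
          Family.sextic.alphaPow (k / 2) ^ 3 := by
      rw [hpow, ← Family.alphaPow_add, ← Family.alphaPow_add, ← Family.alphaPow_add, Family.deg]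
      congr 1; push_cast; ring
    simp only [Family.wFactor, Family.sinProd, hk, h2, e]
    push_cast
    linear_combination (-32 * Family.sextic.sn 1 * Family.sextic.alphaPow (1 / 2) *
      Family.sextic.sn k ^ 3 * Family.sextic.alphaPow (k / 2) ^ 3 *
      Family.sextic.sn (2 * k) * Family.sextic.alphaPow (2 * k / 2) *
      Family.sextic.alphaPow ((k - 1) / 2)) * hI
  · have e : Family.octic.alphaPow (Family.octic.deg * k / 2) = Family.octic.alphaPow (1 / 2) *
        Family.octic.alphaPow ((k - 1) / 2) * Family.octic.alphaPow (4 * k / 2) *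
          Family.octic.alphaPow (k / 2) ^ 3 := by
      rw [hpow, ← Family.alphaPow_add, ← Family.alphaPow_add, ← Family.alphaPow_add, Family.deg]
      congr 1; push_cast; ring
    simp only [Family.wFactor, Family.sinProd, hk, h4, e]
    push_cast
    linear_combination (-32 * Family.octic.sn 1 * Family.octic.alphaPow (1 / 2) *
      Family.octic.sn k ^ 3 * Family.octic.alphaPow (k / 2) ^ 3 *
      Family.octic.sn (4 * k) * Family.octic.alphaPow (4 * k / 2) *
      Family.octic.alphaPow ((k - 1) / 2)) * hI
  · have e : Family.dectic.alphaPow (Family.dectic.deg * k / 2) = Family.dectic.alphaPow (1 / 2) *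
        Family.dectic.alphaPow ((k - 1) / 2) * Family.dectic.alphaPow (5 * k / 2) *
          Family.dectic.alphaPow (2 * k / 2) * Family.dectic.alphaPow (k / 2) ^ 2 := by
      rw [hpow, ← Family.alphaPow_add, ← Family.alphaPow_add, ← Family.alphaPow_add,
        ← Family.alphaPow_add, Family.deg]
      congr 1; push_cast; ring
    simp only [Family.wFactor, Family.sinProd, hk, h2, h5, e]
    push_cast
    linear_combination (-32 * Family.dectic.sn 1 * Family.dectic.alphaPow (1 / 2) *
      Family.dectic.sn k ^ 2 * Family.dectic.alphaPow (k / 2) ^ 2 *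
      Family.dectic.sn (5 * k) * Family.dectic.alphaPow (5 * k / 2) *
      Family.dectic.sn (2 * k) * Family.dectic.alphaPow (2 * k / 2) *
      Family.dectic.alphaPow ((k - 1) / 2)) * hI

theorem Family.alphaPow_deg_mul_nat (X : Family) (k : ℕ) {x : ℂ} (hx : x = X.deg * k) :
    X.alphaPow x = 1 := by
  have : (X.deg : ℂ) ≠ 0 := by exact_mod_cast X.deg_pos.ne'
  rw [Family.alphaPow, hx, Complex.exp_eq_one_iff]
  exact ⟨k, by push_cast; field_simp⟩

/-- For every k such that d - k is not one of the numbers in R_d, some factor of p_d(k) vanishes, so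
only the four genuine local solutions survive. -/
theorem Family.sum_phi (X : Family) (t : ℕ → ℂ) (ht : ∀ k, X.wFactor k = 0 → t k = 0) (ζ : ℂ) :
    ∑ k ∈ Finset.Icc 1 (X.deg - 1), t k * X.phi (X.deg - k) ζ =
      ∑ j, t (X.deg - X.idx j) * X.basis j ζ := by
  have h1 := fun (x : ℂ) (hx : x = X.deg * (1 : ℕ)) => X.alphaPow_deg_mul_nat 1 hx
  have h2 := fun (x : ℂ) (hx : x = X.deg * (2 : ℕ)) => X.alphaPow_deg_mul_nat 2 hx
  have h3 := fun (x : ℂ) (hx : x = X.deg * (3 : ℕ)) => X.alphaPow_deg_mul_nat 3 hx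
  have h4 := fun (x : ℂ) (hx : x = X.deg * (4 : ℕ)) => X.alphaPow_deg_mul_nat 4 hx
  cases X
  · rw [show Finset.Icc 1 (Family.quintic.deg - 1) = {1, 2, 3, 4} from by decide]
    simp [Fin.sum_univ_four, Family.deg, Family.idx, Family.basis]; ring
  · have t3 := ht 3 (by
      simp only [Family.wFactor]; rw [h1 (2 * (3 : ℕ)) (by norm_num [Family.deg])]; ring)
    rw [show Finset.Icc 1 (Family.sextic.deg - 1) = {1, 2, 3, 4, 5} from by decide]
    simp [Fin.sum_univ_four, Family.deg, Family.idx, Family.basis, t3]; ring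
  · have t2 := ht 2 (by
      simp only [Family.wFactor]; rw [h1 (4 * (2 : ℕ)) (by norm_num [Family.deg])]; ring)
    have t4 := ht 4 (by
      simp only [Family.wFactor]; rw [h2 (4 * (4 : ℕ)) (by norm_num [Family.deg])]; ring)
    have t6 := ht 6 (by
      simp only [Family.wFactor]; rw [h3 (4 * (6 : ℕ)) (by norm_num [Family.deg])]; ring)
    rw [show Finset.Icc 1 (Family.octic.deg - 1) = {1, 2, 3, 4, 5, 6, 7} from by decide]
    simp [Fin.sum_univ_four, Family.deg, Family.idx, Family.basis, t2, t4, t6]; ring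
  · have t2 := ht 2 (by
      simp only [Family.wFactor]; rw [h1 (5 * (2 : ℕ)) (by norm_num [Family.deg])]; ring)
    have t4 := ht 4 (by
      simp only [Family.wFactor]; rw [h2 (5 * (4 : ℕ)) (by norm_num [Family.deg])]; ring)
    have t5 := ht 5 (by
      simp only [Family.wFactor]; rw [h1 (2 * (5 : ℕ)) (by norm_num [Family.deg])]; ring)
    have t6 := ht 6 (by
      simp only [Family.wFactor]; rw [h3 (5 * (6 : ℕ)) (by norm_num [Family.deg])]; ring)
    have t8 := ht 8 (by
      simp only [Family.wFactor]; rw [h4 (5 * (8 : ℕ)) (by norm_num [Family.deg])]; ring)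
    rw [show Finset.Icc 1 (Family.dectic.deg - 1) = {1, 2, 3, 4, 5, 6, 7, 8, 9} from by decide]
    simp [Fin.sum_univ_four, Family.deg, Family.idx, Family.basis, t2, t4, t5, t6, t8]; ring

theorem Family.idx_le_deg (X : Family) (j : Fin 4) : X.idx j ≤ X.deg := by
  cases X <;> fin_cases j <;> simp [Family.idx, Family.deg]

theorem Family.alphaPow_sub_idx (X : Family) (j : Fin 4) :
    X.alphaPow ((X.deg - X.idx j : ℕ) : ℂ) = X.mono j := by
  have : (X.deg : ℂ) ≠ 0 := by exact_mod_cast X.deg_pos.ne'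
  rw [Family.alphaPow, Family.mono, Nat.cast_sub (X.idx_le_deg j), Family.root,
    Complex.exp_eq_exp_iff_exists_int]
  exact ⟨1, by push_cast; field_simp; ring⟩

/-- The coefficients of `wHat 0` with respect to the basis at the origin. -/
def Family.wCoeff (X : Family) (j : Fin 4) : ℂ :=
  (1 - X.alphaPow 1) * X.wFactor (X.deg - X.idx j) *
    X.alphaPow (((X.deg - X.idx j : ℕ) - 1) / 2)

/-- Here α^k with k = d - r is the monodromy eigenvalue e^{-2πi r/d}. Thus ŵ_m is the m-th monodromy
transform of ŵ_0, and a column of `N` acts as a polynomial in the eigenvalue. -/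
theorem Family.wHat_eq (X : Family) (m : ℕ) (ζ : ℂ) :
    X.wHat m ζ = ∑ j, X.wCoeff j * X.mono j ^ m * X.basis j ζ := by
  rw [Family.wHat, X.sum_phi (fun k => X.wFactor k * X.alphaPow (k * m + (k - 1) / 2))
    (fun k hk => by simp [hk]), Finset.mul_sum]
  refine Finset.sum_congr rfl fun j _ => ?_
  have : X.alphaPow ((X.deg - X.idx j : ℕ) * m) = X.mono j ^ m := by
    rw [← X.alphaPow_sub_idx, Family.alphaPow, Family.alphaPow, ← Complex.exp_nat_mul]
    congr 1; ring
  rw [X.alphaPow_add, this, Family.wCoeff]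
  ring

/-- The columns of the matrix `N` as polynomials in the monodromy eigenvalue. -/
def Family.colPoly (X : Family) (a : ℂ) (i : Fin 4) (x : ℂ) : ℂ :=
  X.matN a 0 i + X.matN a 1 i * x + X.matN a 2 i * x ^ 2 + X.matN a 3 i * x ^ (X.deg - 1)

theorem Family.f_eq (X : Family) (c a ζ : ℂ) (i : Fin 4) :
    X.f c a ζ i = ∑ j, c * X.wCoeff j * X.colPoly a i (X.mono j) * X.basis j ζ := by
  simp only [Family.f, Pi.smul_apply, smul_eq_mul, Matrix.vecMul, dotProduct, Fin.sum_univ_four,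
    X.wHat_eq, Family.colPoly]
  simp
  ring

theorem Family.isSolution_f (X : Family) (c a : ℂ) (i : Fin 4) :
    X.IsSolution fun ζ => X.f c a ζ i := by
  have := IsSolution.sum Finset.univ fun j (_ : j ∈ Finset.univ) => (X.isSolution_basis j).smul
    (c * X.wCoeff j * X.colPoly a i (X.mono j))
  convert this using 1
  ext ζ
  rw [X.f_eq, Finset.sum_apply]; rfl

theorem Family.f_add_two_pi_I (X : Family) (c a ζ : ℂ) (i : Fin 4) :
    X.f c a (ζ + 2 * Real.pi * Complex.I) i =
      ∑ j, c * X.wCoeff j * (X.colPoly a i (X.mono j) * X.mono j) * X.basis j ζ := by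
  rw [X.f_eq]
  refine Finset.sum_congr rfl fun j _ => ?_
  rw [X.basis_add_two_pi_I, ← Family.mono]; ring

/-- The polynomial annihilating the monodromy at the origin. -/
theorem Family.mono_relation (X : Family) (j : Fin 4) :
    X.mono j * X.mono j ^ (X.deg - 1) = 1 ∧
      (match X with
      | .quintic => Family.quintic.mono j ^ 4 + Family.quintic.mono j ^ 3 +
          Family.quintic.mono j ^ 2 + Family.quintic.mono j + 1 = 0
      | .sextic => Family.sextic.mono j ^ 4 + Family.sextic.mono j ^ 2 + 1 = 0
      | .octic => Family.octic.mono j ^ 4 + 1 = 0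
      | .dectic => Family.dectic.mono j ^ 4 - Family.dectic.mono j ^ 3 +
          Family.dectic.mono j ^ 2 - Family.dectic.mono j + 1 = 0) := by
  have hpow : X.mono j ^ X.deg = 1 := by
    rw [← X.alphaPow_sub_idx, Family.alphaPow, ← Complex.exp_nat_mul, Complex.exp_eq_one_iff]
    have : (X.deg : ℂ) ≠ 0 := by exact_mod_cast X.deg_pos.ne'
    exact ⟨(X.deg - X.idx j : ℕ), by push_cast; field_simp⟩
  refine ⟨by rw [← pow_succ', Nat.sub_add_cancel X.deg_pos, hpow], ?_⟩
  have hne : ∀ n : ℕ, ¬ X.deg ∣ X.idx j * n → X.mono j ^ n ≠ 1 := by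
    intro n hn h
    rw [Family.mono, ← Complex.exp_nat_mul, Complex.exp_eq_one_iff] at h
    obtain ⟨k, hk⟩ := h
    have hd : (X.deg : ℂ) ≠ 0 := by exact_mod_cast X.deg_pos.ne'
    have hp : (2 * Real.pi * Complex.I : ℂ) ≠ 0 := Complex.two_pi_I_ne_zero
    have h2 : -((X.idx j : ℂ) * n) = k * X.deg := by
      refine mul_left_cancel₀ hp ?_
      rw [Family.root] at hk
      push_cast at hk
      field_simp at hk
      linear_combination (2 * Real.pi * Complex.I) * hk
    have h3 : ((X.idx j * n : ℕ) : ℤ) = X.deg * (-k) := by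
      have : ((X.idx j * n : ℕ) : ℂ) = X.deg * (-k) := by push_cast; linear_combination -h2
      exact_mod_cast this
    exact hn (Int.natCast_dvd_natCast.1 ⟨-k, h3⟩)
  cases X
  · have h1 := sub_ne_zero.2 (hne 1 (by fin_cases j <;> simp [Family.idx, Family.deg]))
    simp only [Family.deg, pow_one] at hpow h1 ⊢
    exact mul_left_cancel₀ h1 (by linear_combination hpow)
  · have h1 := sub_ne_zero.2 (hne 2 (by fin_cases j <;> simp [Family.idx, Family.deg]))
    simp only [Family.deg] at hpow h1 ⊢
    exact mul_left_cancel₀ h1 (by linear_combination hpow)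
  · have h1 := sub_ne_zero.2 (hne 4 (by fin_cases j <;> simp [Family.idx, Family.deg]))
    simp only [Family.deg] at hpow h1 ⊢
    exact mul_left_cancel₀ h1 (by linear_combination hpow)
  · have h1 := sub_ne_zero.2 (hne 5 (by fin_cases j <;> simp [Family.idx, Family.deg]))
    have h2 := sub_ne_zero.2 (hne 2 (by fin_cases j <;> simp [Family.idx, Family.deg]))
    simp only [Family.deg] at hpow h1 h2 ⊢
    have h3 : Family.dectic.mono j ^ 5 + 1 = 0 :=
      mul_left_cancel₀ h1 (by linear_combination hpow)
    have h4 : Family.dectic.mono j + 1 ≠ 0 := fun h => h2 (by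
      linear_combination (Family.dectic.mono j - 1) * h)
    exact mul_left_cancel₀ h4 (by linear_combination h3)

/-- The monodromy of f₁, f₂, f₃ reduces to polynomial identities in one eigenvalue x, valid because
x^{d-1} = x⁻¹ and x is a root of the quartic in `Family.mono_relation`. -/
theorem Family.colPoly_monodromy (X : Family) (a : ℂ) (j : Fin 4) :
    (X.colPoly a 0 (X.mono j) * X.mono j - X.colPoly a 0 (X.mono j) =
      -X.colPoly a 3 (X.mono j)) ∧
    (X.colPoly a 1 (X.mono j) * X.mono j - X.colPoly a 1 (X.mono j) =
      -(X.colPoly a 0 (X.mono j) * X.mono j)) ∧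
    (X.colPoly a 2 (X.mono j) * X.mono j - X.colPoly a 2 (X.mono j) =
      -X.kappa * X.colPoly a 1 (X.mono j) +
        (X.kappa / 2 - a) * (X.colPoly a 0 (X.mono j) * X.mono j)) := by
  obtain ⟨h1, h2⟩ := X.mono_relation j
  simp only [Family.colPoly]
  generalize X.mono j ^ (X.deg - 1) = y at *
  have hx : X.mono j ≠ 0 := fun h => by simp [h] at h1
  have hy : y = (X.mono j)⁻¹ := eq_inv_of_mul_eq_one_right h1
  subst hy
  cases X
  · simp only at h2
    generalize Family.quintic.mono j = x at *
    simp [Family.matN, Family.kappa]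
    refine ⟨by ring, ?_, ?_⟩
    · field_simp; linear_combination h2
    · field_simp; linear_combination (2 * a - 5) * h2
  · simp only at h2
    generalize Family.sextic.mono j = x at *
    simp [Family.matN, Family.kappa]
    refine ⟨by ring, ?_, ?_⟩
    · field_simp; linear_combination h2
    · field_simp; linear_combination (2 * a - 3) * h2
  · simp only at h2
    generalize Family.octic.mono j = x at *
    simp [Family.matN, Family.kappa]
    refine ⟨by ring, ?_, ?_⟩
    · field_simp; linear_combination h2
    · field_simp; linear_combination (a - 1) * h2
  · simp only at h2
    generalize Family.dectic.mono j = x at *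
    simp [Family.matN, Family.kappa]
    refine ⟨by ring, ?_, ?_⟩
    · field_simp; linear_combination h2
    · field_simp; linear_combination (2 * a - 1) * h2

/-- The normalizing constant. -/
def Family.cN (X : Family) : ℝ := -(X.mult * X.kappa) / (16 * X.deg * Real.pi ^ 3 * X.sn 1)

theorem Family.sn_one_pos (X : Family) : 0 < X.sn 1 := by
  have h : (X.idx 0 : ℝ) = 1 := by cases X <;> simp [Family.idx]
  simpa [h] using X.sn_root_pos 0

theorem Family.cN_ne_zero (X : Family) : X.cN ≠ 0 := by
  have h1 := X.sn_one_pos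
  have h2 := X.deg_ne_zero
  have h3 : X.mult * X.kappa ≠ 0 := by cases X <;> norm_num [Family.mult, Family.kappa]
  rw [Family.cN]
  exact div_ne_zero (neg_ne_zero.2 h3) (mul_ne_zero (mul_ne_zero (mul_ne_zero (by norm_num) h2)
    (pow_ne_zero 3 Real.pi_ne_zero)) h1.ne')

/-- The last column of `N` is the polynomial 1 - x, which supplies the missing factor 1 - α^k in
`Family.wFactor_mul`. The coefficients then match those of `V`, and `cN` is chosen to make the ratio
-2πi. -/
theorem Family.f_three_eq (X : Family) (a : ℂ) :
    EqOn (fun ζ => X.f X.cN a ζ 3) (fun ζ => -(2 * Real.pi * Complex.I) * X.V ζ) rightStrip := by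
  obtain ⟨e, he⟩ := X.exists_V_eq_sum_basis
  intro ζ hζ
  simp only
  rw [X.f_eq, he hζ, Finset.sum_apply, Finset.mul_sum]
  refine Finset.sum_congr rfl fun j _ => ?_
  have h1 := X.wFactor_mul (X.deg - X.idx j)
  have h2 : X.colPoly a 3 (X.mono j) = 1 - X.mono j := by
    simp only [Family.colPoly]
    cases X <;> simp [Family.matN] <;> ring
  rw [X.alphaPow_sub_idx] at h1
  rw [h2, Family.wCoeff, Pi.smul_apply, smul_eq_mul, X.V_coeff he j, Family.cN]
  have hs : (X.sn 1 : ℂ) ≠ 0 := by exact_mod_cast X.sn_one_pos.ne'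
  have hd : (X.deg : ℂ) ≠ 0 := by exact_mod_cast X.deg_pos.ne'
  have hpi : (Real.pi : ℂ) ≠ 0 := by exact_mod_cast Real.pi_ne_zero
  rw [mul_assoc _ _ (1 - X.mono j), h1]
  push_cast
  generalize (-1 : ℂ) ^ (X.deg - X.idx j) = sg
  field_simp
  ring

/-! ### Convolutions along horizontal lines -/

/-- Correlation of `f` with a kernel along the horizontal line through `w`. -/
def correl (k : ℝ → ℂ) (f : ℂ → ℂ) (w : ℂ) : ℂ := ∫ x : ℝ, f (w + x) * k x

/-- A continuous kernel of size `O((1 + |x|)^j exp (s x))`. -/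
def KernelBound (k : ℝ → ℂ) (j : ℕ) (s : ℝ) : Prop :=
  Continuous k ∧ ∃ B : ℝ, ∀ x : ℝ, ‖k x‖ ≤ B * ((1 + |x|) ^ j * Real.exp (s * x))

theorem add_ofReal_mem_rightStrip {ζ : ℂ} (hζ : ζ ∈ rightStrip) (x : ℝ) : ζ + x ∈ rightStrip := by
  simpa [rightStrip] using hζ

theorem RapidStrip.exists_ball_correl {b s : ℝ} {j : ℕ} {k : ℝ → ℂ} {f : ℂ → ℂ}
    (hf : RapidStrip b f) (hk : KernelBound k j s) (hb : b < s) {w₀ : ℂ} (hw₀ : w₀ ∈ rightStrip) :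
    ∃ r > 0, ∃ A m : ℝ, 0 < m ∧ ∀ w ∈ ball w₀ r, w ∈ rightStrip ∧
      ∀ x : ℝ, ‖f (w + x) * k x‖ ≤ A * Real.exp (-(m * |x|)) := by
  have hw₀' : |w₀.im| < Real.pi / 2 := hw₀
  set r := (Real.pi / 2 - |w₀.im|) / 2 with hr
  have hr0 : 0 < r := by rw [hr]; linarith
  obtain ⟨B, hB⟩ := hk.2
  obtain ⟨A, m, hm, hA⟩ := (hf.2 (|w₀.im| + r) (by rw [hr]; linarith)).exists_bound hb j
  set R := |w₀.re| + r with hR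
  have hR0 : 0 ≤ R := by positivity
  refine ⟨r, hr0, |B| * ((1 + R) ^ j * Real.exp (|s| * R)) * (|A| * Real.exp (m * R)), m, hm,
    fun w hw => ?_⟩
  rw [mem_ball, dist_eq_norm] at hw
  have h1 := (Complex.abs_re_le_norm _).trans hw.le
  have h2 := (Complex.abs_im_le_norm _).trans hw.le
  rw [Complex.sub_re] at h1
  rw [Complex.sub_im] at h2
  have h3 : |w.im| ≤ |w₀.im| + r := by
    have := abs_add_le w₀.im (w.im - w₀.im); rw [add_sub_cancel] at this; linarith
  have h4 : |w.re| ≤ R := by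
    have := abs_add_le w₀.re (w.re - w₀.re); rw [add_sub_cancel] at this; linarith
  refine ⟨show |w.im| < _ by rw [hr] at h3; linarith, fun x => ?_⟩
  have hA' := hA (w + x) (by simpa using abs_le.1 h3)
  simp only [Complex.add_re, Complex.ofReal_re] at hA'
  set t := w.re + x with ht
  have h5 : |x| ≤ R + |t| := by
    have := abs_sub t w.re; rw [ht, add_sub_cancel_left] at this; rw [ht]; linarith
  have h6 : (1 + |x|) ^ j ≤ (1 + R) ^ j * (1 + |t|) ^ j := by
    rw [← mul_pow]
    gcongr
    nlinarith [abs_nonneg t]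
  have h7 : Real.exp (s * x) ≤ Real.exp (|s| * R) * Real.exp (s * t) := by
    rw [← Real.exp_add]
    gcongr
    have : -(s * w.re) ≤ |s| * R := by
      calc -(s * w.re) ≤ |s * w.re| := neg_le_abs _
        _ ≤ _ := by rw [abs_mul]; gcongr
    rw [ht]
    linarith
  have h8 : Real.exp (-(m * |t|)) ≤ Real.exp (m * R) * Real.exp (-(m * |x|)) := by
    rw [← Real.exp_add]
    gcongr
    nlinarith
  calc ‖f (w + x) * k x‖ ≤ ‖f (w + x)‖ * (|B| * (((1 + R) ^ j * (1 + |t|) ^ j) *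
        (Real.exp (|s| * R) * Real.exp (s * t)))) := by
        rw [norm_mul]
        gcongr
        exact (hB x).trans (by gcongr; exact le_abs_self B)
    _ = |B| * ((1 + R) ^ j * Real.exp (|s| * R)) *
        (‖f (w + x)‖ * (1 + |t|) ^ j * Real.exp (s * t)) := by ring
    _ ≤ |B| * ((1 + R) ^ j * Real.exp (|s| * R)) *
        (|A| * (Real.exp (m * R) * Real.exp (-(m * |x|)))) := by
        refine mul_le_mul_of_nonneg_left (hA'.trans ?_) (by positivity)
        gcongr
        exact le_abs_self A
    _ = _ := by ring

theorem RapidStrip.continuous_line {b : ℝ} {f : ℂ → ℂ} (hf : RapidStrip b f) {w : ℂ}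
    (hw : w ∈ rightStrip) : Continuous fun x : ℝ => f (w + x) := by
  rw [← continuousOn_univ]
  exact hf.1.continuousOn.comp (by fun_prop) fun x _ => add_ofReal_mem_rightStrip hw x

theorem RapidStrip.integrable_correl {b s : ℝ} {j : ℕ} {k : ℝ → ℂ} {f : ℂ → ℂ}
    (hf : RapidStrip b f) (hk : KernelBound k j s) (hb : b < s) {w : ℂ} (hw : w ∈ rightStrip) :
    Integrable fun x : ℝ => f (w + x) * k x := by
  obtain ⟨r, hr, A, m, hm, h⟩ := hf.exists_ball_correl hk hb hw
  exact ((integrable_exp_neg_mul_abs hm).const_mul A).mono'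
    ((hf.continuous_line hw).mul hk.1).aestronglyMeasurable
    (Eventually.of_forall (h w (mem_ball_self hr)).2)

theorem deriv_comp_add_ofReal (f : ℂ → ℂ) (x : ℝ) (w : ℂ) :
    deriv (fun w => f (w + x)) w = deriv f (w + x) := deriv_comp_add_const f (x : ℂ) w

theorem RapidStrip.hasDerivAt_correl {b s : ℝ} {j : ℕ} {k : ℝ → ℂ} {f : ℂ → ℂ}
    (hf : RapidStrip b f) (hk : KernelBound k j s) (hb : b < s) {w : ℂ} (hw : w ∈ rightStrip) :
    HasDerivAt (correl k f) (correl k (_root_.deriv f) w) w := by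
  obtain ⟨r, hr, A, m, hm, h⟩ := hf.exists_ball_correl hk hb hw
  have hdt : ∀ x : ℝ, DifferentiableOn ℂ (fun w => f (w + x)) (ball w r) := fun x =>
    hf.1.comp (by fun_prop) fun z hz => add_ofReal_mem_rightStrip (h z hz).1 _
  have := hasDerivAt_integral_of_holomorphic (μ := (volume : Measure ℝ)) hr
    (F := fun w (x : ℝ) => f (w + x) * k x) (bound := fun x => A * Real.exp (-(m * |x|)))
    (fun z hz => ((hf.continuous_line (h z hz).1).mul hk.1).aestronglyMeasurable)
    (Eventually.of_forall fun x => (hdt x).mul_const _)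
    (Eventually.of_forall fun x z hz => (h z hz).2 x)
    ((integrable_exp_neg_mul_abs hm).const_mul A)
  have e : correl k (_root_.deriv f) w =
      ∫ x : ℝ, _root_.deriv (fun w : ℂ => f (w + x) * k x) w := by
    rw [correl]
    refine integral_congr_ae (Eventually.of_forall fun x => ?_)
    simp only
    rw [deriv_mul_const ((hdt x).differentiableAt (isOpen_ball.mem_nhds (mem_ball_self hr))),
      deriv_comp_add_ofReal]
  rw [e]
  exact this

theorem RapidStrip.lin_correl {b s : ℝ} {j : ℕ} {k : ℝ → ℂ} {f : ℂ → ℂ}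
    (hf : RapidStrip b f) (hk : KernelBound k j s) (hb : b < s) (a : ℂ) :
    EqOn (CYStokes.lin a (correl k f)) (correl k (CYStokes.lin a f)) rightStrip := by
  intro w hw
  rw [CYStokes.lin, (hf.hasDerivAt_correl hk hb hw).deriv, correl, correl, correl,
    ← integral_const_mul, ← integral_add (hf.deriv.integrable_correl hk hb hw)
      ((hf.integrable_correl hk hb hw).const_mul a)]
  refine integral_congr_ae (Eventually.of_forall fun x => ?_)
  simp only [CYStokes.lin]
  ring

/-! ### Polynomial kernels -/

theorem kernelBound_pow (j : ℕ) : KernelBound (fun x : ℝ => ((x : ℂ) - Real.pi * Complex.I) ^ j) j 0 := by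
  refine ⟨by fun_prop, (1 + |(0 : ℝ)| + ‖(Real.pi * Complex.I : ℂ)‖) ^ j, fun x => ?_⟩
  simpa using norm_sub_pow_le (x : ℂ) (Real.pi * Complex.I) j

/-- Integration by parts along the line. The hypothesis b < 0 provides decay at the left end, where
the kernel contributes none. -/
theorem RapidStrip.correl_pow_deriv {b : ℝ} {f : ℂ → ℂ} (hf : RapidStrip b f) (hb : b < 0) (j : ℕ)
    {w : ℂ} (hw : w ∈ rightStrip) :
    correl (fun x => ((x : ℂ) - Real.pi * Complex.I) ^ j) (_root_.deriv f) w =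
      -(j * correl (fun x => ((x : ℂ) - Real.pi * Complex.I) ^ (j - 1)) f w) := by
  have hfd : ∀ x : ℝ, HasDerivAt (fun x : ℝ => f (w + x)) (_root_.deriv f (w + x)) x := fun x => by
    have h1 : HasDerivAt f (_root_.deriv f (w + x)) (w + x) :=
      (hf.1.differentiableAt (isOpen_rightStrip.mem_nhds (add_ofReal_mem_rightStrip hw x))).hasDerivAt
    have h2 : HasDerivAt (fun x : ℝ => w + (x : ℂ)) 1 x :=
      (Complex.ofRealCLM.hasDerivAt (x := x)).const_add w
    simpa [Function.comp_def] using h1.comp x h2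
  have hpd : ∀ x : ℝ, HasDerivAt (fun x : ℝ => ((x : ℂ) - Real.pi * Complex.I) ^ j)
      (j * ((x : ℂ) - Real.pi * Complex.I) ^ (j - 1)) x := fun x => by
    have h2 : HasDerivAt (fun x : ℝ => (x : ℂ) - Real.pi * Complex.I) 1 x :=
      (Complex.ofRealCLM.hasDerivAt (x := x)).sub_const _
    simpa using h2.fun_pow j
  have h := integral_mul_deriv_eq_deriv_mul_of_integrable (fun x _ => hpd x) (fun x _ => hfd x)
    (((hf.deriv.integrable_correl (kernelBound_pow j) hb hw)).congr
      (Eventually.of_forall fun x => mul_comm _ _))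
    ((((hf.integrable_correl (kernelBound_pow (j - 1)) hb hw)).const_mul (j : ℂ)).congr
      (Eventually.of_forall fun x => by simp only [Pi.mul_apply]; ring))
    (((hf.integrable_correl (kernelBound_pow j) hb hw)).congr
      (Eventually.of_forall fun x => mul_comm _ _))
  rw [correl, correl, ← integral_const_mul]
  calc _ = _ := integral_congr_ae (Eventually.of_forall fun x => mul_comm _ _)
    _ = _ := h
    _ = _ := by
      congr 1
      exact integral_congr_ae (Eventually.of_forall fun x => by simp only; ring)

/-- Three integrations by parts annihilate a polynomial of degree at most two. -/
theorem RapidStrip.correl_pow_deriv_three {b : ℝ} {f : ℂ → ℂ} (hf : RapidStrip b f) (hb : b < 0)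
    {j : ℕ} (hj : j ≤ 2) {w : ℂ} (hw : w ∈ rightStrip) :
    correl (fun x => ((x : ℂ) - Real.pi * Complex.I) ^ j) (_root_.deriv (_root_.deriv (_root_.deriv f))) w = 0 := by
  rw [hf.deriv.deriv.correl_pow_deriv hb j hw, hf.deriv.correl_pow_deriv hb (j - 1) hw,
    hf.correl_pow_deriv hb (j - 1 - 1) hw]
  interval_cases j <;> simp

theorem RapidStrip.exp_mul_sub {b : ℝ} {f : ℂ → ℂ} (hf : RapidStrip b f) :
    RapidStrip (b - 1) fun ζ => Complex.exp ζ * f ζ := by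
  refine ⟨hf.exp_mul.1, fun δ hδ => ?_⟩
  obtain ⟨C, c, hc, h⟩ := hf.2 δ hδ
  refine ⟨C, c, hc, fun ζ hζ => ?_⟩
  rw [norm_mul, Complex.norm_exp]
  calc _ ≤ Real.exp ζ.re * (C * (Real.exp (-(b * ζ.re)) * Real.exp (-(c * Real.exp ζ.re)))) := by
        gcongr; exact h ζ hζ
    _ = C * ((Real.exp ζ.re * Real.exp (-(b * ζ.re))) * Real.exp (-(c * Real.exp ζ.re))) := by ring
    _ = _ := by rw [← Real.exp_add]; congr 4; ring

/-- The kernel of the Stieltjes transform along the line opposite to the cut. -/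
def stieltjesKer (j : ℕ) (x : ℝ) : ℂ :=
  ((x : ℂ) - Real.pi * Complex.I) ^ j * (Complex.exp x / (1 + Complex.exp x))

theorem one_add_exp_ofReal_ne_zero (x : ℝ) : 1 + Complex.exp (x : ℂ) ≠ 0 := by
  rw [← Complex.ofReal_exp]
  exact_mod_cast (by positivity : (1 + Real.exp x) ≠ 0)

theorem kernelBound_stieltjesKer (j : ℕ) : KernelBound (stieltjesKer j) j 1 := by
  obtain ⟨hc, B, hB⟩ := kernelBound_pow j
  refine ⟨hc.mul ((by fun_prop : Continuous fun x : ℝ => Complex.exp x).div (by fun_prop)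
    one_add_exp_ofReal_ne_zero), B, fun x => ?_⟩
  have h1 : ‖Complex.exp (x : ℂ) / (1 + Complex.exp x)‖ ≤ Real.exp x := by
    rw [← Complex.ofReal_exp, ← Complex.ofReal_one, ← Complex.ofReal_add, ← Complex.ofReal_div,
      Complex.norm_real, Real.norm_eq_abs, abs_of_pos (by positivity)]
    exact div_le_self (Real.exp_pos x).le (by linarith [Real.exp_pos x])
  calc ‖stieltjesKer j x‖ ≤ (B * ((1 + |x|) ^ j * Real.exp (0 * x))) * Real.exp x := by
        rw [stieltjesKer, norm_mul]
        exact mul_le_mul (hB x) h1 (norm_nonneg _) ((norm_nonneg _).trans (hB x))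
    _ = _ := by simp; ring

/-- On the line at height Im ζ - π one has e^τ = -e^x e^ζ, so the kernel no longer depends on ζ and
all ζ-derivatives fall on the density. -/
theorem stieltjes_opposite (U : ℂ → ℂ) (j : ℕ) (ζ : ℂ) :
    stieltjes U j (ζ.im - Real.pi) ζ = correl (stieltjesKer j) U (ζ - Real.pi * Complex.I) := by
  rw [stieltjes, show ζ.im - Real.pi = -Real.pi + ζ.im by ring, ← lineInt_comp_add, lineInt, correl]
  refine integral_congr_ae (Eventually.of_forall fun x => ?_)
  have e : Complex.exp (x + (-Real.pi : ℝ) * Complex.I + ζ) = -(Complex.exp x * Complex.exp ζ) := by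
    rw [Complex.exp_add, Complex.exp_add]
    have : Complex.exp ((-Real.pi : ℝ) * Complex.I) = -1 := by
      rw [Complex.ofReal_neg, neg_mul, Complex.exp_neg, Complex.exp_pi_mul_I]; norm_num
    rw [this]; ring
  simp only
  rw [e, stieltjesKer, show (x : ℂ) + (-Real.pi : ℝ) * Complex.I + ζ - ζ = x - Real.pi * Complex.I by
    push_cast; ring, show (x : ℂ) + (-Real.pi : ℝ) * Complex.I + ζ = ζ - Real.pi * Complex.I + x by
    push_cast; ring]
  have h1 := one_add_exp_ofReal_ne_zero x
  have h2 : -(Complex.exp x * Complex.exp ζ) - Complex.exp ζ ≠ 0 := by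
    rw [show -(Complex.exp x * Complex.exp ζ) - Complex.exp ζ =
      -((1 + Complex.exp x) * Complex.exp ζ) by ring]
    exact neg_ne_zero.2 (mul_ne_zero h1 (Complex.exp_ne_zero _))
  field_simp
  rw [show -Complex.exp (x : ℂ) - 1 = -(1 + Complex.exp x) by ring]
  field_simp

theorem exp_mul_lin_one {f : ℂ → ℂ} {U : Set ℂ} (hU : IsOpen U) (hf : DifferentiableOn ℂ f U) :
    EqOn (fun ζ => Complex.exp ζ * lin 1 f ζ) (deriv fun ζ => Complex.exp ζ * f ζ) U := by
  intro ζ hζ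
  simp only
  rw [deriv_fun_mul Complex.differentiableAt_exp (hf.differentiableAt (hU.mem_nhds hζ)),
    Complex.deriv_exp, lin]
  ring

/-- Apply the operator under the integral and use the equation for V at w + x: the denominator 1 +
e^x cancels, leaving a polynomial of degree j times e^{w+x}(θ+1)³V = θ³(zV). Its integral vanishes
for j ≤ 2. The minus sign on the first term accounts for the later shift by -πi, which changes the
sign of e^w. -/
theorem Family.correl_DE (X : Family) {j : ℕ} (hj : j ≤ 2) {w : ℂ} (hw : w ∈ rightStrip) :
    -(Complex.exp w * lin 1 (lin 1 (lin 1 (correl (stieltjesKer j) X.V))) w) +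
      X.lamR * lin (X.root 0) (lin (X.root 1) (lin (X.root 2) (lin (X.root 3)
        (correl (stieltjesKer j) X.V)))) w = 0 := by
  have hV := X.rapidStrip_V
  have hb : X.gap < 1 := by have := X.root_pos 0; rw [Family.gap]; linarith
  have hk := kernelBound_stieltjesKer j
  have ho := isOpen_rightStrip
  have e1 : lin 1 (lin 1 (lin 1 (correl (stieltjesKer j) X.V))) w =
      correl (stieltjesKer j) (lin 1 (lin 1 (lin 1 X.V))) w := by
    rw [lin_eqOn ho (lin_eqOn ho (hV.lin_correl hk hb 1) 1) 1 hw,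
      lin_eqOn ho ((hV.lin 1).lin_correl hk hb 1) 1 hw, ((hV.lin 1).lin 1).lin_correl hk hb 1 hw]
  have e2 : lin (X.root 0) (lin (X.root 1) (lin (X.root 2) (lin (X.root 3)
        (correl (stieltjesKer j) X.V)))) w =
      correl (stieltjesKer j) (lin (X.root 0) (lin (X.root 1) (lin (X.root 2)
        (lin (X.root 3) X.V)))) w := by
    rw [lin_eqOn ho (lin_eqOn ho (lin_eqOn ho (hV.lin_correl hk hb _) _) _) _ hw,
      lin_eqOn ho (lin_eqOn ho ((hV.lin _).lin_correl hk hb _) _) _ hw,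
      lin_eqOn ho (((hV.lin _).lin _).lin_correl hk hb _) _ hw,
      (((hV.lin _).lin _).lin _).lin_correl hk hb _ hw]
  have hd1 : DifferentiableOn ℂ X.V rightStrip := hV.1
  have e3 : EqOn (fun ζ => Complex.exp ζ * lin 1 (lin 1 (lin 1 X.V)) ζ)
      (deriv (deriv (deriv fun ζ => Complex.exp ζ * X.V ζ))) rightStrip := by
    intro ζ hζ
    have h1 := exp_mul_lin_one ho ((hV.lin 1).lin 1).1 hζ
    have h2 := (exp_mul_lin_one ho (hV.lin 1).1).deriv ho hζ
    have h3 := ((exp_mul_lin_one ho hV.1).deriv ho).deriv ho hζ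
    exact h1.trans (h2.trans h3)
  have h0 := hV.exp_mul_sub.correl_pow_deriv_three (by linarith) hj hw
  rw [e1, e2, ← neg_eq_zero, ← h0, correl, correl, correl, ← integral_const_mul,
    ← integral_const_mul, neg_add, neg_neg, ← integral_neg, ← integral_add]
  · refine integral_congr_ae (Eventually.of_forall fun x => ?_)
    have hx := add_ofReal_mem_rightStrip hw x
    have h1 := X.DE_V hx
    have h2 := e3 hx
    simp only [Family.DE, Pi.zero_apply] at h1 h2
    simp only
    rw [← h2, stieltjesKer, Complex.exp_add]
    rw [Complex.exp_add] at h1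
    have h3 := one_add_exp_ofReal_ne_zero x
    field_simp
    linear_combination (-(x - Real.pi * Complex.I) ^ j) * h1
  · exact (((hV.lin 1).lin 1).lin 1).integrable_correl hk hb hw |>.const_mul _
  · exact ((((hV.lin _).lin _).lin _).lin _).integrable_correl hk hb hw |>.const_mul _ |>.neg

theorem eqOn_strip_of_eqOn_line {F G : ℂ → ℂ} {a b y : ℝ} (hy : y ∈ Ioo a b)
    (hF : DifferentiableOn ℂ F (Complex.im ⁻¹' Ioo a b))
    (hG : DifferentiableOn ℂ G (Complex.im ⁻¹' Ioo a b))
    (h : ∀ ζ : ℂ, ζ.im = y → F ζ = G ζ) : EqOn F G (Complex.im ⁻¹' Ioo a b) := by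
  have ho : IsOpen (Complex.im ⁻¹' Ioo a b) := isOpen_Ioo.preimage Complex.continuous_im
  have hc : IsPreconnected (Complex.im ⁻¹' Ioo a b) :=
    ((convex_Ioo _ _).is_linear_preimage Complex.imLm.isLinear).isPreconnected
  refine (hF.analyticOnNhd ho).eqOn_of_preconnected_of_frequently_eq (hG.analyticOnNhd ho) hc
    (z₀ := y * Complex.I) (by simpa using hy) ?_
  have ht : Tendsto (fun x : ℝ => (x : ℂ) + y * Complex.I) (𝓝[≠] 0) (𝓝[≠] (y * Complex.I)) := by
    refine tendsto_nhdsWithin_of_tendsto_nhds_of_eventually_within _ ?_ ?_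
    · refine ((by fun_prop : Continuous fun x : ℝ => (x : ℂ) + y * Complex.I).tendsto' 0 _
        (by simp)).mono_left nhdsWithin_le_nhds
    · filter_upwards [self_mem_nhdsWithin] with x hx
      simpa using hx
  exact ht.frequently (Eventually.of_forall fun x => h _ (by simp)).frequently

theorem isPreconnected_im_preimage_Ioo (a b : ℝ) : IsPreconnected (Complex.im ⁻¹' Ioo a b) :=
  ((convex_Ioo _ _).is_linear_preimage Complex.imLm.isLinear).isPreconnected

theorem RapidStrip.rapid_line {b : ℝ} {f : ℂ → ℂ} (hf : RapidStrip b f) {y : ℝ}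
    (hy : |y| < Real.pi / 2) : Rapid f b y y :=
  (hf.2 _ hy).mono (neg_abs_le y) (le_abs_self y)

theorem RapidStrip.continuous_line' {b : ℝ} {f : ℂ → ℂ} (hf : RapidStrip b f) {y : ℝ}
    (hy : |y| < Real.pi / 2) : Continuous fun x : ℝ => f (x + y * Complex.I) := by
  have := hf.continuous_line (w := y * Complex.I) (by simpa [rightStrip] using hy)
  simpa [add_comm] using this

theorem Family.gap_lt_one (X : Family) : X.gap < 1 := by
  have := X.root_pos 0; rw [Family.gap]; linarith

/-- Letting the line follow ζ at distance π gives a solution for π/2 < Im ζ < 3π/2, which extends to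
an entire one. For fixed η the transform agrees with it on Im ζ = η + π, hence throughout its strip
of holomorphy. -/
theorem Family.exists_stieltjes_solution (X : Family) {j : ℕ} (hj : j ≤ 2) :
    ∃ F, X.IsSolution F ∧ ∀ η : ℝ, |η| < Real.pi / 2 → ∀ ζ : ℂ, η < ζ.im →
      ζ.im < η + 2 * Real.pi → F ζ = -stieltjes X.V j η ζ := by
  have hV := X.rapidStrip_V
  set E : ℂ → ℂ := fun ζ => (-1 : ℂ) • correl (stieltjesKer j) X.V (ζ + -(Real.pi * Complex.I)) with hE
  -- For ζ in this strip the opposite line has height in (-π/2, π/2), where `V` is holomorphic and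
  -- decays.
  set S : Set ℂ := Complex.im ⁻¹' Ioo (Real.pi / 2) (3 * Real.pi / 2) with hS
  have hSm : ∀ ζ ∈ S, ζ + -(Real.pi * Complex.I) ∈ rightStrip := fun ζ hζ => by
    simp only [hS, mem_preimage, mem_Ioo] at hζ
    simp only [rightStrip, mem_ofPred_eq, abs_lt]
    constructor <;> simp <;> linarith [hζ.1, hζ.2]
  have hSo : IsOpen S := isOpen_Ioo.preimage Complex.continuous_im
  have hEd : DifferentiableOn ℂ E S := by
    have h1 : DifferentiableOn ℂ (correl (stieltjesKer j) X.V) rightStrip := fun w hw =>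
      ((hV.hasDerivAt_correl (kernelBound_stieltjesKer j) X.gap_lt_one
        hw).differentiableAt).differentiableWithinAt
    have h2 : DifferentiableOn ℂ (fun ζ : ℂ => ζ + -(Real.pi * Complex.I)) S := by fun_prop
    exact (h1.comp h2 hSm).const_smul (-1 : ℂ)
  have hED : ∀ ζ ∈ S, X.DE E ζ = 0 := fun ζ hζ => by
    have e : E = (-1 : ℂ) • fun ζ => correl (stieltjesKer j) X.V (ζ + -(Real.pi * Complex.I)) := rfl
    have h := X.correl_DE hj (hSm ζ hζ)
    have e2 : Complex.exp (ζ + -(Real.pi * Complex.I)) = -Complex.exp ζ := by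
      rw [← sub_eq_add_neg, Complex.exp_sub_pi_mul_I]
    rw [e2] at h
    simp only [Family.DE, e, lin_smul, lin_comp_add, Pi.smul_apply, smul_eq_mul]
    linear_combination -h
  obtain ⟨e, he⟩ := X.exists_eq_sum_basis hSo (isPreconnected_im_preimage_Ioo _ _)
    ⟨Real.pi * Complex.I, by simp [hS]; constructor <;> linarith [Real.pi_pos]⟩ hEd hED
  have hsol : X.IsSolution (∑ i, e i • X.basis i) :=
    Family.IsSolution.sum _ fun i _ => (X.isSolution_basis i).smul _
  refine ⟨_, hsol, fun η hη ζ h1 h2 => ?_⟩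
  obtain ⟨hη1, hη2⟩ := abs_lt.1 hη
  refine eqOn_strip_of_eqOn_line (a := η) (b := η + 2 * Real.pi) (y := η + Real.pi)
    ⟨by linarith [Real.pi_pos], by linarith [Real.pi_pos]⟩ hsol.1.differentiableOn
    (G := fun ζ => -stieltjes X.V j η ζ) (fun z hz => ((hV.rapid_line hη).differentiableAt_stieltjes
      X.gap_lt_one (hV.continuous_line' hη) j hz.1 hz.2).neg.differentiableWithinAt)
    (fun z hz => ?_) ⟨h1, h2⟩
  have hz' : z ∈ S := by rw [hS, mem_preimage, hz]; constructor <;> linarith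
  rw [← he hz', hE]
  simp only
  rw [← sub_eq_add_neg, ← stieltjes_opposite, hz, add_sub_cancel_right, neg_one_smul]

/-! ### Derivatives of the formal series with respect to the parameter -/

theorem exp_add_mul_abs_le (σ r x : ℝ) :
    Real.exp (σ * x + r * |x|) ≤ Real.exp ((σ + r) * x) + Real.exp ((σ - r) * x) := by
  rcases abs_cases x with ⟨h, -⟩ | ⟨h, -⟩
  · rw [h, show σ * x + r * x = (σ + r) * x by ring]; linarith [Real.exp_pos ((σ - r) * x)]
  · rw [h, show σ * x + r * -x = (σ - r) * x by ring]; linarith [Real.exp_pos ((σ + r) * x)]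

/-- For p near p₀ the factor |e^{px}| is bounded by two exponentials with exponents Re p₀ ± r, both
still larger than b. -/
theorem Rapid.exists_ball_bound {f : ℂ → ℂ} {b : ℝ} (hf : Rapid f b 0 0) (j : ℕ) (ζ : ℂ) {p₀ : ℂ}
    (hp : b < p₀.re) : ∃ r > 0, ∃ A m : ℝ, 0 < m ∧ ∀ p ∈ ball p₀ r, ∀ x : ℝ,
      ‖f x * ((x - ζ) ^ j * Complex.exp (p * (x - ζ)))‖ ≤ A * Real.exp (-(m * |x|)) := by
  set r := (p₀.re - b) / 2 with hr
  have hr0 : 0 < r := by rw [hr]; linarith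
  obtain ⟨A₁, m₁, hm₁, h₁⟩ := hf.exists_bound (s := p₀.re + r) (by rw [hr]; linarith) j
  obtain ⟨A₂, m₂, hm₂, h₂⟩ := hf.exists_bound (s := p₀.re - r) (by rw [hr]; linarith) j
  set D := (1 + ‖ζ‖) ^ j * Real.exp ((‖p₀‖ + r) * ‖ζ‖) with hD
  refine ⟨r, hr0, D * (|A₁| + |A₂|), min m₁ m₂, lt_min hm₁ hm₂, fun p hp x => ?_⟩
  have k₁ := h₁ x (by simp)
  have k₂ := h₂ x (by simp)
  simp only [Complex.ofReal_re] at k₁ k₂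
  rw [mem_ball, dist_eq_norm] at hp
  have e1 : ‖((x : ℂ) - ζ) ^ j‖ ≤ (1 + ‖ζ‖) ^ j * (1 + |x|) ^ j := by
    simpa using norm_sub_pow_le (x : ℂ) ζ j
  have e2 : ‖Complex.exp (p * (x - ζ))‖ ≤ Real.exp ((‖p₀‖ + r) * ‖ζ‖) *
      (Real.exp ((p₀.re + r) * x) + Real.exp ((p₀.re - r) * x)) := by
    refine le_trans ?_ (mul_le_mul_of_nonneg_left (exp_add_mul_abs_le p₀.re r x) (Real.exp_pos _).le)
    rw [Complex.norm_exp, ← Real.exp_add]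
    gcongr
    have n1 : (p * ζ).re ≥ -((‖p₀‖ + r) * ‖ζ‖) := by
      have n2 : ‖p‖ ≤ ‖p₀‖ + r := by
        have := norm_add_le p₀ (p - p₀); rw [add_sub_cancel] at this; linarith
      have n3 := (abs_le.1 (Complex.abs_re_le_norm (p * ζ))).1
      rw [norm_mul] at n3
      nlinarith [norm_nonneg ζ]
    have n4 : (p.re - p₀.re) * x ≤ r * |x| := by
      calc _ ≤ |(p.re - p₀.re) * x| := le_abs_self _
        _ = |p.re - p₀.re| * |x| := abs_mul _ _
        _ ≤ _ := by
          gcongr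
          have := Complex.abs_re_le_norm (p - p₀)
          rw [Complex.sub_re] at this
          linarith
    have n5 : (p * (x - ζ)).re = p.re * x - (p * ζ).re := by
      rw [mul_sub, Complex.sub_re, Complex.re_mul_ofReal]
    rw [n5]
    linarith
  have e3 : A₁ * Real.exp (-(m₁ * |x|)) ≤ |A₁| * Real.exp (-(min m₁ m₂ * |x|)) := by
    gcongr
    · exact le_abs_self _
    · exact min_le_left _ _
  have e4 : A₂ * Real.exp (-(m₂ * |x|)) ≤ |A₂| * Real.exp (-(min m₁ m₂ * |x|)) := by
    gcongr
    · exact le_abs_self _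
    · exact min_le_right _ _
  calc _ ≤ ‖f x‖ * (((1 + ‖ζ‖) ^ j * (1 + |x|) ^ j) * (Real.exp ((‖p₀‖ + r) * ‖ζ‖) *
      (Real.exp ((p₀.re + r) * x) + Real.exp ((p₀.re - r) * x)))) := by
        rw [norm_mul, norm_mul]; gcongr
    _ = D * (‖f x‖ * (1 + |x|) ^ j * Real.exp ((p₀.re + r) * x) +
        ‖f x‖ * (1 + |x|) ^ j * Real.exp ((p₀.re - r) * x)) := by rw [hD]; ring
    _ ≤ D * (|A₁| * Real.exp (-(min m₁ m₂ * |x|)) + |A₂| * Real.exp (-(min m₁ m₂ * |x|))) :=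
        mul_le_mul_of_nonneg_left (add_le_add (k₁.trans e3) (k₂.trans e4)) (by positivity)
    _ = _ := by ring

theorem integral_add_mul_add_mul {f g h : ℝ → ℂ} (hf : Integrable f) (hg : Integrable g)
    (hh : Integrable h) (c d : ℂ) :
    ∫ x, (f x + c * g x + d * h x) = (∫ x, f x) + c * (∫ x, g x) + d * (∫ x, h x) := by
  rw [integral_add (f := fun x => f x + c * g x) (hf.add (hg.const_mul c)) (hh.const_mul d),
    integral_add hf (hg.const_mul c), integral_const_mul, integral_const_mul]

/-- The moments of `V` against `(τ - ζ)^j exp (p (τ - ζ))`. -/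
def Family.logMoment (X : Family) (j : ℕ) (ζ p : ℂ) : ℂ :=
  ∫ x : ℝ, X.V x * ((x - ζ) ^ j * Complex.exp (p * (x - ζ)))

theorem Family.continuous_V (X : Family) : Continuous fun x : ℝ => X.V x := by
  simpa using X.rapidStrip_V.continuous_line (w := 0) (by simp [rightStrip, Real.pi_pos])

theorem Family.rapid_V (X : Family) : Rapid X.V X.gap 0 0 :=
  X.rapidStrip_V.rapid_line (by simp [Real.pi_pos])

theorem Family.hasDerivAt_logMoment (X : Family) (j : ℕ) (ζ : ℂ) {p : ℂ} (hp : X.gap < p.re) :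
    HasDerivAt (X.logMoment j ζ) (X.logMoment (j + 1) ζ p) p := by
  obtain ⟨r, hr, A, m, hm, h⟩ := X.rapid_V.exists_ball_bound j ζ hp
  have hdx : ∀ (x : ℝ) (p : ℂ), HasDerivAt
      (fun p => X.V x * ((x - ζ) ^ j * Complex.exp (p * (x - ζ))))
      (X.V x * ((x - ζ) ^ (j + 1) * Complex.exp (p * (x - ζ)))) p := fun x p => by
    have := ((((hasDerivAt_id p).mul_const ((x : ℂ) - ζ)).cexp).const_mul ((x - ζ) ^ j)).const_mul
      (X.V x)
    exact this.congr_deriv (by simp only [id_eq]; ring)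
  have := hasDerivAt_integral_of_holomorphic (μ := (volume : Measure ℝ)) hr
    (F := fun p (x : ℝ) => X.V x * ((x - ζ) ^ j * Complex.exp (p * (x - ζ))))
    (bound := fun x => A * Real.exp (-(m * |x|)))
    (fun p _ => (X.continuous_V.mul (by fun_prop)).aestronglyMeasurable)
    (Eventually.of_forall fun x p _ => (hdx x p).differentiableAt.differentiableWithinAt)
    (Eventually.of_forall fun x p hp => h p hp x)
    ((integrable_exp_neg_mul_abs hm).const_mul A)
  have e : X.logMoment (j + 1) ζ p = ∫ x : ℝ,
      deriv (fun p => X.V x * ((x - ζ) ^ j * Complex.exp (p * (x - ζ)))) p := by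
    rw [Family.logMoment]
    exact integral_congr_ae (Eventually.of_forall fun x => ((hdx x p).deriv).symm)
  rw [e]
  exact this

/-- The Gamma quotient is a moment of V, so the term is ∫ V(x) e^{(n+1+ρ)(x-ζ)} dx; each
ρ-derivative then brings down a factor x - ζ. -/
theorem Family.GTerm_eq (X : Family) (n : ℕ) (ζ : ℂ) {ρ : ℂ} (hρ : -X.root 0 < ρ.re) :
    X.GTerm n ζ ρ = X.logMoment 0 ζ (n + 1 + ρ) := by
  have hn : (0 : ℝ) ≤ n := n.cast_nonneg
  rw [Family.GTerm, ← X.moment_V (by simp; linarith), moment, Family.logMoment, ← integral_mul_const]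
  refine integral_congr_ae (Eventually.of_forall fun x => ?_)
  simp only
  rw [mul_assoc, ← Complex.exp_add, pow_zero, one_mul]
  ring_nf

theorem Family.eventually_neg_root_lt_re (X : Family) : ∀ᶠ ρ : ℂ in 𝓝 0, -X.root 0 < ρ.re :=
  (Complex.continuous_re.tendsto 0).eventually_const_lt (by simpa using X.root_pos 0)

theorem Family.hasDerivAt_logMoment_add (X : Family) (j n : ℕ) (ζ : ℂ) {ρ : ℂ}
    (hρ : -X.root 0 < ρ.re) : HasDerivAt (fun ρ => X.logMoment j ζ (n + 1 + ρ))
      (X.logMoment (j + 1) ζ (n + 1 + ρ)) ρ := by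
  have hn : (0 : ℝ) ≤ n := n.cast_nonneg
  exact (X.hasDerivAt_logMoment j ζ (by rw [Family.gap]; simp; linarith)).comp_const_add _ _

theorem Family.deriv_GTerm_eventuallyEq (X : Family) (n : ℕ) (ζ : ℂ) :
    deriv (X.GTerm n ζ) =ᶠ[𝓝 0] fun ρ => X.logMoment 1 ζ (n + 1 + ρ) := by
  have h : X.GTerm n ζ =ᶠ[𝓝 0] fun ρ => X.logMoment 0 ζ (n + 1 + ρ) := by
    filter_upwards [X.eventually_neg_root_lt_re] with ρ hρ using X.GTerm_eq n ζ hρ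
  refine h.deriv.trans ?_
  filter_upwards [X.eventually_neg_root_lt_re] with ρ hρ
  exact (X.hasDerivAt_logMoment_add 0 n ζ hρ).deriv

theorem Family.GTerm_zero (X : Family) (n : ℕ) (ζ : ℂ) :
    X.GTerm n ζ 0 = X.logMoment 0 ζ (n + 1) := by
  rw [X.GTerm_eq n ζ (by simpa using X.root_pos 0), add_zero]

theorem Family.deriv_GTerm_zero (X : Family) (n : ℕ) (ζ : ℂ) :
    deriv (X.GTerm n ζ) 0 = X.logMoment 1 ζ (n + 1) := by
  simpa using (X.deriv_GTerm_eventuallyEq n ζ).self_of_nhds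

theorem Family.iteratedDeriv_two_GTerm_zero (X : Family) (n : ℕ) (ζ : ℂ) :
    iteratedDeriv 2 (X.GTerm n ζ) 0 = X.logMoment 2 ζ (n + 1) := by
  rw [iteratedDeriv_succ, iteratedDeriv_one, (X.deriv_GTerm_eventuallyEq n ζ).deriv_eq,
    (X.hasDerivAt_logMoment_add 1 n ζ (by simpa using X.root_pos 0)).deriv, add_zero]

theorem Family.gap_lt_nat_add_one (X : Family) (n : ℕ) : X.gap < n + 1 := by
  have : (0 : ℝ) ≤ n := n.cast_nonneg
  linarith [X.gap_lt_one]

/-- The integrand has no poles, so the line may be moved to the real axis and the terms do not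
depend on η. -/
theorem Family.stieltjesTerm_V (X : Family) (j n : ℕ) {η : ℝ} (hη : |η| < Real.pi / 2) (ζ : ℂ) :
    stieltjesTerm X.V j n η ζ = X.logMoment j ζ (n + 1) := by
  have h0 : X.logMoment j ζ (n + 1) = stieltjesTerm X.V j n 0 ζ := by
    simp [Family.logMoment, stieltjesTerm, lineInt]
  have hV := X.rapidStrip_V
  have key : ∀ δ, δ < Real.pi / 2 →
      ExpDecay (fun τ => X.V τ * ((τ - ζ) ^ j * Complex.exp ((n + 1) * (τ - ζ)))) (-δ) δ ∧
      DifferentiableOn ℂ (fun τ => X.V τ * ((τ - ζ) ^ j * Complex.exp ((n + 1) * (τ - ζ))))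
        (Complex.im ⁻¹' Icc (-δ) δ) := fun δ hδ => by
    constructor
    · obtain ⟨A, m, hm, h⟩ := (hV.2 δ hδ).exists_bound (X.gap_lt_nat_add_one n) j
      refine ⟨((1 + |δ| + ‖ζ‖) ^ j * Real.exp (-((n + 1) * ζ.re))) * A, m, hm, fun τ hτ => ?_⟩
      have e1 := norm_sub_pow_le τ ζ j
      have e2 : |τ.im| ≤ |δ| := (abs_le.2 hτ).trans (le_abs_self δ)
      have e3 : ((n + 1 : ℂ) * (τ - ζ)).re = -((n + 1) * ζ.re) + (n + 1) * τ.re := by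
        simp; ring
      rw [norm_mul, norm_mul, Complex.norm_exp, e3, Real.exp_add]
      calc _ ≤ ‖X.V τ‖ * (((1 + |δ| + ‖ζ‖) ^ j * (1 + |τ.re|) ^ j) *
            (Real.exp (-((n + 1) * ζ.re)) * Real.exp ((n + 1) * τ.re))) := by
            gcongr
            exact e1.trans (by gcongr)
        _ = ((1 + |δ| + ‖ζ‖) ^ j * Real.exp (-((n + 1) * ζ.re))) *
            (‖X.V τ‖ * (1 + |τ.re|) ^ j * Real.exp ((n + 1) * τ.re)) := by ring
        _ ≤ _ := by rw [mul_assoc _ A]; exact mul_le_mul_of_nonneg_left (h τ hτ) (by positivity)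
    · refine (hV.1.mono fun τ hτ => ?_).mul (by fun_prop)
      exact (abs_le.2 hτ).trans_lt hδ
  obtain ⟨h1, h2⟩ := key |η| hη
  have l1 := (h1.mono (le_refl _) (le_abs_self η)).lineInt_eq (neg_abs_le η)
    (h2.mono (preimage_mono (Icc_subset_Icc_right (le_abs_self η))))
  have l2 := (h1.mono (le_refl _) (abs_nonneg η)).lineInt_eq (by simp)
    (h2.mono (preimage_mono (Icc_subset_Icc_right (abs_nonneg η))))
  rw [h0, stieltjesTerm, stieltjesTerm, ← l1, l2]

theorem Family.integrable_logMoment (X : Family) (j n : ℕ) (ζ : ℂ) :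
    Integrable fun x : ℝ => X.V x * ((x - ζ) ^ j * Complex.exp ((n + 1) * (x - ζ))) := by
  simpa using X.rapid_V.integrable_term X.gap_lt_one (by simpa using X.continuous_V) j n ζ

/-- The exponent is an integer multiple of x - ζ, hence the exponential is unchanged modulo 2πi;
only (x - ζ)^j changes, by the binomial formula. -/
theorem Family.logMoment_shift (X : Family) (n : ℕ) (k : ℤ) (ζ : ℂ) :
    X.logMoment 0 (ζ - k * (2 * Real.pi * Complex.I)) (n + 1) = X.logMoment 0 ζ (n + 1) ∧
    X.logMoment 1 (ζ - k * (2 * Real.pi * Complex.I)) (n + 1) =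
      X.logMoment 1 ζ (n + 1) + k * (2 * Real.pi * Complex.I) * X.logMoment 0 ζ (n + 1) ∧
    X.logMoment 2 (ζ - k * (2 * Real.pi * Complex.I)) (n + 1) =
      X.logMoment 2 ζ (n + 1) + 2 * (k * (2 * Real.pi * Complex.I)) * X.logMoment 1 ζ (n + 1) +
        (k * (2 * Real.pi * Complex.I)) ^ 2 * X.logMoment 0 ζ (n + 1) := by
  have he : ∀ x : ℝ, Complex.exp ((n + 1) * (x - (ζ - k * (2 * Real.pi * Complex.I)))) =
      Complex.exp ((n + 1) * (x - ζ)) := fun x => by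
    rw [show ((n : ℂ) + 1) * (x - (ζ - k * (2 * Real.pi * Complex.I))) =
      (n + 1) * (x - ζ) + ((n + 1) * k : ℤ) * (2 * Real.pi * Complex.I) by push_cast; ring,
      Complex.exp_add, Complex.exp_int_mul_two_pi_mul_I, mul_one]
  have i0 := X.integrable_logMoment 0 n ζ
  have i1 := X.integrable_logMoment 1 n ζ
  have i2 := X.integrable_logMoment 2 n ζ
  simp only [Family.logMoment, he]
  refine ⟨by simp, ?_, ?_⟩
  · rw [← integral_const_mul, ← integral_add i1 (i0.const_mul _)]
    exact integral_congr_ae (Eventually.of_forall fun x => by simp only; ring)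
  · rw [← integral_add_mul_add_mul i2 i1 i0]
    exact integral_congr_ae (Eventually.of_forall fun x => by simp only; ring)

/-! ### The first three solutions as Stieltjes transforms -/

theorem isLittleO_of_eq_neg_stieltjes {X : Family} {F : ℂ → ℂ} {j : ℕ} {η α β : ℝ}
    (hη : |η| < Real.pi / 2) (hα : η < α) (hβ : β < η + 2 * Real.pi)
    (hF : ∀ ζ : ℂ, η < ζ.im → ζ.im < η + 2 * Real.pi → F ζ = -stieltjes X.V j η ζ) (N : ℕ) :
    (fun ζ => F ζ - ∑ n ∈ Finset.range N, X.logMoment j ζ (n + 1))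
      =o[comap Complex.re atTop ⊓ 𝓟 {ζ : ℂ | α ≤ ζ.im ∧ ζ.im ≤ β}]
      fun ζ : ℂ => Real.exp (-(N * ζ.re)) := by
  have hV := X.rapidStrip_V
  refine ((hV.rapid_line hη).stieltjes_isLittleO X.gap_lt_one (hV.continuous_line' hη) j hα hβ
    N).neg_left.congr' ?_ EventuallyEq.rfl
  filter_upwards [mem_inf_of_right (mem_principal_self _)] with ζ hζ
  rw [hF ζ (hα.trans_le hζ.1) (hζ.2.trans_lt hβ)]
  simp only [X.stieltjesTerm_V j _ hη]
  ring

theorem Family.eq_of_eqOn_rightStrip {F G : ℂ → ℂ} (hF : Differentiable ℂ F)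
    (hG : Differentiable ℂ G) (h : EqOn F G rightStrip) : F = G := by
  refine AnalyticOnNhd.eq_of_eventuallyEq (z₀ := 0) (fun z _ => hF.analyticAt z)
    (fun z _ => hG.analyticAt z) ?_
  filter_upwards [isOpen_rightStrip.mem_nhds (by simp [rightStrip, Real.pi_pos] : (0 : ℂ) ∈ rightStrip)]
    with z hz using h hz

theorem Family.integrable_kernel_V (X : Family) (j : ℕ) {η : ℝ} (hη : |η| < Real.pi / 2) {ζ : ℂ}
    (h0 : η ≠ ζ.im) (h1 : ζ.im - 2 * Real.pi < η) (h2 : η < ζ.im + 2 * Real.pi) :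
    Integrable fun x : ℝ => X.V (x + η * Complex.I) * (x + η * Complex.I - ζ) ^ j *
      (Complex.exp (x + η * Complex.I) / (Complex.exp (x + η * Complex.I) - Complex.exp ζ)) := by
  have hV := X.rapidStrip_V
  refine ((hV.rapid_line hη).tame_mul_pow X.gap_lt_one ζ j).integrable_kernel ?_ h0 h1 h2
  refine (hV.1.continuousOn.mono fun τ hτ => ?_).mul (by fun_prop)
  have : τ.im = η := le_antisymm hτ.2 hτ.1
  rw [rightStrip, mem_ofPred_eq, this]
  exact hη

/-- The jumps of the transforms of `V` across the line `arg z = 0`. -/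
theorem Family.stieltjes_jump (X : Family) {η₁ η₂ : ℝ} {ζ : ℂ} (h1 : -(Real.pi / 2) < η₁)
    (h2 : η₁ < ζ.im) (h3 : ζ.im < η₂) (h4 : η₂ < Real.pi / 2) :
    stieltjes X.V 0 η₂ (ζ + 2 * Real.pi * Complex.I) =
      stieltjes X.V 0 η₁ ζ - 2 * Real.pi * Complex.I * X.V ζ ∧
    stieltjes X.V 1 η₂ (ζ + 2 * Real.pi * Complex.I) = stieltjes X.V 1 η₁ ζ -
      2 * Real.pi * Complex.I * stieltjes X.V 0 η₂ (ζ + 2 * Real.pi * Complex.I) ∧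
    stieltjes X.V 2 η₂ (ζ + 2 * Real.pi * Complex.I) = stieltjes X.V 2 η₁ ζ -
      4 * Real.pi * Complex.I * stieltjes X.V 1 η₁ ζ +
      (2 * Real.pi * Complex.I) ^ 2 * stieltjes X.V 0 η₂ (ζ + 2 * Real.pi * Complex.I) := by
  have hpi := Real.pi_pos
  have hV := X.rapidStrip_V
  have hη₂ : |η₂| < Real.pi / 2 := abs_lt.2 ⟨by linarith, h4⟩
  have hI : ∀ j, Integrable fun x : ℝ => X.V (x + η₂ * Complex.I) * (x + η₂ * Complex.I - ζ) ^ j *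
      (Complex.exp (x + η₂ * Complex.I) / (Complex.exp (x + η₂ * Complex.I) - Complex.exp ζ)) :=
    fun j => X.integrable_kernel_V j hη₂ (by linarith) (by linarith) (by linarith)
  set δ := max |η₁| |η₂| with hδ
  have hδ' : δ < Real.pi / 2 := max_lt (abs_lt.2 ⟨h1, by linarith⟩) hη₂
  have hT : ∀ j, Tame (fun τ => X.V τ * (τ - ζ) ^ j) η₁ η₂ := fun j =>
    ((hV.2 δ hδ').tame_mul_pow X.gap_lt_one ζ j).mono
      ((neg_le_neg (le_max_left _ _)).trans (neg_abs_le η₁)) ((le_abs_self η₂).trans (le_max_right _ _))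
  have hD : ∀ j, DifferentiableOn ℂ (fun τ => X.V τ * (τ - ζ) ^ j) (Complex.im ⁻¹' Icc η₁ η₂) :=
    fun j => (hV.1.mono fun τ hτ => abs_lt.2 ⟨h1.trans_le hτ.1, hτ.2.trans_lt h4⟩).mul (by fun_prop)
  -- Crossing ζ costs the residue 2πi V(ζ) for j = 0. For j = 1, 2 the factor (τ - ζ)^j vanishes at
  -- the pole and nothing is lost.
  have s0 := (hT 0).lineInt_kernel_sub (hD 0) h2 h3 (by linarith) (by linarith)
  have s1 := (hT 1).lineInt_kernel_eq (hD 1) h2 h3 (by linarith) (by linarith) (by simp)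
  have s2 := (hT 2).lineInt_kernel_eq (hD 2) h2 h3 (by linarith) (by linarith) (by simp)
  change stieltjes X.V 0 η₁ ζ - stieltjes X.V 0 η₂ ζ = _ at s0
  change stieltjes X.V 1 η₁ ζ = stieltjes X.V 1 η₂ ζ at s1
  change stieltjes X.V 2 η₁ ζ = stieltjes X.V 2 η₂ ζ at s2
  have t0 : stieltjes X.V 0 η₂ (ζ + 2 * Real.pi * Complex.I) = stieltjes X.V 0 η₂ ζ := by
    simp only [stieltjes, exp_add_two_pi_I, pow_zero]
  have t1 : stieltjes X.V 1 η₂ (ζ + 2 * Real.pi * Complex.I) =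
      stieltjes X.V 1 η₂ ζ - 2 * Real.pi * Complex.I * stieltjes X.V 0 η₂ ζ := by
    simp only [stieltjes, exp_add_two_pi_I, lineInt]
    rw [← integral_const_mul, ← integral_sub (hI 1) ((hI 0).const_mul _)]
    exact integral_congr_ae (Eventually.of_forall fun x => by simp only; ring)
  have t2 : stieltjes X.V 2 η₂ (ζ + 2 * Real.pi * Complex.I) =
      stieltjes X.V 2 η₂ ζ - 4 * Real.pi * Complex.I * stieltjes X.V 1 η₂ ζ +
        (2 * Real.pi * Complex.I) ^ 2 * stieltjes X.V 0 η₂ ζ := by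
    simp only [stieltjes, exp_add_two_pi_I, lineInt]
    rw [sub_eq_add_neg, ← neg_mul, ← integral_add_mul_add_mul (hI 2) (hI 1) (hI 0)]
    exact integral_congr_ae (Eventually.of_forall fun x => by simp only; ring)
  rw [t0, t1, t2, s1, s2]
  simp only [pow_zero, mul_one] at s0
  exact ⟨by linear_combination -s0, rfl, rfl⟩

theorem Family.f_monodromy (X : Family) (c a ζ : ℂ) :
    X.f c a (ζ + 2 * Real.pi * Complex.I) 0 = X.f c a ζ 0 - X.f c a ζ 3 ∧
    X.f c a (ζ + 2 * Real.pi * Complex.I) 1 =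
      X.f c a ζ 1 - X.f c a (ζ + 2 * Real.pi * Complex.I) 0 ∧
    X.f c a (ζ + 2 * Real.pi * Complex.I) 2 = X.f c a ζ 2 - X.kappa * X.f c a ζ 1 +
      (X.kappa / 2 - a) * X.f c a (ζ + 2 * Real.pi * Complex.I) 0 := by
  simp only [X.f_add_two_pi_I, X.f_eq, Finset.mul_sum, ← Finset.sum_sub_distrib,
    ← Finset.sum_add_distrib]
  refine ⟨Finset.sum_congr rfl fun j _ => ?_, Finset.sum_congr rfl fun j _ => ?_,
    Finset.sum_congr rfl fun j _ => ?_⟩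
  · linear_combination (c * X.wCoeff j * X.basis j ζ) * (X.colPoly_monodromy a j).1
  · linear_combination (c * X.wCoeff j * X.basis j ζ) * (X.colPoly_monodromy a j).2.1
  · linear_combination (c * X.wCoeff j * X.basis j ζ) * (X.colPoly_monodromy a j).2.2

/-- The difference is a single-valued solution, hence zero. -/
theorem Family.IsSolution.eq_of_jump_eq {X : Family} {F G : ℂ → ℂ} (hF : X.IsSolution F)
    (hG : X.IsSolution G) (h : ∀ ζ, F (ζ + 2 * Real.pi * Complex.I) - F ζ =
      G (ζ + 2 * Real.pi * Complex.I) - G ζ) : F = G :=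
  sub_eq_zero.1 ((hF.sub hG).eq_zero_of_periodic fun ζ => by
    simp only [Pi.sub_apply]; linear_combination h ζ)

theorem two_pi_I_ne_zero : (2 * Real.pi * Complex.I : ℂ) ≠ 0 := Complex.two_pi_I_ne_zero

/-- The first three components of `f` in terms of the transforms of `V`. -/
theorem Family.exists_f_eq_stieltjes (X : Family) (a : ℂ) : ∃ E : ℕ → ℂ → ℂ,
    (∀ j ≤ 2, ∀ η : ℝ, |η| < Real.pi / 2 → ∀ ζ : ℂ, η < ζ.im → ζ.im < η + 2 * Real.pi →
      E j ζ = -stieltjes X.V j η ζ) ∧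
    (∀ ζ, X.f X.cN a ζ 0 = E 0 ζ) ∧
    (∀ ζ, X.f X.cN a ζ 1 = (2 * Real.pi * Complex.I)⁻¹ * E 1 ζ) ∧
    (∀ ζ, X.f X.cN a ζ 2 = X.kappa / 2 * ((2 * Real.pi * Complex.I)⁻¹ ^ 2 * E 2 ζ) +
      a * ((2 * Real.pi * Complex.I)⁻¹ * E 1 ζ)) := by
  obtain ⟨E₀, s0, h0⟩ := X.exists_stieltjes_solution (j := 0) (by norm_num)
  obtain ⟨E₁, s1, h1⟩ := X.exists_stieltjes_solution (j := 1) (by norm_num)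
  obtain ⟨E₂, s2, h2⟩ := X.exists_stieltjes_solution (j := 2) (by norm_num)
  have hpi := Real.pi_pos
  have hI := two_pi_I_ne_zero
  have hshift : Differentiable ℂ fun ζ : ℂ => ζ + 2 * Real.pi * Complex.I := by fun_prop
  have jump : ∀ ζ ∈ rightStrip, E₀ (ζ + 2 * Real.pi * Complex.I) =
        E₀ ζ + 2 * Real.pi * Complex.I * X.V ζ ∧
      E₁ (ζ + 2 * Real.pi * Complex.I) =
        E₁ ζ - 2 * Real.pi * Complex.I * E₀ (ζ + 2 * Real.pi * Complex.I) ∧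
      E₂ (ζ + 2 * Real.pi * Complex.I) = E₂ ζ - 4 * Real.pi * Complex.I * E₁ ζ +
        (2 * Real.pi * Complex.I) ^ 2 * E₀ (ζ + 2 * Real.pi * Complex.I) := fun ζ hζ => by
    obtain ⟨hl, hr⟩ := abs_lt.1 (show |ζ.im| < Real.pi / 2 from hζ)
    obtain ⟨η₁, a1, a2⟩ := exists_between hl
    obtain ⟨η₂, b1, b2⟩ := exists_between hr
    have k1 : |η₁| < Real.pi / 2 := abs_lt.2 ⟨a1, by linarith⟩
    have k2 : |η₂| < Real.pi / 2 := abs_lt.2 ⟨by linarith, b2⟩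
    have him : (ζ + 2 * Real.pi * Complex.I).im = ζ.im + 2 * Real.pi := by simp
    obtain ⟨j0, j1, j2⟩ := X.stieltjes_jump a1 a2 b1 b2
    rw [h0 η₂ k2 _ (by rw [him]; linarith) (by rw [him]; linarith),
      h1 η₂ k2 _ (by rw [him]; linarith) (by rw [him]; linarith),
      h2 η₂ k2 _ (by rw [him]; linarith) (by rw [him]; linarith),
      h0 η₁ k1 ζ a2 (by linarith), h1 η₁ k1 ζ a2 (by linarith), h2 η₁ k1 ζ a2 (by linarith)]
    exact ⟨by linear_combination -j0, by linear_combination -j1, by linear_combination -j2⟩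
  have d0 := s0.1
  have d1 := s1.1
  have d2 := s2.1
  have d3 := (X.isSolution_f X.cN a 3).1
  -- The jump is computed only on the right strip, but both sides are entire, so it holds
  -- everywhere.
  have J0 : (fun ζ => E₀ (ζ + 2 * Real.pi * Complex.I)) = fun ζ => E₀ ζ - X.f X.cN a ζ 3 :=
    Family.eq_of_eqOn_rightStrip (d0.comp hshift) (d0.sub d3) fun ζ hζ => by
      have := X.f_three_eq a hζ
      simp only at this ⊢
      rw [(jump ζ hζ).1, this]; ring
  have J1 : (fun ζ => E₁ (ζ + 2 * Real.pi * Complex.I)) =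
      fun ζ => E₁ ζ - 2 * Real.pi * Complex.I * E₀ (ζ + 2 * Real.pi * Complex.I) :=
    Family.eq_of_eqOn_rightStrip (d1.comp hshift) (d1.sub ((d0.comp hshift).const_mul _))
      fun ζ hζ => (jump ζ hζ).2.1
  have J2 : (fun ζ => E₂ (ζ + 2 * Real.pi * Complex.I)) =
      fun ζ => E₂ ζ - 4 * Real.pi * Complex.I * E₁ ζ +
        (2 * Real.pi * Complex.I) ^ 2 * E₀ (ζ + 2 * Real.pi * Complex.I) :=
    Family.eq_of_eqOn_rightStrip (d2.comp hshift)
      ((d2.sub (d1.const_mul _)).add ((d0.comp hshift).const_mul _)) fun ζ hζ => (jump ζ hζ).2.2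
  have e0 : (fun ζ => X.f X.cN a ζ 0) = E₀ :=
    (X.isSolution_f X.cN a 0).eq_of_jump_eq s0 fun ζ => by
      rw [(X.f_monodromy X.cN a ζ).1, congrFun J0 ζ]; ring
  have e1 : (fun ζ => X.f X.cN a ζ 1) = (2 * Real.pi * Complex.I)⁻¹ • E₁ :=
    (X.isSolution_f X.cN a 1).eq_of_jump_eq (s1.smul _) fun ζ => by
      have h := congrFun J1 ζ
      simp only [Pi.smul_apply, smul_eq_mul]
      rw [(X.f_monodromy X.cN a ζ).2.1, h,
        show X.f X.cN a (ζ + 2 * Real.pi * Complex.I) 0 = E₀ (ζ + 2 * Real.pi * Complex.I) from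
          congrFun e0 _]
      field_simp
      ring
  have e2 : (fun ζ => X.f X.cN a ζ 2) = (X.kappa / 2 * (2 * Real.pi * Complex.I)⁻¹ ^ 2) • E₂ +
      (a * (2 * Real.pi * Complex.I)⁻¹) • E₁ :=
    (X.isSolution_f X.cN a 2).eq_of_jump_eq ((s2.smul _).add (s1.smul _)) fun ζ => by
      have h := congrFun J1 ζ
      have h' := congrFun J2 ζ
      simp only [Pi.smul_apply, Pi.add_apply, smul_eq_mul]
      rw [(X.f_monodromy X.cN a ζ).2.2, h, h',
        show X.f X.cN a (ζ + 2 * Real.pi * Complex.I) 0 = E₀ (ζ + 2 * Real.pi * Complex.I) from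
          congrFun e0 _,
        show X.f X.cN a ζ 1 = (2 * Real.pi * Complex.I)⁻¹ * E₁ ζ from congrFun e1 _]
      field_simp
      ring
  -- Only the indices 0, 1, 2 are used; reduction modulo 3 makes the family total on ℕ.
  refine ⟨![E₀, E₁, E₂] ∘ (Fin.ofNat 3), fun j hj => ?_, congrFun e0, congrFun e1, fun ζ => ?_⟩
  · interval_cases j
    exacts [h0, h1, h2]
  · have := congrFun e2 ζ
    simp only [Pi.smul_apply, Pi.add_apply, smul_eq_mul] at this
    rw [this]
    change _ = X.kappa / 2 * ((2 * Real.pi * Complex.I)⁻¹ ^ 2 * E₂ ζ) +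
      a * ((2 * Real.pi * Complex.I)⁻¹ * E₁ ζ)
    ring

/-- The terms of the formal series `g_1, g_2, g_3`. -/
def Family.gTerm (X : Family) (a : ℂ) (i : Fin 4) (n : ℕ) (ζ : ℂ) : ℂ :=
  -- The last entry is a filler: the fourth formal solution is treated separately.
  ![X.logMoment 0 ζ (n + 1), (2 * Real.pi * Complex.I)⁻¹ * X.logMoment 1 ζ (n + 1),
    X.kappa / 2 * ((2 * Real.pi * Complex.I)⁻¹ ^ 2 * X.logMoment 2 ζ (n + 1)) +
      a * ((2 * Real.pi * Complex.I)⁻¹ * X.logMoment 1 ζ (n + 1)), 0] i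

theorem Family.f_isLittleO (X : Family) (a : ℂ) {i : Fin 4} (hi : i ≠ 3) {η α β : ℝ}
    (hη : |η| < Real.pi / 2) (hα : η < α) (hβ : β < η + 2 * Real.pi) (N : ℕ) :
    (fun ζ => X.f X.cN a ζ i - ∑ n ∈ Finset.range N, X.gTerm a i n ζ)
      =o[comap Complex.re atTop ⊓ 𝓟 {ζ : ℂ | α ≤ ζ.im ∧ ζ.im ≤ β}]
      fun ζ : ℂ => Real.exp (-(N * ζ.re)) := by
  obtain ⟨E, hE, e0, e1, e2⟩ := X.exists_f_eq_stieltjes a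
  have h0 := isLittleO_of_eq_neg_stieltjes hη hα hβ (hE 0 (by norm_num) η hη) N
  have h1 := isLittleO_of_eq_neg_stieltjes hη hα hβ (hE 1 (by norm_num) η hη) N
  have h2 := isLittleO_of_eq_neg_stieltjes hη hα hβ (hE 2 (by norm_num) η hη) N
  fin_cases i
  · exact h0.congr_left fun ζ => by simp [Family.gTerm, e0]
  · refine (h1.const_mul_left (2 * Real.pi * Complex.I)⁻¹).congr_left fun ζ => ?_
    simp [Family.gTerm, e1, Finset.mul_sum, mul_sub]
  · refine ((h2.const_mul_left (X.kappa / 2 * (2 * Real.pi * Complex.I)⁻¹ ^ 2)).add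
      (h1.const_mul_left (a * (2 * Real.pi * Complex.I)⁻¹))).congr_left fun ζ => ?_
    simp only [Family.gTerm, Fin.reduceFinMk, e2, Finset.sum_add_distrib, Matrix.cons_val,
      ← Finset.mul_sum]
    ring
  · exact absurd rfl hi

/-! ### The fourth solution -/

/-- The integer in the last column of the Stokes matrix. -/
def Family.stokes : Family → ℂ
  | .quintic => 5
  | .sextic => 4
  | .octic => 4
  | .dectic => 3

/-- The integer in the Stokes matrix is exactly what makes this identity follow from x · x^{d-1} = 1
alone. -/
theorem Family.colPoly_three_monodromy (X : Family) (a : ℂ) (j : Fin 4) :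
    X.colPoly a 3 (X.mono j) = (-X.stokes * X.colPoly a 0 (X.mono j) +
      (a - X.kappa / 2) * X.colPoly a 1 (X.mono j) - X.colPoly a 2 (X.mono j) +
        X.colPoly a 3 (X.mono j)) * X.mono j := by
  obtain ⟨h1, -⟩ := X.mono_relation j
  simp only [Family.colPoly]
  generalize X.mono j ^ (X.deg - 1) = y at *
  cases X <;> simp [Family.matN, Family.stokes, Family.kappa] <;> linear_combination -h1

theorem Family.f_three_monodromy (X : Family) (c a ζ : ℂ) :
    X.f c a ζ 3 = -X.stokes * X.f c a (ζ + 2 * Real.pi * Complex.I) 0 +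
      (a - X.kappa / 2) * X.f c a (ζ + 2 * Real.pi * Complex.I) 1 -
      X.f c a (ζ + 2 * Real.pi * Complex.I) 2 + X.f c a (ζ + 2 * Real.pi * Complex.I) 3 := by
  simp only [X.f_add_two_pi_I, X.f_eq, Finset.mul_sum, ← Finset.sum_sub_distrib,
    ← Finset.sum_add_distrib]
  refine Finset.sum_congr rfl fun j _ => ?_
  linear_combination (c * X.wCoeff j * X.basis j ζ) * X.colPoly_three_monodromy a j

theorem Family.f_three_eq_zero_param (X : Family) (c a ζ : ℂ) : X.f c a ζ 3 = X.f c 0 ζ 3 := by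
  simp only [X.f_eq, Family.colPoly]
  cases X <;> simp [Family.matN]

/-- The fourth solution without its exponential factor. -/
def Family.H (X : Family) (ζ : ℂ) : ℂ := Complex.exp (Complex.exp ζ / X.lamR) * X.f X.cN 0 ζ 3

theorem Family.differentiable_f (X : Family) (c a : ℂ) (i : Fin 4) :
    Differentiable ℂ fun ζ => X.f c a ζ i := (X.isSolution_f c a i).1

theorem Family.differentiable_H (X : Family) : Differentiable ℂ X.H :=
  ((Complex.differentiable_exp.div_const _).cexp).mul (X.differentiable_f _ _ _)

theorem Family.gap_eq (X : Family) : X.gap = X.root 3 := by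
  have := X.root_rev 0
  rw [Family.gap, ← this]; rfl

theorem Family.root_mem (X : Family) (j : Fin 4) : X.root 0 ≤ X.root j ∧ X.root j ≤ X.gap :=
  ⟨X.root_strictMono.monotone (Fin.zero_le j), by
    rw [X.gap_eq]; exact X.root_strictMono.monotone (Fin.le_last j)⟩

/-- For Re ζ ≥ 0 the bound keeps the exact growth e^{|z|/λ} of the local solutions, with the
smallest power a₀; for Re ζ ≤ 0 the largest power, a₃ = 1 - a₀, dominates. -/
theorem Family.exists_norm_f_le (X : Family) (c a : ℂ) (i : Fin 4) : ∃ C : ℝ, 0 ≤ C ∧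
    (∀ ζ : ℂ, ζ.re ≤ 0 → ‖X.f c a ζ i‖ ≤ C * Real.exp (-(X.gap * ζ.re))) ∧
    (∀ ζ : ℂ, 0 ≤ ζ.re → ‖X.f c a ζ i‖ ≤
      C * (Real.exp (-(X.root 0 * ζ.re)) * Real.exp (Real.exp ζ.re / X.lamR))) := by
  set D : Fin 4 → ℝ := fun j => ‖c * X.wCoeff j * X.colPoly a i (X.mono j)‖ *
    ‖X.phiCoeff (X.idx j) 0‖ with hD
  have hl := X.lamR_pos
  have hD0 : ∀ j, 0 ≤ D j := fun j => by positivity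
  have key : ∀ ζ, ‖X.f c a ζ i‖ ≤ ∑ j, D j *
      (Real.exp (-(X.root j * ζ.re)) * Real.exp (Real.exp ζ.re / X.lamR)) := fun ζ => by
    rw [X.f_eq]
    refine (norm_sum_le _ _).trans (Finset.sum_le_sum fun j _ => ?_)
    rw [norm_mul]
    refine (mul_le_mul_of_nonneg_left (X.norm_basis_le j ζ) (norm_nonneg _)).trans_eq ?_
    simp only [hD]
    ring
  have h1 : 1 ≤ Real.exp (1 / X.lamR) := Real.one_le_exp (by positivity)
  refine ⟨(∑ j, D j) * Real.exp (1 / X.lamR),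
    mul_nonneg (Finset.sum_nonneg fun j _ => hD0 j) (Real.exp_pos _).le, fun ζ hζ => ?_,
    fun ζ hζ => ?_⟩
  · refine (key ζ).trans ?_
    rw [Finset.sum_mul, Finset.sum_mul]
    refine Finset.sum_le_sum fun j _ => ?_
    rw [mul_assoc (D j), mul_comm (Real.exp (1 / X.lamR))]
    have e1 : Real.exp ζ.re ≤ 1 := Real.exp_le_one_iff.2 hζ
    have e2 : -(X.root j * ζ.re) ≤ -(X.gap * ζ.re) := by nlinarith [(X.root_mem j).2]
    exact mul_le_mul_of_nonneg_left (mul_le_mul (Real.exp_le_exp.2 e2)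
      (Real.exp_le_exp.2 (by gcongr)) (Real.exp_pos _).le (Real.exp_pos _).le) (hD0 j)
  · refine (key ζ).trans ?_
    rw [mul_assoc, Finset.sum_mul]
    refine Finset.sum_le_sum fun j _ => mul_le_mul_of_nonneg_left ?_ (hD0 j)
    have e2 : -(X.root j * ζ.re) ≤ -(X.root 0 * ζ.re) := by nlinarith [(X.root_mem j).1]
    calc _ ≤ Real.exp (-(X.root 0 * ζ.re)) * Real.exp (Real.exp ζ.re / X.lamR) :=
          mul_le_mul_of_nonneg_right (Real.exp_le_exp.2 e2) (Real.exp_pos _).le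
      _ ≤ _ := le_mul_of_one_le_left (by positivity) h1

/-! ### Power bounds for H by the Phragmén-Lindelöf principle -/

theorem norm_exp_exp_div (ζ : ℂ) (l : ℝ) : ‖Complex.exp (Complex.exp ζ / l)‖ =
    Real.exp (Real.exp ζ.re * Real.cos ζ.im / l) := by
  rw [Complex.norm_exp, Complex.div_ofReal_re, Complex.exp_re]

/-- A Phragmén-Lindelöf bound: polynomial decay on the boundary rays of a sector of opening less
than `π` propagates to the interior. -/
theorem exists_decay_of_boundary_decay {G : ℂ → ℂ} (hG : Differentiable ℂ G) {y₁ y₂ C B p q : ℝ}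
    (hy1 : 0 < y₁) (hy2 : y₂ < 2 * Real.pi) (hy : y₁ < y₂) (hlt : y₂ - y₁ < Real.pi) (hp : 0 ≤ p)
    (hq : q ≤ 1 + p) (hC : 0 ≤ C)
    (hneg : ∀ ζ : ℂ, ζ.im ∈ Icc y₁ y₂ → ζ.re ≤ 0 → ‖G ζ‖ ≤ C * Real.exp (-(q * ζ.re)))
    (hpos : ∀ ζ : ℂ, ζ.im ∈ Icc y₁ y₂ → 0 ≤ ζ.re → ‖G ζ‖ ≤ C * Real.exp (B * Real.exp ζ.re))
    (hbd : ∀ ζ : ℂ, ζ.im = y₁ ∨ ζ.im = y₂ → 0 ≤ ζ.re → ‖G ζ‖ ≤ C * Real.exp (-(p * ζ.re))) :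
    ∃ C', 0 ≤ C' ∧ ∀ ζ : ℂ, ζ.im ∈ Icc y₁ y₂ → 0 ≤ ζ.re →
      ‖G ζ‖ ≤ C' * Real.exp (-(p * ζ.re)) := by
  obtain ⟨c, hc, hk⟩ := le_norm_one_sub_exp_of_im hy1 hy2
  -- The multiplier behaves like e^{pζ} on the right, compensating the expected decay, and like
  -- e^{(1+p)ζ} on the left, where it beats e^{-qζ} since q ≤ 1 + p. Its poles at multiples of 2πi
  -- lie outside the strip.
  set M : ℂ → ℂ := fun ζ => Complex.exp (p * ζ) * (Complex.exp ζ / (1 - Complex.exp ζ)) with hM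
  have hne : ∀ ζ : ℂ, ζ.im ∈ Icc y₁ y₂ → 1 - Complex.exp ζ ≠ 0 := fun ζ hζ h => by
    have := hk ζ hζ
    rw [h, norm_zero] at this
    nlinarith [Real.exp_pos ζ.re]
  have hMle : ∀ ζ : ℂ, ζ.im ∈ Icc y₁ y₂ → ‖M ζ‖ ≤
      c⁻¹ * (Real.exp (p * ζ.re) * (Real.exp ζ.re / (1 + Real.exp ζ.re))) := fun ζ hζ => by
    have e1 : ((p : ℂ) * ζ).re = p * ζ.re := by simp
    rw [hM]
    simp only
    rw [norm_mul, norm_div, Complex.norm_exp, Complex.norm_exp, e1, mul_left_comm]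
    refine mul_le_mul_of_nonneg_left ?_ (Real.exp_pos _).le
    rw [inv_mul_eq_div, div_div, mul_comm _ c]
    exact div_le_div_of_nonneg_left (Real.exp_pos _).le (by positivity) (hk ζ hζ)
  have hfrac : ∀ x : ℝ, Real.exp x / (1 + Real.exp x) ≤ 1 := fun x => by
    rw [div_le_one (by positivity)]; linarith [Real.exp_pos x]
  have hfrac' : ∀ x : ℝ, Real.exp x / (1 + Real.exp x) ≤ Real.exp x := fun x =>
    div_le_self (Real.exp_pos x).le (by linarith [Real.exp_pos x])
  -- the product is bounded on the left half and on the boundary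
  have hleft : ∀ ζ : ℂ, ζ.im ∈ Icc y₁ y₂ → ζ.re ≤ 0 → ‖G ζ * M ζ‖ ≤ C * c⁻¹ := fun ζ hζ h0 => by
    rw [norm_mul]
    calc _ ≤ (C * Real.exp (-(q * ζ.re))) * (c⁻¹ * (Real.exp (p * ζ.re) * Real.exp ζ.re)) := by
          gcongr
          · exact hneg ζ hζ h0
          · exact (hMle ζ hζ).trans (by gcongr; exact hfrac' _)
      _ = C * c⁻¹ * Real.exp ((1 + p - q) * ζ.re) := by
          rw [show (1 + p - q) * ζ.re = -(q * ζ.re) + (p * ζ.re + ζ.re) by ring, Real.exp_add,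
            Real.exp_add]; ring
      _ ≤ C * c⁻¹ * 1 := by
          gcongr
          exact Real.exp_le_one_iff.2 (mul_nonpos_of_nonneg_of_nonpos (by linarith) h0)
      _ = _ := mul_one _
  have hbdy : ∀ ζ : ℂ, ζ.im = y₁ ∨ ζ.im = y₂ → ‖G ζ * M ζ‖ ≤ C * c⁻¹ := fun ζ hζ => by
    have him : ζ.im ∈ Icc y₁ y₂ := by
      rcases hζ with h | h <;> rw [h] <;> constructor <;> linarith
    rcases le_total ζ.re 0 with h0 | h0
    · exact hleft ζ him h0
    · rw [norm_mul]
      calc _ ≤ (C * Real.exp (-(p * ζ.re))) * (c⁻¹ * (Real.exp (p * ζ.re) * 1)) := by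
            gcongr
            · exact hbd ζ hζ h0
            · exact (hMle ζ him).trans (by gcongr; exact hfrac _)
        _ = C * c⁻¹ * (Real.exp (-(p * ζ.re)) * Real.exp (p * ζ.re)) := by ring
        _ = _ := by rw [← Real.exp_add]; simp
  have hdiff : DifferentiableOn ℂ (fun ζ => G ζ * M ζ) (Complex.im ⁻¹' Icc y₁ y₂) := by
    refine hG.differentiableOn.mul (DifferentiableOn.mul (by fun_prop)
      (DifferentiableOn.div (by fun_prop) (by fun_prop) fun ζ hζ => hne ζ hζ))
  have hcl : closure (Complex.im ⁻¹' Ioo y₁ y₂) = Complex.im ⁻¹' Icc y₁ y₂ := by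
    rw [Complex.closure_preimage_im, closure_Ioo hy.ne]
  have hgrow : ∃ c < Real.pi / (y₂ - y₁), ∃ B, (fun ζ => G ζ * M ζ)
      =O[comap (_root_.abs ∘ Complex.re) atTop ⊓ 𝓟 (Complex.im ⁻¹' Ioo y₁ y₂)]
      fun z ↦ Real.exp (B * Real.exp (c * |z.re|)) := by
    -- The growth is of order one in z, which is admissible precisely because the opening is less
    -- than π.
    refine ⟨1, by rw [lt_div_iff₀ (by linarith)]; linarith, |B| + p, IsBigO.of_bound (C * c⁻¹) ?_⟩
    filter_upwards [mem_inf_of_right (mem_principal_self _)] with ζ hζ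
    have him : ζ.im ∈ Icc y₁ y₂ := Ioo_subset_Icc_self hζ
    rw [Real.norm_of_nonneg (Real.exp_pos _).le]
    rcases le_total ζ.re 0 with h0 | h0
    · refine (hleft ζ him h0).trans (le_mul_of_one_le_right (by positivity) ?_)
      exact Real.one_le_exp (by positivity)
    · rw [norm_mul, abs_of_nonneg h0, one_mul]
      have e1 : ζ.re ≤ Real.exp ζ.re := by linarith [Real.add_one_le_exp ζ.re]
      calc _ ≤ (C * Real.exp (|B| * Real.exp ζ.re)) *
            (c⁻¹ * (Real.exp (p * Real.exp ζ.re) * 1)) := by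
            gcongr
            · refine (hpos ζ him h0).trans ?_
              gcongr
              exact le_abs_self B
            · exact (hMle ζ him).trans (by gcongr; exact hfrac _)
        _ = C * c⁻¹ * (Real.exp (|B| * Real.exp ζ.re) * Real.exp (p * Real.exp ζ.re)) := by ring
        _ = _ := by rw [← Real.exp_add, add_mul]
  have hPL : ∀ ζ : ℂ, ζ.im ∈ Icc y₁ y₂ → ‖G ζ * M ζ‖ ≤ C * c⁻¹ := fun ζ hζ =>
    PhragmenLindelof.horizontal_strip (f := fun ζ => G ζ * M ζ) (DifferentiableOn.diffContOnCl (by rwa [hcl])) hgrow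
      (fun z hz => hbdy z (Or.inl hz)) (fun z hz => hbdy z (Or.inr hz)) hζ.1 hζ.2
  refine ⟨C * c⁻¹ * 2, by positivity, fun ζ hζ h0 => ?_⟩
  have h1 := hPL ζ hζ
  have h2 : Real.exp (p * ζ.re) * (1 / 2) ≤ ‖M ζ‖ := by
    have e1 : ((p : ℂ) * ζ).re = p * ζ.re := by simp
    rw [hM]
    simp only
    rw [norm_mul, norm_div, Complex.norm_exp, Complex.norm_exp, e1]
    refine mul_le_mul_of_nonneg_left ?_ (Real.exp_pos _).le
    have e2 : 1 ≤ Real.exp ζ.re := Real.one_le_exp h0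
    have e3 : ‖1 - Complex.exp ζ‖ ≤ 1 + Real.exp ζ.re := by
      have := norm_sub_le 1 (Complex.exp ζ)
      rwa [norm_one, Complex.norm_exp] at this
    rw [div_le_div_iff₀ (by norm_num) (norm_pos_iff.2 (hne ζ hζ))]
    linarith
  rw [norm_mul] at h1
  have h3 : ‖G ζ‖ * (Real.exp (p * ζ.re) * (1 / 2)) ≤ C * c⁻¹ :=
    (mul_le_mul_of_nonneg_left h2 (norm_nonneg _)).trans h1
  have h4 : Real.exp (-(p * ζ.re)) * Real.exp (p * ζ.re) = 1 := by rw [← Real.exp_add]; simp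
  calc ‖G ζ‖ = ‖G ζ‖ * (Real.exp (p * ζ.re) * (1 / 2)) * (2 * Real.exp (-(p * ζ.re))) := by
        linear_combination (-‖G ζ‖) * h4
    _ ≤ C * c⁻¹ * (2 * Real.exp (-(p * ζ.re))) := by gcongr
    _ = _ := by ring

theorem Family.root_zero_le_gap (X : Family) : X.root 0 ≤ X.gap := (X.root_mem 0).2

theorem Family.H_eq_V (X : Family) {ζ : ℂ} (hζ : ζ ∈ rightStrip) :
    X.H ζ = -(2 * Real.pi * Complex.I) * (Complex.exp (Complex.exp ζ / X.lamR) * X.V ζ) := by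
  have := X.f_three_eq 0 hζ
  simp only at this
  rw [Family.H, this]
  ring

theorem Family.exists_norm_H_le_rightStrip (X : Family) : ∃ C : ℝ, 0 ≤ C ∧ ∀ ζ ∈ rightStrip,
    ‖X.H ζ‖ ≤ C * Real.exp (-(X.gap * ζ.re)) := by
  obtain ⟨C, hC⟩ := X.expClass_V.2
  refine ⟨‖(2 * Real.pi * Complex.I : ℂ)‖ * |C|, by positivity, fun ζ hζ => ?_⟩
  rw [X.H_eq_V hζ, norm_mul, norm_neg, norm_mul (Complex.exp _), mul_assoc _ |C|, Complex.norm_exp,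
    Complex.div_ofReal_re]
  refine mul_le_mul_of_nonneg_left ?_ (norm_nonneg _)
  calc _ ≤ Real.exp ((Complex.exp ζ).re / X.lamR) *
        (|C| * (Real.exp (-(X.gap * ζ.re)) * Real.exp (-((Complex.exp ζ).re / X.lamR)))) := by
        gcongr
        exact (hC ζ hζ).trans (by gcongr; exact le_abs_self C)
    _ = |C| * (Real.exp (-(X.gap * ζ.re)) * (Real.exp ((Complex.exp ζ).re / X.lamR) *
        Real.exp (-((Complex.exp ζ).re / X.lamR)))) := by ring
    _ = _ := by rw [← Real.exp_add, add_neg_cancel, Real.exp_zero, mul_one]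

/-- On the negative axis the factor e^{z/λ} cancels the growth e^{|z|/λ} of f₄ exactly; this is
where the sharp exponential type matters. -/
theorem Family.exists_norm_H_le (X : Family) : ∃ C : ℝ, 0 ≤ C ∧
    (∀ ζ : ℂ, ζ.re ≤ 0 → ‖X.H ζ‖ ≤ C * Real.exp (-(X.gap * ζ.re))) ∧
    (∀ ζ : ℂ, 0 ≤ ζ.re → ‖X.H ζ‖ ≤ C * Real.exp (2 / X.lamR * Real.exp ζ.re)) ∧
    (∀ ζ : ℂ, 0 ≤ ζ.re → Real.cos ζ.im = -1 → ‖X.H ζ‖ ≤ C * Real.exp (-(X.root 0 * ζ.re))) := by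
  obtain ⟨C, hC, h1, h2⟩ := X.exists_norm_f_le X.cN 0 3
  have hl := X.lamR_pos
  have hone : 1 ≤ Real.exp (1 / X.lamR) := Real.one_le_exp (by positivity)
  refine ⟨C * Real.exp (1 / X.lamR), by positivity, fun ζ hζ => ?_, fun ζ hζ => ?_,
    fun ζ hζ hcos => ?_⟩
  · rw [Family.H, norm_mul, norm_exp_exp_div]
    have e1 : Real.exp ζ.re ≤ 1 := Real.exp_le_one_iff.2 hζ
    have e2 : Real.exp ζ.re * Real.cos ζ.im ≤ 1 := by
      nlinarith [Real.cos_le_one ζ.im, Real.exp_pos ζ.re]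
    calc _ ≤ Real.exp (1 / X.lamR) * (C * Real.exp (-(X.gap * ζ.re))) := by
          gcongr
          exact h1 ζ hζ
      _ = _ := by ring
  · rw [Family.H, norm_mul, norm_exp_exp_div]
    have e2 : Real.exp ζ.re * Real.cos ζ.im ≤ Real.exp ζ.re := by
      nlinarith [Real.cos_le_one ζ.im, Real.exp_pos ζ.re]
    have e3 : Real.exp (-(X.root 0 * ζ.re)) ≤ 1 := by
      rw [Real.exp_le_one_iff, neg_nonpos]; exact mul_nonneg (X.root_pos 0).le hζ
    calc _ ≤ Real.exp (Real.exp ζ.re / X.lamR) * (C * (1 * Real.exp (Real.exp ζ.re / X.lamR))) := by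
          gcongr
          exact (h2 ζ hζ).trans (by gcongr)
      _ = C * (1 * (Real.exp (Real.exp ζ.re / X.lamR) * Real.exp (Real.exp ζ.re / X.lamR))) := by
          ring
      _ ≤ C * (Real.exp (1 / X.lamR) * (Real.exp (Real.exp ζ.re / X.lamR) *
          Real.exp (Real.exp ζ.re / X.lamR))) := by gcongr
      _ = _ := by rw [← Real.exp_add (Real.exp ζ.re / X.lamR), mul_assoc]; ring_nf
  · rw [Family.H, norm_mul, norm_exp_exp_div, hcos]
    calc _ ≤ Real.exp (Real.exp ζ.re * -1 / X.lamR) *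
          (C * (Real.exp (-(X.root 0 * ζ.re)) * Real.exp (Real.exp ζ.re / X.lamR))) := by
          gcongr
          exact h2 ζ hζ
      _ = C * (1 * Real.exp (-(X.root 0 * ζ.re))) * (Real.exp (Real.exp ζ.re * -1 / X.lamR) *
          Real.exp (Real.exp ζ.re / X.lamR)) := by ring
      _ = C * (1 * Real.exp (-(X.root 0 * ζ.re))) := by
          rw [← Real.exp_add, show Real.exp ζ.re * -1 / X.lamR + Real.exp ζ.re / X.lamR = 0 by ring,
            Real.exp_zero, mul_one]
      _ ≤ C * (Real.exp (1 / X.lamR) * Real.exp (-(X.root 0 * ζ.re))) := by gcongr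
      _ = _ := by ring

/-- The missing sectors are [π/4, π] and [-π, -π/4], the second treated after a shift by 2πi. Each
has opening 3π/4, one edge in the right half plane, where V controls H, and the other on the
negative axis. -/
theorem Family.exists_norm_H_le_strip (X : Family) : ∃ C : ℝ, 0 ≤ C ∧ ∀ ζ : ℂ, |ζ.im| ≤ Real.pi →
    ‖X.H ζ‖ ≤ C * (Real.exp (-(X.root 0 * ζ.re)) + Real.exp (-(X.gap * ζ.re))) := by
  have hpi := Real.pi_pos
  obtain ⟨C₁, hC₁, hr⟩ := X.exists_norm_H_le_rightStrip
  obtain ⟨C₂, hC₂, h1, h2, h3⟩ := X.exists_norm_H_le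
  have hgr : X.gap ≤ 1 + X.root 0 := by linarith [X.gap_lt_one, X.root_pos 0]
  set C := max C₁ C₂ with hCdef
  have hC : 0 ≤ C := le_max_of_le_left hC₁
  have l1 : C₁ ≤ C := le_max_left _ _
  have l2 : C₂ ≤ C := le_max_right _ _
  have hr0 : ∀ ζ ∈ rightStrip, 0 ≤ ζ.re → ‖X.H ζ‖ ≤ C * Real.exp (-(X.root 0 * ζ.re)) :=
    fun ζ hζ h0 => (hr ζ hζ).trans (by
      gcongr
      exact X.root_zero_le_gap)
  obtain ⟨C₃, hC₃, h4⟩ := exists_decay_of_boundary_decay X.differentiable_H (y₁ := Real.pi / 4)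
    (y₂ := Real.pi) (C := C) (B := 2 / X.lamR) (by positivity) (by linarith) (by linarith)
    (by linarith) (X.root_pos 0).le hgr hC (fun ζ _ h0 => (h1 ζ h0).trans (by gcongr))
    (fun ζ _ h0 => (h2 ζ h0).trans (by gcongr)) (fun ζ hζ h0 => by
      rcases hζ with hζ | hζ
      · exact hr0 ζ (by rw [rightStrip, mem_ofPred_eq, hζ, abs_of_pos] <;> linarith) h0
      · exact (h3 ζ h0 (by rw [hζ, Real.cos_pi])).trans (by gcongr))
  have hshift : Differentiable ℂ fun ζ => X.H (ζ - 2 * Real.pi * Complex.I) :=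
    X.differentiable_H.comp (by fun_prop)
  obtain ⟨C₄, hC₄, h5⟩ := exists_decay_of_boundary_decay hshift (y₁ := Real.pi)
    (y₂ := 7 * Real.pi / 4) (C := C) (B := 2 / X.lamR) (p := X.root 0) (q := X.gap) hpi
    (by linarith) (by linarith) (by linarith) (X.root_pos 0).le hgr hC
    (fun ζ _ h0 => (h1 (ζ - 2 * Real.pi * Complex.I) (by simpa using h0)).trans (by simp; gcongr))
    (fun ζ _ h0 => (h2 (ζ - 2 * Real.pi * Complex.I) (by simpa using h0)).trans (by simp; gcongr))
    (fun ζ hζ h0 => by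
      have e : (ζ - 2 * Real.pi * Complex.I).re = ζ.re := by simp
      rcases hζ with hζ | hζ
      · refine (h3 (ζ - 2 * Real.pi * Complex.I) (by simpa using h0) ?_).trans
          (by rw [e]; gcongr)
        simp [hζ, Real.cos_sub_two_pi]
      · have := hr0 (ζ - 2 * Real.pi * Complex.I) (by
          rw [rightStrip, mem_ofPred_eq, abs_lt]
          simp [hζ]
          constructor <;> linarith) (by simpa using h0)
        rwa [e] at this)
  refine ⟨max C (max C₃ C₄), le_max_of_le_left hC, fun ζ hζ => ?_⟩
  have m3 : C₃ ≤ max C (max C₃ C₄) := (le_max_left _ _).trans (le_max_right _ _)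
  have m4 : C₄ ≤ max C (max C₃ C₄) := (le_max_right _ _).trans (le_max_right _ _)
  obtain ⟨ha, hb⟩ := abs_le.1 hζ
  rcases le_total ζ.re 0 with h0 | h0
  · refine (h1 ζ h0).trans ?_
    have := Real.exp_pos (-(X.root 0 * ζ.re))
    refine mul_le_mul (l2.trans (le_max_left _ _)) ?_ (Real.exp_pos _).le
      (le_max_of_le_left hC)
    linarith
  · have key : ∃ D, 0 ≤ D ∧ D ≤ max C (max C₃ C₄) ∧ ‖X.H ζ‖ ≤ D * Real.exp (-(X.root 0 * ζ.re)) := by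
      rcases le_or_gt (Real.pi / 4) ζ.im with h | h
      · exact ⟨C₃, hC₃, m3, h4 ζ ⟨h, hb⟩ h0⟩
      rcases le_or_gt ζ.im (-(Real.pi / 4)) with h' | h'
      · refine ⟨C₄, hC₄, m4, ?_⟩
        have := h5 (ζ + 2 * Real.pi * Complex.I) (by simp; constructor <;> linarith) (by simpa using h0)
        simpa using this
      · exact ⟨C, hC, le_max_left _ _, hr0 ζ
          (show |ζ.im| < Real.pi / 2 from abs_lt.2 ⟨by linarith, by linarith⟩) h0⟩
    obtain ⟨D, hD, hDle, hDH⟩ := key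
    refine hDH.trans (mul_le_mul hDle ?_ (Real.exp_pos _).le (le_max_of_le_left hC))
    linarith [Real.exp_pos (-(X.gap * ζ.re))]

/-! ### The jump of H and the representation of H as its Cauchy integral -/

/-- The jump of `H` around the origin. -/
def Family.J (X : Family) (ζ : ℂ) : ℂ := X.H (ζ - 2 * Real.pi * Complex.I) - X.H ζ

theorem Family.differentiable_J (X : Family) : Differentiable ℂ X.J :=
  (X.differentiable_H.comp (by fun_prop)).sub X.differentiable_H

theorem Family.J_eq (X : Family) (ζ : ℂ) : X.J ζ = Complex.exp (Complex.exp ζ / X.lamR) *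
    (-X.stokes * X.f X.cN 0 ζ 0 - X.kappa / 2 * X.f X.cN 0 ζ 1 - X.f X.cN 0 ζ 2) := by
  have := X.f_three_monodromy X.cN 0 (ζ - 2 * Real.pi * Complex.I)
  rw [sub_add_cancel] at this
  rw [Family.J, Family.H, Family.H, exp_sub_two_pi_I, this]
  ring

/-- The asymptotic expansion with no terms gives boundedness for large |z|; the remaining range 0 ≤
Re ζ ≤ R is covered by the crude bound. -/
theorem Family.exists_norm_f_le_of_pos (X : Family) {i : Fin 4} (hi : i ≠ 3) {δ : ℝ}
    (hδ0 : 0 ≤ δ) (hδ : δ < Real.pi / 2) : ∃ C : ℝ, 0 ≤ C ∧ ∀ ζ : ℂ,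
      ζ.im ∈ Icc (Real.pi - δ) (Real.pi + δ) → 0 ≤ ζ.re → ‖X.f X.cN 0 ζ i‖ ≤ C := by
  have hpi := Real.pi_pos
  obtain ⟨C, hC, -, h2⟩ := X.exists_norm_f_le X.cN 0 i
  have h := X.f_isLittleO 0 hi (η := 0) (α := Real.pi - δ) (β := Real.pi + δ) (by simpa)
    (by linarith) (by linarith) 0
  have h' := h.bound one_pos
  rw [eventually_inf_principal] at h'
  obtain ⟨s, hs, hs'⟩ := mem_comap.1 h'
  obtain ⟨R, hR⟩ := mem_atTop_sets.1 hs
  have hl := X.lamR_pos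
  refine ⟨max 1 (C * Real.exp (Real.exp R / X.lamR)), le_max_of_le_left zero_le_one,
    fun ζ hζ h0 => ?_⟩
  rcases le_total R ζ.re with h3 | h3
  · have := hs' (hR _ h3) hζ
    simp only [Finset.range_zero, Finset.sum_empty, sub_zero, CharP.cast_eq_zero, zero_mul,
      neg_zero, Real.exp_zero, norm_one, mul_one] at this
    exact this.trans (le_max_left _ _)
  · refine (h2 ζ h0).trans (le_max_of_le_right ?_)
    have e3 : Real.exp (-(X.root 0 * ζ.re)) ≤ 1 := by
      rw [Real.exp_le_one_iff, neg_nonpos]; exact mul_nonneg (X.root_pos 0).le h0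
    calc _ ≤ C * (1 * Real.exp (Real.exp R / X.lamR)) := by gcongr
      _ = _ := by ring

/-- The jump is e^{z/λ} times a combination of f₁, f₂, f₃. Near arg z = π these are bounded for |z|
≥ 1 while e^{z/λ} decays; towards the origin the bound on H suffices. -/
theorem Family.rapid_J (X : Family) {δ : ℝ} (hδ0 : 0 ≤ δ) (hδ : δ < Real.pi / 2) :
    Rapid X.J X.gap (Real.pi - δ) (Real.pi + δ) := by
  have hpi := Real.pi_pos
  obtain ⟨A₀, hA₀, a0⟩ := X.exists_norm_f_le_of_pos (i := 0) (by decide) hδ0 hδ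
  obtain ⟨A₁, hA₁, a1⟩ := X.exists_norm_f_le_of_pos (i := 1) (by decide) hδ0 hδ
  obtain ⟨A₂, hA₂, a2⟩ := X.exists_norm_f_le_of_pos (i := 2) (by decide) hδ0 hδ
  obtain ⟨B, hB, b, -⟩ := X.exists_norm_H_le
  have hl := X.lamR_pos
  set M := ‖X.stokes‖ * A₀ + ‖(X.kappa / 2 : ℂ)‖ * A₁ + A₂ with hM
  have hM0 : 0 ≤ M := by positivity
  set c := Real.cos δ / X.lamR with hc
  have hc0 : 0 < c := div_pos (Real.cos_pos_of_mem_Ioo ⟨by linarith, hδ⟩) hl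
  -- On the right, half of the rate c is spent on absorbing e^{gap · Re ζ}; hence c/2.
  refine ⟨max (2 * B * Real.exp (c / 2)) (M * (2 / c)), c / 2, half_pos hc0, fun ζ hζ => ?_⟩
  rcases le_total ζ.re 0 with h0 | h0
  · have e0 : Real.exp ζ.re ≤ 1 := Real.exp_le_one_iff.2 h0
    have e1 : ‖X.J ζ‖ ≤ 2 * B * Real.exp (-(X.gap * ζ.re)) := by
      have k1 := b (ζ - 2 * Real.pi * Complex.I) (by simpa using h0)
      have k2 := b ζ h0
      have e : (ζ - 2 * Real.pi * Complex.I).re = ζ.re := by simp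
      rw [e] at k1
      refine (norm_sub_le _ _).trans ?_
      linarith
    have e2 : 1 ≤ Real.exp (c / 2) * Real.exp (-(c / 2 * Real.exp ζ.re)) := by
      rw [← Real.exp_add]
      exact Real.one_le_exp (by nlinarith)
    calc _ ≤ 2 * B * Real.exp (-(X.gap * ζ.re)) *
          (Real.exp (c / 2) * Real.exp (-(c / 2 * Real.exp ζ.re))) :=
          e1.trans (le_mul_of_one_le_right (by positivity) e2)
      _ = (2 * B * Real.exp (c / 2)) *
          (Real.exp (-(X.gap * ζ.re)) * Real.exp (-(c / 2 * Real.exp ζ.re))) := by ring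
      _ ≤ _ := by gcongr; exact le_max_left _ _
  · have e1 : ‖X.J ζ‖ ≤ Real.exp (-(c * Real.exp ζ.re)) * M := by
      rw [X.J_eq, norm_mul, norm_exp_exp_div]
      have hcos : Real.cos ζ.im ≤ -Real.cos δ := by
        have k : Real.cos δ ≤ Real.cos (ζ.im - Real.pi) := by
          rw [← Real.cos_abs (ζ.im - Real.pi)]
          refine Real.cos_le_cos_of_nonneg_of_le_pi (abs_nonneg _) (by linarith) (abs_le.2 ⟨?_, ?_⟩)
            <;> linarith [hζ.1, hζ.2]
        rw [Real.cos_sub_pi] at k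
        linarith
      have e2 : Real.exp ζ.re * Real.cos ζ.im / X.lamR ≤ -(c * Real.exp ζ.re) := by
        rw [hc, div_mul_eq_mul_div, ← neg_div]
        gcongr
        nlinarith [Real.exp_pos ζ.re]
      refine mul_le_mul (Real.exp_le_exp.2 e2) ?_ (norm_nonneg _) (Real.exp_pos _).le
      refine (norm_sub_le _ _).trans (add_le_add ((norm_sub_le _ _).trans (add_le_add ?_ ?_))
        (a2 ζ hζ h0))
      · rw [norm_mul, norm_neg]; gcongr; exact a0 ζ hζ h0
      · rw [norm_mul]; gcongr; exact a1 ζ hζ h0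
    have e3 : 1 ≤ (2 / c) * (Real.exp (c / 2 * Real.exp ζ.re) * Real.exp (-(X.gap * ζ.re))) := by
      have k1 : Real.exp (X.gap * ζ.re) ≤ Real.exp ζ.re :=
        Real.exp_le_exp.2 (by nlinarith [X.gap_lt_one])
      have k2 : Real.exp ζ.re ≤ 2 / c * Real.exp (c / 2 * Real.exp ζ.re) := by
        have := Real.add_one_le_exp (c / 2 * Real.exp ζ.re)
        rw [div_mul_eq_mul_div, le_div_iff₀ hc0]
        linarith
      have k3 : Real.exp (X.gap * ζ.re) * Real.exp (-(X.gap * ζ.re)) = 1 := by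
        rw [← Real.exp_add]; simp
      rw [← k3, ← mul_assoc]
      exact mul_le_mul_of_nonneg_right (k1.trans k2) (Real.exp_pos _).le
    calc _ ≤ Real.exp (-(c * Real.exp ζ.re)) * M *
          ((2 / c) * (Real.exp (c / 2 * Real.exp ζ.re) * Real.exp (-(X.gap * ζ.re)))) :=
          e1.trans (le_mul_of_one_le_right (by positivity) e3)
      _ = M * (2 / c) * (Real.exp (-(X.gap * ζ.re)) *
          (Real.exp (-(c * Real.exp ζ.re)) * Real.exp (c / 2 * Real.exp ζ.re))) := by ring
      _ = M * (2 / c) * (Real.exp (-(X.gap * ζ.re)) * Real.exp (-(c / 2 * Real.exp ζ.re))) := by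
          rw [← Real.exp_add]; congr 3; ring
      _ ≤ _ := by gcongr; exact le_max_right _ _

theorem Family.exists_norm_J_le (X : Family) {δ : ℝ} (hδ0 : 0 ≤ δ) (hδ : δ < Real.pi / 2) :
    ∃ C : ℝ, 0 ≤ C ∧ ∀ ζ : ℂ, ζ.im ∈ Icc (Real.pi - δ) (Real.pi + δ) →
      ‖X.J ζ‖ ≤ C * (Real.exp (-(X.root 0 * ζ.re)) + Real.exp (-(X.gap * ζ.re))) := by
  obtain ⟨C, c, hc, h⟩ := X.rapid_J hδ0 hδ
  refine ⟨|C|, abs_nonneg C, fun ζ hζ => (h ζ hζ).trans ?_⟩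
  have e : Real.exp (-(c * Real.exp ζ.re)) ≤ 1 := by
    rw [Real.exp_le_one_iff, neg_nonpos]; positivity
  calc _ ≤ |C| * (Real.exp (-(X.gap * ζ.re)) * 1) := by gcongr; exact le_abs_self C
    _ ≤ _ := by
      rw [mul_one]
      gcongr
      linarith [Real.exp_pos (-(X.root 0 * ζ.re))]

/-- Beyond |Im ζ| = π, shift back by 2πi and correct by the jump, which obeys the same power bounds.
-/
theorem Family.tame_H (X : Family) {δ : ℝ} (hδ0 : 0 ≤ δ) (hδ : δ < Real.pi / 2) :
    Tame X.H (-Real.pi - δ) (Real.pi + δ) := by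
  obtain ⟨C, hC, h⟩ := X.exists_norm_H_le_strip
  obtain ⟨D, hD, hJ⟩ := X.exists_norm_J_le hδ0 hδ
  have hpi := Real.pi_pos
  refine Tame.of_bound (C := C + D) (X.root_pos 0) X.root_zero_le_gap X.gap_lt_one fun ζ hζ => ?_
  set E := Real.exp (-(X.root 0 * ζ.re)) + Real.exp (-(X.gap * ζ.re)) with hE
  have hE0 : 0 ≤ E := by positivity
  have r1 : (ζ - 2 * Real.pi * Complex.I).re = ζ.re := by simp
  have i1 : (ζ - 2 * Real.pi * Complex.I).im = ζ.im - 2 * Real.pi := by simp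
  have r2 : (ζ + 2 * Real.pi * Complex.I).re = ζ.re := by simp
  have i2 : (ζ + 2 * Real.pi * Complex.I).im = ζ.im + 2 * Real.pi := by simp
  rcases le_or_gt ζ.im Real.pi with h1 | h1
  · rcases le_or_gt (-Real.pi) ζ.im with h2 | h2
    · exact (h ζ (abs_le.2 ⟨h2, h1⟩)).trans (by gcongr; linarith)
    · have e : X.H ζ = X.H (ζ + 2 * Real.pi * Complex.I) + X.J (ζ + 2 * Real.pi * Complex.I) := by
        rw [Family.J, add_sub_cancel_right]; ring
      have k1 := h (ζ + 2 * Real.pi * Complex.I) (by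
        rw [i2, abs_le]; constructor <;> linarith [hζ.1])
      have k2 := hJ (ζ + 2 * Real.pi * Complex.I) (by
        rw [i2]; constructor <;> linarith [hζ.1])
      rw [r2] at k1 k2
      rw [e, add_mul]
      exact (norm_add_le _ _).trans (add_le_add k1 k2)
  · have e : X.H ζ = X.H (ζ - 2 * Real.pi * Complex.I) - X.J ζ := by rw [Family.J]; ring
    have k1 := h (ζ - 2 * Real.pi * Complex.I) (by
      rw [i1, abs_le]; constructor <;> linarith [hζ.2])
    have k2 := hJ ζ (by constructor <;> linarith [hζ.2])
    rw [r1] at k1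
    rw [e, add_mul]
    exact (norm_sub_le _ _).trans (add_le_add k1 k2)

theorem lineInt_add_two_pi (F : ℂ → ℂ) (y : ℝ) :
    lineInt (fun τ => F (τ - 2 * Real.pi * Complex.I)) (y + 2 * Real.pi) = lineInt F y := by
  rw [lineInt, lineInt]
  refine integral_congr_ae (Eventually.of_forall fun x => ?_)
  simp only
  congr 1
  push_cast
  ring

/-- Cauchy's formula on a strip of height exactly 2π. The kernel being periodic, the lower line can
be carried onto the upper one, where the two densities combine into the jump. -/
theorem Family.H_eq_stieltjes (X : Family) {η : ℝ} (hη : |η| < Real.pi / 2) {ζ : ℂ}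
    (h1 : η - Real.pi < ζ.im) (h2 : ζ.im < η + Real.pi) :
    X.H ζ = (2 * Real.pi * Complex.I)⁻¹ *
      stieltjes X.J 0 (η + Real.pi) (ζ + 2 * Real.pi * Complex.I) := by
  have hT := (X.tame_H (abs_nonneg η) hη).mono (y₁' := η - Real.pi) (y₂' := η + Real.pi)
    (by linarith [neg_abs_le η]) (by linarith [le_abs_self η])
  have hd := X.differentiable_H
  have hpi := Real.pi_pos
  have h := hT.lineInt_kernel_sub hd.differentiableOn h1 h2 (by linarith) (by linarith)
  have hs : lineInt (fun τ => X.H τ * (Complex.exp τ / (Complex.exp τ - Complex.exp ζ)))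
      (η - Real.pi) = lineInt (fun τ => X.H (τ - 2 * Real.pi * Complex.I) *
        (Complex.exp τ / (Complex.exp τ - Complex.exp ζ))) (η + Real.pi) := by
    rw [← lineInt_add_two_pi]
    simp only [exp_sub_two_pi_I]
    congr 1; ring
  have hi2 := (hT.mono (y₁' := η + Real.pi) (by linarith) le_rfl).integrable_kernel
    hd.continuous.continuousOn (ζ := ζ) (by linarith) (by linarith) (by linarith)
  have hi1 := (hT.mono (y₂' := η - Real.pi) le_rfl (by linarith)).integrable_kernel
    hd.continuous.continuousOn (ζ := ζ) (by linarith) (by linarith) (by linarith)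
  have hi1' : Integrable fun x : ℝ => X.H (x + (η + Real.pi : ℝ) * Complex.I -
      2 * Real.pi * Complex.I) * (Complex.exp (x + (η + Real.pi : ℝ) * Complex.I) /
      (Complex.exp (x + (η + Real.pi : ℝ) * Complex.I) - Complex.exp ζ)) := by
    refine hi1.congr (Eventually.of_forall fun x => ?_)
    have e : (x : ℂ) + (η + Real.pi : ℝ) * Complex.I =
        x + (η - Real.pi : ℝ) * Complex.I + 2 * Real.pi * Complex.I := by push_cast; ring
    simp only [e, exp_add_two_pi_I, add_sub_cancel_right]
  have hJ : stieltjes X.J 0 (η + Real.pi) (ζ + 2 * Real.pi * Complex.I) =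
      2 * Real.pi * Complex.I * X.H ζ := by
    rw [← h, hs, stieltjes, lineInt, lineInt, lineInt, ← integral_sub hi1' hi2]
    refine integral_congr_ae (Eventually.of_forall fun x => ?_)
    simp only [exp_add_two_pi_I, Family.J, pow_zero]
    ring
  rw [hJ, inv_mul_cancel_left₀ two_pi_I_ne_zero]

theorem tendsto_add_strip {c : ℂ} (hc : c.re = 0) {α β : ℝ} :
    Tendsto (fun ζ => ζ + c) (comap Complex.re atTop ⊓ 𝓟 {ζ : ℂ | α ≤ ζ.im ∧ ζ.im ≤ β})
      (comap Complex.re atTop ⊓ 𝓟 {ζ : ℂ | α + c.im ≤ ζ.im ∧ ζ.im ≤ β + c.im}) := by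
  refine tendsto_inf.2 ⟨tendsto_comap_iff.2 ?_, tendsto_principal.2 ?_⟩
  · have : (Complex.re ∘ fun ζ => ζ + c) = Complex.re := by ext; simp [hc]
    rw [this]
    exact tendsto_comap.mono_left inf_le_left
  · filter_upwards [mem_inf_of_right (mem_principal_self _)] with ζ hζ
    simpa using hζ

theorem Rapid.expDecay_mul_exp {U : ℂ → ℂ} {b y₁ y₂ : ℝ} (h : Rapid U b y₁ y₂) (hb : b < 1)
    (n : ℕ) : ExpDecay (fun τ => U τ * Complex.exp ((n + 1) * τ)) y₁ y₂ := by
  have hn : (0 : ℝ) ≤ n := n.cast_nonneg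
  obtain ⟨A, m, hm, hA⟩ := h.exists_bound (s := n + 1) (by linarith) 0
  refine ⟨A, m, hm, fun ζ hζ => ?_⟩
  have := hA ζ hζ
  rw [norm_mul, Complex.norm_exp]
  simpa using this

/-- The coefficients of the power series part of the formal solution approximating `H`. -/
def Family.hCoeff (X : Family) (n : ℕ) : ℂ :=
  -((2 * Real.pi * Complex.I)⁻¹ *
    lineInt (fun τ => X.J τ * Complex.exp ((n + 1) * τ)) Real.pi)

/-- The integral is independent of η by moving the line inside the region where the jump decays, and
the ζ-dependence factors out as a pure power z^{-(n+1)} since j = 0. -/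
theorem Family.stieltjesTerm_J (X : Family) (n : ℕ) {η : ℝ} (hη : |η| < Real.pi / 2) (ζ : ℂ) :
    stieltjesTerm X.J 0 n (η + Real.pi) (ζ + 2 * Real.pi * Complex.I) =
      -(2 * Real.pi * Complex.I) * (X.hCoeff n * Complex.exp (-((n + 1) * ζ))) := by
  have h := (X.rapid_J (abs_nonneg η) hη).expDecay_mul_exp X.gap_lt_one n
  have hd : Differentiable ℂ fun τ => X.J τ * Complex.exp ((n + 1) * τ) :=
    X.differentiable_J.mul (by fun_prop)
  have l1 := (h.mono (y₁' := Real.pi - |η|) (y₂' := Real.pi) le_rfl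
    (by linarith [abs_nonneg η])).lineInt_eq (by linarith [abs_nonneg η]) hd.differentiableOn
  have l2 := (h.mono (y₁' := Real.pi - |η|) (y₂' := η + Real.pi) le_rfl
    (by linarith [le_abs_self η])).lineInt_eq (by linarith [neg_abs_le η]) hd.differentiableOn
  have hI := two_pi_I_ne_zero
  have e : stieltjesTerm X.J 0 n (η + Real.pi) (ζ + 2 * Real.pi * Complex.I) =
      Complex.exp (-((n + 1) * ζ)) *
        lineInt (fun τ => X.J τ * Complex.exp ((n + 1) * τ)) (η + Real.pi) := by
    rw [stieltjesTerm, lineInt, lineInt, ← integral_const_mul]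
    refine integral_congr_ae (Eventually.of_forall fun x => ?_)
    simp only
    set τ : ℂ := x + (η + Real.pi : ℝ) * Complex.I
    have : Complex.exp ((n + 1) * (τ - (ζ + 2 * Real.pi * Complex.I))) =
        Complex.exp ((n + 1) * τ) * Complex.exp (-((n + 1) * ζ)) := by
      rw [← Complex.exp_add, show ((n : ℂ) + 1) * (τ - (ζ + 2 * Real.pi * Complex.I)) =
        ((n + 1) * τ + -((n + 1) * ζ)) + (-(n + 1) : ℤ) * (2 * Real.pi * Complex.I) by
          push_cast; ring, Complex.exp_add _ ((-(n + 1) : ℤ) * (2 * Real.pi * Complex.I)),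
        Complex.exp_int_mul_two_pi_mul_I, mul_one]
    rw [this, pow_zero]
    ring
  rw [e, ← l2, l1, Family.hCoeff]
  field_simp

theorem Family.H_isLittleO (X : Family) {η α β : ℝ} (hη : |η| < Real.pi / 2)
    (hα : η - Real.pi < α) (hβ : β < η + Real.pi) (N : ℕ) :
    (fun ζ => X.H ζ - ∑ n ∈ Finset.range N, X.hCoeff n * Complex.exp (-((n + 1) * ζ)))
      =o[comap Complex.re atTop ⊓ 𝓟 {ζ : ℂ | α ≤ ζ.im ∧ ζ.im ≤ β}]
      fun ζ : ℂ => Real.exp (-(N * ζ.re)) := by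
  have hR := (X.rapid_J (abs_nonneg η) hη).mono (y₁' := η + Real.pi) (y₂' := η + Real.pi)
    (by linarith [neg_abs_le η]) (by linarith [le_abs_self η])
  have hc : Continuous fun x : ℝ => X.J (x + (η + Real.pi : ℝ) * Complex.I) :=
    X.differentiable_J.continuous.comp (by fun_prop)
  have h := hR.stieltjes_isLittleO X.gap_lt_one hc 0 (α := α + (2 * Real.pi * Complex.I).im)
    (β := β + (2 * Real.pi * Complex.I).im) (by simp; linarith) (by simp; linarith) N
  have h' := (h.comp_tendsto (tendsto_add_strip (c := 2 * Real.pi * Complex.I)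
    (by simp))).const_mul_left (2 * Real.pi * Complex.I)⁻¹
  refine h'.congr' ?_ (Eventually.of_forall fun ζ => by simp)
  filter_upwards [mem_inf_of_right (mem_principal_self _)] with ζ hζ
  simp only [Function.comp]
  rw [X.H_eq_stieltjes hη (hα.trans_le hζ.1) (hζ.2.trans_lt hβ)]
  simp only [X.stieltjesTerm_J _ hη, ← Finset.mul_sum]
  have := two_pi_I_ne_zero
  field_simp
  ring

/-! ### Formal power series expansions -/

/-- `F` has the asymptotic expansion `∑ m ≥ K, u m * exp (-(m ζ))` on closed substrips of the right
strip. -/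
def HasExp (K : ℤ) (F : ℂ → ℂ) (u : ℤ → ℂ) : Prop :=
  DifferentiableOn ℂ F rightStrip ∧ (∀ m < K, u m = 0) ∧ ∀ δ < Real.pi / 2, ∀ N : ℕ,
    (fun ζ => F ζ - ∑ n ∈ Finset.range N, u (K + n) * Complex.exp (-((K + n : ℤ) * ζ)))
      =o[comap Complex.re atTop ⊓ 𝓟 {ζ : ℂ | |ζ.im| ≤ δ}]
      fun ζ : ℂ => Real.exp (-((K + N - 1) * ζ.re))

/-- Lowering the starting index only adds a zero coefficient. It lets terms with different starting
indices be brought to a common one before adding. -/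
theorem HasExp.pred {K : ℤ} {F : ℂ → ℂ} {u : ℤ → ℂ} (h : HasExp K F u) : HasExp (K - 1) F u := by
  refine ⟨h.1, fun m hm => h.2.1 m (by linarith), fun δ hδ N => ?_⟩
  rcases N with _ | N
  · have h0 := h.2.2 δ hδ 0
    simp only [Finset.range_zero, Finset.sum_empty, sub_zero, Nat.cast_zero, add_zero] at h0 ⊢
    refine h0.trans_isBigO (IsBigO.of_bound 1 ?_)
    have : ∀ᶠ ζ : ℂ in comap Complex.re atTop, 0 ≤ ζ.re :=
      tendsto_comap.eventually (eventually_ge_atTop (0 : ℝ))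
    filter_upwards [mem_inf_of_left this] with ζ hζ
    rw [one_mul, Real.norm_of_nonneg (Real.exp_pos _).le, Real.norm_of_nonneg (Real.exp_pos _).le]
    push_cast
    gcongr
    linarith
  · have h0 := h.2.2 δ hδ N
    simp only [Finset.sum_range_succ']
    refine h0.congr (fun ζ => ?_) fun ζ => by push_cast; ring_nf
    have e : ∀ n : ℕ, K - 1 + ((n + 1 : ℕ) : ℤ) = K + n := fun n => by push_cast; ring
    simp only [e]
    rw [h.2.1 (K - 1 + ((0 : ℕ) : ℤ)) (by simp)]
    simp

theorem HasExp.add_smul {K : ℤ} {F G : ℂ → ℂ} {u v : ℤ → ℂ} (h : HasExp K F u)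
    (h' : HasExp K G v) (c : ℂ) : HasExp K (F + c • G) (u + c • v) := by
  refine ⟨h.1.add (h'.1.const_smul c), fun m hm => by simp [h.2.1 m hm, h'.2.1 m hm],
    fun δ hδ N => ?_⟩
  refine ((h.2.2 δ hδ N).add ((h'.2.2 δ hδ N).const_mul_left c)).congr_left fun ζ => ?_
  simp only [Pi.add_apply, Pi.smul_apply, smul_eq_mul, add_mul, Finset.sum_add_distrib, mul_sub,
    Finset.mul_sum, mul_assoc]
  ring

theorem HasExp.const_smul {K : ℤ} {F : ℂ → ℂ} {u : ℤ → ℂ} (h : HasExp K F u) (c : ℂ) :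
    HasExp K (c • F) (c • u) := by
  refine ⟨h.1.const_smul c, fun m hm => by simp [h.2.1 m hm], fun δ hδ N => ?_⟩
  refine ((h.2.2 δ hδ N).const_mul_left c).congr_left fun ζ => ?_
  simp only [Pi.smul_apply, smul_eq_mul, mul_sub, Finset.mul_sum, mul_assoc]

theorem HasExp.exp_mul {K : ℤ} {F : ℂ → ℂ} {u : ℤ → ℂ} (h : HasExp K F u) :
    HasExp (K - 1) (fun ζ => Complex.exp ζ * F ζ) fun m => u (m + 1) := by
  refine ⟨Complex.differentiable_exp.differentiableOn.mul h.1,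
    fun m hm => h.2.1 _ (by linarith), fun δ hδ N => ?_⟩
  have h1 : (fun ζ : ℂ => Complex.exp ζ) =O[comap Complex.re atTop ⊓ 𝓟 {ζ : ℂ | |ζ.im| ≤ δ}]
      fun ζ : ℂ => Real.exp ζ.re :=
    IsBigO.of_bound 1 (Eventually.of_forall fun ζ => by
      rw [Complex.norm_exp, Real.norm_of_nonneg (Real.exp_pos _).le, one_mul])
  refine (h1.mul_isLittleO (h.2.2 δ hδ N)).congr (fun ζ => ?_) fun ζ => ?_
  · rw [mul_sub, Finset.mul_sum]
    congr 1
    refine Finset.sum_congr rfl fun n _ => ?_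
    simp only
    rw [show K - 1 + (n : ℤ) + 1 = K + n by ring, mul_left_comm, ← Complex.exp_add]
    congr 2
    push_cast
    ring
  · rw [← Real.exp_add]
    push_cast
    ring_nf

/-- Cauchy's estimate on discs whose radius is the difference of the widths; the comparison function
varies by at most e^{|M|r} on such a disc. -/
theorem isLittleO_deriv_of_isLittleO {g : ℂ → ℂ} {δ δ' M : ℝ} (hg : DifferentiableOn ℂ g rightStrip)
    (hδ : δ < δ') (hδ' : δ' < Real.pi / 2)
    (h : g =o[comap Complex.re atTop ⊓ 𝓟 {ζ : ℂ | |ζ.im| ≤ δ'}] fun ζ : ℂ => Real.exp (-(M * ζ.re))) :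
    deriv g =o[comap Complex.re atTop ⊓ 𝓟 {ζ : ℂ | |ζ.im| ≤ δ}]
      fun ζ : ℂ => Real.exp (-(M * ζ.re)) := by
  set r := δ' - δ with hr
  have hr0 : 0 < r := sub_pos.2 hδ
  refine IsLittleO.of_bound fun c hc => ?_
  have h1 := h.bound (show 0 < c * r * Real.exp (-(|M| * r)) by positivity)
  rw [eventually_inf_principal] at h1 ⊢
  obtain ⟨s, hs, hs'⟩ := mem_comap.1 h1
  obtain ⟨R, hR⟩ := mem_atTop_sets.1 hs
  have h2 : ∀ᶠ ζ : ℂ in comap Complex.re atTop, R + r ≤ ζ.re :=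
    tendsto_comap.eventually (eventually_ge_atTop (R + r))
  filter_upwards [h2] with ζ hζR hζ
  have hball : ∀ w ∈ closedBall ζ r, |w.im| ≤ δ' ∧ R ≤ w.re ∧ |w.re - ζ.re| ≤ r := fun w hw => by
    rw [mem_closedBall, dist_eq_norm] at hw
    have a1 := (Complex.abs_re_le_norm _).trans hw
    have a2 := (Complex.abs_im_le_norm _).trans hw
    rw [Complex.sub_re] at a1
    rw [Complex.sub_im] at a2
    refine ⟨?_, by linarith [(abs_le.1 a1).1], a1⟩
    have := abs_add_le ζ.im (w.im - ζ.im)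
    rw [add_sub_cancel] at this
    have hζ' : |ζ.im| ≤ δ := hζ
    linarith
  have hd : DiffContOnCl ℂ g (ball ζ r) := by
    refine DifferentiableOn.diffContOnCl_ball (U := rightStrip) hg fun w hw => ?_
    exact (hball w hw).1.trans_lt hδ'
  have hb : ∀ w ∈ sphere ζ r, ‖g w‖ ≤ c * r * Real.exp (-(M * ζ.re)) := fun w hw => by
    obtain ⟨b1, b2, b3⟩ := hball w (sphere_subset_closedBall hw)
    have h3 := hs' (hR _ b2) b1
    rw [Real.norm_of_nonneg (Real.exp_pos _).le] at h3
    refine h3.trans ?_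
    rw [mul_assoc, ← Real.exp_add]
    gcongr
    have : -(M * (w.re - ζ.re)) ≤ |M| * r := by
      calc _ ≤ |M * (w.re - ζ.re)| := neg_le_abs _
        _ ≤ _ := by rw [abs_mul]; gcongr
    linarith
  have h4 := Complex.norm_deriv_le_of_forall_mem_sphere_norm_le hr0 hd hb
  rw [Real.norm_of_nonneg (Real.exp_pos _).le]
  refine h4.trans_eq ?_
  field_simp

theorem HasExp.deriv {K : ℤ} {F : ℂ → ℂ} {u : ℤ → ℂ} (h : HasExp K F u) :
    HasExp K (deriv F) fun m => -(m : ℂ) * u m := by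
  refine ⟨h.1.deriv isOpen_rightStrip, fun m hm => by simp [h.2.1 m hm], fun δ hδ N => ?_⟩
  obtain ⟨δ', h1, h2⟩ := exists_between hδ
  have hterm : ∀ (n : ℕ) (ζ : ℂ), HasDerivAt
      (fun ζ : ℂ => u (K + n) * Complex.exp (-((K + n : ℤ) * ζ)))
      (-((K + n : ℤ) : ℂ) * u (K + n) * Complex.exp (-((K + n : ℤ) * ζ))) ζ := fun n ζ => by
    have := ((((hasDerivAt_id ζ).const_mul ((K + n : ℤ) : ℂ)).neg).cexp).const_mul (u (K + n))
    exact this.congr_deriv (by simp only [id_eq, Pi.neg_apply]; ring)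
  have hS : ∀ ζ : ℂ, HasDerivAt
      (fun ζ : ℂ => ∑ n ∈ Finset.range N, u (K + n) * Complex.exp (-((K + n : ℤ) * ζ)))
      (∑ n ∈ Finset.range N, -((K + n : ℤ) : ℂ) * u (K + n) * Complex.exp (-((K + n : ℤ) * ζ))) ζ :=
    fun ζ => HasDerivAt.fun_sum fun n _ => hterm n ζ
  have hD := isLittleO_deriv_of_isLittleO (h.1.sub fun ζ _ =>
    (hS ζ).differentiableAt.differentiableWithinAt) h1 h2 (h.2.2 δ' h2 N)
  refine hD.congr' ?_ EventuallyEq.rfl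
  filter_upwards [mem_inf_of_right (mem_principal_self _)] with ζ hζ
  have hm : ζ ∈ rightStrip := lt_of_le_of_lt hζ hδ
  exact ((h.1.differentiableAt (isOpen_rightStrip.mem_nhds hm)).hasDerivAt.sub (hS ζ)).deriv

/-- Uniqueness of asymptotic expansions: along the real axis the first nonzero term would have to be
negligible against itself. -/
theorem HasExp.eq_zero {K : ℤ} {u : ℤ → ℂ} (h : HasExp K (fun _ => 0) u) : u = 0 := by
  have hn : ∀ n : ℕ, u (K + n) = 0 := fun n => by
    induction n using Nat.strong_induction_on with
    | _ n ih =>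
      have h1 := h.2.2 0 (by positivity) (n + 1)
      have hs : ∀ ζ : ℂ, (0 - ∑ i ∈ Finset.range (n + 1),
          u (K + i) * Complex.exp (-((K + i : ℤ) * ζ))) =
          -(u (K + n) * Complex.exp (-((K + n : ℤ) * ζ))) := fun ζ => by
        rw [Finset.sum_range_succ, Finset.sum_eq_zero fun i hi => by
          rw [ih i (Finset.mem_range.1 hi), zero_mul], zero_add, zero_sub]
      simp only [hs] at h1
      have ht : Tendsto (fun x : ℝ => (x : ℂ)) atTop
          (comap Complex.re atTop ⊓ 𝓟 {ζ : ℂ | |ζ.im| ≤ 0}) := by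
        refine tendsto_inf.2 ⟨tendsto_comap_iff.2 ?_, tendsto_principal.2 ?_⟩
        · exact tendsto_id
        · exact Eventually.of_forall fun x => by simp
      have h2 := (h1.comp_tendsto ht)
      by_contra hne
      have h3 := h2.bound (show 0 < ‖u (K + n)‖ / 2 by positivity)
      obtain ⟨x, hx⟩ := h3.exists
      have e1 : (-(((K + n : ℤ) : ℂ) * (x : ℂ))).re = -((K + n) * x) := by
        rw [Complex.neg_re, Complex.re_mul_ofReal]; simp
      simp only [Function.comp, norm_neg, norm_mul, Complex.norm_exp, e1, Complex.ofReal_re,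
        Real.norm_of_nonneg (Real.exp_pos _).le] at hx
      rw [show -(((K : ℝ) + ((n + 1 : ℕ) : ℝ) - 1) * x) = -((K + n) * x) by push_cast; ring] at hx
      have h4 := le_of_mul_le_mul_right hx (Real.exp_pos _)
      have h5 : 0 < ‖u (K + n)‖ := norm_pos_iff.2 hne
      linarith
  ext m
  rcases lt_or_ge m K with hm | hm
  · exact h.2.1 m hm
  · obtain ⟨n, hn'⟩ := Int.eq_ofNat_of_zero_le (sub_nonneg.2 hm)
    rw [show m = K + n by linarith]
    exact hn n

/-! ### Transfer of the differential operator -/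

/-- A transfer principle: a graded relation compatible with first order factors, with z and with
linear combinations passes to the whole operator in four steps. It serves both for conjugation by an
exponential and for passing from functions to formal series. -/
theorem Family.op_rel (X : Family) {V W : Type} [AddCommGroup V] [Module ℂ V] [AddCommGroup W]
    [Module ℂ W] {θ₁ z₁ : V → V} {θ₂ z₂ : W → W} (R : ℕ → V → W → Prop)
    (hθ : ∀ k F G, R k F G → ∀ d r : ℂ, R (k + 1) (d • θ₁ F + r • F) (d • θ₂ G + r • G))
    (hz : ∀ k F G, R k F G → R (k + 1) (z₁ F) (z₂ G))
    (hadd : ∀ k F G F' G', R k F G → R k F' G' → ∀ c : ℂ, R k (F + c • F') (G + c • G'))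
    {F : V} {G : W} (h : R 0 F G) : R 4 (X.op θ₁ z₁ F) (X.op θ₂ z₂ G) := by
  have hθ1 : ∀ k F G, R k F G → R (k + 1) (θ₁ F + F) (θ₂ G + G) := fun k F G h => by
    simpa using hθ k F G h 1 1
  refine hadd 4 _ _ _ _ (hz 3 _ _ (hθ1 2 _ _ (hθ1 1 _ _ (hθ1 0 _ _ h)))) ?_ X.lead
  cases X <;>
    exact hθ 3 _ _ (hθ 2 _ _ (hθ 1 _ _ (hθ 0 _ _ h _ _) _ _) _ _) _ _

/-- Conjugation by e^{-z/λ} replaces θ by θ - z/λ. -/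
theorem Family.op_H (X : Family) : X.op (V := ℂ → ℂ)
    (fun G ζ => deriv G ζ - X.lam⁻¹ * (Complex.exp ζ * G ζ)) (fun G ζ => Complex.exp ζ * G ζ)
      X.H = 0 := by
  set E : ℂ → ℂ := fun ζ => Complex.exp (-(Complex.exp ζ / X.lamR)) with hE
  have hEd : ∀ ζ, HasDerivAt E (-(X.lam⁻¹ * Complex.exp ζ) * E ζ) ζ := fun ζ => by
    have := (((Complex.hasDerivAt_exp ζ).div_const (X.lamR : ℂ)).neg).cexp
    exact this.congr_deriv (by rw [X.lam_eq, hE]; simp only [Pi.neg_apply]; ring)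
  have h := X.op_rel (θ₁ := fun G ζ => deriv G ζ - X.lam⁻¹ * (Complex.exp ζ * G ζ))
    (z₁ := fun G ζ => Complex.exp ζ * G ζ) (θ₂ := deriv)
    (z₂ := fun G ζ => Complex.exp ζ * G ζ)
    (fun _ (G F : ℂ → ℂ) => Differentiable ℂ G ∧ F = fun ζ => E ζ * G ζ) ?_ ?_ ?_
    (F := X.H) (G := fun ζ => X.f X.cN 0 ζ 3) ?_
  · have h2 := (X.isSolution_f X.cN 0 3).2
    rw [h.2] at h2
    ext ζ
    have h3 := congrFun h2 ζ
    simp only [Pi.zero_apply, mul_eq_zero] at h3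
    exact h3.resolve_left (Complex.exp_ne_zero _)
  · rintro k G F ⟨hG, rfl⟩ d r
    refine ⟨((hG.deriv.sub ((Complex.differentiable_exp.mul hG).const_mul _)).const_smul d).add
      (hG.const_smul r), ?_⟩
    ext ζ
    simp only [Pi.add_apply, Pi.smul_apply, smul_eq_mul]
    rw [((hEd ζ).fun_mul (hG ζ).hasDerivAt).deriv]
    ring
  · rintro k G F ⟨hG, rfl⟩
    exact ⟨Complex.differentiable_exp.mul hG, by ext ζ; simp only; ring⟩
  · rintro k G F G' F' ⟨hG, rfl⟩ ⟨hG', rfl⟩ c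
    exact ⟨hG.add (hG'.const_smul c), by ext ζ; simp; ring⟩
  · refine ⟨X.differentiable_H, ?_⟩
    ext ζ
    rw [Family.H, hE]
    simp only
    rw [← mul_assoc, ← Complex.exp_add, neg_add_cancel, Complex.exp_zero, one_mul]

theorem Family.hasExp_op (X : Family) {K : ℤ} {F : ℂ → ℂ} {u : ℤ → ℂ} (h : HasExp K F u) :
    HasExp (K - 4) (X.op (V := ℂ → ℂ)
      (fun G ζ => deriv G ζ - X.lam⁻¹ * (Complex.exp ζ * G ζ)) (fun G ζ => Complex.exp ζ * G ζ) F)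
      (X.op (V := ℤ → ℂ) (fun u m => -(m : ℂ) * u m - X.lam⁻¹ * u (m + 1))
        (fun u m => u (m + 1)) u) := by
  refine X.op_rel (fun k (F : ℂ → ℂ) (u : ℤ → ℂ) => HasExp (K - k) F u) ?_ ?_ ?_ (by simpa using h)
  · intro k F u h d r
    have h1 : HasExp (K - (k + 1 : ℕ)) F u := by
      have := h.pred; rwa [show K - (k : ℤ) - 1 = K - (k + 1 : ℕ) by push_cast; ring] at this
    have h2 : HasExp (K - (k + 1 : ℕ)) (deriv F) fun m => -(m : ℂ) * u m := by
      have := h.deriv.pred; rwa [show K - (k : ℤ) - 1 = K - (k + 1 : ℕ) by push_cast; ring] at this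
    have h3 : HasExp (K - (k + 1 : ℕ)) (fun ζ => Complex.exp ζ * F ζ) fun m => u (m + 1) := by
      have := h.exp_mul; rwa [show K - (k : ℤ) - 1 = K - (k + 1 : ℕ) by push_cast; ring] at this
    have h4 := ((h2.add_smul h3 (-X.lam⁻¹)).const_smul d).add_smul h1 r
    convert h4 using 2
    · ext ζ; simp; left; ring
    · ext m; simp; left; ring
  · intro k F u h
    have := h.exp_mul
    rwa [show K - (k : ℤ) - 1 = K - (k + 1 : ℕ) by push_cast; ring] at this
  · intro k F u G v h h' c
    exact h.add_smul h' c

/-- The coefficient sequence of the formal expansion of `H`. -/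
def Family.hSeq (X : Family) (m : ℤ) : ℂ := if m < 1 then 0 else X.hCoeff (m - 1).toNat

theorem Family.hasExp_H (X : Family) : HasExp 1 X.H X.hSeq := by
  refine ⟨X.differentiable_H.differentiableOn, fun m hm => by simp [Family.hSeq, hm],
    fun δ hδ N => ?_⟩
  have hpi := Real.pi_pos
  have h := X.H_isLittleO (η := 0) (α := -δ) (β := δ) (by simpa) (by linarith) (by linarith) N
  have e : {ζ : ℂ | |ζ.im| ≤ δ} = {ζ : ℂ | -δ ≤ ζ.im ∧ ζ.im ≤ δ} := by ext; simp [abs_le]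
  rw [e]
  refine h.congr (fun ζ => ?_) fun ζ => by simp
  congr 1
  refine Finset.sum_congr rfl fun n _ => ?_
  have : ¬ (1 + (n : ℤ) < 1) := by linarith [Int.natCast_nonneg n]
  simp only [Family.hSeq, this, if_false]
  congr 1
  · congr 1; simp
  · push_cast; ring_nf

/-- The expansion of H is mapped term by term to the expansion of the zero function, whose
coefficients all vanish. -/
theorem Family.op_hSeq (X : Family) : X.op (V := ℤ → ℂ)
    (fun u m => -(m : ℂ) * u m - X.lam⁻¹ * u (m + 1)) (fun u m => u (m + 1)) X.hSeq = 0 := by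
  have h := X.hasExp_op X.hasExp_H
  rw [X.op_H] at h
  exact h.eq_zero

/-- The recurrence satisfied by the coefficients of the exponential formal solution. -/
theorem Family.op_seq_apply (X : Family) : ∃ D : ℤ → ℂ, ∀ (u : ℤ → ℂ) (m : ℤ),
    X.lam ^ 2 * X.op (V := ℤ → ℂ) (fun u m => -(m : ℂ) * u m - X.lam⁻¹ * u (m + 1))
      (fun u m => u (m + 1)) u m = (m + 1) * u (m + 3) +
        (-X.expCoeff.1 + 3 * X.lam * m * (m + 1)) * u (m + 2) +
        X.lam * (2 * (-X.expCoeff.1 - X.lam) * m + 3 * X.lam * m ^ 3) * u (m + 1) + D m * u m := by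
  -- The contributions of u(m+4) cancel, which reflects the choice of the exponential rate -1/λ. The
  -- constants 120, 360, 1680, 15120 are μ_d times the product of the numbers in R_d.
  refine ⟨fun m => X.lam ^ 2 * (X.lam * m ^ 4 - 2 * X.lam * m ^ 3 - X.expCoeff.1 * m ^ 2 +
    (X.expCoeff.1 + X.lam) * m + match X with
      | .quintic => 120
      | .sextic => 360
      | .octic => 1680
      | .dectic => 15120), fun u m => ?_⟩
  have e2 : m + 1 + 1 = m + 2 := by ring
  have e3 : m + 2 + 1 = m + 3 := by ring
  have e4 : m + 3 + 1 = m + 4 := by ring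
  cases X <;>
  · simp only [Family.op, Family.shifts, List.foldr, Function.iterate_succ, Function.iterate_zero,
      Function.comp, id, Pi.add_apply, Pi.smul_apply, smul_eq_mul, e2, e3, e4, Family.lead,
      Family.deg, Family.lam, Family.expCoeff]
    push_cast
    ring

/-! ### The leading coefficient -/

theorem Family.sum_root (X : Family) : ∑ j, (X.root j : ℂ) = 2 := by
  cases X <;> simp [Fin.sum_univ_four, Family.root, Family.idx, Family.deg] <;> norm_num

theorem Gamma_add_nat_mul_GammaSeq {s : ℂ} (hs : 0 < s.re) {n : ℕ} (hn : n ≠ 0) :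
    Complex.Gamma (s + (n + 1 : ℕ)) * Complex.GammaSeq s n =
      Complex.exp (Real.log n * s) * n.factorial * Complex.Gamma s := by
  have hne : ∏ j ∈ Finset.range (n + 1), (s + (j : ℂ)) ≠ 0 :=
    Finset.prod_ne_zero_iff.2 fun j _ h => by
      have := congrArg Complex.re h
      simp at this
      linarith [(Nat.cast_nonneg j : (0 : ℝ) ≤ j)]
  rw [Gamma_add_nat_of_re_pos hs, Complex.GammaSeq, Complex.cpow_def_of_ne_zero
    (by exact_mod_cast hn), Complex.natCast_log]
  field_simp

/-- Euler's limit gives Γ(a + n + 1) ~ n^a n! for each root, and the roots sum to 2. -/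
theorem Family.tendsto_prod_Gamma (X : Family) :
    Tendsto (fun n : ℕ => (∏ j, Complex.Gamma (X.root j + (n + 1 : ℕ))) /
      ((n : ℂ) ^ 2 * (n.factorial : ℂ) ^ 4)) atTop (𝓝 1) := by
  have hre : ∀ j, 0 < (X.root j : ℂ).re := fun j => by simpa using X.root_pos j
  have h1 : Tendsto (fun n : ℕ => ∏ j, Complex.GammaSeq (X.root j) n) atTop
      (𝓝 (∏ j, Complex.Gamma (X.root j))) :=
    tendsto_finsetProd _ fun j _ => Complex.GammaSeq_tendsto_Gamma _
  have hne : ∏ j, Complex.Gamma (X.root j) ≠ 0 :=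
    Finset.prod_ne_zero_iff.2 fun j _ => Complex.Gamma_ne_zero_of_re_pos (hre j)
  have h2 := (tendsto_const_nhds (x := ∏ j, Complex.Gamma (X.root j))).div h1 hne
  rw [div_self hne] at h2
  refine h2.congr' ?_
  filter_upwards [eventually_ne_atTop 0, h1.eventually_ne hne] with n hn hq
  have hn' : (n : ℂ) ≠ 0 := by exact_mod_cast hn
  have hf : (n.factorial : ℂ) ≠ 0 := by exact_mod_cast n.factorial_ne_zero
  have hexp : ∏ j, Complex.exp (Real.log n * X.root j) = (n : ℂ) ^ 2 := by
    rw [← Complex.exp_sum, ← Finset.mul_sum, X.sum_root, mul_comm, ← Nat.cast_ofNat,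
      Complex.exp_nat_mul, ← Complex.ofReal_exp, Real.exp_log (by positivity), Complex.ofReal_natCast]
  have key : (∏ j, Complex.Gamma (X.root j + (n + 1 : ℕ))) * ∏ j, Complex.GammaSeq (X.root j) n =
      (n : ℂ) ^ 2 * (n.factorial : ℂ) ^ 4 * ∏ j, Complex.Gamma (X.root j) := by
    rw [← Finset.prod_mul_distrib, Finset.prod_congr rfl fun j _ =>
      Gamma_add_nat_mul_GammaSeq (hre j) hn, Finset.prod_mul_distrib, Finset.prod_mul_distrib, hexp]
    simp
  simp only [Pi.div_apply]
  rw [div_eq_div_iff hq (by positivity)]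
  linear_combination -key

/-- The product of Gammas at index k + 2 grows like (k+2)² (k+2)!⁴, and division by (k+3)!³ leaves
(k+1)! times a ratio tending to 1. -/
theorem Family.tendsto_gGamma (X : Family) :
    Tendsto (fun k : ℕ => X.gGamma (k + 3 : ℕ) / ((k + 1).factorial * X.lam ^ (k + 2))) atTop
      (𝓝 (X.lam * X.gConst)) := by
  have hl : (X.lamR : ℂ) ≠ 0 := by exact_mod_cast X.lamR_pos.ne'
  have h1 := X.tendsto_prod_Gamma.comp (tendsto_add_atTop_nat 2)
  have h2 : Tendsto (fun k : ℕ => (((k + 2 : ℕ) : ℂ) / ((k + 2 : ℕ) + 1)) ^ 3) atTop (𝓝 1) := by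
    have := ((tendsto_natCast_div_add_atTop (1 : ℂ)).comp (tendsto_add_atTop_nat 2)).pow 3
    simpa using this
  have h3 := (h1.mul h2).const_mul (X.lam * X.gConst)
  rw [mul_one, mul_one] at h3
  refine h3.congr fun k => ?_
  have hlog : Complex.exp ((k + 3 : ℕ) * Real.log X.lamR) = (X.lamR : ℂ) ^ (k + 3) := by
    rw [Complex.exp_nat_mul, ← Complex.ofReal_exp, Real.exp_log X.lamR_pos]
  have hG : Complex.Gamma (1 + (k + 3 : ℕ)) = ((k + 3).factorial : ℂ) := by
    rw [add_comm, Complex.Gamma_nat_eq_factorial]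
  rw [X.gGamma_eq (by simp; linarith [X.root_pos 0, (Nat.cast_nonneg k : (0 : ℝ) ≤ k)]), hlog, hG,
    X.lam_eq]
  have hprod : ∏ j, Complex.Gamma ((k + 3 : ℕ) + X.root j) =
      ∏ j, Complex.Gamma (X.root j + (k + 2 + 1 : ℕ)) :=
    Finset.prod_congr rfl fun j _ => by rw [add_comm]
  rw [hprod]
  simp only [Function.comp]
  generalize ∏ j, Complex.Gamma (X.root j + (k + 2 + 1 : ℕ)) = A
  have f1 : ((k + 3).factorial : ℂ) = (k + 3) * ((k + 2) * (k + 1).factorial) := by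
    rw [Nat.factorial_succ, Nat.factorial_succ (k + 1)]; push_cast; ring
  have f2 : ((k + 2).factorial : ℂ) = (k + 2) * (k + 1).factorial := by
    rw [Nat.factorial_succ]; push_cast; ring
  have n1 : ((k + 1).factorial : ℂ) ≠ 0 := by exact_mod_cast Nat.factorial_ne_zero _
  have n2 : (k : ℂ) + 2 ≠ 0 := by exact_mod_cast (Nat.succ_ne_zero (k + 1))
  have n3 : (k : ℂ) + 3 ≠ 0 := by exact_mod_cast (Nat.succ_ne_zero (k + 2))
  rw [f1, f2]
  push_cast
  rw [show (k : ℂ) + 2 + 1 = k + 3 by ring]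
  field_simp
  ring

theorem integrable_exp_neg_mul_exp {l : ℝ} (hl : 0 < l) {b s : ℝ} (hs : b < s) : Integrable fun x : ℝ =>
    Real.exp (-(b * x)) * Real.exp (-(Real.exp x / l)) * Real.exp (s * x) := by
  refine (integrable_exp_mul_exp_neg_exp (sub_pos.2 hs) (inv_pos.2 hl)).congr
    (Eventually.of_forall fun x => ?_)
  simp only
  rw [← Real.exp_add, ← Real.exp_add, ← Real.exp_add]
  ring_nf

theorem moment_exp_neg_nat (X : Family) (k j : ℕ) :
    moment (fun ζ => Complex.exp (-(((j : ℝ) : ℂ) * ζ)) * Complex.exp (-(Complex.exp ζ / X.lamR)))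
      (k + 1 + j : ℕ) = X.lam ^ (k + 2) * (k + 1).factorial := by
  rw [moment_exp_neg_exp X.lamR_pos (by simp; linarith [(Nat.cast_nonneg k : (0 : ℝ) ≤ k)])]
  have e : ((k + 1 + j : ℕ) : ℂ) + 1 - (j : ℝ) = (k + 2 : ℕ) := by push_cast; ring
  rw [e, Complex.exp_nat_mul, ← Complex.ofReal_exp, Real.exp_log X.lamR_pos, ← X.lam_eq,
    show ((k + 2 : ℕ) : ℂ) = (k + 1 : ℕ) + 1 by push_cast; ring, Complex.Gamma_nat_eq_factorial]

/-- At m = -2 the recurrence reduces to -u(1) = 0, so the expansion starts with z^{-2}. -/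
theorem Family.hSeq_of_lt_two (X : Family) {m : ℤ} (hm : m < 2) : X.hSeq m = 0 := by
  rcases lt_or_ge m 1 with h | h
  · simp [Family.hSeq, h]
  · obtain rfl : m = 1 := by omega
    obtain ⟨D, hD⟩ := X.op_seq_apply
    have h1 := hD X.hSeq (-2)
    rw [X.op_hSeq] at h1
    have z : ∀ m : ℤ, m < 1 → X.hSeq m = 0 := fun m hm => by simp [Family.hSeq, hm]
    norm_num [z] at h1
    exact h1

/-- The two-term expansion gives the bound for large x. To the left of R it follows from the power
bound on H, since e^{-3x} dominates both e^{-gap·x} and e^{-2x} there up to constants. -/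
theorem Family.exists_norm_H_sub_le (X : Family) : ∃ C : ℝ, ∀ x : ℝ,
    ‖X.H x - X.hSeq 2 * Complex.exp (-(2 * x))‖ ≤ C * Real.exp (-(3 * x)) := by
  obtain ⟨C, hC, hb⟩ := X.exists_norm_H_le_rightStrip
  have h := (X.hasExp_H.2.2 0 (by positivity) 3).bound one_pos
  rw [eventually_inf_principal] at h
  obtain ⟨s, hs, hs'⟩ := mem_comap.1 h
  obtain ⟨R, hR⟩ := mem_atTop_sets.1 hs
  set M := C * Real.exp ((3 - X.gap) * R) + ‖X.hSeq 2‖ * Real.exp R with hM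
  have hn2 : ∀ x : ℝ, ‖Complex.exp (-(2 * (x : ℂ)))‖ = Real.exp (-(2 * x)) := fun x => by
    rw [Complex.norm_exp]; simp
  have hn3 : ∀ x : ℝ, ‖Complex.exp (-(3 * (x : ℂ)))‖ = Real.exp (-(3 * x)) := fun x => by
    rw [Complex.norm_exp]; simp
  refine ⟨max M (1 + ‖X.hSeq 3‖), fun x => ?_⟩
  rcases le_total R x with hx | hx
  · have h1 := hs' (show (x : ℂ) ∈ Complex.re ⁻¹' s from hR _ (by simpa using hx)) (by simp)
    have e : ∑ n ∈ Finset.range 3, X.hSeq (1 + n) * Complex.exp (-((1 + n : ℤ) * (x : ℂ))) =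
        X.hSeq 2 * Complex.exp (-(2 * x)) + X.hSeq 3 * Complex.exp (-(3 * x)) := by
      simp only [Finset.sum_range_succ, Finset.sum_range_zero]
      norm_num [X.hSeq_of_lt_two (show (1 : ℤ) < 2 by norm_num)]
    rw [e, Real.norm_of_nonneg (Real.exp_pos _).le] at h1
    have e2 : Real.exp (-((((1 : ℤ) : ℝ) + (3 : ℕ) - 1) * (x : ℂ).re)) = Real.exp (-(3 * x)) := by
      norm_num
    rw [e2, one_mul] at h1
    have h2 : ‖X.H x - X.hSeq 2 * Complex.exp (-(2 * x))‖ ≤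
        Real.exp (-(3 * x)) + ‖X.hSeq 3‖ * Real.exp (-(3 * x)) := by
      have := norm_add_le (X.H x - (X.hSeq 2 * Complex.exp (-(2 * x)) +
        X.hSeq 3 * Complex.exp (-(3 * x)))) (X.hSeq 3 * Complex.exp (-(3 * x)))
      rw [norm_mul, hn3, ← sub_sub, sub_add_cancel] at this
      rw [← sub_sub] at h1
      linarith
    refine h2.trans ?_
    rw [show Real.exp (-(3 * x)) + ‖X.hSeq 3‖ * Real.exp (-(3 * x)) =
      (1 + ‖X.hSeq 3‖) * Real.exp (-(3 * x)) by ring]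
    gcongr
    exact le_max_right _ _
  · have h1 := hb x (ofReal_mem_rightStrip x)
    have e1 : Real.exp (-(X.gap * (x : ℂ).re)) ≤ Real.exp ((3 - X.gap) * R) * Real.exp (-(3 * x)) := by
      rw [← Real.exp_add, Complex.ofReal_re]
      gcongr
      nlinarith [X.gap_lt_one]
    have e2 : Real.exp (-(2 * x)) ≤ Real.exp R * Real.exp (-(3 * x)) := by
      rw [← Real.exp_add]
      gcongr
      linarith
    calc _ ≤ ‖X.H x‖ + ‖X.hSeq 2‖ * Real.exp (-(2 * x)) := by
          rw [← hn2, ← norm_mul]; exact norm_sub_le _ _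
      _ ≤ C * (Real.exp ((3 - X.gap) * R) * Real.exp (-(3 * x))) +
          ‖X.hSeq 2‖ * (Real.exp R * Real.exp (-(3 * x))) := by
          gcongr
          exact h1.trans (by gcongr)
      _ = M * Real.exp (-(3 * x)) := by rw [hM]; ring
      _ ≤ _ := by gcongr; exact le_max_left _ _

/-- Large moments see only the behaviour at infinity: inserting the leading term of H gives -2πi
γ_d(k+4) = u(2) λ^{k+3} (k+2)! + O(λ^{k+2} (k+1)!). Comparison with the growth of γ_d determines
u(2) = -2πi λ `gConst`. -/
theorem Family.hSeq_two (X : Family) :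
    X.hSeq 2 = X.lam * Real.sqrt X.kappa / (2 * Real.pi * Complex.I) := by
  have hI := two_pi_I_ne_zero
  have hlR := X.lamR_pos
  have hl : X.lam ≠ 0 := by rw [X.lam_eq]; exact_mod_cast hlR.ne'
  obtain ⟨C, hC⟩ := X.exists_norm_H_sub_le
  set w : ℂ → ℂ := fun ζ => Complex.exp (-(Complex.exp ζ / X.lamR)) with hw
  have hwR : ∀ x : ℝ, ‖w x‖ = Real.exp (-(Real.exp x / X.lamR)) := fun x => by
    rw [hw]; simp only
    rw [Complex.norm_exp, Complex.neg_re, Complex.div_ofReal_re, Complex.exp_ofReal_re]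
  have hVH : ∀ x : ℝ, w x * X.H x = -(2 * Real.pi * Complex.I) * X.V x := fun x => by
    rw [X.H_eq_V (ofReal_mem_rightStrip x), hw]
    simp only
    rw [mul_left_comm, ← mul_assoc (Complex.exp _), ← Complex.exp_add, neg_add_cancel,
      Complex.exp_zero, one_mul]
  have herr : ∀ k : ℕ, ‖-(2 * Real.pi * Complex.I) * X.gGamma (k + 4 : ℕ) -
      X.hSeq 2 * (X.lam ^ (k + 3) * (k + 2).factorial)‖ ≤
        C * (X.lamR ^ (k + 2) * (k + 1).factorial) := fun k => by
    have hk : (0 : ℝ) ≤ k := k.cast_nonneg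
    set B : ℝ → ℝ := fun x => Real.exp (-((3 : ℕ) * x)) * Real.exp (-(Real.exp x / X.lamR)) *
      Real.exp ((((k + 1 + 3 : ℕ) : ℝ) + 1) * x) with hB
    have hBi : Integrable B := integrable_exp_neg_mul_exp hlR (by push_cast; linarith)
    have hBv : ∫ x, B x = X.lamR ^ (k + 2) * (k + 1).factorial := by
      have h := moment_exp_neg_nat X k 3
      rw [X.lam_eq, moment] at h
      have : ((∫ x, B x : ℝ) : ℂ) = ((X.lamR ^ (k + 2) * (k + 1).factorial : ℝ) : ℂ) := by
        rw [← integral_complex_ofReal]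
        push_cast at h ⊢
        rw [← h]
        refine integral_congr_ae (Eventually.of_forall fun x => ?_)
        simp only [hB]
        push_cast
        rfl
      exact_mod_cast this
    have hm2 := moment_exp_neg_nat X (k + 1) 2
    have hmV := X.moment_V (s := (k + 4 : ℕ)) (by simp; linarith [X.root_pos 0])
    have hi1 : Integrable fun x : ℝ => X.V x * Complex.exp ((((k + 4 : ℕ) : ℂ) + 1) * x) := by
      have := X.integrable_logMoment 0 (k + 4) 0
      simpa using this
    have hi2 : Integrable fun x : ℝ => Complex.exp (-(((2 : ℕ) : ℝ) * (x : ℂ))) * w x *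
        Complex.exp ((((k + 4 : ℕ) : ℂ) + 1) * x) := by
      have h := (integrable_exp_neg_mul_exp hlR (b := 2) (s := ((k + 4 : ℕ) : ℝ) + 1)
        (by push_cast; linarith)).ofReal (𝕜 := ℂ)
      refine h.congr (Eventually.of_forall fun x => ?_)
      simp [hw]
    have heq : -(2 * Real.pi * Complex.I) * X.gGamma (k + 4 : ℕ) -
        X.hSeq 2 * (X.lam ^ (k + 3) * (k + 2).factorial) =
        ∫ x : ℝ, w x * (X.H x - X.hSeq 2 * Complex.exp (-(2 * x))) *
          Complex.exp ((((k + 4 : ℕ) : ℂ) + 1) * x) := by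
      rw [← hmV, ← hm2, moment, moment, ← integral_const_mul, ← integral_const_mul,
        show k + 1 + 1 + 2 = k + 4 by ring, ← integral_sub (hi1.const_mul _) (hi2.const_mul _)]
      refine integral_congr_ae (Eventually.of_forall fun x => ?_)
      simp only
      have := hVH x
      rw [mul_sub, this, hw]
      push_cast
      ring
    rw [heq, ← hBv, ← integral_const_mul]
    refine norm_integral_le_of_norm_le (hBi.const_mul C) (Eventually.of_forall fun x => ?_)
    have e1 : ‖Complex.exp ((((k + 4 : ℕ) : ℂ) + 1) * x)‖ =
        Real.exp ((((k + 1 + 3 : ℕ) : ℝ) + 1) * x) := by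
      rw [Complex.norm_exp, Complex.re_mul_ofReal]; simp; left; ring
    rw [norm_mul, norm_mul, hwR, e1]
    calc _ ≤ Real.exp (-(Real.exp x / X.lamR)) * (C * Real.exp (-(3 * x))) *
          Real.exp ((((k + 1 + 3 : ℕ) : ℝ) + 1) * x) := by gcongr; exact hC x
      _ = _ := by rw [hB]; push_cast; ring
  have hlim1 : Tendsto (fun k : ℕ => -(2 * Real.pi * Complex.I) *
      (X.gGamma (k + 1 + 3 : ℕ) / ((k + 1 + 1).factorial * X.lam ^ (k + 1 + 2))) - X.hSeq 2) atTop
      (𝓝 (-(2 * Real.pi * Complex.I) * (X.lam * X.gConst) - X.hSeq 2)) :=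
    ((X.tendsto_gGamma.comp (tendsto_add_atTop_nat 1)).const_mul _).sub_const _
  have hlim2 : Tendsto (fun k : ℕ => -(2 * Real.pi * Complex.I) *
      (X.gGamma (k + 1 + 3 : ℕ) / ((k + 1 + 1).factorial * X.lam ^ (k + 1 + 2))) - X.hSeq 2) atTop
      (𝓝 0) := by
    -- The error is one factorial lower than the main term, so the quotient is at most C/λ times
    -- 1/(k+2).
    have hz : Tendsto (fun k : ℕ => C / X.lamR * (1 / ((k : ℝ) + 1))) atTop (𝓝 0) := by
      simpa using tendsto_one_div_add_atTop_nhds_zero_nat.const_mul (C / X.lamR)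
    have hC0 : 0 ≤ C := by
      have := (norm_nonneg _).trans (hC 0)
      simpa using this
    refine squeeze_zero_norm (fun k => ?_) hz
    have hD : (((k + 1 + 1).factorial : ℂ) * X.lam ^ (k + 1 + 2)) ≠ 0 :=
      mul_ne_zero (by exact_mod_cast Nat.factorial_ne_zero _) (pow_ne_zero _ hl)
    have e : -(2 * Real.pi * Complex.I) *
        (X.gGamma (k + 1 + 3 : ℕ) / ((k + 1 + 1).factorial * X.lam ^ (k + 1 + 2))) - X.hSeq 2 =
        (-(2 * Real.pi * Complex.I) * X.gGamma (k + 4 : ℕ) -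
          X.hSeq 2 * (X.lam ^ (k + 3) * (k + 2).factorial)) /
          ((k + 1 + 1).factorial * X.lam ^ (k + 1 + 2)) := by
      have n1 : ((k + 1 + 1).factorial : ℂ) ≠ 0 := by exact_mod_cast Nat.factorial_ne_zero _
      have n2 : X.lam ^ (k + 1 + 2) ≠ 0 := pow_ne_zero _ hl
      rw [show k + 4 = k + 1 + 3 by ring, show k + 3 = k + 1 + 2 by ring,
        show k + 2 = k + 1 + 1 by ring, eq_div_iff hD]
      field_simp
    have hN : ‖((k + 1 + 1).factorial * X.lam ^ (k + 1 + 2) : ℂ)‖ =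
        (k + 2).factorial * X.lamR ^ (k + 3) := by
      rw [norm_mul, norm_pow, X.lam_eq, Complex.norm_real, Complex.norm_natCast,
        Real.norm_of_nonneg hlR.le]
    rw [e, norm_div, hN]
    have hf : (((k + 2).factorial : ℕ) : ℝ) = (k + 2) * (k + 1).factorial := by
      rw [Nat.factorial_succ]; push_cast; ring
    have hp : (0 : ℝ) < (k + 1).factorial := by exact_mod_cast Nat.factorial_pos _
    have hk : (0 : ℝ) ≤ k := k.cast_nonneg
    calc _ ≤ C * (X.lamR ^ (k + 2) * (k + 1).factorial) / ((k + 2).factorial * X.lamR ^ (k + 3)) := by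
          gcongr; exact herr k
      _ = C / X.lamR * (1 / ((k : ℝ) + 2)) := by rw [hf]; field_simp; ring
      _ ≤ _ := by gcongr; norm_num
  have h0 := tendsto_nhds_unique hlim1 hlim2
  have hpi : (Real.pi : ℂ) ≠ 0 := by exact_mod_cast Real.pi_ne_zero
  rw [← sub_eq_zero.1 h0, X.gConst_eq, eq_div_iff hI]
  push_cast
  field_simp
  rw [Complex.I_sq]
  ring

/-! ### The exponential formal solution -/

theorem Family.isExpSeries_iff (X : Family) {D : ℤ → ℂ} (hD : ∀ (u : ℤ → ℂ) (m : ℤ),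
    X.lam ^ 2 * X.op (V := ℤ → ℂ) (fun u m => -(m : ℂ) * u m - X.lam⁻¹ * u (m + 1))
      (fun u m => u (m + 1)) u m = (m + 1) * u (m + 3) +
        (-X.expCoeff.1 + 3 * X.lam * m * (m + 1)) * u (m + 2) +
        X.lam * (2 * (-X.expCoeff.1 - X.lam) * m + 3 * X.lam * m ^ 3) * u (m + 1) + D m * u m)
    (u : ℤ → ℂ) : X.IsExpSeries u ↔ (∀ m < 2, u m = 0) ∧ u 2 = 1 ∧ ∀ m : ℤ,
      (m + 1) * u (m + 3) + (-X.expCoeff.1 + 3 * X.lam * m * (m + 1)) * u (m + 2) +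
        X.lam * (2 * (-X.expCoeff.1 - X.lam) * m + 3 * X.lam * m ^ 3) * u (m + 1) + D m * u m = 0 := by
  have hl : X.lam ^ 2 ≠ 0 := by
    rw [X.lam_eq]; exact pow_ne_zero _ (by exact_mod_cast X.lamR_pos.ne')
  rw [Family.IsExpSeries, funext_iff]
  simp only [← hD, mul_eq_zero, hl, false_or, Pi.zero_apply]

theorem Family.lam_ne_zero (X : Family) : X.lam ≠ 0 := by
  rw [X.lam_eq]; exact_mod_cast X.lamR_pos.ne'

theorem Family.hSeq_two_ne_zero (X : Family) : X.hSeq 2 ≠ 0 := by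
  have hk : 0 < X.kappa := by cases X <;> norm_num [Family.kappa]
  rw [X.hSeq_two]
  exact div_ne_zero (mul_ne_zero X.lam_ne_zero (by exact_mod_cast (Real.sqrt_pos.2 hk).ne'))
    two_pi_I_ne_zero

/-- The normalized coefficient sequence of the exponential formal solution. -/
def Family.expSeq (X : Family) (m : ℤ) : ℂ := X.hSeq m / X.hSeq 2

theorem Family.isExpSeries_expSeq (X : Family) : X.IsExpSeries X.expSeq := by
  obtain ⟨D, hD⟩ := X.op_seq_apply
  rw [X.isExpSeries_iff hD]
  refine ⟨fun m hm => by simp [Family.expSeq, X.hSeq_of_lt_two hm],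
    div_self X.hSeq_two_ne_zero, fun m => ?_⟩
  have h := hD X.hSeq m
  rw [X.op_hSeq] at h
  simp only [Pi.zero_apply, mul_zero] at h
  simp only [Family.expSeq]
  have := X.hSeq_two_ne_zero
  field_simp
  linear_combination -h

/-- The recurrence at m = n ≥ 0 determines u(n+3) from earlier terms because its coefficient n + 1
is nonzero. -/
theorem Family.IsExpSeries.unique {X : Family} {u v : ℤ → ℂ} (hu : X.IsExpSeries u)
    (hv : X.IsExpSeries v) : u = v := by
  obtain ⟨D, hD⟩ := X.op_seq_apply
  rw [X.isExpSeries_iff hD] at hu hv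
  have h : ∀ n : ℕ, u (n + 2) = v (n + 2) := fun n => by
    have e : ∀ i : ℤ, i < 2 → u i = v i := fun i hi => by rw [hu.1 i hi, hv.1 i hi]
    induction n using Nat.strong_induction_on with
    | _ n ih =>
      rcases n with _ | n
      · simpa using hu.2.1.trans hv.2.1.symm
      · have hprev : ∀ i : ℤ, i < n + 3 → u i = v i := fun i hi => by
          rcases lt_or_ge i 2 with h | h
          · exact e i h
          · obtain ⟨j, rfl⟩ : ∃ j : ℕ, i = j + 2 := ⟨(i - 2).toNat, by omega⟩
            exact ih j (by omega)
        have h1 := hu.2.2 n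
        have h2 := hv.2.2 n
        rw [hprev _ (show (n : ℤ) + 2 < n + 3 by omega), hprev _ (show (n : ℤ) + 1 < n + 3 by omega),
          hprev _ (show (n : ℤ) < n + 3 by omega)] at h1
        have hn : ((n : ℤ) : ℂ) + 1 ≠ 0 := by exact_mod_cast Nat.succ_ne_zero n
        have h3 : u ((n : ℤ) + 3) = v (n + 3) := mul_left_cancel₀ hn (by linear_combination h1 - h2)
        rw [show ((n + 1 : ℕ) : ℤ) + 2 = n + 3 by push_cast; ring]
        exact h3
  ext i
  rcases lt_or_ge i 2 with hi | hi
  · rw [hu.1 i hi, hv.1 i hi]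
  · obtain ⟨j, rfl⟩ : ∃ j : ℕ, i = j + 2 := ⟨(i - 2).toNat, by omega⟩
    exact h j

/-- The first two instances of the recurrence, m = 0 and m = 1, with u(0) = u(1) = 0 and u(2) = 1.
-/
theorem Family.IsExpSeries.coeff {X : Family} {u : ℤ → ℂ} (hu : X.IsExpSeries u) :
    u 3 = X.expCoeff.1 ∧ u 4 = X.expCoeff.2 := by
  obtain ⟨D, hD⟩ := X.op_seq_apply
  rw [X.isExpSeries_iff hD] at hu
  have h0 := hu.2.2 0
  have h1 := hu.2.2 1
  norm_num [hu.2.1, hu.1 1 (by norm_num), hu.1 0 (by norm_num)] at h0 h1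
  have e3 : u 3 = X.expCoeff.1 := by linear_combination h0
  refine ⟨e3, ?_⟩
  rw [e3] at h1
  cases X <;> norm_num [Family.expCoeff, Family.lam] at h1 ⊢ <;> linear_combination h1 / 2

/-! ### Powers of the monodromy matrix -/

/-- The one-parameter group of unipotent matrices through `L`. -/
def Family.unip (X : Family) (a t : ℂ) : Matrix (Fin 4) (Fin 4) ℂ :=
  !![1, t, t * a + X.kappa * t ^ 2 / 2, 0; 0, 1, X.kappa * t, 0; 0, 0, 1, 0; 0, 0, 0, 1]

theorem Family.matL_eq (X : Family) (a : ℂ) : X.matL a = X.unip a 1 := by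
  cases X <;> simp [Family.matL, Family.unip, Family.kappa]

theorem Family.unip_mul (X : Family) (a s t : ℂ) :
    X.unip a s * X.unip a t = X.unip a (s + t) := by
  ext i j
  fin_cases i <;> fin_cases j <;> simp [Family.unip, Matrix.mul_apply, Fin.sum_univ_four] <;> ring

theorem Family.unip_zero (X : Family) (a : ℂ) : X.unip a 0 = 1 := by
  ext i j
  fin_cases i <;> fin_cases j <;> simp [Family.unip]

/-- `L` lies in a one-parameter group, so integer powers, including negative ones, are explicit. -/
theorem Family.matL_zpow (X : Family) (a : ℂ) (k : ℤ) : X.matL a ^ k = X.unip a k := by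
  have hn : ∀ n : ℕ, X.matL a ^ n = X.unip a n := fun n => by
    induction n with
    | zero => simp [X.unip_zero]
    | succ n ih => rw [pow_succ, ih, X.matL_eq, X.unip_mul]; push_cast; rfl
  cases k with
  | ofNat n => simpa using hn n
  | negSucc n =>
    rw [zpow_negSucc, hn]
    refine Matrix.inv_eq_right_inv ?_
    rw [X.unip_mul, ← X.unip_zero a]
    congr 1
    push_cast
    ring

theorem Family.vecMul_unip (X : Family) (a t : ℂ) (v : Fin 4 → ℂ) :
    v ᵥ* X.unip a t = ![v 0, t * v 0 + v 1,
      (t * a + X.kappa * t ^ 2 / 2) * v 0 + X.kappa * t * v 1 + v 2, v 3] := by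
  ext j
  fin_cases j <;> simp [Family.unip, Matrix.vecMul, dotProduct, Fin.sum_univ_four] <;> ring

theorem Family.matKbar_eq (X : Family) (a : ℂ) : X.matKbar a =
    !![1, 0, 0, -X.stokes; 0, 1, 0, a - X.kappa / 2; 0, 0, 1, -1; 0, 0, 0, 1] := by
  cases X <;> simp [Family.matKbar, Family.stokes, Family.kappa]

/-! ### The fundamental systems -/

/-- The row vector of which `Φ` is a constant multiple. -/
def Family.row (X : Family) (a : ℂ) (p : ℤ) (ζ : ℂ) : Fin 4 → ℂ :=
  ![X.f X.cN a ζ 0, X.f X.cN a ζ 1, X.f X.cN a ζ 2, X.f X.cN a (ζ - p * (2 * Real.pi * Complex.I)) 3]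

/-- Even and odd sectors are treated uniformly: p = 1 only moves the fourth component back by one
turn. -/
theorem Family.Phi_eq (X : Family) (a : ℂ) (k p : ℤ) (hp : p = 0 ∨ p = 1) (ζ : ℂ) :
    X.Phi X.cN a (2 * k + p) ζ =
      X.row a p (ζ - k * (2 * Real.pi * Complex.I)) ᵥ* X.unip a (-k) := by
  rcases hp with rfl | rfl
  · have e : rot (2 * k) ζ = ζ - k * (2 * Real.pi * Complex.I) := by
      rw [rot]; push_cast; ring
    rw [add_zero, Family.Phi, if_pos (even_two_mul k), Int.mul_ediv_cancel_left _ two_ne_zero,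
      X.matL_zpow, e]
    push_cast
    congr 1
    ext i
    fin_cases i <;> simp [Family.row]
  · have e : rot (2 * k) ζ = ζ - k * (2 * Real.pi * Complex.I) := by
      rw [rot]; push_cast; ring
    have e' : ∀ w, rot 2 w = w - (1 : ℤ) * (2 * Real.pi * Complex.I) := fun w => by
      rw [rot]; push_cast; ring
    rw [Family.Phi, if_neg (Int.not_even_two_mul_add_one k), add_sub_cancel_right,
      Int.mul_ediv_cancel_left _ two_ne_zero, X.matL_zpow, e, e',
      Int.cast_neg, Family.row]

theorem exp_neg_int_mul_two_pi_I (n : ℤ) : Complex.exp (-(n * (2 * Real.pi * Complex.I))) = 1 := by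
  rw [Complex.exp_neg, Complex.exp_int_mul_two_pi_mul_I, inv_one]

theorem Family.row_three (X : Family) (a : ℂ) (k p : ℤ) (ζ : ℂ) :
    X.row a p (ζ - k * (2 * Real.pi * Complex.I)) 3 =
      X.f X.cN a (ζ - (k + p : ℤ) * (2 * Real.pi * Complex.I)) 3 := by
  rw [show ζ - (k + p : ℤ) * (2 * Real.pi * Complex.I) = ζ - k * (2 * Real.pi * Complex.I) -
    p * (2 * Real.pi * Complex.I) by push_cast; ring]
  rfl

theorem Family.isSolution_row (X : Family) (a : ℂ) (k p : ℤ) (i : Fin 4) :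
    X.IsSolution fun ζ => X.row a p (ζ - k * (2 * Real.pi * Complex.I)) i := by
  have h : ∀ (n : ℤ) (i : Fin 4),
      X.IsSolution fun ζ => X.f X.cN a (ζ - n * (2 * Real.pi * Complex.I)) i := fun n i => by
    simpa only [← sub_eq_add_neg] using (X.isSolution_f X.cN a i).comp_add (exp_neg_int_mul_two_pi_I n)
  fin_cases i
  · exact h k 0
  · exact h k 1
  · exact h k 2
  · exact (funext fun ζ => (X.row_three a k p ζ).symm) ▸ h (k + p) 3

theorem Family.isSolution_Phi (X : Family) (a : ℂ) (k p : ℤ) (hp : p = 0 ∨ p = 1) (j : Fin 4) :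
    X.IsSolution fun ζ => X.Phi X.cN a (2 * k + p) ζ j := by
  have e : (fun ζ => X.Phi X.cN a (2 * k + p) ζ j) = ∑ i : Fin 4, X.unip a (-k) i j •
      fun ζ => X.row a p (ζ - k * (2 * Real.pi * Complex.I)) i := by
    ext ζ
    rw [X.Phi_eq a k p hp]
    simp [Matrix.vecMul, dotProduct, mul_comm]
  rw [e]
  exact Family.IsSolution.sum _ fun i _ => (X.isSolution_row a k p i).smul _

/-! ### Asymptotic expansions -/

/-- Continuation by k turns mixes the logarithmic moments binomially, and L^{-k} is exactly the
inverse mixing. The formal solutions are therefore the same in every sector. -/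
theorem Family.gTerm_eq (X : Family) (a : ℂ) (k : ℤ) (n : ℕ) (ζ : ℂ) (j : Fin 4) :
    X.gTerm a j n ζ = ∑ i, X.unip a (-k) i j * X.gTerm a i n (ζ - k * (2 * Real.pi * Complex.I)) := by
  obtain ⟨h0, h1, h2⟩ := X.logMoment_shift n k ζ
  have hI := two_pi_I_ne_zero
  simp only [Family.gTerm, h0, h1, h2]
  generalize (2 * Real.pi * Complex.I : ℂ) = T at hI
  fin_cases j <;> simp [Fin.sum_univ_four, Family.unip] <;> field_simp <;> ring

theorem Family.Psi_of_ne_three (X : Family) (a : ℂ) (c : ℤ → ℂ) {j : Fin 4} (hj : j ≠ 3) :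
    X.Psi a c j = ⟨0, X.gTerm a j⟩ := by
  fin_cases j <;> simp [Family.Psi, Family.gTerm, X.GTerm_zero, X.deriv_GTerm_zero,
    X.iteratedDeriv_two_GTerm_zero, funext_iff] at hj ⊢

theorem exists_angle {s t u v : ℝ} (h1 : s < t) (h2 : s < v) (h3 : u < t) (h4 : u < v) :
    ∃ η, s < η ∧ u < η ∧ η < t ∧ η < v := by
  obtain ⟨η, h, h'⟩ := exists_between (max_lt (lt_min h1 h2) (lt_min h3 h4))
  exact ⟨η, (max_lt_iff.1 h).1, (max_lt_iff.1 h).2, (lt_min_iff.1 h').1, (lt_min_iff.1 h').2⟩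

theorem re_neg_int_mul_two_pi_I (k : ℤ) : (-(k * (2 * Real.pi * Complex.I)) : ℂ).re = 0 := by simp

theorem im_neg_int_mul_two_pi_I (k : ℤ) :
    (-(k * (2 * Real.pi * Complex.I)) : ℂ).im = -(k * (2 * Real.pi)) := by simp

theorem Family.isAsymp_Phi_of_ne_three (X : Family) (a : ℂ) (c : ℤ → ℂ) (k p : ℤ)
    (hp : p = 0 ∨ p = 1) {j : Fin 4} (hj : j ≠ 3) :
    IsAsymp (2 * k + p) (fun ζ => X.Phi X.cN a (2 * k + p) ζ j) (X.Psi a c j) := by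
  intro α β hα hβ N
  have hpi := Real.pi_pos
  have hp0 : (0 : ℝ) ≤ p ∧ (p : ℝ) ≤ 1 := by rcases hp with rfl | rfl <;> norm_num
  rw [X.Psi_of_ne_three a c hj]
  push_cast at hα hβ
  -- A line of integration in (-π/2, π/2) must lie below the shifted subsector and within 2π of its
  -- top; the bounds of the sector guarantee room for both p = 0 and p = 1.
  obtain ⟨η, h1, h2, h3, h4⟩ := exists_angle (s := -(Real.pi / 2)) (t := Real.pi / 2)
    (u := β + -(k * (2 * Real.pi)) - 2 * Real.pi) (v := α + -(k * (2 * Real.pi)))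
    (by linarith) (by nlinarith) (by nlinarith) (by nlinarith)
  have ht := tendsto_add_strip (re_neg_int_mul_two_pi_I k) (α := α) (β := β)
  rw [im_neg_int_mul_two_pi_I] at ht
  have h := fun (i : Fin 4) (hi : i ≠ 3) =>
    ((X.f_isLittleO a hi (abs_lt.2 ⟨h1, h3⟩) h4 (by linarith) N).comp_tendsto ht).const_mul_left
      (X.unip a (-k) i j)
  have hs := ((h 0 (by decide)).add (h 1 (by decide))).add (h 2 (by decide))
  refine (hs.congr_left fun ζ => ?_).congr_right fun ζ => ?_
  · have h3j : X.unip a (-k) 3 j = 0 := by fin_cases j <;> simp [Family.unip] at hj ⊢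
    have hrow : X.Phi X.cN a (2 * k + p) ζ j = X.unip a (-k) 0 j *
        X.f X.cN a (ζ - k * (2 * Real.pi * Complex.I)) 0 + X.unip a (-k) 1 j *
        X.f X.cN a (ζ - k * (2 * Real.pi * Complex.I)) 1 + X.unip a (-k) 2 j *
        X.f X.cN a (ζ - k * (2 * Real.pi * Complex.I)) 2 := by
      rw [X.Phi_eq a k p hp]
      simp [Matrix.vecMul, dotProduct, Fin.sum_univ_four, h3j, Family.row, mul_comm]
    simp only [Function.comp, ← sub_eq_add_neg, zero_mul, neg_zero, Complex.exp_zero, one_mul, hrow]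
    rw [Finset.sum_congr rfl fun n _ => X.gTerm_eq a k n ζ j]
    simp only [Fin.sum_univ_four, h3j, zero_mul, add_zero, Finset.sum_add_distrib, ← Finset.mul_sum]
    ring
  · simp

theorem Family.isAsymp_Phi_three (X : Family) (a : ℂ) (k p : ℤ) (hp : p = 0 ∨ p = 1) :
    IsAsymp (2 * k + p) (fun ζ => X.Phi X.cN a (2 * k + p) ζ 3) (X.Psi a X.expSeq 3) := by
  intro α β hα hβ N
  have hpi := Real.pi_pos
  have hp0 : (0 : ℝ) ≤ p ∧ (p : ℝ) ≤ 1 := by rcases hp with rfl | rfl <;> norm_num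
  push_cast at hα hβ
  -- For the fourth component the shifted subsector must lie within π of η on either side, matching
  -- the range in which H is the Cauchy integral of its jump.
  obtain ⟨η, h1, h2, h3, h4⟩ := exists_angle (s := -(Real.pi / 2)) (t := Real.pi / 2)
    (u := β + -((k + p : ℤ) * (2 * Real.pi)) - Real.pi)
    (v := α + -((k + p : ℤ) * (2 * Real.pi)) + Real.pi)
    (by linarith) (by push_cast; nlinarith) (by push_cast; nlinarith) (by push_cast; nlinarith)
  have ht := tendsto_add_strip (re_neg_int_mul_two_pi_I (k + p)) (α := α) (β := β)
  rw [im_neg_int_mul_two_pi_I] at ht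
  have h := (X.H_isLittleO (abs_lt.2 ⟨h1, h3⟩) (by linarith) (by linarith) N).comp_tendsto ht
  refine (h.congr_left fun ζ => ?_).congr_right fun ζ => ?_
  · have hrow : X.Phi X.cN a (2 * k + p) ζ 3 =
        X.f X.cN 0 (ζ - (k + p : ℤ) * (2 * Real.pi * Complex.I)) 3 := by
      rw [X.Phi_eq a k p hp, X.vecMul_unip, ← X.f_three_eq_zero_param _ a]
      exact X.row_three a k p ζ
    have hexp : ∀ n : ℕ, Complex.exp (-((n + 1) * (ζ - (k + p : ℤ) * (2 * Real.pi * Complex.I)))) =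
        Complex.exp (-((n + 1) * ζ)) := fun n => by
      rw [show -(((n : ℂ) + 1) * (ζ - (k + p : ℤ) * (2 * Real.pi * Complex.I))) =
        -((n + 1) * ζ) + ((n + 1) * (k + p) : ℤ) * (2 * Real.pi * Complex.I) by push_cast; ring,
        Complex.exp_add, Complex.exp_int_mul_two_pi_mul_I, mul_one]
    have hexp' : Complex.exp (ζ - (k + p : ℤ) * (2 * Real.pi * Complex.I)) = Complex.exp ζ := by
      rw [sub_eq_add_neg, Complex.exp_add, exp_neg_int_mul_two_pi_I, mul_one]
    have hc : ∀ n : ℕ, X.hCoeff n = X.lam * Real.sqrt X.kappa / (2 * Real.pi * Complex.I) *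
        X.expSeq (n + 1) := fun n => by
      rw [Family.expSeq, ← X.hSeq_two, mul_div_cancel₀ _ X.hSeq_two_ne_zero, Family.hSeq,
        if_neg (by omega)]
      simp
    simp only [Function.comp, ← sub_eq_add_neg, hrow, Family.Psi, Matrix.cons_val, hexp, Family.H,
      hexp', hc]
    rw [show -(-X.lam⁻¹ * Complex.exp ζ) = Complex.exp ζ / X.lamR by rw [X.lam_eq]; ring]
    simp only [mul_assoc]
  · simp

/-! ### Stokes matrices -/

/-- This is the relation expressing f₄ one turn back through the present f₁, ..., f₄. -/
theorem Family.vecMul_matKbar (X : Family) (a : ℂ) (ζ : ℂ) :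
    X.row a 0 ζ ᵥ* X.matKbar a = X.row a 1 ζ := by
  have h := X.f_three_monodromy X.cN a (ζ - 2 * Real.pi * Complex.I)
  rw [sub_add_cancel] at h
  ext j
  fin_cases j <;> simp [X.matKbar_eq, Matrix.vecMul, dotProduct, Fin.sum_univ_four, Family.row, h]
  ring

/-- One turn back acts on the first three components by `L`, with a multiple of f₄ added only to f₁
before `L` acts on the others: this is the monodromy of f₁, f₂, f₃. The fourth component is common
to both rows. -/
theorem Family.vecMul_matK (X : Family) (a : ℂ) (ζ : ℂ) :
    X.row a 0 (ζ - 2 * Real.pi * Complex.I) = X.row a 1 ζ ᵥ* (X.unip a 1 * matK) := by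
  obtain ⟨h0, h1, h2⟩ := X.f_monodromy X.cN a (ζ - 2 * Real.pi * Complex.I)
  rw [sub_add_cancel] at h0 h1 h2
  rw [← Matrix.vecMul_vecMul, X.vecMul_unip]
  ext j
  fin_cases j <;> simp [matK, Matrix.vecMul, dotProduct, Fin.sum_univ_four, Family.row]
  · linear_combination -h0
  · linear_combination -h1
  · linear_combination -h2 - X.kappa * h1

theorem Family.Phi_odd_eq (X : Family) (a : ℂ) (k : ℤ) (ζ : ℂ) : X.Phi X.cN a (2 * k + 1) ζ =
    X.Phi X.cN a (2 * k) ζ ᵥ* (X.matL a ^ k * X.matKbar a * X.matL a ^ (-k)) := by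
  have h0 := X.Phi_eq a k 0 (Or.inl rfl) ζ
  rw [add_zero] at h0
  rw [X.Phi_eq a k 1 (Or.inr rfl), h0, X.matL_zpow, X.matL_zpow, ← X.vecMul_matKbar,
    Matrix.vecMul_vecMul, Matrix.vecMul_vecMul, Matrix.mul_assoc (X.unip a k), ← Matrix.mul_assoc,
    X.unip_mul, neg_add_cancel, X.unip_zero, Matrix.one_mul]
  push_cast
  rfl

theorem Family.Phi_even_eq (X : Family) (a : ℂ) (k : ℤ) (ζ : ℂ) : X.Phi X.cN a (2 * k + 2) ζ =
    X.Phi X.cN a (2 * k + 1) ζ ᵥ* (X.matL a ^ (k + 1) * matK * X.matL a ^ (-k - 1)) := by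
  have h0 := X.Phi_eq a (k + 1) 0 (Or.inl rfl) ζ
  rw [add_zero, show 2 * (k + 1) = 2 * k + 2 by ring] at h0
  have e : ζ - (k + 1 : ℤ) * (2 * Real.pi * Complex.I) =
      ζ - k * (2 * Real.pi * Complex.I) - 2 * Real.pi * Complex.I := by push_cast; ring
  rw [h0, X.Phi_eq a k 1 (Or.inr rfl), X.matL_zpow, X.matL_zpow, e, X.vecMul_matK,
    Matrix.vecMul_vecMul, Matrix.vecMul_vecMul, Matrix.mul_assoc (X.unip a (k + 1 : ℤ)),
    ← Matrix.mul_assoc (X.unip a (-k)), X.unip_mul, ← Matrix.mul_assoc]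
  push_cast
  ring_nf

end

end CYStokes

/-! ### Assembly of the theorem -/

theorem mainTheorem1 (X : CYStokes.Family) :
    ∃ C : ℤ → ℂ, X.IsExpSeries C ∧ (∀ C' : ℤ → ℂ, X.IsExpSeries C' → C' = C) ∧
      C 3 = X.expCoeff.1 ∧ C 4 = X.expCoeff.2 ∧
      ∃ cN : ℝ, cN ≠ 0 ∧ ∀ a : ℂ,
        (∀ (m : ℤ) (j : Fin 4),
          X.IsSolution (fun ζ => X.Phi cN a m ζ j) ∧
          CYStokes.IsAsymp m (fun ζ => X.Phi cN a m ζ j) (X.Psi a C j)) ∧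
        (∀ k : ℤ,
          (∀ ζ ∈ CYStokes.sector (2 * k + 1) ∩ CYStokes.sector (2 * k),
            X.Phi cN a (2 * k + 1) ζ =
              X.Phi cN a (2 * k) ζ ᵥ*
                ((X.matL a) ^ k * X.matKbar a * (X.matL a) ^ (-k))) ∧
          (∀ ζ ∈ CYStokes.sector (2 * k + 2) ∩ CYStokes.sector (2 * k + 1),
            X.Phi cN a (2 * k + 2) ζ =
              X.Phi cN a (2 * k + 1) ζ ᵥ*
                ((X.matL a) ^ (k + 1) * CYStokes.matK * (X.matL a) ^ (-k - 1)))) := by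
  refine ⟨X.expSeq, X.isExpSeries_expSeq, fun C' hC' => hC'.unique X.isExpSeries_expSeq,
    X.isExpSeries_expSeq.coeff.1, X.isExpSeries_expSeq.coeff.2, X.cN, X.cN_ne_zero, fun a =>
    ⟨fun m j => ?_, fun k => ⟨fun ζ _ => X.Phi_odd_eq a k ζ, fun ζ _ => X.Phi_even_eq a k ζ⟩⟩⟩
  -- Write m as 2k + p with p its parity; k counts full turns.
  obtain ⟨k, p, hp, rfl⟩ : ∃ k p : ℤ, (p = 0 ∨ p = 1) ∧ m = 2 * k + p :=
    ⟨m / 2, m % 2, by omega, by omega⟩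
  refine ⟨X.isSolution_Phi a k p hp j, ?_⟩
  rcases eq_or_ne j 3 with rfl | hj
  · exact X.isAsymp_Phi_three a k p hp
  · exact X.isAsymp_Phi_of_ne_three a X.expSeq k p hp hj
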